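/- Let $X$ be a Calabi–Yau threefold: a complex manifold of complex dimension $3$ with complex structure $J$, a Kähler form $\omega$ with Kähler metric $g_X(u,v)=\omega(u,Jv)$, and a nowhere vanishing closed form $\epsilon$ of type $(3,0)$ with $\epsilon\wedge\bar\epsilon=-\mathbf i\,c\,\omega^3$ for some constant $c>0$. Let $\pi\colon Y\to X$ be a smooth, locally trivial fibration with fibre $S^1$ (so $\dim Y=7$), with a global angular form $\theta$: a smooth real $1$-form on $Y$ which does not vanish on nonzero vertical vectors and satisfies $v\lrcorner d\theta=0$ for every vertical vector $v$. Let $\xi$ be the vertical vector field with $\theta(\xi)=1$, and let $\Phi\in\mathrm{End}(TY)$ be determined by $\theta\circ\Phi=0$ and $d\pi\circ\Phi=J\circ d\pi$. Let $B^{0,1}$ be the $(-\mathbf i)$-eigenbundle of $\Phi$ on $(\ker\theta)\otimes\mathbb C$, and $\tilde B^{0,1}=B^{0,1}\oplus\mathbb C\xi\subset TY\otimes\mathbb C$. Endow $Y$ with the natural $\mathrm G_2$-structure $\varphi=\theta\wedge\pi^*\omega+\pi^*\operatorname{Im}\epsilon$, with $4$-form $$\psi=\tfrac12\,\pi^*\omega\wedge\pi^*\omega+\theta\wedge\pi^*\operatorname{Re}\epsilon$$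 ($c=4/3$ is the normalization for which $\psi=*\varphi$). A connection $A'$ on a complex vector bundle over $Y$ is a $\mathrm G_2$-instanton if $F_{A'}\wedge\psi=0$. Let $\mathcal E_0\to X$ be a holomorphic vector bundle, i.e. a smooth complex vector bundle $E_0$ with a flat partial connection $\bar\partial_0$ along $T^{0,1}X$. A Chern connection on $\mathcal E_0$ is a connection that preserves some Hermitian metric on $E_0$ and induces $\bar\partial_0$ along $T^{0,1}X$; a connection $A$ on $E_0$ is Hermitian Yang–Mills (HYM) if $(F_A,\omega)=0$ and $F_A^{0,2}=0$. A holomorphic Sasakian bundle structure on a complex vector bundle over $Y$ consists of a partial connection $D_\xi$ along $\mathbb C\xi$ and a flat partial connection $\bar\partial$ along the involutive distribution $\tilde B^{0,1}$ whose restriction to $\mathbb C\xi$ is $D_\xi$. Then: 1. If $d\theta=\lambda\,\pi^*\omega$ for a constant $\lambda<0$, then $(\theta,g,\Phi)$ with $g=-\tfrac{\lambda}{2}\pi^*g_X+\theta\otimes\theta$ is a Sasakian structure on $Y$ with Reeb field $\xi$: $\theta\wedge(d\theta)^3$ vanishes nowhere, $\theta(\xi)=1$, $\xi\lrcorner d\theta=0$,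 $g(\xi,\xi)=1$, $\Phi^2=-\mathrm{Id}+\theta\otimes\xi$, $g(\Phi U,\Phi V)=g(U,V)-\theta(U)\theta(V)$, $\nabla^g_U\xi=-\Phi U$ and $(\nabla^g_U\Phi)V=g(U,V)\xi-\theta(V)U$. 2. $\mathcal E=\pi^*\mathcal E_0$ is a holomorphic Sasakian bundle: $\pi^*E_0$ carries a holomorphic Sasakian bundle structure $(D_\xi,\bar\partial)$ with $\bar\partial=\pi^*\bar\partial_0$, that is, $\bar\partial_u(\pi^*s)=\pi^*\big((\bar\partial_0)_{d\pi(u)}s\big)$ for all $u\in\tilde B^{0,1}$ and all local sections $s$ of $E_0$. 3. For every Chern connection $A$ on $\mathcal E_0$, the pullback connection $\pi^*A$ on $\pi^*E_0$, characterized by $(\pi^*A)_v(\pi^*s)=\pi^*(A_{d\pi(v)}s)$, exists, and $A$ is HYM if and only if $\pi^*A$ is a $\mathrm G_2$-instanton. -/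

import Mathlib

open Bundle Set
open scoped Manifold ContDiff TensorProduct Topology

noncomputable section

/-! ### Differential forms and vector fields on real manifolds -/

section Forms

variable {E : Type*} [NormedAddCommGroup E] [NormedSpace ℝ E]
  {M : Type*} [TopologicalSpace M] [ChartedSpace E M]
  {G : Type*} [NormedAddCommGroup G] [NormedSpace ℝ G]

variable (E M G) in
/-- (Not necessarily smooth) differential `k`-forms on `M` with values in `G`. -/
abbrev DForm (k : ℕ) : Type _ := Π x : M, TangentSpace 𝓘(ℝ, E) x [⋀^Fin k]→L[ℝ] G

/-- The expression of a form in the chart at `x₀`: its pullback under the inverse of the chart. -/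
def DForm.inChart {k : ℕ} (α : DForm E M G k) (x₀ : M) : E → E [⋀^Fin k]→L[ℝ] G := fun z =>
  (α ((extChartAt 𝓘(ℝ, E) x₀).symm z)).compContinuousLinearMap
    (mfderiv 𝓘(ℝ, E) 𝓘(ℝ, E) (extChartAt 𝓘(ℝ, E) x₀).symm z)

/-- A form is smooth if it is smooth in every chart. -/
def DForm.IsSmooth {k : ℕ} (α : DForm E M G k) : Prop :=
  ∀ x₀ : M, ContDiffOn ℝ ∞ (α.inChart x₀) (extChartAt 𝓘(ℝ, E) x₀).target

/-- The exterior derivative: at `x₀` it is the exterior derivative of the expression of the form in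
the chart at `x₀` (which identifies the tangent space at `x₀` with the model space `E`). -/
def DForm.d {k : ℕ} (α : DForm E M G k) : DForm E M G (k + 1) := fun x₀ =>
  (extDeriv (α.inChart x₀) (extChartAt 𝓘(ℝ, E) x₀ x₀) : E [⋀^Fin (k + 1)]→L[ℝ] G)

/-- A field of covectors as a `1`-form. -/
def covectorForm (θ : Π x : M, TangentSpace 𝓘(ℝ, E) x →L[ℝ] ℝ) : DForm E M ℝ 1 := fun x =>
  ContinuousAlternatingMap.ofSubsingleton ℝ (TangentSpace 𝓘(ℝ, E) x) ℝ (0 : Fin 1) (θ x)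

variable [IsManifold 𝓘(ℝ, E) ∞ M]

/-- A vector field is smooth on `O`. -/
def SmoothFieldOn (Z : Π x : M, TangentSpace 𝓘(ℝ, E) x) (O : Set M) : Prop :=
  ContMDiffOn 𝓘(ℝ, E) 𝓘(ℝ, E).tangent ∞ (fun x => (⟨x, Z x⟩ : TangentBundle 𝓘(ℝ, E) M)) O

/-- A vector field is differentiable at `x`. -/
def DiffFieldAt (Z : Π x : M, TangentSpace 𝓘(ℝ, E) x) (x : M) : Prop :=
  MDifferentiableAt 𝓘(ℝ, E) 𝓘(ℝ, E).tangent
    (fun x => (⟨x, Z x⟩ : TangentBundle 𝓘(ℝ, E) M)) x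

end Forms

/-- The wedge product of alternating functions `a`, `b` of `k`, resp. `l`, vectors,
`(a ∧ b)(v) = 1/(k! l!) ∑_σ sgn(σ) a(v_{σ(1)}, …, v_{σ(k)}) b(v_{σ(k+1)}, …, v_{σ(k+l)})`.
The first factor may take values in any module over the ring of values of the second one. -/
def wedge {𝕜 T G : Type*} [Field 𝕜] [AddCommGroup G] [Module 𝕜 G] {k l : ℕ}
    (a : (Fin k → T) → G) (b : (Fin l → T) → 𝕜) : (Fin (k + l) → T) → G := fun v =>
  ((k.factorial * l.factorial : 𝕜)⁻¹) • ∑ σ : Equiv.Perm (Fin (k + l)),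
    ((σ.sign : ℤ) : 𝕜) • (b (fun j => v (σ (Fin.natAdd k j))) •
      a (fun i => v (σ (Fin.castAdd l i))))

/-! ### Sasakian structures on 7-manifolds -/

section Sasakian

variable {E : Type*} [NormedAddCommGroup E] [NormedSpace ℝ E]
  {M : Type*} [TopologicalSpace M] [ChartedSpace E M] [IsManifold 𝓘(ℝ, E) ∞ M]

/-- `∇` is a Levi-Civita connection of `g`: it is metric and torsion-free. -/
structure IsLeviCivita
    (g : Π x : M, TangentSpace 𝓘(ℝ, E) x →ₗ[ℝ] TangentSpace 𝓘(ℝ, E) x →ₗ[ℝ] ℝ)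
    (cov : CovariantDerivative 𝓘(ℝ, E) E (TangentSpace 𝓘(ℝ, E) : M → Type _)) : Prop where
  metric : ∀ (x : M) (Z W : Π x : M, TangentSpace 𝓘(ℝ, E) x), DiffFieldAt Z x → DiffFieldAt W x →
    ∀ v : TangentSpace 𝓘(ℝ, E) x,
      mvfderiv 𝓘(ℝ, E) (fun x' => g x' (Z x') (W x')) x v =
        g x (cov Z x v) (W x) + g x (Z x) (cov W x v)
  torsion_free : ∀ (x : M) (Z W : Π x : M, TangentSpace 𝓘(ℝ, E) x),
    DiffFieldAt Z x → DiffFieldAt W x →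
      cov W x (Z x) - cov Z x (W x) = VectorField.mlieBracket 𝓘(ℝ, E) Z W x

/-- Sasakian structures `(θ, g, Φ)` with Reeb field `ξ` on a `7`-manifold. -/
structure IsSasakian
    (θ : Π x : M, TangentSpace 𝓘(ℝ, E) x →L[ℝ] ℝ)
    (ξ : Π x : M, TangentSpace 𝓘(ℝ, E) x)
    (g : Π x : M, TangentSpace 𝓘(ℝ, E) x →ₗ[ℝ] TangentSpace 𝓘(ℝ, E) x →ₗ[ℝ] ℝ)
    (Φ : Π x : M, TangentSpace 𝓘(ℝ, E) x →L[ℝ] TangentSpace 𝓘(ℝ, E) x) : Prop where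
  smooth_form : (covectorForm θ).IsSmooth
  smooth_metric : ∀ (O : Set M), IsOpen O → ∀ Z W, SmoothFieldOn Z O → SmoothFieldOn W O →
    ContMDiffOn 𝓘(ℝ, E) 𝓘(ℝ, ℝ) ∞ (fun x => g x (Z x) (W x)) O
  smooth_endo : ∀ (O : Set M), IsOpen O → ∀ Z, SmoothFieldOn Z O →
    SmoothFieldOn (fun x => Φ x (Z x)) O
  smooth_reeb : SmoothFieldOn ξ univ
  metric_symm : ∀ x u v, g x u v = g x v u
  metric_pos : ∀ x u, u ≠ 0 → 0 < g x u u
  contact : ∀ x, ∃ v : Fin 7 → TangentSpace 𝓘(ℝ, E) x,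
    wedge (𝕜 := ℝ) (k := 1) (l := 6) (covectorForm θ x)
      (wedge (𝕜 := ℝ) (k := 2) (l := 4) ((covectorForm θ).d x)
        (wedge (𝕜 := ℝ) (k := 2) (l := 2) ((covectorForm θ).d x) ((covectorForm θ).d x))) v ≠ 0
  reeb_one : ∀ x, θ x (ξ x) = 1
  reeb_d : ∀ x v, (covectorForm θ).d x ![ξ x, v] = 0
  reeb_unit : ∀ x, g x (ξ x) (ξ x) = 1
  endo_sq : ∀ x u, Φ x (Φ x u) = -u + θ x u • ξ x
  compat : ∀ x u v, g x (Φ x u) (Φ x v) = g x u v - θ x u * θ x v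
  nabla_reeb : ∀ cov, IsLeviCivita g cov → ∀ x u, cov ξ x u = -Φ x u
  nabla_endo : ∀ cov, IsLeviCivita g cov → ∀ (x : M) (Z : Π x : M, TangentSpace 𝓘(ℝ, E) x),
    DiffFieldAt Z x → ∀ u : TangentSpace 𝓘(ℝ, E) x,
      cov (fun x' => Φ x' (Z x')) x u - Φ x (cov Z x u) = g x u (Z x) • ξ x - θ x (Z x) • u

end Sasakian

/-! ### Partial connections on complex vector bundles -/

section Complexified

variable {E : Type*} [NormedAddCommGroup E] [NormedSpace ℝ E]
  {M : Type*} [TopologicalSpace M] [ChartedSpace E M] [IsManifold 𝓘(ℝ, E) ∞ M]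

variable (E) in
/-- The complexified tangent space. -/
abbrev CTangent (x : M) : Type _ := ℂ ⊗[ℝ] TangentSpace 𝓘(ℝ, E) x

/-- The complex vector field `U₁ + i U₂`. -/
def complexField (U₁ U₂ : Π x : M, TangentSpace 𝓘(ℝ, E) x) (x : M) : CTangent E x :=
  (1 : ℂ) ⊗ₜ[ℝ] U₁ x + Complex.I ⊗ₜ[ℝ] U₂ x

/-- The Lie bracket `[U₁ + i U₂, V₁ + i V₂]`. -/
def complexBracket (U₁ U₂ V₁ V₂ : Π x : M, TangentSpace 𝓘(ℝ, E) x) (x : M) : CTangent E x :=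
  complexField
    (fun x => VectorField.mlieBracket 𝓘(ℝ, E) U₁ V₁ x - VectorField.mlieBracket 𝓘(ℝ, E) U₂ V₂ x)
    (fun x => VectorField.mlieBracket 𝓘(ℝ, E) U₁ V₂ x + VectorField.mlieBracket 𝓘(ℝ, E) U₂ V₁ x) x

/-- `U₁ + i U₂` is a smooth local section over `O` of the distribution `L`. -/
structure IsLocalSection (L : Π x : M, Submodule ℂ (CTangent E x))
    (O : Set M) (U₁ U₂ : Π x : M, TangentSpace 𝓘(ℝ, E) x) : Prop where
  smooth_re : SmoothFieldOn U₁ O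
  smooth_im : SmoothFieldOn U₂ O
  mem : ∀ x ∈ O, complexField U₁ U₂ x ∈ L x

/-- `L ⊆ TM ⊗ ℂ` is closed under the Lie bracket. -/
def IsInvolutive (L : Π x : M, Submodule ℂ (CTangent E x)) : Prop :=
  ∀ O : Set M, IsOpen O → ∀ U₁ U₂ V₁ V₂, IsLocalSection L O U₁ U₂ → IsLocalSection L O V₁ V₂ →
    ∀ x ∈ O, complexBracket U₁ U₂ V₁ V₂ x ∈ L x

variable (F : Type*) [NormedAddCommGroup F] [NormedSpace ℂ F]
  (B : M → Type*) [TopologicalSpace (TotalSpace F B)]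
  [∀ x, AddCommGroup (B x)] [∀ x, Module ℂ (B x)]
  [∀ x, TopologicalSpace (B x)] [FiberBundle F B]

variable {B} in
/-- A section of `B` is smooth on `O`. -/
def SmoothSectionOn (s : Π x : M, B x) (O : Set M) : Prop :=
  ContMDiffOn 𝓘(ℝ, E) (𝓘(ℝ, E).prod 𝓘(ℝ, F)) ∞ (fun x => (⟨x, s x⟩ : TotalSpace F B)) O

variable (E) {B} in
/-- A section of `B` is differentiable at `x`. -/
def DiffSectionAt (s : Π x : M, B x) (x : M) : Prop :=
  MDifferentiableAt 𝓘(ℝ, E) (𝓘(ℝ, E).prod 𝓘(ℝ, F)) (fun x => (⟨x, s x⟩ : TotalSpace F B)) x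

/-- A partial connection on the complex vector bundle `B` along the distribution
`L ⊆ TM ⊗ ℂ`. -/
structure PartialConnection (L : Π x : M, Submodule ℂ (CTangent E x)) where
  toFun : (Π x : M, B x) → Π x : M, L x →ₗ[ℂ] B x
  add : ∀ (s t : Π x : M, B x) (x : M), DiffSectionAt E F s x → DiffSectionAt E F t x →
    toFun (fun x => s x + t x) x = toFun s x + toFun t x
  leibniz : ∀ (f : M → ℂ) (s : Π x : M, B x) (x : M),
    MDifferentiableAt 𝓘(ℝ, E) 𝓘(ℝ, ℂ) f x → DiffSectionAt E F s x → ∀ u : L x,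
      toFun (fun x => f x • s x) x u = f x • toFun s x u +
        LinearMap.liftBaseChange ℂ
          (mvfderiv 𝓘(ℝ, E) f x : TangentSpace 𝓘(ℝ, E) x →ₗ[ℝ] ℂ) (u : CTangent E x) • s x
  smooth : ∀ (O : Set M), IsOpen O → ∀ (s : Π x : M, B x), SmoothSectionOn (E := E) F s O →
    ∀ U₁ U₂, IsLocalSection L O U₁ U₂ → ∀ t : Π x : M, B x,
      (∀ (x : M) (_ : x ∈ O) (hU : complexField U₁ U₂ x ∈ L x),
        t x = toFun s x ⟨complexField U₁ U₂ x, hU⟩) → SmoothSectionOn (E := E) F t O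

variable {F B}

open Classical in
/-- `D_u s` at `x`, for a complex tangent vector `u` in `L` (and `0` for all other `u`). -/
def PartialConnection.deriv {L : Π x : M, Submodule ℂ (CTangent E x)}
    (D : PartialConnection F B L) (s : Π x : M, B x) (x : M) (u : CTangent E x) : B x :=
  if h : u ∈ L x then D.toFun s x ⟨u, h⟩ else 0

/-- The partial connection `D` along the integrable distribution `L` is flat: `L` is involutive
and the curvature `D_U D_V - D_V D_U - D_{[U,V]}` vanishes for all local sections `U`, `V`
of `L`. -/
def PartialConnection.IsFlat {L : Π x : M, Submodule ℂ (CTangent E x)}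
    (D : PartialConnection F B L) : Prop :=
  IsInvolutive L ∧
  ∀ O : Set M, IsOpen O → ∀ U₁ U₂ V₁ V₂, IsLocalSection L O U₁ U₂ → IsLocalSection L O V₁ V₂ →
    ∀ s : Π x : M, B x, SmoothSectionOn (E := E) F s O → ∀ x ∈ O,
      D.deriv (fun x' => D.deriv s x' (complexField V₁ V₂ x')) x (complexField U₁ U₂ x)
        - D.deriv (fun x' => D.deriv s x' (complexField U₁ U₂ x')) x (complexField V₁ V₂ x)
        - D.deriv s x (complexBracket U₁ U₂ V₁ V₂ x) = 0

/-- The complex line spanned by `ξ`. -/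
def reebLine (ξ : Π x : M, TangentSpace 𝓘(ℝ, E) x) (x : M) : Submodule ℂ (CTangent E x) :=
  Submodule.span ℂ {(1 : ℂ) ⊗ₜ[ℝ] ξ x}

/-- The `(-i)`-eigenspace of an endomorphism field. -/
def antiholomorphicPart (Φ : Π x : M, TangentSpace 𝓘(ℝ, E) x →L[ℝ] TangentSpace 𝓘(ℝ, E) x)
    (x : M) : Submodule ℂ (CTangent E x) :=
  Module.End.eigenspace
    (LinearMap.baseChange ℂ (Φ x : TangentSpace 𝓘(ℝ, E) x →ₗ[ℝ] TangentSpace 𝓘(ℝ, E) x))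
    (-Complex.I)

/-- `B^{0,1}`: the `(-i)`-eigenspace of `Φ` on the complexification of `ker θ`. -/
def contactAntiholomorphicPart (θ : Π x : M, TangentSpace 𝓘(ℝ, E) x →L[ℝ] ℝ)
    (Φ : Π x : M, TangentSpace 𝓘(ℝ, E) x →L[ℝ] TangentSpace 𝓘(ℝ, E) x)
    (x : M) : Submodule ℂ (CTangent E x) :=
  LinearMap.ker (LinearMap.baseChange ℂ (θ x : TangentSpace 𝓘(ℝ, E) x →ₗ[ℝ] ℝ)) ⊓
    antiholomorphicPart Φ x

/-- The extended antiholomorphic distribution `B^{0,1} ⊕ ξ_ℂ`. -/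
def extendedAntiholomorphicPart (θ : Π x : M, TangentSpace 𝓘(ℝ, E) x →L[ℝ] ℝ)
    (ξ : Π x : M, TangentSpace 𝓘(ℝ, E) x)
    (Φ : Π x : M, TangentSpace 𝓘(ℝ, E) x →L[ℝ] TangentSpace 𝓘(ℝ, E) x)
    (x : M) : Submodule ℂ (CTangent E x) :=
  contactAntiholomorphicPart θ Φ x ⊔ reebLine ξ x

variable (F B) in
/-- A holomorphic Sasakian bundle structure on the complex vector bundle `B`, relative to the
form `θ`, the Reeb field `ξ` and the endomorphism field `Φ`: a partial connection along `ξ`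
together with a flat partial connection along `B^{0,1} ⊕ ξ_ℂ` that restricts to it. -/
structure HolomorphicSasakianBundle (θ : Π x : M, TangentSpace 𝓘(ℝ, E) x →L[ℝ] ℝ)
    (ξ : Π x : M, TangentSpace 𝓘(ℝ, E) x)
    (Φ : Π x : M, TangentSpace 𝓘(ℝ, E) x →L[ℝ] TangentSpace 𝓘(ℝ, E) x) where
  reebConnection : PartialConnection F B (reebLine ξ)
  dbar : PartialConnection F B (extendedAntiholomorphicPart θ ξ Φ)
  flat : dbar.IsFlat
  restrict : ∀ (s : Π x : M, B x) (x : M), DiffSectionAt E F s x → ∀ u ∈ reebLine ξ x,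
    dbar.deriv s x u = reebConnection.deriv s x u

end Complexified

/-! ### Connections, curvature and Hermitian metrics -/

section Connections

variable {E : Type*} [NormedAddCommGroup E] [NormedSpace ℝ E]
  {M : Type*} [TopologicalSpace M] [ChartedSpace E M] [IsManifold 𝓘(ℝ, E) ∞ M]
  {F : Type*} [NormedAddCommGroup F] [NormedSpace ℂ F]
  {B : M → Type*} [TopologicalSpace (TotalSpace F B)]
  [∀ x, AddCommGroup (B x)] [∀ x, Module ℂ (B x)] [∀ x, Module ℝ (B x)]
  [∀ x, IsScalarTower ℝ ℂ (B x)]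
  [∀ x, TopologicalSpace (B x)] [∀ x, IsTopologicalAddGroup (B x)]
  [∀ x, ContinuousSMul ℝ (B x)] [FiberBundle F B]

/-- `A` is a smooth connection on the complex vector bundle `B` (a smooth covariant derivative that
commutes with multiplication by `i`). -/
structure IsComplexConnection [VectorBundle ℝ F B]
    (A : CovariantDerivative 𝓘(ℝ, E) F B) : Prop where
  smooth : ∀ O : Set M, IsOpen O → ContMDiffCovariantDerivativeOn F ∞ A.toFun O
  complex_linear : ∀ (s : Π x : M, B x) (x : M), DiffSectionAt E F s x →
    ∀ v : TangentSpace 𝓘(ℝ, E) x, A (fun x => Complex.I • s x) x v = Complex.I • A s x v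

/-- The connection form of `A` in the chart and the trivialization at `x₀`, evaluated at the point
`z` of the chart, on the vector `v` and on the fibre element `f`: the covariant derivative of the
section which is constantly `f` in the trivialization. -/
def connectionForm (A : CovariantDerivative 𝓘(ℝ, E) F B) (x₀ : M) (z v : E) (f : F) : F :=
  (trivializationAt F B x₀
    ⟨(extChartAt 𝓘(ℝ, E) x₀).symm z,
      A (fun x => (trivializationAt F B x₀).symm x f) ((extChartAt 𝓘(ℝ, E) x₀).symm z)
        (mfderiv 𝓘(ℝ, E) 𝓘(ℝ, E) (extChartAt 𝓘(ℝ, E) x₀).symm z v)⟩).2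

/-- The curvature `dA + A ∧ A` at `x₀`, computed in the chart and the trivialization at `x₀`, as a
function of two elements of the model space, with values in the endomorphisms of the
model fibre. -/
def localCurvature (A : CovariantDerivative 𝓘(ℝ, E) F B) (x₀ : M) (u v : E) (f : F) : F :=
  let z₀ : E := extChartAt 𝓘(ℝ, E) x₀ x₀
  let a := connectionForm A x₀
  fderiv ℝ (fun z => a z v f) z₀ u - fderiv ℝ (fun z => a z u f) z₀ v
    + a z₀ u (a z₀ v f) - a z₀ v (a z₀ u f)

/-- The curvature `F_A`, an alternating function of two tangent vectors with values in the
endomorphisms of the fibre. -/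
def curvature (A : CovariantDerivative 𝓘(ℝ, E) F B) (x₀ : M)
    (w : Fin 2 → TangentSpace 𝓘(ℝ, E) x₀) : B x₀ → B x₀ := fun e =>
  (trivializationAt F B x₀).symm x₀
    (localCurvature A x₀ (w 0) (w 1) (trivializationAt F B x₀ ⟨x₀, e⟩).2)

variable (E F B) in
/-- A smooth Hermitian metric on a complex vector bundle. -/
structure HermitianMetric where
  toFun : Π x : M, B x →ₗ⋆[ℂ] B x →ₗ[ℂ] ℂ
  symm : ∀ x v w, starRingEnd ℂ (toFun x v w) = toFun x w v
  pos : ∀ x v, v ≠ 0 → 0 < (toFun x v v).re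
  smooth : ∀ O : Set M, IsOpen O → ∀ s t : Π x : M, B x,
    SmoothSectionOn (E := E) F s O → SmoothSectionOn (E := E) F t O →
      ContMDiffOn 𝓘(ℝ, E) 𝓘(ℝ, ℂ) ∞ (fun x => toFun x (s x) (t x)) O

/-- The connection `A` preserves the Hermitian metric `h`. -/
def IsUnitary (h : HermitianMetric E F B) (A : CovariantDerivative 𝓘(ℝ, E) F B) : Prop :=
  ∀ (s t : Π x : M, B x) (x : M), DiffSectionAt E F s x → DiffSectionAt E F t x →
    ∀ v : TangentSpace 𝓘(ℝ, E) x,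
      mvfderiv 𝓘(ℝ, E) (fun x' => h.toFun x' (s x') (t x')) x v =
        h.toFun x (A s x v) (t x) + h.toFun x (s x) (A t x v)

/-- The partial connection along `L` induced by the connection `A` is `D`. -/
def InducesPartialConnection {L : Π x : M, Submodule ℂ (CTangent E x)}
    (A : CovariantDerivative 𝓘(ℝ, E) F B) (D : PartialConnection F B L) : Prop :=
  ∀ (s : Π x : M, B x) (x : M), DiffSectionAt E F s x → ∀ u ∈ L x,
    LinearMap.liftBaseChange ℂ (A s x : TangentSpace 𝓘(ℝ, E) x →ₗ[ℝ] B x) u = D.deriv s x u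

end Connections

/-! ### Calabi–Yau threefolds -/

section CalabiYau

variable {V : Type*} [NormedAddCommGroup V] [NormedSpace ℂ V]
  {X : Type*} [TopologicalSpace X] [ChartedSpace V X]

/-- A complex manifold is a smooth real manifold. -/
instance isManifold_real_of_complex [IsManifold 𝓘(ℂ, V) ω X] : IsManifold 𝓘(ℝ, V) ∞ X := by
  refine isManifold_of_contDiffOn 𝓘(ℝ, V) ∞ X fun e e' he he' => ?_
  have h := (contDiffGroupoid ω 𝓘(ℂ, V)).compatible he he'
  rw [contDiffGroupoid, mem_groupoid_of_pregroupoid] at h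
  have h2 : ContDiffOn ℂ ω (𝓘(ℂ, V) ∘ (e.symm ≫ₕ e') ∘ 𝓘(ℂ, V).symm)
      (𝓘(ℂ, V).symm ⁻¹' (e.symm ≫ₕ e').source ∩ range 𝓘(ℂ, V)) := h.1
  exact (h2.restrict_scalars ℝ).of_le le_top

variable [IsManifold 𝓘(ℂ, V) ω X]

/-- The complex structure `J` of a complex manifold. -/
def complexStructure (x : X) : TangentSpace 𝓘(ℝ, V) x →L[ℝ] TangentSpace 𝓘(ℝ, V) x :=
  ((Complex.I • ContinuousLinearMap.id ℂ V).restrictScalars ℝ : V →L[ℝ] V)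

variable (V X) in
/-- A Calabi–Yau structure on a complex threefold: a Kähler form `kah` and a nowhere vanishing
closed form `vol` of type `(3,0)`, with `vol ∧ conj vol = -i c kah³` for a constant `c > 0`. -/
structure CalabiYauStructure where
  kah : DForm V X ℝ 2
  vol : DForm V X ℂ 3
  kah_smooth : kah.IsSmooth
  vol_smooth : vol.IsSmooth
  kah_closed : ∀ x, kah.d x = 0
  vol_closed : ∀ x, vol.d x = 0
  kah_type : ∀ (x : X) (u v : TangentSpace 𝓘(ℝ, V) x),
    kah x ![complexStructure x u, complexStructure x v] = kah x ![u, v]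
  kah_pos : ∀ (x : X) (u : TangentSpace 𝓘(ℝ, V) x), u ≠ 0 → 0 < kah x ![u, complexStructure x u]
  vol_type : ∀ (x : X) (u v w : TangentSpace 𝓘(ℝ, V) x),
    vol x ![complexStructure x u, v, w] = Complex.I * vol x ![u, v, w]
  normalized : ∃ c : ℝ, 0 < c ∧ ∀ (x : X) (v : Fin 6 → TangentSpace 𝓘(ℝ, V) x),
    wedge (𝕜 := ℂ) (k := 3) (l := 3) (vol x) (fun w => starRingEnd ℂ (vol x w)) v =
      -Complex.I * c * (wedge (𝕜 := ℝ) (k := 2) (l := 4) (kah x)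
        (wedge (𝕜 := ℝ) (k := 2) (l := 2) (kah x) (kah x)) v : ℝ)

/-- The Kähler metric `g(u, v) = kah(u, J v)`. -/
def CalabiYauStructure.metric (cy : CalabiYauStructure V X) (x : X)
    (u v : TangentSpace 𝓘(ℝ, V) x) : ℝ := cy.kah x ![u, complexStructure x v]

variable {F : Type*} [NormedAddCommGroup F] [NormedSpace ℂ F]
  {B : X → Type*} [TopologicalSpace (TotalSpace F B)]
  [∀ x, AddCommGroup (B x)] [∀ x, Module ℂ (B x)] [∀ x, Module ℝ (B x)]
  [∀ x, IsScalarTower ℝ ℂ (B x)]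
  [∀ x, TopologicalSpace (B x)] [∀ x, IsTopologicalAddGroup (B x)]
  [∀ x, ContinuousSMul ℝ (B x)] [FiberBundle F B]

variable (V F B) in
/-- A holomorphic structure on a smooth complex vector bundle over a complex manifold: a flat
partial connection along `T^{0,1}X`. -/
structure HolomorphicStructure where
  dbar : PartialConnection F B (antiholomorphicPart (complexStructure (V := V) (X := X)))
  flat : dbar.IsFlat

/-- `A` is the Chern connection of the holomorphic structure `hol` and the Hermitian metric `h`. -/
structure IsChernConnection [VectorBundle ℝ F B]
    (hol : HolomorphicStructure V F B) (h : HermitianMetric V F B)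
    (A : CovariantDerivative 𝓘(ℝ, V) F B) : Prop where
  connection : IsComplexConnection A
  unitary : IsUnitary h A
  integrable : InducesPartialConnection A hol.dbar

/-- Hermitian Yang–Mills connections over a Calabi–Yau threefold: `(F_A, kah) = 0`, the pointwise
inner product of `2`-forms being computed in orthonormal bases, and `F_A^{0,2} = 0`, i.e. the complex
bilinear extension of `F_A` vanishes on all pairs of vectors `u + i J u`, `v + i J v` of type
`(0,1)`. -/
structure IsHYM (cy : CalabiYauStructure V X) (A : CovariantDerivative 𝓘(ℝ, V) F B) : Prop where
  trace_zero : ∀ (x : X) (b : Fin 6 → TangentSpace 𝓘(ℝ, V) x),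
    (∀ i j, cy.metric x (b i) (b j) = if i = j then 1 else 0) →
      ∑ i, ∑ j with i < j, cy.kah x ![b i, b j] • curvature A x ![b i, b j] = 0
  type_zero_two : ∀ (x : X) (u v : TangentSpace 𝓘(ℝ, V) x) (e : B x),
    (curvature A x ![u, v] e - curvature A x ![complexStructure x u, complexStructure x v] e)
      + Complex.I • (curvature A x ![u, complexStructure x v] e
        + curvature A x ![complexStructure x u, v] e) = 0

end CalabiYau

/-! ### Circle fibrations and their natural G₂-structures -/

section CircleFibration

variable {V : Type*} [NormedAddCommGroup V] [NormedSpace ℂ V]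
  {X : Type*} [TopologicalSpace X] [ChartedSpace V X] [IsManifold 𝓘(ℂ, V) ω X]
  {W : Type*} [NormedAddCommGroup W] [NormedSpace ℝ W]
  {Y : Type*} [TopologicalSpace Y] [ChartedSpace W Y] [IsManifold 𝓘(ℝ, W) ∞ Y]

/-- The differential of `p`. -/
abbrev dproj (p : C^∞⟮𝓘(ℝ, W), Y; 𝓘(ℝ, V), X⟯) (y : Y) :
    TangentSpace 𝓘(ℝ, W) y →L[ℝ] TangentSpace 𝓘(ℝ, V) (p y) :=
  mfderiv 𝓘(ℝ, W) 𝓘(ℝ, V) p y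

/-- `p` is a smooth, locally trivial fibration with fibre the circle: over a neighbourhood `U` of
every point there are mutually inverse smooth maps `(p, τ) : p⁻¹(U) → U × S¹` and
`σ : U × S¹ → p⁻¹(U)`. -/
def IsCircleFibration (p : C^∞⟮𝓘(ℝ, W), Y; 𝓘(ℝ, V), X⟯) : Prop :=
  ∀ x : X, ∃ U : Set X, IsOpen U ∧ x ∈ U ∧ ∃ (τ : Y → Circle) (σ : X × Circle → Y),
    ContMDiffOn 𝓘(ℝ, W) (𝓡 1) ∞ τ (p ⁻¹' U) ∧
    ContMDiffOn (𝓘(ℝ, V).prod (𝓡 1)) 𝓘(ℝ, W) ∞ σ (U ×ˢ univ) ∧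
    (∀ y ∈ p ⁻¹' U, σ (p y, τ y) = y) ∧
    ∀ x' ∈ U, ∀ c : Circle, p (σ (x', c)) = x' ∧ τ (σ (x', c)) = c

/-- `θ` is a global angular form of the circle fibration `p`: a smooth `1`-form without zeros on the
fibres whose exterior derivative is horizontal. -/
structure IsAngularForm (p : C^∞⟮𝓘(ℝ, W), Y; 𝓘(ℝ, V), X⟯)
    (θ : Π y : Y, TangentSpace 𝓘(ℝ, W) y →L[ℝ] ℝ) : Prop where
  smooth : (covectorForm θ).IsSmooth
  ne_zero : ∀ (y : Y) (v : TangentSpace 𝓘(ℝ, W) y), dproj p y v = 0 → v ≠ 0 → θ y v ≠ 0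
  d_horizontal : ∀ (y : Y) (v w : TangentSpace 𝓘(ℝ, W) y), dproj p y v = 0 →
    (covectorForm θ).d y ![v, w] = 0

/-- The isomorphism `(dp, θ) : T_yY → T_{p(y)}X × ℝ`. -/
def splitting (p : C^∞⟮𝓘(ℝ, W), Y; 𝓘(ℝ, V), X⟯) (θ : Π y : Y, TangentSpace 𝓘(ℝ, W) y →L[ℝ] ℝ)
    (y : Y) : TangentSpace 𝓘(ℝ, W) y →L[ℝ] (TangentSpace 𝓘(ℝ, V) (p y) × ℝ) :=
  (dproj p y).prod (θ y)

/-- The Reeb field: the vertical vector field `ξ` with `θ(ξ) = 1`. -/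
def reebField (p : C^∞⟮𝓘(ℝ, W), Y; 𝓘(ℝ, V), X⟯) (θ : Π y : Y, TangentSpace 𝓘(ℝ, W) y →L[ℝ] ℝ)
    (y : Y) : TangentSpace 𝓘(ℝ, W) y :=
  (splitting p θ y).inverse (0, 1)

/-- The horizontal lift of the complex structure: `Φ ξ = 0`, and `Φ` preserves `ker θ` and
covers `J`. -/
def transverseComplexStructure (p : C^∞⟮𝓘(ℝ, W), Y; 𝓘(ℝ, V), X⟯)
    (θ : Π y : Y, TangentSpace 𝓘(ℝ, W) y →L[ℝ] ℝ) (y : Y) :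
    TangentSpace 𝓘(ℝ, W) y →L[ℝ] TangentSpace 𝓘(ℝ, W) y :=
  (splitting p θ y).inverse ∘L
    ((ContinuousLinearMap.inl ℝ (TangentSpace 𝓘(ℝ, V) (p y)) ℝ) ∘L
      (complexStructure (p y) ∘L dproj p y))

/-- The pullback of a form under `p`. -/
def pullbackForm {G : Type*} [NormedAddCommGroup G] [NormedSpace ℝ G] {k : ℕ}
    (p : C^∞⟮𝓘(ℝ, W), Y; 𝓘(ℝ, V), X⟯) (α : DForm V X G k) : DForm W Y G k := fun y =>
  (α (p y)).compContinuousLinearMap (dproj p y)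

theorem twoForm_add_left {T : Type*} [AddCommGroup T] [Module ℝ T] [TopologicalSpace T]
    (a : T [⋀^Fin 2]→L[ℝ] ℝ) (u u' v : T) : a ![u + u', v] = a ![u, v] + a ![u', v] :=
  a.toMultilinearMap.cons_add ![v] u u'

theorem twoForm_smul_left {T : Type*} [AddCommGroup T] [Module ℝ T] [TopologicalSpace T]
    (a : T [⋀^Fin 2]→L[ℝ] ℝ) (c : ℝ) (u v : T) : a ![c • u, v] = c * a ![u, v] :=
  a.toMultilinearMap.cons_smul ![v] c u

theorem twoForm_swap {T : Type*} [AddCommGroup T] [Module ℝ T] [TopologicalSpace T]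
    (a : T [⋀^Fin 2]→L[ℝ] ℝ) (u v : T) : a ![u, v] = -a ![v, u] := by
  have h := a.toAlternatingMap.map_swap ![v, u] (i := 0) (j := 1) (by decide)
  have h' : (![v, u] ∘ Equiv.swap (0 : Fin 2) 1 : Fin 2 → T) = ![u, v] := by
    ext i; fin_cases i <;> simp
  rw [h'] at h
  exact h

/-- The metric `r p^*g_X + θ ⊗ θ`. -/
def fibrationMetric (cy : CalabiYauStructure V X) (p : C^∞⟮𝓘(ℝ, W), Y; 𝓘(ℝ, V), X⟯)
    (θ : Π y : Y, TangentSpace 𝓘(ℝ, W) y →L[ℝ] ℝ) (r : ℝ) (y : Y) :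
    TangentSpace 𝓘(ℝ, W) y →ₗ[ℝ] TangentSpace 𝓘(ℝ, W) y →ₗ[ℝ] ℝ :=
  LinearMap.mk₂ ℝ
    (fun u v => r * cy.metric (p y) (dproj p y u) (dproj p y v) + θ y u * θ y v)
    (fun u u' v => by
      simp only [CalabiYauStructure.metric, map_add, twoForm_add_left]; ring)
    (fun c u v => by
      simp only [CalabiYauStructure.metric, map_smul, twoForm_smul_left, smul_eq_mul]; ring)
    (fun u v v' => by
      simp only [CalabiYauStructure.metric, map_add]
      rw [twoForm_swap, twoForm_add_left, twoForm_swap _ _ (dproj p y u),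
        twoForm_swap _ (complexStructure _ (dproj p y v'))]
      ring)
    (fun c u v => by
      simp only [CalabiYauStructure.metric, map_smul, smul_eq_mul]
      rw [twoForm_swap, twoForm_smul_left, twoForm_swap _ _ (dproj p y u)]
      ring)

/-- The `4`-form `ψ = ½ ω ∧ ω + θ ∧ Re ε` of the natural G₂-structure
`φ = θ ∧ ω + Im ε`, where `ω` and `ε` are the pullbacks of the Kähler form and the
holomorphic volume form. -/
def naturalFourForm (cy : CalabiYauStructure V X) (p : C^∞⟮𝓘(ℝ, W), Y; 𝓘(ℝ, V), X⟯)
    (θ : Π y : Y, TangentSpace 𝓘(ℝ, W) y →L[ℝ] ℝ) (y : Y)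
    (v : Fin 4 → TangentSpace 𝓘(ℝ, W) y) : ℝ :=
  (1 / 2 : ℝ) * wedge (𝕜 := ℝ) (k := 2) (l := 2) (pullbackForm p cy.kah y)
      (pullbackForm p cy.kah y) v
    + wedge (𝕜 := ℝ) (k := 1) (l := 3) (covectorForm θ y)
      (fun w => (pullbackForm p cy.vol y w).re) v

variable {F : Type*} [NormedAddCommGroup F] [NormedSpace ℂ F]

/-- The connection `A` is a G₂-instanton for the G₂-structure with `4`-form `ψ`:
`F_A ∧ ψ = 0`. -/
def IsGTwoInstanton {B : Y → Type*} [TopologicalSpace (TotalSpace F B)]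
    [∀ y, AddCommGroup (B y)] [∀ y, Module ℝ (B y)]
    [∀ y, TopologicalSpace (B y)] [∀ y, IsTopologicalAddGroup (B y)]
    [∀ y, ContinuousSMul ℝ (B y)] [FiberBundle F B]
    (ψ : Π y : Y, (Fin 4 → TangentSpace 𝓘(ℝ, W) y) → ℝ)
    (A : CovariantDerivative 𝓘(ℝ, W) F B) : Prop :=
  ∀ (y : Y) (v : Fin 6 → TangentSpace 𝓘(ℝ, W) y),
    wedge (𝕜 := ℝ) (k := 2) (l := 4) (curvature A y) (ψ y) v = 0

variable {B : X → Type*} [TopologicalSpace (TotalSpace F B)]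
  [∀ x, AddCommGroup (B x)] [∀ x, Module ℂ (B x)] [∀ x, Module ℝ (B x)]
  [∀ x, IsScalarTower ℝ ℂ (B x)]
  [∀ x, TopologicalSpace (B x)] [∀ x, IsTopologicalAddGroup (B x)]
  [∀ x, ContinuousSMul ℝ (B x)] [FiberBundle F B]

instance pullbackAddCommGroup (p : Y → X) (y : Y) : AddCommGroup ((p *ᵖ B) y) :=
  inferInstanceAs (AddCommGroup (B (p y)))

instance pullbackTopAddGroup (p : Y → X) (y : Y) : IsTopologicalAddGroup ((p *ᵖ B) y) :=
  inferInstanceAs (IsTopologicalAddGroup (B (p y)))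

instance pullbackContinuousSMul (p : Y → X) (y : Y) : ContinuousSMul ℝ ((p *ᵖ B) y) :=
  inferInstanceAs (ContinuousSMul ℝ (B (p y)))

/-- The connection `A'` on `p^*B` is the pullback of the connection `A`: on pullbacks of sections it
is given by `A'_v(p^*s) = p^*(A_{dp(v)} s)`. -/
def IsPullbackConnection (p : C^∞⟮𝓘(ℝ, W), Y; 𝓘(ℝ, V), X⟯)
    (A : CovariantDerivative 𝓘(ℝ, V) F B)
    (A' : CovariantDerivative 𝓘(ℝ, W) F (p *ᵖ B)) : Prop :=
  ∀ (s : Π x : X, B x) (y : Y), DiffSectionAt V F s (p y) →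
    ∀ v : TangentSpace 𝓘(ℝ, W) y,
      A' (fun y' => (s (p y') : (p *ᵖ B) y')) y v = (A s (p y) (dproj p y v) : B (p y))

/-- The partial connection `D'` on `p^*B` along `L'` is the pullback of the partial connection `D`
along `L`: `dp` maps `L'` to `L`, and `D'_u(p^*s) = p^*(D_{dp(u)} s)`. -/
def IsPullbackPartialConnection (p : C^∞⟮𝓘(ℝ, W), Y; 𝓘(ℝ, V), X⟯)
    {L : Π x : X, Submodule ℂ (CTangent V x)} {L' : Π y : Y, Submodule ℂ (CTangent W y)}
    (D : PartialConnection F B L) (D' : PartialConnection F (p *ᵖ B) L') : Prop :=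
  ∀ (y : Y) (u : CTangent W y), u ∈ L' y →
    LinearMap.baseChange ℂ
      (dproj p y : TangentSpace 𝓘(ℝ, W) y →ₗ[ℝ] TangentSpace 𝓘(ℝ, V) (p y)) u ∈ L (p y) ∧
    ∀ s : Π x : X, B x, DiffSectionAt V F s (p y) →
      D'.deriv (fun y' => (s (p y') : (p *ᵖ B) y')) y u =
        (D.deriv s (p y) (LinearMap.baseChange ℂ
          (dproj p y : TangentSpace 𝓘(ℝ, W) y →ₗ[ℝ] TangentSpace 𝓘(ℝ, V) (p y)) u) : B (p y))

end CircleFibration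

end

/-! The base and fibre directions are separated by the isomorphism `(dp, θ) : T_yY → T_{p(y)}X × ℝ`
(`isSplitting`): `θ` is nonzero on nonzero vertical vectors and the dimensions are `7 = 6 + 1`. The
Reeb field and `Φ` are defined through it. Every assertion then becomes a computation in the charts
centred at `y` and `p y`, where the coefficients of forms and connections on `X` are pulled back
along the local expression `P` of `p`. The second derivative of `P` is symmetric and cancels in each
of these computations.

Sasakian structure. In a chart the metric is `r k(dP a, i dP b) + t(a) t(b)`, with `k` and `t` the
coefficients of `ω` and `θ`. Koszul's formula (`IsLeviCivita.koszul`) pins down any Levi-Civita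
connection, and the equations for `∇ξ` and `∇Φ` become linear algebra (`localMetric_nabla_reeb`,
`localMetric_nabla_endo`): the antisymmetrized derivative of `t` is `λ k`, the scale is `r = -λ/2`,
and `k` is closed and of type (1,1). The contact condition holds because `θ ∧ (dθ)³` takes the value
`6 λ³` on `ξ` together with a lifted unitary frame (`wedge_contact`).

Holomorphic Sasakian bundle. `B^{0,1} ⊕ ℂξ` is the full preimage of `T^{0,1}X` under `dp`
(`mem_extendedAntiholomorphicPart_iff`), so `∂̄₀` can be pulled back along it. In a trivialization
the pullback is the derivative plus the pulled-back coefficients of `∂̄₀`, and its curvature is the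
pullback of the curvature of `∂̄₀`, which is zero (`localDbar_flat`, `pullback_isFlat`).

Instantons. The curvature of a Chern connection has type (1,1): flatness of `∂̄₀` removes the (0,2)
part, and unitarity then removes the (2,0) part (`IsChernConnection.curvature_complexStructure`).
Curvature is natural under pullback (`IsPullbackConnection.curvature_eq`), so `F_{A'} ∧ ψ` is the
pullback of `½ F_A ∧ ω²` plus a term containing `F_A ∧ Re ε`. The latter vanishes, since (1,1) times
(3,0) + (0,3) is zero in complex dimension three (`IsThreeZeroRe.altSum_five_eq_zero`), and `F_A ∧
ω²` is a nonzero multiple of `(F_A, ω)` times the volume form (`IsOneOne.altSum_six_eq_zero_iff`,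
`IsOneOne.sum_orthonormal`). As `p` and `dp` are surjective, vanishing on `Y` and on `X` are
equivalent. -/

set_option linter.unusedSectionVars false

open Bundle Set
open scoped Manifold ContDiff TensorProduct Topology

noncomputable section

/-! ### Alternating sums over permutations -/

section AltSum

variable {T G : Type*} [AddCommGroup G]

/-- The signed sum of a function of `n` vectors over all orderings of its arguments. -/
def altSum (n : ℕ) (H : (Fin n → T) → G) (v : Fin n → T) : G :=
  ∑ σ : Equiv.Perm (Fin n), ((σ.sign : ℤ)) • H (fun i => v (σ i))

/-- Laplace expansion in the first argument. A permutation is determined by the image `i` of `0` and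
a permutation of the remaining indices; bringing `i` to the front is the cycle `i.cycleRange`, whose
sign is `(-1)^i`. -/
theorem altSum_succ (n : ℕ) (H : (Fin (n + 1) → T) → G) (v : Fin (n + 1) → T) :
    altSum (n + 1) H v = ∑ i : Fin (n + 1), ((-1 : ℤ) ^ (i : ℕ)) •
      altSum n (fun w => H (Fin.cons (v i) w)) (fun j => v (i.succAbove j)) := by
  have hb : Function.Bijective (fun q : Fin (n + 1) × Equiv.Perm (Fin n) =>
      (q.1.cycleRange.symm * Equiv.Perm.decomposeFin.symm (0, q.2) : Equiv.Perm (Fin (n + 1)))) := by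
    rw [Fintype.bijective_iff_injective_and_card]
    constructor
    · rintro ⟨i, τ⟩ ⟨j, τ'⟩ h
      have h0 := congrArg (fun s : Equiv.Perm (Fin (n + 1)) => s 0) h
      simp at h0
      subst h0
      simpa using h
    · simp [Fintype.card_perm, Nat.factorial_succ]
  unfold altSum
  rw [← hb.sum_comp, Fintype.sum_prod_type]
  refine Finset.sum_congr rfl fun i _ => ?_
  rw [Finset.smul_sum]
  refine Finset.sum_congr rfl fun τ _ => ?_
  rw [smul_smul]
  congr 1
  · simp [Equiv.Perm.sign_inv, ← Equiv.Perm.inv_def]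
  · congr 1
    ext k
    refine Fin.cases ?_ (fun j => ?_) k
    · simp
    · simp

/-- `H` itself need not be alternating: left multiplication by `τ` permutes the summands. -/
theorem altSum_comp_perm {n : ℕ} (H : (Fin n → T) → G) (τ : Equiv.Perm (Fin n)) (v : Fin n → T) :
    altSum n H (fun i => v (τ i)) = (τ.sign : ℤ) • altSum n H v := by
  unfold altSum
  have h := Equiv.sum_comp (Equiv.mulLeft τ)
    (fun σ : Equiv.Perm (Fin n) => ((σ.sign : ℤ)) • H (fun i => v (σ i)))
  rw [← h, Finset.smul_sum]
  refine Finset.sum_congr rfl fun σ _ => ?_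
  rw [smul_smul]
  congr 1
  simp only [Equiv.coe_mulLeft, map_mul, Units.val_mul, ← mul_assoc]
  rw [← Units.val_mul, Int.units_mul_self, Units.val_one, one_mul]

/-- Here the slots of `H` are permuted instead of the vectors, so the reindexing is by right
multiplication. It serves to bring the slot of `θ` to the front in `wedge_fourForm`. -/
theorem altSum_perm_arg {n : ℕ} (H : (Fin n → T) → G) (τ : Equiv.Perm (Fin n)) (v : Fin n → T) :
    altSum n (fun w => H (fun i => w (τ i))) v = (τ.sign : ℤ) • altSum n H v := by
  unfold altSum
  have h := Equiv.sum_comp (Equiv.mulRight τ)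
    (fun σ : Equiv.Perm (Fin n) => ((σ.sign : ℤ)) • H (fun i => v (σ i)))
  rw [← h, Finset.smul_sum]
  refine Finset.sum_congr rfl fun σ _ => ?_
  rw [smul_smul]
  congr 1
  simp only [Equiv.coe_mulRight, map_mul, Units.val_mul]
  rw [mul_comm (σ.sign : ℤ), ← mul_assoc, ← Units.val_mul, Int.units_mul_self, Units.val_one,
    one_mul]

/-- Each of the `n!` outer terms reproduces the same alternating sum, its two signs cancelling. -/
theorem altSum_altSum {n : ℕ} (H : (Fin n → T) → G) (v : Fin n → T) :
    altSum n (altSum n H) v = n.factorial • altSum n H v := by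
  conv_lhs => unfold altSum
  have : ∀ σ : Equiv.Perm (Fin n), ((σ.sign : ℤ)) •
      (∑ τ : Equiv.Perm (Fin n), ((τ.sign : ℤ)) • H (fun i => v (σ (τ i)))) = altSum n H v := by
    intro σ
    have := altSum_comp_perm H σ v
    unfold altSum at this ⊢
    rw [this, smul_smul, ← Units.val_mul, Int.units_mul_self, Units.val_one, one_smul]
  rw [Finset.sum_congr rfl fun σ _ => this σ]
  simp [Fintype.card_perm]

theorem altSum_add {n : ℕ} (H K : (Fin n → T) → G) (v : Fin n → T) :
    altSum n (fun w => H w + K w) v = altSum n H v + altSum n K v := by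
  simp [altSum, Finset.sum_add_distrib]

theorem altSum_map {n : ℕ} {G' : Type*} [AddCommGroup G'] (f : G →+ G') (H : (Fin n → T) → G)
    (v : Fin n → T) : altSum n (fun w => f (H w)) v = f (altSum n H v) := by
  simp [altSum, map_sum, map_zsmul]

theorem altSum_smul {n : ℕ} {R : Type*} [Ring R] [Module R G] (c : R) (H : (Fin n → T) → G)
    (v : Fin n → T) : altSum n (fun w => c • H w) v = c • altSum n H v :=
  altSum_map (DistribSMul.toAddMonoidHom G c) H v

/-- Expansion of an alternating sum of a product along the two arguments of the first factor. -/
theorem altSum_smul_tail {R : Type*} [Ring R] [Module R G] (n : ℕ) (a : T → T → G)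
    (h : (Fin n → T) → R) (v : Fin (n + 2) → T) :
    altSum (n + 2) (fun w => h (fun k => w k.succ.succ) • a (w 0) (w 1)) v =
      ∑ i : Fin (n + 2), ∑ j : Fin (n + 1), ((-1 : ℤ) ^ (i : ℕ) * (-1 : ℤ) ^ (j : ℕ)) •
        altSum n h (fun k => v (i.succAbove (j.succAbove k))) • a (v i) (v (i.succAbove j)) := by
  rw [altSum_succ]
  refine Finset.sum_congr rfl fun i _ => ?_
  rw [altSum_succ, Finset.smul_sum]
  refine Finset.sum_congr rfl fun j _ => ?_
  rw [smul_smul]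
  congr 1
  exact altSum_map ((smulAddHom R G).flip (a (v i) (v (i.succAbove j)))) h _

/-- Alternating a function whose last arguments are already alternated. -/
theorem altSum_altSum_tail {R : Type*} [Ring R] [Module R G] (n : ℕ) (a : T → T → G)
    (h : (Fin n → T) → R) (v : Fin (n + 2) → T) :
    altSum (n + 2) (fun w => altSum n h (fun k => w k.succ.succ) • a (w 0) (w 1)) v =
      n.factorial • altSum (n + 2) (fun w => h (fun k => w k.succ.succ) • a (w 0) (w 1)) v := by
  rw [altSum_smul_tail, altSum_smul_tail, Finset.smul_sum]
  refine Finset.sum_congr rfl fun i _ => ?_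
  rw [Finset.smul_sum]
  refine Finset.sum_congr rfl fun j _ => ?_
  rw [altSum_altSum, smul_assoc, smul_comm]

/-- Bridge between the wedge product and `altSum`; nested wedges are then flattened into a single
alternating sum by `altSum_altSum_tail`. -/
theorem wedge_eq_altSum {k l : ℕ} {𝕜 : Type*} [Field 𝕜] [Module 𝕜 G]
    (a : (Fin k → T) → G) (b : (Fin l → T) → 𝕜) (v : Fin (k + l) → T) :
    wedge a b v = ((k.factorial * l.factorial : 𝕜)⁻¹) • altSum (k + l)
      (fun w => b (fun j => w (Fin.natAdd k j)) • a (fun i => w (Fin.castAdd l i))) v := by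
  simp [wedge, altSum, Int.cast_smul_eq_zsmul]

end AltSum

/-! ### Alternating forms of low degree on real vector spaces -/

section AlternatingAlgebra

variable {V : Type*} [AddCommGroup V] [Module ℝ V] {G : Type*} [AddCommGroup G] [Module ℝ G]

/-- The product of two multilinear maps, the second one scalar-valued. -/
def multilinearProd {k l : ℕ} (a : MultilinearMap ℝ (fun _ : Fin k => V) G)
    (b : MultilinearMap ℝ (fun _ : Fin l => V) ℝ) :
    MultilinearMap ℝ (fun _ : Fin (k + l) => V) G :=
  (TensorProduct.rid ℝ G).toLinearMap.compMultilinearMap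
    ((a.domCoprod b).domDomCongr finSumFinEquiv)

theorem multilinearProd_apply {k l : ℕ} (a : MultilinearMap ℝ (fun _ : Fin k => V) G)
    (b : MultilinearMap ℝ (fun _ : Fin l => V) ℝ) (w : Fin (k + l) → V) :
    multilinearProd a b w =
      b (fun j => w (Fin.natAdd k j)) • a (fun i => w (Fin.castAdd l i)) := by
  simp [multilinearProd]

/-- For multilinear `m` the alternating sum is an honest alternating map, so its vanishing can be
tested on a basis. -/
theorem altSum_eq_alternatization {n : ℕ} (m : MultilinearMap ℝ (fun _ : Fin n => V) G)
    (v : Fin n → V) : altSum n m v = MultilinearMap.alternatization m v := by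
  simp [altSum, MultilinearMap.alternatization_apply, Units.smul_def]

theorem altSum_alternating {n : ℕ} (a : V [⋀^Fin n]→ₗ[ℝ] G) (v : Fin n → V) :
    altSum n a v = n.factorial • a v := by
  have : ∀ σ : Equiv.Perm (Fin n), (σ.sign : ℤ) • a (fun i => v (σ i)) = a v := by
    intro σ
    have := a.map_perm v σ
    simp only [Function.comp_def] at this
    rw [this, Units.smul_def, smul_smul, ← Units.val_mul, Int.units_mul_self, Units.val_one,
      one_smul]
  unfold altSum
  rw [Finset.sum_congr rfl fun σ _ => this σ]
  simp [Fintype.card_perm]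

theorem alternating_two_swap (a : V [⋀^Fin 2]→ₗ[ℝ] G) (u v : V) : a ![u, v] = -a ![v, u] := by
  have h := a.map_swap ![v, u] (i := 0) (j := 1) (by decide)
  have h' : (![v, u] ∘ Equiv.swap (0 : Fin 2) 1 : Fin 2 → V) = ![u, v] := by
    ext i; fin_cases i <;> simp
  rw [h'] at h
  exact h

theorem alternating_two_self (a : V [⋀^Fin 2]→ₗ[ℝ] G) (u : V) : a ![u, u] = 0 :=
  a.map_eq_zero_of_eq ![u, u] (i := 0) (j := 1) rfl (by decide)

theorem alternating_two_add_left (a : V [⋀^Fin 2]→ₗ[ℝ] G) (u u' v : V) :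
    a ![u + u', v] = a ![u, v] + a ![u', v] :=
  a.toMultilinearMap.cons_add ![v] u u'

theorem alternating_two_smul_left (a : V [⋀^Fin 2]→ₗ[ℝ] G) (c : ℝ) (u v : V) :
    a ![c • u, v] = c • a ![u, v] :=
  a.toMultilinearMap.cons_smul ![v] c u

theorem alternating_two_neg_left (a : V [⋀^Fin 2]→ₗ[ℝ] G) (u v : V) :
    a ![-u, v] = -a ![u, v] := by
  simpa using alternating_two_smul_left a (-1) u v

theorem alternating_two_neg_right (a : V [⋀^Fin 2]→ₗ[ℝ] G) (u v : V) :
    a ![u, -v] = -a ![u, v] := by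
  rw [alternating_two_swap, alternating_two_neg_left, alternating_two_swap a u v]

theorem cyclic_three (ρ : V [⋀^Fin 3]→ₗ[ℝ] G) (a b c : V) : ρ ![a, b, c] = ρ ![b, c, a] := by
  have := ρ.map_perm ![a, b, c] (finRotate 3)
  have h' : (![a, b, c] ∘ finRotate 3 : Fin 3 → V) = ![b, c, a] := by
    ext i; fin_cases i <;> simp
  rw [h'] at this
  have hs : (finRotate 3).sign = 1 := by decide
  rw [this, hs, one_smul]

/-- The 24 orderings split into three groups of eight, one for each way to pair up four vectors;
within a group one may exchange the two factors and the entries of each. -/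
theorem altSum_two_mul_two (a : V [⋀^Fin 2]→ₗ[ℝ] ℝ) (v : Fin 4 → V) :
    altSum 4 (fun w => a ![w 2, w 3] • a ![w 0, w 1]) v =
      8 * (a ![v 0, v 1] * a ![v 2, v 3] - a ![v 0, v 2] * a ![v 1, v 3]
        + a ![v 0, v 3] * a ![v 1, v 2]) := by
  have h := altSum_smul_tail 2 (fun x y => a ![x, y]) a v
  have e : ∀ w : Fin 4 → V, (fun k : Fin 2 => w k.succ.succ) = ![w 2, w 3] := by
    intro w; ext k; fin_cases k <;> rfl
  have e2 : ∀ u : Fin 2 → V, u = ![u 0, u 1] := by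
    intro w; ext k; fin_cases k <;> rfl
  simp only [e] at h
  rw [h]
  have h2 : ∀ u : Fin 2 → V, altSum 2 a u = 2 * a ![u 0, u 1] := by
    intro u
    rw [altSum_alternating, ← e2 u]
    simp [Nat.factorial]
  simp only [h2]
  simp [Fin.sum_univ_succ, Fin.succAbove]
  rw [alternating_two_swap a (v 1) (v 0), alternating_two_swap a (v 2) (v 0),
    alternating_two_swap a (v 3) (v 0), alternating_two_swap a (v 2) (v 1),
    alternating_two_swap a (v 3) (v 1), alternating_two_swap a (v 3) (v 2)]
  ring

end AlternatingAlgebra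

/-! ### Forms of type (1,1) and (3,0) on a complex vector space of dimension three -/

section HermitianAlgebra

variable {V : Type*} [AddCommGroup V] [Module ℂ V] [Module ℝ V] [IsScalarTower ℝ ℂ V]
  {G : Type*} [AddCommGroup G] [Module ℝ G]

/-- The real frame `e₀, i e₀, e₁, i e₁, e₂, i e₂` of a complex frame. -/
def realFrame (e : Fin 3 → V) : Fin 6 → V :=
  ![e 0, Complex.I • e 0, e 1, Complex.I • e 1, e 2, Complex.I • e 2]

/-- The real frame of a complex basis is a real basis. -/
theorem exists_basis_realFrame (b : Module.Basis (Fin 3) ℂ V) :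
    ∃ c : Module.Basis (Fin 6) ℝ V, ⇑c = realFrame b := by
  -- The index (real or imaginary part, basis vector) goes to `2 * vector + part`, which interlaces
  -- `e j` and `i e j` as in `realFrame`.
  let E : (Fin 2 × Fin 3) ≃ Fin 6 :=
    ⟨fun q => ⟨2 * q.2 + q.1, by omega⟩, fun k => (⟨k % 2, by omega⟩, ⟨k / 2, by omega⟩),
      by decide, by decide⟩
  refine ⟨(Complex.basisOneI.smulTower b).reindex E, ?_⟩
  ext k
  fin_cases k <;>
    simp [realFrame, E, Module.Basis.smulTower_apply, Complex.coe_basisOneI]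

theorem I_smul_I_smul (u : V) : Complex.I • Complex.I • u = -u := by
  rw [smul_smul, Complex.I_mul_I, neg_one_smul]

/-- A real `2`-form on a complex vector space is of type `(1,1)`. -/
def IsOneOne (F : V [⋀^Fin 2]→ₗ[ℝ] G) : Prop :=
  ∀ u v, F ![Complex.I • u, Complex.I • v] = F ![u, v]

theorem IsOneOne.move {F : V [⋀^Fin 2]→ₗ[ℝ] G} (hF : IsOneOne F) (u v : V) :
    F ![Complex.I • u, v] = -F ![u, Complex.I • v] := by
  rw [← hF (Complex.I • u), I_smul_I_smul, alternating_two_neg_left]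

/-- A sum over the frame `e, i e` of the product of a Hermitian form with a `(1,1)`-form. -/
theorem IsOneOne.altSum_six {F : V [⋀^Fin 2]→ₗ[ℝ] G} {κ : V [⋀^Fin 2]→ₗ[ℝ] ℝ}
    (hF : IsOneOne F) (hκ : IsOneOne κ) (e : Fin 3 → V)
    (h1 : ∀ i j, κ ![e i, Complex.I • e j] = if i = j then 1 else 0)
    (h2 : ∀ i j, κ ![e i, e j] = 0) :
    altSum 6 (fun w => (κ ![w 4, w 5] * κ ![w 2, w 3]) • F ![w 0, w 1]) (realFrame e) =
      (16 : ℝ) • ∑ i, F ![e i, Complex.I • e i] := by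
  have h := altSum_smul_tail 4 (fun x y => F ![x, y])
    (fun u => κ ![u 2, u 3] • κ ![u 0, u 1]) (realFrame e)
  refine h.trans ?_
  -- A term survives only if `F` receives some `e k, i e k`, for otherwise `κ` has to pair vectors
  -- of different complex lines. The factor 16 is 2 (order of the pair in `F`) times 8 (from
  -- `altSum_two_mul_two`).
  simp only [altSum_two_mul_two]
  have h3 : ∀ i j, κ ![Complex.I • e i, Complex.I • e j] = 0 := fun i j => by rw [hκ, h2]
  have h4 : ∀ i j, κ ![Complex.I • e i, e j] = if i = j then -1 else 0 := fun i j => by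
    rw [hκ.move, h1]; split_ifs <;> simp
  simp [Fin.sum_univ_succ, Fin.succAbove, realFrame, h1, h2, h3, h4, hF.move]
  module

/-- The real part of a complex multilinear `3`-form: `i` can be moved between the arguments. -/
def IsThreeZeroRe (ρ : V [⋀^Fin 3]→ₗ[ℝ] ℝ) : Prop :=
  ∀ u v w, ρ ![Complex.I • u, v, w] = ρ ![u, Complex.I • v, w]

theorem IsThreeZeroRe.move {ρ : V [⋀^Fin 3]→ₗ[ℝ] ℝ} (hρ : IsThreeZeroRe ρ) (u v w : V) :
    ρ ![u, Complex.I • v, w] = ρ ![u, v, Complex.I • w] := by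
  have hc := cyclic_three ρ
  rw [hc, hρ, hc, hc, hc]

/-- A product of types (1,1) and (3,0) + (0,3) has type (4,1) + (1,4), which is zero in complex
dimension three. On five vectors of the frame this is visible directly: `ρ` vanishes on two vectors
of one complex line, so it takes one vector from each line, and the surviving terms cancel in pairs
on moving `i` in `F` and in `ρ`. -/
theorem IsThreeZeroRe.altSum_five {F : V [⋀^Fin 2]→ₗ[ℝ] G} {ρ : V [⋀^Fin 3]→ₗ[ℝ] ℝ}
    (hF : IsOneOne F) (hρ : IsThreeZeroRe ρ) (e : Fin 3 → V) (m : Fin 6) :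
    altSum 5 (fun w => ρ ![w 2, w 3, w 4] • F ![w 0, w 1])
      (fun k => realFrame e (m.succAbove k)) = 0 := by
  have h := altSum_smul_tail 3 (fun x y => F ![x, y]) ρ (fun k => realFrame e (m.succAbove k))
  have e1 : ∀ w : Fin 5 → V, (fun k : Fin 3 => w k.succ.succ) = ![w 2, w 3, w 4] := by
    intro w; ext k; fin_cases k <;> rfl
  have e2 : ∀ u : Fin 3 → V, u = ![u 0, u 1, u 2] := by
    intro w; ext k; fin_cases k <;> rfl
  simp only [e1] at h
  refine h.trans ?_
  have h2 : ∀ u : Fin 3 → V, altSum 3 ρ u = 6 * ρ ![u 0, u 1, u 2] := by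
    intro u
    rw [altSum_alternating, ← e2 u]
    simp [Nat.factorial]
  simp only [h2]
  have r1 : ∀ u v w, ρ ![Complex.I • u, v, w] = ρ ![u, v, Complex.I • w] := fun u v w => by
    rw [hρ, hρ.move]
  have r3 : ∀ u v w, ρ ![u, v, -w] = -ρ ![u, v, w] := fun u v w => by
    rw [← cyclic_three ρ, ← cyclic_three ρ w u v]
    simpa using ρ.toMultilinearMap.cons_smul ![u, v] (-1 : ℝ) w
  have z1 : ∀ u w, ρ ![u, u, w] = 0 := fun u w =>
    ρ.map_eq_zero_of_eq ![u, u, w] (i := 0) (j := 1) rfl (by decide)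
  have z2 : ∀ u w, ρ ![w, u, u] = 0 := fun u w =>
    ρ.map_eq_zero_of_eq ![w, u, u] (i := 1) (j := 2) rfl (by decide)
  -- Swapping the last two arguments changes the sign, whereas moving `i` between them does not.
  have z3 : ∀ u w, ρ ![w, u, Complex.I • u] = 0 := fun u w => by
    have a1 := ρ.map_swap ![w, u, Complex.I • u] (i := 1) (j := 2) (by decide)
    have h' : (![w, u, Complex.I • u] ∘ Equiv.swap (1 : Fin 3) 2 : Fin 3 → V) =
        ![w, Complex.I • u, u] := by
      ext i; fin_cases i <;> rfl
    rw [h', hρ.move] at a1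
    linarith
  have r2 := hρ.move
  fin_cases m <;>
    simp [Fin.sum_univ_succ, Fin.succAbove, realFrame, r1, r2, r3, z1, z2, z3, hF.move,
      I_smul_I_smul, alternating_two_neg_right]

/-- `κ(x, i y) + i κ(x, y)` is a Hermitian inner product, conjugate linear in `x`. The real and
imaginary parts of the orthonormality relations of a basis are the two conclusions. -/
theorem exists_unitary_basis [FiniteDimensional ℂ V] (hV : Module.finrank ℂ V = 3)
    {κ : V [⋀^Fin 2]→ₗ[ℝ] ℝ} (hκ : IsOneOne κ) (hpos : ∀ u, u ≠ 0 → 0 < κ ![u, Complex.I • u]) :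
    ∃ b : Module.Basis (Fin 3) ℂ V, (∀ i j, κ ![b i, Complex.I • b j] = if i = j then 1 else 0) ∧
      ∀ i j, κ ![b i, b j] = 0 := by
  have hsymm : ∀ x y, κ ![y, Complex.I • x] = κ ![x, Complex.I • y] := fun x y => by
    rw [alternating_two_swap, hκ.move, neg_neg]
  have hsm : ∀ (r : ℂ) (x : V), r • x = r.re • x + r.im • Complex.I • x := fun r x => by
    rw [← algebraMap_smul ℂ r.re x, ← algebraMap_smul ℂ r.im, smul_smul, ← add_smul]
    simp [Complex.re_add_im]
  let core : InnerProductSpace.Core ℂ V :=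
    { inner := fun x y => (κ ![x, Complex.I • y] : ℂ) + Complex.I * κ ![x, y]
      conj_inner_symm := fun x y => by
        rw [hsymm, alternating_two_swap κ y x]
        apply Complex.ext <;> simp
      re_inner_nonneg := fun x => by
        by_cases hx : x = 0
        · subst hx
          simp [alternating_two_self]
        · simpa using (hpos x hx).le
      add_left := fun x y z => by
        simp only [alternating_two_add_left]
        push_cast; ring
      smul_left := fun x y r => by
        rw [hsm r x]
        simp only [alternating_two_add_left, alternating_two_smul_left, hκ.move, I_smul_I_smul,
          alternating_two_neg_right, smul_eq_mul]
        apply Complex.ext <;> simp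
      definite := fun x hx => by
        by_contra hne
        have h := congrArg Complex.re hx
        have := hpos x hne
        simp at h
        linarith }
  let _ : NormedAddCommGroup V := @InnerProductSpace.Core.toNormedAddCommGroup ℂ V _ _ _ core
  let _ : InnerProductSpace ℂ V := InnerProductSpace.ofCore core.toCore
  let b := (stdOrthonormalBasis ℂ V).reindex (finCongr hV)
  have hin : ∀ i j, (κ ![b i, Complex.I • b j] : ℂ) + Complex.I * κ ![b i, b j] =
      if i = j then 1 else 0 := fun i j => (orthonormal_iff_ite.1 b.orthonormal) i j
  refine ⟨b.toBasis, fun i j => ?_, fun i j => ?_⟩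
  · have := congrArg Complex.re (hin i j)
    split_ifs at this ⊢ <;> simpa using this
  · have := congrArg Complex.im (hin i j)
    split_ifs at this <;> simpa using this

theorem orthonormal_expand {n : ℕ} (g : V →ₗ[ℝ] V →ₗ[ℝ] ℝ) (c : Module.Basis (Fin n) ℝ V)
    (hc : ∀ i j, g (c i) (c j) = if i = j then 1 else 0) (u : V) :
    ∑ j, g u (c j) • c j = u := by
  conv_rhs => rw [← c.sum_repr u]
  refine Finset.sum_congr rfl fun j _ => ?_
  congr 1
  have h := congrArg (fun x => g x (c j)) (c.sum_repr u)
  simp only [map_sum, LinearMap.sum_apply, map_smul, LinearMap.smul_apply, hc] at h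
  simpa using h.symm

/-- The trace of a bilinear form does not depend on the orthonormal basis. -/
theorem sum_orthonormal_eq {n : ℕ} (g : V →ₗ[ℝ] V →ₗ[ℝ] ℝ) (hs : ∀ u v, g u v = g v u)
    (Q : V →ₗ[ℝ] V →ₗ[ℝ] G) (b c : Module.Basis (Fin n) ℝ V)
    (hb : ∀ i j, g (b i) (b j) = if i = j then 1 else 0)
    (hc : ∀ i j, g (c i) (c j) = if i = j then 1 else 0) :
    ∑ i, Q (b i) (b i) = ∑ i, Q (c i) (c i) := by
  calc ∑ i, Q (b i) (b i) = ∑ i, ∑ j, ∑ k, (g (b i) (c j) * g (b i) (c k)) • Q (c j) (c k) := by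
        refine Finset.sum_congr rfl fun i _ => ?_
        conv_lhs => rw [← orthonormal_expand g c hc (b i)]
        simp only [map_sum, LinearMap.sum_apply, map_smul, LinearMap.smul_apply, Finset.smul_sum]
        rw [Finset.sum_comm]
        simp only [smul_smul, mul_comm]
    _ = ∑ j, ∑ k, (∑ i, g (b i) (c j) * g (b i) (c k)) • Q (c j) (c k) := by
        rw [Finset.sum_comm]
        refine Finset.sum_congr rfl fun j _ => ?_
        rw [Finset.sum_comm]
        simp only [Finset.sum_smul]
    -- Parseval's identity in the orthonormal basis `b`.
    _ = ∑ j, ∑ k, g (c j) (c k) • Q (c j) (c k) := by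
        refine Finset.sum_congr rfl fun j _ => Finset.sum_congr rfl fun k _ => ?_
        congr 1
        conv_rhs => rw [← orthonormal_expand g b hb (c j)]
        simp only [map_sum, LinearMap.sum_apply, map_smul, LinearMap.smul_apply, smul_eq_mul]
        exact Finset.sum_congr rfl fun i _ => by rw [hs (b i) (c j)]
    _ = _ := by simp [hc]

/-- The bilinear form `F(u, i v)`. -/
def twistedForm (F : V [⋀^Fin 2]→ₗ[ℝ] G) : V →ₗ[ℝ] V →ₗ[ℝ] G :=
  LinearMap.mk₂ ℝ (fun u v => F ![u, Complex.I • v])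
    (fun u u' v => alternating_two_add_left F u u' _)
    (fun c u v => alternating_two_smul_left F c u _)
    (fun u v v' => by
      rw [smul_add, alternating_two_swap, alternating_two_add_left, neg_add,
        ← alternating_two_swap, ← alternating_two_swap])
    (fun c u v => by
      rw [smul_comm, alternating_two_swap, alternating_two_smul_left, ← smul_neg,
        ← alternating_two_swap])

@[simp]
theorem twistedForm_apply (F : V [⋀^Fin 2]→ₗ[ℝ] G) (u v : V) :
    twistedForm F u v = F ![u, Complex.I • v] := rfl

theorem sum_lt_of_symm {n : ℕ} (s : Fin n → Fin n → G) (h0 : ∀ i, s i i = 0)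
    (hs : ∀ i j, s i j = s j i) : ∑ i, ∑ j, s i j = (2 : ℝ) • ∑ i, ∑ j with i < j, s i j := by
  have h : ∀ i j, s i j = (if i < j then s i j else 0) + (if j < i then s j i else 0) := by
    intro i j
    rcases lt_trichotomy i j with h | h | h
    · simp [h, h.not_gt]
    · subst h; simp [h0]
    · simp [h, h.not_gt, hs i j]
  calc ∑ i, ∑ j, s i j
      = ∑ i, ∑ j, ((if i < j then s i j else 0) + (if j < i then s j i else 0)) :=
        Finset.sum_congr rfl fun i _ => Finset.sum_congr rfl fun j _ => h i j
    _ = (∑ i, ∑ j, if i < j then s i j else 0) + ∑ i, ∑ j, if j < i then s j i else 0 := by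
        simp only [Finset.sum_add_distrib]
    _ = _ := by
        rw [Finset.sum_comm (f := fun i j => if j < i then s j i else 0), ← two_smul ℝ]
        simp only [Finset.sum_filter]

/-- The inner product of a `(1,1)`-form with the Hermitian form, in a unitary basis. -/
theorem IsOneOne.realFrame_orthonormal {κ : V [⋀^Fin 2]→ₗ[ℝ] ℝ} (hκ : IsOneOne κ) (e : Fin 3 → V)
    (h1 : ∀ i j, κ ![e i, Complex.I • e j] = if i = j then 1 else 0)
    (h2 : ∀ i j, κ ![e i, e j] = 0) (i j : Fin 6) :
    κ ![realFrame e i, Complex.I • realFrame e j] = if i = j then 1 else 0 := by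
  have h3 : ∀ i j, κ ![Complex.I • e i, Complex.I • e j] = 0 := fun i j => by rw [hκ, h2]
  have h4 : ∀ i j, κ ![Complex.I • e i, e j] = if i = j then -1 else 0 := fun i j => by
    rw [hκ.move, h1]; split_ifs <;> simp
  fin_cases i <;> fin_cases j <;>
    simp [realFrame, h1, h2, h3, h4, I_smul_I_smul, alternating_two_neg_right]

/-- The numbers `κ(b i, b j)` are the coordinates of `i b_i` in the basis `b`, so summing over all
`j` gives `F(b_i, i b_i)`. Twice the sum over `i < j` is therefore the trace of `twistedForm F`,
which does not depend on the orthonormal basis; on the real frame of `e` each `F(e_i, i e_i)` is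
counted twice. -/
theorem IsOneOne.sum_orthonormal {F : V [⋀^Fin 2]→ₗ[ℝ] G} {κ : V [⋀^Fin 2]→ₗ[ℝ] ℝ}
    (hF : IsOneOne F) (hκ : IsOneOne κ) (e : Module.Basis (Fin 3) ℂ V)
    (h1 : ∀ i j, κ ![e i, Complex.I • e j] = if i = j then 1 else 0)
    (h2 : ∀ i j, κ ![e i, e j] = 0) (b : Fin 6 → V)
    (hb : ∀ i j, κ ![b i, Complex.I • b j] = if i = j then 1 else 0) :
    ∑ i, ∑ j with i < j, κ ![b i, b j] • F ![b i, b j] = ∑ i, F ![e i, Complex.I • e i] := by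
  obtain ⟨c, hc⟩ := exists_basis_realFrame e
  have hcg : ∀ i j, twistedForm κ (c i) (c j) = if i = j then 1 else 0 := by
    intro i j
    rw [hc]
    exact hκ.realFrame_orthonormal e h1 h2 i j
  have hs : ∀ u v, twistedForm κ u v = twistedForm κ v u := fun u v => by
    rw [twistedForm_apply, twistedForm_apply, alternating_two_swap, hκ.move, neg_neg]
  have hli : LinearIndependent ℝ b := by
    rw [Fintype.linearIndependent_iff]
    intro a ha i
    have := congrArg (fun x => twistedForm κ x (b i)) ha
    simpa [hb] using this
  have : Nonempty (Fin 6) := ⟨0⟩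
  let b' := basisOfLinearIndependentOfCardEqFinrank hli
    (by rw [Module.finrank_eq_card_basis c])
  have hb' : ⇑b' = b := coe_basisOfLinearIndependentOfCardEqFinrank _ _
  have hbg : ∀ i j, twistedForm κ (b' i) (b' j) = if i = j then 1 else 0 := by
    rw [hb']; exact hb
  have htr := sum_orthonormal_eq (twistedForm κ) hs (twistedForm F) b' c hbg hcg
  have hJ : ∀ i, ∑ j, κ ![b i, b j] • F ![b i, b j] = F ![b i, Complex.I • b i] := by
    intro i
    have h := orthonormal_expand (twistedForm κ) b' hbg (Complex.I • b i)
    rw [hb'] at h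
    simp only [twistedForm_apply, hκ _ _] at h
    have h5 := congrArg (fun x => -twistedForm F (b i) (Complex.I • x)) h
    simp only [I_smul_I_smul, map_neg, neg_neg, Finset.smul_sum, map_sum] at h5
    rw [twistedForm_apply] at h5
    rw [← h5, ← Finset.sum_neg_distrib]
    refine Finset.sum_congr rfl fun j _ => ?_
    rw [smul_comm, map_smul, twistedForm_apply, I_smul_I_smul, alternating_two_neg_right, smul_neg,
      neg_neg]
  have h6 := sum_lt_of_symm (fun i j => κ ![b i, b j] • F ![b i, b j])
    (fun i => by simp [alternating_two_self])
    (fun i j => by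
      rw [alternating_two_swap κ, alternating_two_swap F, smul_neg, neg_smul, neg_neg])
  rw [hb'] at htr
  simp only [hJ] at h6
  simp only [twistedForm_apply] at htr
  rw [htr, hc] at h6
  have h7 : (2 : ℝ) • ∑ i, F ![e i, Complex.I • e i] =
      (2 : ℝ) • ∑ i, ∑ j with i < j, κ ![b i, b j] • F ![b i, b j] := by
    rw [← h6]
    simp [Fin.sum_univ_succ, realFrame, I_smul_I_smul, alternating_two_neg_right, hF.move]
    module
  exact ((smul_right_injective G (two_ne_zero (α := ℝ))) h7).symm

theorem alternating_eq_zero_of_basis {n : ℕ} (c : Module.Basis (Fin n) ℝ V)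
    (a : V [⋀^Fin n]→ₗ[ℝ] G) (h : a c = 0) : a = 0 := by
  refine c.ext_alternating fun v hv => ?_
  have := a.map_perm c (Equiv.ofBijective v (Finite.injective_iff_bijective.1 hv))
  simp only [Function.comp_def, Equiv.ofBijective_apply] at this
  rw [this, h]
  simp

/-- `n` distinct vectors of a basis with `n + 1` elements omit some index `m`, hence are a
reordering of the face opposite to `m`. -/
theorem alternating_eq_zero_of_faces {n : ℕ} (c : Module.Basis (Fin (n + 1)) ℝ V)
    (a : V [⋀^Fin n]→ₗ[ℝ] G) (h : ∀ m : Fin (n + 1), a (fun k => c (m.succAbove k)) = 0) :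
    a = 0 := by
  refine c.ext_alternating fun v hv => ?_
  have hns : ¬ Function.Surjective v := fun hs => by
    have := Fintype.card_le_of_surjective v hs
    simp at this
  simp only [Function.Surjective, not_forall, not_exists] at hns
  obtain ⟨m, hm⟩ := hns
  choose τ hτ using fun i => Fin.exists_succAbove_eq (hm i)
  have hτi : Function.Injective τ := fun i j hij => hv (by rw [← hτ i, ← hτ j, hij])
  have := a.map_perm (fun k => c (m.succAbove k))
    (Equiv.ofBijective τ (Finite.injective_iff_bijective.1 hτi))
  simp only [Function.comp_def, Equiv.ofBijective_apply, hτ] at this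
  rw [this, h m]
  simp

/-- The alternating sum is a 5-form in real dimension six, so only the faces of the real frame have
to be checked. -/
theorem IsThreeZeroRe.altSum_five_eq_zero {F : V [⋀^Fin 2]→ₗ[ℝ] G} {ρ : V [⋀^Fin 3]→ₗ[ℝ] ℝ}
    (hF : IsOneOne F) (hρ : IsThreeZeroRe ρ) (e : Module.Basis (Fin 3) ℂ V) (v : Fin 5 → V) :
    altSum 5 (fun w => ρ ![w 2, w 3, w 4] • F ![w 0, w 1]) v = 0 := by
  obtain ⟨c, hc⟩ := exists_basis_realFrame e
  let m := multilinearProd F.toMultilinearMap ρ.toMultilinearMap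
  have hm : (fun w : Fin 5 → V => ρ ![w 2, w 3, w 4] • F ![w 0, w 1]) = m := by
    ext w
    have e1 : (fun j : Fin 3 => w (Fin.natAdd 2 j)) = ![w 2, w 3, w 4] := by
      ext i; fin_cases i <;> rfl
    have e2 : (fun j : Fin 2 => w (Fin.castAdd 3 j)) = ![w 0, w 1] := by
      ext i; fin_cases i <;> rfl
    refine Eq.trans ?_ (multilinearProd_apply _ _ _).symm
    rw [e1, e2]
    rfl
  have h0 : MultilinearMap.alternatization m = 0 := by
    refine alternating_eq_zero_of_faces c _ fun k => ?_
    rw [← altSum_eq_alternatization, ← hm, hc]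
    exact hρ.altSum_five hF e k
  rw [hm]
  refine (altSum_eq_alternatization m v).trans ?_
  rw [h0]
  rfl

/-- A 6-form in real dimension six vanishes as soon as it vanishes on one basis, and on the real
frame its value is 16 times the trace. -/
theorem IsOneOne.altSum_six_eq_zero_iff {F : V [⋀^Fin 2]→ₗ[ℝ] G} {κ : V [⋀^Fin 2]→ₗ[ℝ] ℝ}
    (hF : IsOneOne F) (hκ : IsOneOne κ) (e : Module.Basis (Fin 3) ℂ V)
    (h1 : ∀ i j, κ ![e i, Complex.I • e j] = if i = j then 1 else 0)
    (h2 : ∀ i j, κ ![e i, e j] = 0) :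
    (∀ v : Fin 6 → V, altSum 6 (fun w => (κ ![w 4, w 5] * κ ![w 2, w 3]) • F ![w 0, w 1]) v = 0) ↔
      ∑ i, F ![e i, Complex.I • e i] = 0 := by
  have hval := hF.altSum_six hκ e h1 h2
  constructor
  · intro h
    rw [h] at hval
    exact (smul_eq_zero.1 hval.symm).resolve_left (by norm_num)
  · intro h v
    rw [h, smul_zero] at hval
    obtain ⟨c, hc⟩ := exists_basis_realFrame e
    let m := multilinearProd F.toMultilinearMap
      (multilinearProd κ.toMultilinearMap κ.toMultilinearMap)
    have hm : (fun w : Fin 6 → V => (κ ![w 4, w 5] * κ ![w 2, w 3]) • F ![w 0, w 1]) = m := by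
      ext w
      have e1 : (fun j : Fin 2 => w (Fin.natAdd 2 (Fin.natAdd 2 j))) = ![w 4, w 5] := by
        ext i; fin_cases i <;> rfl
      have e2 : (fun j : Fin 2 => w (Fin.natAdd 2 (Fin.castAdd 2 j))) = ![w 2, w 3] := by
        ext i; fin_cases i <;> rfl
      have e3 : (fun j : Fin 2 => w (Fin.castAdd (2 + 2) j)) = ![w 0, w 1] := by
        ext i; fin_cases i <;> rfl
      refine Eq.trans ?_ (multilinearProd_apply _ _ _).symm
      rw [multilinearProd_apply, smul_eq_mul, e1, e2, e3]
      rfl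
    have h0 : MultilinearMap.alternatization m = 0 := by
      refine alternating_eq_zero_of_basis c _ ?_
      rw [← altSum_eq_alternatization, ← hm, hc]
      exact hval
    rw [hm]
    refine (altSum_eq_alternatization m v).trans ?_
    rw [h0]
    rfl

/-- The `4`-form `½ κ ∧ κ + t ∧ ρ`, with `κ` and `ρ` pulled back by `L`. -/
theorem wedge_fourForm {T : Type*} [AddCommGroup T] [Module ℝ T] (L : T →ₗ[ℝ] V) (t : T → ℝ)
    {F : V [⋀^Fin 2]→ₗ[ℝ] G} {κ : V [⋀^Fin 2]→ₗ[ℝ] ℝ} {ρ : V [⋀^Fin 3]→ₗ[ℝ] ℝ}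
    (hF : IsOneOne F) (hρ : IsThreeZeroRe ρ) (e : Module.Basis (Fin 3) ℂ V) (v : Fin 6 → T) :
    wedge (𝕜 := ℝ) (k := 2) (l := 4) (fun w : Fin 2 → T => F (fun i => L (w i)))
      (fun u => (1 / 2 : ℝ) * wedge (𝕜 := ℝ) (k := 2) (l := 2) (fun w => κ (fun i => L (w i)))
          (fun w => κ (fun i => L (w i))) u
        + wedge (𝕜 := ℝ) (k := 1) (l := 3) (fun w => t (w 0)) (fun w => ρ (fun i => L (w i))) u) v
      = (1 / 16 : ℝ) • altSum 6 (fun w => (κ ![w 4, w 5] * κ ![w 2, w 3]) • F ![w 0, w 1])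
        (fun i => L (v i)) := by
  let h₁ : (Fin 4 → T) → ℝ := fun w => κ ![L (w 2), L (w 3)] * κ ![L (w 0), L (w 1)]
  let h₂ : (Fin 4 → T) → ℝ := fun w => ρ ![L (w 1), L (w 2), L (w 3)] * t (w 0)
  -- The 4-form as one alternating sum: `1/8 = ½ · 1/(2! 2!)` and `1/6 = 1/(1! 3!)`.
  have hψ : ∀ u : Fin 4 → T, (1 / 2 : ℝ) * wedge (𝕜 := ℝ) (k := 2) (l := 2)
      (fun w => κ (fun i => L (w i))) (fun w => κ (fun i => L (w i))) u
        + wedge (𝕜 := ℝ) (k := 1) (l := 3) (fun w => t (w 0)) (fun w => ρ (fun i => L (w i))) u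
      = altSum 4 (fun w => (1 / 8 : ℝ) • h₁ w + (1 / 6 : ℝ) • h₂ w) u := by
    intro u
    rw [altSum_add, altSum_smul, altSum_smul, wedge_eq_altSum, wedge_eq_altSum]
    have e1 : (fun w : Fin (2 + 2) → T => κ (fun i => L (w (Fin.natAdd 2 i))) •
        κ (fun i => L (w (Fin.castAdd 2 i)))) = h₁ := by
      ext w
      simp only [smul_eq_mul, h₁]
      congr 2
      · ext i; fin_cases i <;> rfl
      · ext i; fin_cases i <;> rfl
    have e2 : (fun w : Fin (1 + 3) → T => ρ (fun i => L (w (Fin.natAdd 1 i))) •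
        t (w (Fin.castAdd 3 0))) = h₂ := by
      ext w
      simp only [smul_eq_mul, h₂]
      congr 2
      ext i; fin_cases i <;> rfl
    rw [e1, e2]
    simp only [smul_eq_mul]
    norm_num [Nat.factorial]
    ring
  rw [funext hψ, wedge_eq_altSum]
  have e3 : (fun w : Fin (2 + 4) → T =>
      altSum 4 (fun w => (1 / 8 : ℝ) • h₁ w + (1 / 6 : ℝ) • h₂ w) (fun j => w (Fin.natAdd 2 j)) •
        F (fun i => L (w (Fin.castAdd 4 i)))) = fun w =>
      altSum 4 (fun w => (1 / 8 : ℝ) • h₁ w + (1 / 6 : ℝ) • h₂ w) (fun j => w j.succ.succ) •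
        F ![L (w 0), L (w 1)] := by
    ext w
    congr 2
    · ext i; fin_cases i <;> rfl
    · ext i; fin_cases i <;> rfl
  rw [e3]
  -- The inner alternation over the last four slots is absorbed into the outer one at the cost of a
  -- factor `4!`.
  have e4 := altSum_altSum_tail 4 (fun x y : T => F ![L x, L y])
    (fun w => (1 / 8 : ℝ) • h₁ w + (1 / 6 : ℝ) • h₂ w) v
  refine (congrArg _ e4).trans ?_
  have e5 : (fun w : Fin (4 + 2) → T => ((1 / 8 : ℝ) • h₁ (fun k => w k.succ.succ)
      + (1 / 6 : ℝ) • h₂ (fun k => w k.succ.succ)) • F ![L (w 0), L (w 1)]) = fun w =>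
      (1 / 8 : ℝ) • (h₁ (fun k => w k.succ.succ) • F ![L (w 0), L (w 1)]) +
      (1 / 6 : ℝ) • (h₂ (fun k => w k.succ.succ) • F ![L (w 0), L (w 1)]) := by
    ext w
    module
  rw [e5, altSum_add, altSum_smul, altSum_smul]
  -- The contribution of `t ∧ ρ` vanishes: the even permutation `τ` brings the slot of `t` to the
  -- front, and Laplace expansion along it leaves alternating sums of `ρ` and `F` over five vectors.
  have e6 : altSum (4 + 2) (fun w => h₂ (fun k => w k.succ.succ) • F ![L (w 0), L (w 1)]) v = 0 := by
    let τ : Equiv.Perm (Fin 6) := (Equiv.swap 0 1) * (Equiv.swap 1 2)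
    have hτ : τ.sign = 1 := by decide
    have h7 := altSum_perm_arg
      (fun w : Fin 6 → T => h₂ (fun k => w k.succ.succ) • F ![L (w 0), L (w 1)]) τ v
    rw [hτ, Units.val_one, one_smul] at h7
    refine h7.symm.trans ?_
    rw [altSum_succ]
    refine Finset.sum_eq_zero fun i _ => ?_
    have h8 : (fun w : Fin 5 → T => h₂ (fun k => (Fin.cons (v i) w : Fin 6 → T) (τ k.succ.succ)) •
        F ![L ((Fin.cons (v i) w : Fin 6 → T) (τ 0)), L ((Fin.cons (v i) w : Fin 6 → T) (τ 1))]) =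
        fun w => t (v i) • (ρ ![L (w 2), L (w 3), L (w 4)] • F ![L (w 0), L (w 1)]) := by
      ext w
      rw [smul_smul, mul_comm]
      rfl
    rw [h8, altSum_smul]
    have h9 := hρ.altSum_five_eq_zero hF e (fun j => L (v (i.succAbove j)))
    have h10 : altSum 5 (fun w => ρ ![L (w 2), L (w 3), L (w 4)] • F ![L (w 0), L (w 1)])
        (fun j => v (i.succAbove j)) = 0 := h9
    rw [h10, smul_zero, smul_zero]
  rw [e6, smul_zero, add_zero]
  have e7 : altSum (4 + 2) (fun w => h₁ (fun k => w k.succ.succ) • F ![L (w 0), L (w 1)]) v =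
      altSum 6 (fun w => (κ ![w 4, w 5] * κ ![w 2, w 3]) • F ![w 0, w 1])
        (fun i => L (v i)) := rfl
  -- The constant is `1/(2! 4!) · 4! · 1/8 = 1/16`.
  rw [e7, ← Nat.cast_smul_eq_nsmul ℝ, smul_smul, smul_smul]
  congr 1
  norm_num [Nat.factorial]

/-- The same flattening as in `wedge_fourForm`; the factor `1/8` is `1/(2!)³`, the inner `4!` having
cancelled. -/
theorem wedge_cube {T : Type*} (L : T → V) (κ : V [⋀^Fin 2]→ₗ[ℝ] ℝ) (l : ℝ) (v : Fin 6 → T) :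
    wedge (𝕜 := ℝ) (k := 2) (l := 4) (fun w : Fin 2 → T => l * κ (fun i => L (w i)))
      (wedge (𝕜 := ℝ) (k := 2) (l := 2) (fun w => l * κ (fun i => L (w i)))
          (fun w => l * κ (fun i => L (w i)))) v
      = (l ^ 3 / 8) * altSum 6 (fun w => (κ ![w 4, w 5] * κ ![w 2, w 3]) • κ ![w 0, w 1])
        (fun i => L (v i)) := by
  let h : (Fin 4 → T) → ℝ := fun w => κ ![L (w 2), L (w 3)] * κ ![L (w 0), L (w 1)]
  have h2 : (wedge (𝕜 := ℝ) (k := 2) (l := 2) (fun w => l * κ (fun i => L (w i)))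
          (fun w => l * κ (fun i => L (w i)))) = altSum 4 (fun w => (l ^ 2 / 4) • h w) := by
    ext u
    rw [wedge_eq_altSum, altSum_smul]
    have e1 : (fun w : Fin (2 + 2) → T => (l * κ (fun i => L (w (Fin.natAdd 2 i)))) •
        (l * κ (fun i => L (w (Fin.castAdd 2 i))))) = fun w => (l ^ 2) • h w := by
      ext w
      have e1 : (fun j : Fin 2 => L (w (Fin.natAdd 2 j))) = ![L (w 2), L (w 3)] := by
        ext i; fin_cases i <;> rfl
      have e2 : (fun j : Fin 2 => L (w (Fin.castAdd 2 j))) = ![L (w 0), L (w 1)] := by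
        ext i; fin_cases i <;> rfl
      rw [e1, e2]
      simp only [smul_eq_mul, h]
      ring
    rw [e1, altSum_smul]
    simp only [smul_eq_mul]
    norm_num [Nat.factorial]
    ring
  rw [h2, wedge_eq_altSum]
  have e3 : (fun w : Fin (2 + 4) → T =>
      altSum 4 (fun w => (l ^ 2 / 4) • h w) (fun j => w (Fin.natAdd 2 j)) •
        (l * κ (fun i => L (w (Fin.castAdd 4 i))))) = fun w =>
      altSum 4 (fun w => (l ^ 2 / 4) • h w) (fun j => w j.succ.succ) •
        (l * κ ![L (w 0), L (w 1)]) := by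
    ext w
    congr 2
    · ext i; fin_cases i <;> rfl
    · congr 1; ext i; fin_cases i <;> rfl
  rw [e3]
  have e4 := altSum_altSum_tail 4 (fun x y : T => l * κ ![L x, L y])
    (fun w => (l ^ 2 / 4) • h w) v
  refine (congrArg _ e4).trans ?_
  have e5 : (fun w : Fin (4 + 2) → T => ((l ^ 2 / 4) • h (fun k => w k.succ.succ)) •
      (l * κ ![L (w 0), L (w 1)])) = fun w =>
      (l ^ 3 / 4) • (h (fun k => w k.succ.succ) • κ ![L (w 0), L (w 1)]) := by
    ext w
    simp only [smul_eq_mul]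
    ring
  rw [e5, altSum_smul]
  have e7 : altSum (4 + 2) (fun w => h (fun k => w k.succ.succ) • κ ![L (w 0), L (w 1)]) v =
      altSum 6 (fun w => (κ ![w 4, w 5] * κ ![w 2, w 3]) • κ ![w 0, w 1])
        (fun i => L (v i)) := rfl
  rw [e7]
  simp only [smul_eq_mul, nsmul_eq_mul]
  norm_num [Nat.factorial]
  ring

/-- The value of `t ∧ (l κ)³` on a unitary frame completed by a vector `ξ` with `t(ξ) = 1`. -/
theorem wedge_contact {T : Type*} (L : T → V) (t : (Fin 1 → T) → ℝ) {κ : V [⋀^Fin 2]→ₗ[ℝ] ℝ}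
    (hκ : IsOneOne κ) (l : ℝ) (e : Fin 3 → V)
    (h1 : ∀ i j, κ ![e i, Complex.I • e j] = if i = j then 1 else 0)
    (h2 : ∀ i j, κ ![e i, e j] = 0) (v : Fin 7 → T) (h0 : t (fun _ => v 0) = 1)
    (ht : ∀ i : Fin 6, t (fun _ => v i.succ) = 0) (hL : ∀ i : Fin 6, L (v i.succ) = realFrame e i)
    (β : (Fin 2 → T) → ℝ) (hβ : ∀ w, β w = l * κ (fun i => L (w i))) :
    wedge (𝕜 := ℝ) (k := 1) (l := 6) t (wedge (𝕜 := ℝ) (k := 2) (l := 4) β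
      (wedge (𝕜 := ℝ) (k := 2) (l := 2) β β)) v = 6 * l ^ 3 := by
  obtain rfl : β = fun w => l * κ (fun i => L (w i)) := funext hβ
  rw [funext (wedge_cube L κ l), wedge_eq_altSum]
  let H : (Fin 6 → T) → ℝ := fun w =>
    (κ ![L (w 4), L (w 5)] * κ ![L (w 2), L (w 3)]) • κ ![L (w 0), L (w 1)]
  have e1 : (fun w : Fin (1 + 6) → T => (l ^ 3 / 8 * altSum 6
      (fun w => (κ ![w 4, w 5] * κ ![w 2, w 3]) • κ ![w 0, w 1])
        (fun i => L (w (Fin.natAdd 1 i)))) • t (fun i => w (Fin.castAdd 6 i))) =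
      fun w : Fin 7 → T => (l ^ 3 / 8) • (t (fun _ => w 0) • altSum 6 H (fun i => w i.succ)) := by
    ext w
    have e2 : (fun i : Fin 6 => w (Fin.natAdd 1 i)) = fun i => w i.succ := by
      ext i; fin_cases i <;> rfl
    have e3 : (fun i : Fin 1 => w (Fin.castAdd 6 i)) = fun i => w 0 := by
      ext i; fin_cases i; rfl
    have e4 : altSum 6 (fun w => (κ ![w 4, w 5] * κ ![w 2, w 3]) • κ ![w 0, w 1])
        (fun i => L (w (Fin.natAdd 1 i))) = altSum 6 H (fun i => w (Fin.natAdd 1 i)) := rfl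
    rw [e4, e2, e3]
    simp only [smul_eq_mul]
    ring
  rw [e1, altSum_smul]
  -- `720 = 6!` comes from alternating the last six slots twice, and `16 * 3` from `altSum_six` with
  -- `F = κ`, whose trace over the unitary basis is 3.
  have e5 : altSum 7 (fun w : Fin 7 → T => t (fun _ => w 0) • altSum 6 H (fun i => w i.succ)) v =
      720 * (16 * 3) := by
    rw [altSum_succ, Fin.sum_univ_succ]
    -- `t` vanishes on all the vectors except `v 0`, so only the first term of the expansion
    -- survives.
    rw [Finset.sum_eq_zero, add_zero]
    · have e6 : (fun w : Fin 6 → T => t (fun _ => (Fin.cons (v 0) w : Fin 7 → T) 0) •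
          altSum 6 H (fun i => (Fin.cons (v 0) w : Fin 7 → T) i.succ)) = altSum 6 H := by
        ext w
        simp [h0]
      rw [e6, altSum_altSum]
      have e7 : altSum 6 H (fun j => v (Fin.succAbove 0 j)) = altSum 6
          (fun w => (κ ![w 4, w 5] * κ ![w 2, w 3]) • κ ![w 0, w 1]) (realFrame e) := by
        have : (fun j => L (v (Fin.succAbove 0 j))) = realFrame e := by
          ext j
          simp [hL]
        rw [← this]
        rfl
      rw [e7, hκ.altSum_six hκ e h1 h2]
      simp [h1, Nat.factorial]
    · intro i _
      have e6 : (fun w : Fin 6 → T => t (fun _ => (Fin.cons (v i.succ) w : Fin 7 → T) 0) •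
          altSum 6 H (fun j => (Fin.cons (v i.succ) w : Fin 7 → T) j.succ)) = fun w => 0 := by
        ext w
        simp [ht]
      rw [e6]
      simp [altSum]
  refine (congrArg (fun x : ℝ => _ • _ • x) e5).trans ?_
  simp only [smul_eq_mul]
  norm_num [Nat.factorial]
  ring

end HermitianAlgebra

/-! ### Vector fields, derivatives and Lie brackets in a chart -/

section ChartTools

variable {E : Type*} [NormedAddCommGroup E] [NormedSpace ℝ E]
  {M : Type*} [TopologicalSpace M] [ChartedSpace E M] [IsManifold 𝓘(ℝ, E) ∞ M]
  {G : Type*} [NormedAddCommGroup G] [NormedSpace ℝ G]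

/-- The differential of the chart at `x₀`. -/
def chartD (x₀ x : M) : TangentSpace 𝓘(ℝ, E) x →L[ℝ] E :=
  mfderiv 𝓘(ℝ, E) 𝓘(ℝ, E) (extChartAt 𝓘(ℝ, E) x₀) x

/-- The differential of the inverse of the chart at `x₀`. -/
def coordL (x₀ x : M) : E →L[ℝ] TangentSpace 𝓘(ℝ, E) x :=
  (trivializationAt E (TangentSpace 𝓘(ℝ, E)) x₀).symmL ℝ x

/-- The coordinate vector field of the chart at `x₀` with constant value `v`. -/
def coordField (x₀ : M) (v : E) (x : M) : TangentSpace 𝓘(ℝ, E) x := coordL x₀ x v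

/-- The expression of a vector field in the chart at `x₀`. -/
def fieldRep (x₀ : M) (Z : Π x : M, TangentSpace 𝓘(ℝ, E) x) (z : E) : E :=
  chartD x₀ ((extChartAt 𝓘(ℝ, E) x₀).symm z) (Z ((extChartAt 𝓘(ℝ, E) x₀).symm z))

theorem mem_extChartAt_target_of_mem {x₀ x : M} (hx : x ∈ (chartAt E x₀).source) :
    extChartAt 𝓘(ℝ, E) x₀ x ∈ (extChartAt 𝓘(ℝ, E) x₀).target :=
  (extChartAt 𝓘(ℝ, E) x₀).map_source (by rwa [extChartAt_source])

theorem extChartAt_symm_apply_of_mem {x₀ x : M} (hx : x ∈ (chartAt E x₀).source) :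
    (extChartAt 𝓘(ℝ, E) x₀).symm (extChartAt 𝓘(ℝ, E) x₀ x) = x :=
  (extChartAt 𝓘(ℝ, E) x₀).left_inv (by rwa [extChartAt_source])

theorem extChartAt_symm_mem {x₀ : M} {z : E} (hz : z ∈ (extChartAt 𝓘(ℝ, E) x₀).target) :
    (extChartAt 𝓘(ℝ, E) x₀).symm z ∈ (chartAt E x₀).source := by
  simpa [extChartAt_source] using (extChartAt 𝓘(ℝ, E) x₀).map_target hz

theorem coordL_eq_mfderiv {x₀ x : M} (hx : x ∈ (chartAt E x₀).source) :
    (coordL (E := E) x₀ x : E →L[ℝ] E) =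
      (mfderiv 𝓘(ℝ, E) 𝓘(ℝ, E) (extChartAt 𝓘(ℝ, E) x₀).symm (extChartAt 𝓘(ℝ, E) x₀ x) :
        E →L[ℝ] E) := by
  have h := TangentBundle.symmL_trivializationAt (I := 𝓘(ℝ, E)) hx
  simp only [modelWithCornersSelf_coe, range_id, mfderivWithin_univ] at h
  exact h

theorem chartD_eq {x₀ x : M} (hx : x ∈ (chartAt E x₀).source) :
    chartD x₀ x = (trivializationAt E (TangentSpace 𝓘(ℝ, E)) x₀).continuousLinearMapAt ℝ x :=
  (TangentBundle.continuousLinearMapAt_trivializationAt hx).symm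

theorem chartD_eq_snd {x₀ x : M} (hx : x ∈ (chartAt E x₀).source) (u : TangentSpace 𝓘(ℝ, E) x) :
    chartD x₀ x u = (trivializationAt E (TangentSpace 𝓘(ℝ, E)) x₀ ⟨x, u⟩).2 := by
  rw [chartD_eq hx, Trivialization.continuousLinearMapAt_apply,
    Trivialization.coe_linearMapAt_of_mem]
  exact hx

@[simp]
theorem chartD_coordL {x₀ x : M} (hx : x ∈ (chartAt E x₀).source) (v : E) :
    chartD x₀ x (coordL x₀ x v) = v := by
  rw [chartD_eq hx]
  exact Trivialization.continuousLinearMapAt_symmL _ hx v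

@[simp]
theorem coordL_chartD {x₀ x : M} (hx : x ∈ (chartAt E x₀).source) (u : TangentSpace 𝓘(ℝ, E) x) :
    coordL x₀ x (chartD x₀ x u) = u := by
  rw [chartD_eq hx]
  exact Trivialization.symmL_continuousLinearMapAt _ hx u

-- The tangent space at `x₀` is identified with the model space through the chart at `x₀` itself.
-- This is why all tensorial identities below are verified at the centre of a chart.
@[simp]
theorem chartD_self (x₀ : M) (u : TangentSpace 𝓘(ℝ, E) x₀) : chartD x₀ x₀ u = u := by
  have h := mfderiv_chartAt_eq_tangentCoordChange (I := 𝓘(ℝ, E)) (mem_chart_source E x₀)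
  have h2 := tangentCoordChange_self (I := 𝓘(ℝ, E)) (x := x₀) (z := x₀) (v := u)
    (mem_extChartAt_source x₀)
  rw [← h] at h2
  exact h2

@[simp]
theorem coordL_self (x₀ : M) (v : E) : coordL x₀ x₀ v = v := by
  have := coordL_chartD (mem_chart_source E x₀) (v : TangentSpace 𝓘(ℝ, E) x₀)
  exact (congrArg (coordL x₀ x₀) (chartD_self x₀ v)).symm.trans this

theorem contMDiffAt_iff_chart {n : ℕ∞ω} [IsManifold 𝓘(ℝ, E) n M] {x₀ x : M}
    (hx : x ∈ (chartAt E x₀).source) (f : M → G) :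
    ContMDiffAt 𝓘(ℝ, E) 𝓘(ℝ, G) n f x ↔
      ContDiffAt ℝ n (f ∘ (extChartAt 𝓘(ℝ, E) x₀).symm) (extChartAt 𝓘(ℝ, E) x₀ x) := by
  rw [contMDiffAt_iff_source_of_mem_source hx]
  simp [contMDiffWithinAt_univ, contMDiffAt_iff_contDiffAt]

theorem mdifferentiableAt_iff_chart {x₀ x : M}
    (hx : x ∈ (chartAt E x₀).source) (f : M → G) :
    MDifferentiableAt 𝓘(ℝ, E) 𝓘(ℝ, G) f x ↔
      DifferentiableAt ℝ (f ∘ (extChartAt 𝓘(ℝ, E) x₀).symm) (extChartAt 𝓘(ℝ, E) x₀ x) := by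
  rw [mdifferentiableAt_iff_source_of_mem_source hx]
  simp [mdifferentiableWithinAt_univ, mdifferentiableAt_iff_differentiableAt]

theorem mdifferentiableAt_extChartAt_symm {x₀ x : M} (hx : x ∈ (chartAt E x₀).source) :
    MDifferentiableAt 𝓘(ℝ, E) 𝓘(ℝ, E) (extChartAt 𝓘(ℝ, E) x₀).symm (extChartAt 𝓘(ℝ, E) x₀ x) := by
  have := mdifferentiableWithinAt_extChartAt_symm (I := 𝓘(ℝ, E)) (mem_extChartAt_target_of_mem hx)
  simpa [mdifferentiableWithinAt_univ] using this

theorem fderiv_chart {x₀ x : M} (hx : x ∈ (chartAt E x₀).source) {f : M → G}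
    (hf : MDifferentiableAt 𝓘(ℝ, E) 𝓘(ℝ, G) f x) (v : E) :
    fderiv ℝ (f ∘ (extChartAt 𝓘(ℝ, E) x₀).symm) (extChartAt 𝓘(ℝ, E) x₀ x) v =
      mvfderiv 𝓘(ℝ, E) f x (coordL x₀ x v) := by
  have hx' := extChartAt_symm_apply_of_mem hx
  rw [← mfderiv_eq_fderiv, mfderiv_comp _ (by rwa [hx']) (mdifferentiableAt_extChartAt_symm hx)]
  have h1 : (mfderiv 𝓘(ℝ, E) 𝓘(ℝ, G) f ((extChartAt 𝓘(ℝ, E) x₀).symm (extChartAt 𝓘(ℝ, E) x₀ x)) :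
      E →L[ℝ] G) = (mfderiv 𝓘(ℝ, E) 𝓘(ℝ, G) f x : E →L[ℝ] G) := by rw [hx']
  have h2 := congrArg (fun T : E →L[ℝ] E => T v) (coordL_eq_mfderiv hx)
  exact (congrArg (fun T : E →L[ℝ] G => T _) h1).trans
    (congrArg (mfderiv 𝓘(ℝ, E) 𝓘(ℝ, G) f x : E →L[ℝ] G) h2.symm)

theorem mvfderiv_eq_fderiv_chart {x₀ x : M} (hx : x ∈ (chartAt E x₀).source) {f : M → G}
    (hf : MDifferentiableAt 𝓘(ℝ, E) 𝓘(ℝ, G) f x) (u : TangentSpace 𝓘(ℝ, E) x) :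
    mvfderiv 𝓘(ℝ, E) f x u =
      fderiv ℝ (f ∘ (extChartAt 𝓘(ℝ, E) x₀).symm) (extChartAt 𝓘(ℝ, E) x₀ x) (chartD x₀ x u) := by
  rw [fderiv_chart hx hf, coordL_chartD hx]

theorem contDiffAt_congr_of_eventuallyEq' {n : ℕ∞ω} {f g : E → G} {z : E} (h : f =ᶠ[𝓝 z] g) :
    ContDiffAt ℝ n f z ↔ ContDiffAt ℝ n g z :=
  ⟨fun hf => hf.congr_of_eventuallyEq h.symm, fun hg => hg.congr_of_eventuallyEq h⟩

theorem contMDiffAt_field_iff {n : ℕ∞ω} [IsManifold 𝓘(ℝ, E) n M]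
    [ContMDiffVectorBundle n E (TangentSpace 𝓘(ℝ, E) : M → Type _) 𝓘(ℝ, E)] {x₀ x : M}
    (hx : x ∈ (chartAt E x₀).source) (Z : Π x : M, TangentSpace 𝓘(ℝ, E) x) :
    ContMDiffAt 𝓘(ℝ, E) 𝓘(ℝ, E).tangent n (fun x => (⟨x, Z x⟩ : TangentBundle 𝓘(ℝ, E) M)) x ↔
      ContDiffAt ℝ n (fieldRep x₀ Z) (extChartAt 𝓘(ℝ, E) x₀ x) := by
  rw [Trivialization.contMDiffAt_section_iff (trivializationAt E (TangentSpace 𝓘(ℝ, E)) x₀) hx,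
    contMDiffAt_iff_chart hx]
  refine contDiffAt_congr_of_eventuallyEq' ?_
  filter_upwards [(isOpen_extChartAt_target x₀).mem_nhds (mem_extChartAt_target_of_mem hx)] with z hz
  exact (chartD_eq_snd (extChartAt_symm_mem hz) _).symm

theorem diffFieldAt_iff {x₀ x : M}
    (hx : x ∈ (chartAt E x₀).source) (Z : Π x : M, TangentSpace 𝓘(ℝ, E) x) :
    DiffFieldAt Z x ↔ DifferentiableAt ℝ (fieldRep x₀ Z) (extChartAt 𝓘(ℝ, E) x₀ x) := by
  rw [DiffFieldAt, Trivialization.mdifferentiableAt_section_iff 𝓘(ℝ, E)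
    (trivializationAt E (TangentSpace 𝓘(ℝ, E)) x₀) _ hx, mdifferentiableAt_iff_chart hx]
  refine Filter.EventuallyEq.differentiableAt_iff ?_
  filter_upwards [(isOpen_extChartAt_target x₀).mem_nhds (mem_extChartAt_target_of_mem hx)] with z hz
  exact (chartD_eq_snd (extChartAt_symm_mem hz) _).symm

theorem fieldRep_coordField {x₀ : M} (v : E) {z : E}
    (hz : z ∈ (extChartAt 𝓘(ℝ, E) x₀).target) : fieldRep x₀ (coordField x₀ v) z = v :=
  chartD_coordL (extChartAt_symm_mem hz) v

theorem fieldRep_coordField_eventuallyEq {x₀ x : M} (hx : x ∈ (chartAt E x₀).source) (v : E) :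
    fieldRep x₀ (coordField x₀ v) =ᶠ[𝓝 (extChartAt 𝓘(ℝ, E) x₀ x)] fun _ => v := by
  filter_upwards [(isOpen_extChartAt_target x₀).mem_nhds (mem_extChartAt_target_of_mem hx)] with z hz
  exact fieldRep_coordField v hz

theorem smoothFieldOn_coordField (x₀ : M) (v : E) :
    SmoothFieldOn (coordField x₀ v) (chartAt E x₀).source := fun x hx => by
  refine ContMDiffAt.contMDiffWithinAt ?_
  rw [contMDiffAt_field_iff hx]
  exact contDiffAt_const.congr_of_eventuallyEq (fieldRep_coordField_eventuallyEq hx v)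

theorem diffFieldAt_coordField {x₀ x : M} (hx : x ∈ (chartAt E x₀).source) (v : E) :
    DiffFieldAt (coordField x₀ v) x := by
  rw [diffFieldAt_iff hx]
  exact (differentiableAt_const v).congr_of_eventuallyEq (fieldRep_coordField_eventuallyEq hx v)

/-- The Lie bracket at the centre of a chart. -/
theorem mlieBracket_eq (Z W : Π x : M, TangentSpace 𝓘(ℝ, E) x) (x₀ : M) :
    VectorField.mlieBracket 𝓘(ℝ, E) Z W x₀ =
      VectorField.lieBracket ℝ (fieldRep x₀ Z) (fieldRep x₀ W) (extChartAt 𝓘(ℝ, E) x₀ x₀) := by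
  have key : ∀ Z : Π x : M, TangentSpace 𝓘(ℝ, E) x,
      VectorField.mpullbackWithin 𝓘(ℝ, E) 𝓘(ℝ, E) (extChartAt 𝓘(ℝ, E) x₀).symm Z
        (range 𝓘(ℝ, E)) =ᶠ[𝓝 (extChartAt 𝓘(ℝ, E) x₀ x₀)] fieldRep x₀ Z := by
    intro Z
    filter_upwards [(isOpen_extChartAt_target x₀).mem_nhds (mem_extChartAt_target x₀)] with z hz
    have h1 := mfderiv_extChartAt_comp_mfderivWithin_extChartAt_symm (I := 𝓘(ℝ, E)) hz
    have h2 := mfderivWithin_extChartAt_symm_comp_mfderiv_extChartAt (I := 𝓘(ℝ, E)) hz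
    rw [VectorField.mpullbackWithin_apply, ContinuousLinearMap.inverse_eq h2 h1]
    rfl
  rw [← VectorField.mlieBracketWithin_univ, VectorField.mlieBracketWithin_apply]
  have hid : (mfderiv 𝓘(ℝ, E) 𝓘(ℝ, E) (extChartAt 𝓘(ℝ, E) x₀) x₀) =
      ContinuousLinearMap.id ℝ E := by
    ext u
    exact chartD_self x₀ u
  rw [hid]
  have hinv : (ContinuousLinearMap.id ℝ E).inverse = ContinuousLinearMap.id ℝ E :=
    ContinuousLinearMap.inverse_id
  refine (congrArg (fun T : E →L[ℝ] E => T _) hinv).trans ?_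
  simp only [preimage_univ, univ_inter, ContinuousLinearMap.id_apply, modelWithCornersSelf_coe,
    range_id]
  have k1 := key Z
  have k2 := key W
  simp only [modelWithCornersSelf_coe, range_id] at k1 k2
  refine Eq.trans ?_ (Filter.EventuallyEq.lieBracket_vectorField_eq (𝕜 := ℝ) k1 k2)
  exact congrFun (VectorField.lieBracketWithin_univ (𝕜 := ℝ)) _

end ChartTools

/-! ### Complexified tangent vectors and derivatives of vector-valued functions -/

section ComplexTangent

variable {T : Type*} [AddCommGroup T] [Module ℝ T]

theorem complexify_exists (u : ℂ ⊗[ℝ] T) :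
    ∃ u₁ u₂ : T, u = (1 : ℂ) ⊗ₜ[ℝ] u₁ + Complex.I ⊗ₜ[ℝ] u₂ := by
  induction u using TensorProduct.induction_on with
  | zero => exact ⟨0, 0, by simp⟩
  | tmul c t =>
    refine ⟨c.re • t, c.im • t, ?_⟩
    rw [← TensorProduct.smul_tmul, ← TensorProduct.smul_tmul, ← TensorProduct.add_tmul]
    congr 1
    apply Complex.ext <;> simp
  | add a b ha hb =>
    obtain ⟨a₁, a₂, rfl⟩ := ha
    obtain ⟨b₁, b₂, rfl⟩ := hb
    exact ⟨a₁ + b₁, a₂ + b₂, by simp only [TensorProduct.tmul_add]; abel⟩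

theorem complexify_inj {u₁ u₂ v₁ v₂ : T}
    (h : (1 : ℂ) ⊗ₜ[ℝ] u₁ + Complex.I ⊗ₜ[ℝ] u₂ = (1 : ℂ) ⊗ₜ[ℝ] v₁ + Complex.I ⊗ₜ[ℝ] v₂) :
    u₁ = v₁ ∧ u₂ = v₂ := by
  constructor
  · have := congrArg ((TensorProduct.lid ℝ T).toLinearMap ∘ₗ LinearMap.rTensor T Complex.reLm) h
    simpa using this
  · have := congrArg ((TensorProduct.lid ℝ T).toLinearMap ∘ₗ LinearMap.rTensor T Complex.imLm) h
    simpa using this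

variable {N : Type*} [AddCommGroup N] [Module ℝ N] [Module ℂ N] [IsScalarTower ℝ ℂ N]

theorem liftBaseChange_complex (l : T →ₗ[ℝ] N) (u₁ u₂ : T) :
    LinearMap.liftBaseChange ℂ l ((1 : ℂ) ⊗ₜ[ℝ] u₁ + Complex.I ⊗ₜ[ℝ] u₂) =
      l u₁ + Complex.I • l u₂ := by
  simp

end ComplexTangent

section Derivative

variable {E : Type*} [NormedAddCommGroup E] [NormedSpace ℝ E]
  {M : Type*} [TopologicalSpace M] [ChartedSpace E M]
  {G G' : Type*} [NormedAddCommGroup G] [NormedSpace ℝ G] [NormedAddCommGroup G'] [NormedSpace ℝ G']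

theorem mvfderiv_clm_comp {f : M → G} {x : M} (hf : MDifferentiableAt 𝓘(ℝ, E) 𝓘(ℝ, G) f x)
    (l : G →L[ℝ] G') (u : TangentSpace 𝓘(ℝ, E) x) :
    mvfderiv 𝓘(ℝ, E) (fun x => l (f x)) x u = l (mvfderiv 𝓘(ℝ, E) f x u) := by
  have h := (l.hasMFDerivAt (x := f x)).comp x hf.hasMFDerivAt
  have h2 : mfderiv 𝓘(ℝ, E) 𝓘(ℝ, G') (fun x => l (f x)) x = _ := h.mfderiv
  simp only [mvfderiv]
  rw [h2]
  rfl

theorem MDifferentiableAt.clm_comp' {f : M → G} {x : M}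
    (hf : MDifferentiableAt 𝓘(ℝ, E) 𝓘(ℝ, G) f x) (l : G →L[ℝ] G') :
    MDifferentiableAt 𝓘(ℝ, E) 𝓘(ℝ, G') (fun x => l (f x)) x :=
  ((l.hasMFDerivAt (x := f x)).comp x hf.hasMFDerivAt).mdifferentiableAt

theorem mvfderiv_congr {f g : M → G} {x : M} (h : f =ᶠ[𝓝 x] g) :
    mvfderiv 𝓘(ℝ, E) f x = (mvfderiv 𝓘(ℝ, E) g x : TangentSpace 𝓘(ℝ, E) x →L[ℝ] G) := by
  ext u
  simp only [mvfderiv]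
  exact congrArg (fun T : E →L[ℝ] G => T u) h.mfderiv_eq

end Derivative

/-! ### Locality and local expressions of partial connections -/

section PartialConnections

variable {E : Type*} [NormedAddCommGroup E] [NormedSpace ℝ E]
  {M : Type*} [TopologicalSpace M] [ChartedSpace E M] [IsManifold 𝓘(ℝ, E) ∞ M]
  {F : Type*} [NormedAddCommGroup F] [NormedSpace ℂ F]
  {B : M → Type*} [TopologicalSpace (TotalSpace F B)]
  [∀ x, AddCommGroup (B x)] [∀ x, Module ℂ (B x)] [∀ x, Module ℝ (B x)]
  [∀ x, IsScalarTower ℝ ℂ (B x)]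
  [∀ x, TopologicalSpace (B x)] [FiberBundle F B] [VectorBundle ℂ F B] [VectorBundle ℝ F B]

/-- The section which is constant in a trivialization. -/
def constSec (e : Trivialization F (π F B)) (f : F) (x : M) : B x := e.symm x f

theorem constSec_eq (e : Trivialization F (π F B)) [MemTrivializationAtlas e] {x : M}
    (hx : x ∈ e.baseSet) (f : F) : constSec e f x = e.symmₗ ℂ x f := by
  rw [Trivialization.coe_symmₗ e hx]; rfl

theorem snd_eq (e : Trivialization F (π F B)) [MemTrivializationAtlas e] {x : M}
    (hx : x ∈ e.baseSet) (b : B x) : (e ⟨x, b⟩).2 = e.linearMapAt ℂ x b := by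
  rw [Trivialization.coe_linearMapAt_of_mem e hx]

theorem snd_constSec (e : Trivialization F (π F B)) {x : M} (hx : x ∈ e.baseSet) (f : F) :
    (e ⟨x, constSec e f x⟩).2 = f := by
  rw [constSec, e.apply_mk_symm hx]

theorem constSec_snd (e : Trivialization F (π F B)) {x : M} (hx : x ∈ e.baseSet) (b : B x) :
    constSec e (e ⟨x, b⟩).2 x = b := e.symm_apply_apply_mk hx b

theorem snd_injective (e : Trivialization F (π F B)) {x : M} (hx : x ∈ e.baseSet) {b c : B x}
    (h : (e ⟨x, b⟩).2 = (e ⟨x, c⟩).2) : b = c := by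
  rw [← constSec_snd e hx b, h, constSec_snd e hx]

variable [ContMDiffVectorBundle ∞ F B 𝓘(ℝ, E)]

variable (E F B) in
theorem contMDiffVectorBundle_one : ContMDiffVectorBundle 1 F B 𝓘(ℝ, E) :=
  ContMDiffVectorBundle.of_le (n := ∞) (by norm_num)

theorem diffSectionAt_iff (e : Trivialization F (π F B)) [MemTrivializationAtlas e] {x : M}
    (hx : x ∈ e.baseSet) (s : Π x : M, B x) :
    DiffSectionAt E F s x ↔ MDifferentiableAt 𝓘(ℝ, E) 𝓘(ℝ, F) (fun x => (e ⟨x, s x⟩).2) x := by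
  have := contMDiffVectorBundle_one E F B
  exact e.mdifferentiableAt_section_iff 𝓘(ℝ, E) s hx

theorem smoothSectionAt_iff (e : Trivialization F (π F B)) [MemTrivializationAtlas e] {x : M}
    (hx : x ∈ e.baseSet) (s : Π x : M, B x) :
    ContMDiffAt 𝓘(ℝ, E) (𝓘(ℝ, E).prod 𝓘(ℝ, F)) ∞ (fun x => (⟨x, s x⟩ : TotalSpace F B)) x ↔
      ContMDiffAt 𝓘(ℝ, E) 𝓘(ℝ, F) ∞ (fun x => (e ⟨x, s x⟩).2) x :=
  e.contMDiffAt_section_iff hx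

theorem SmoothSectionOn.contMDiffAt {s : Π x : M, B x} {O : Set M}
    (hs : SmoothSectionOn (E := E) F s O) (hO : IsOpen O) {x : M} (hx : x ∈ O) :
    ContMDiffAt 𝓘(ℝ, E) (𝓘(ℝ, E).prod 𝓘(ℝ, F)) ∞ (fun x => (⟨x, s x⟩ : TotalSpace F B)) x :=
  (hs x hx).contMDiffAt (hO.mem_nhds hx)

theorem SmoothSectionOn.diffSectionAt {s : Π x : M, B x} {O : Set M}
    (hs : SmoothSectionOn (E := E) F s O) (hO : IsOpen O) {x : M} (hx : x ∈ O) :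
    DiffSectionAt E F s x :=
  (hs.contMDiffAt hO hx).mdifferentiableAt (by norm_num)

theorem smoothSectionOn_constSec (e : Trivialization F (π F B)) [MemTrivializationAtlas e] (f : F) :
    SmoothSectionOn (E := E) F (constSec e f) e.baseSet := fun x hx => by
  refine ContMDiffAt.contMDiffWithinAt ?_
  rw [smoothSectionAt_iff e hx]
  refine (contMDiffAt_const (c := f)).congr_of_eventuallyEq ?_
  filter_upwards [e.open_baseSet.mem_nhds hx] with x' hx'
  exact snd_constSec e hx' f

theorem diffSectionAt_constSec (e : Trivialization F (π F B)) [MemTrivializationAtlas e] (f : F)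
    {x : M} (hx : x ∈ e.baseSet) : DiffSectionAt E F (constSec e f) x :=
  (smoothSectionOn_constSec e f).diffSectionAt e.open_baseSet hx

theorem DiffSectionAt.add {s t : Π x : M, B x} {x : M} (hs : DiffSectionAt E F s x)
    (ht : DiffSectionAt E F t x) : DiffSectionAt E F (fun x => s x + t x) x :=
  mdifferentiableAt_add_section hs ht

theorem DiffSectionAt.smul {f : M → ℂ} {s : Π x : M, B x} {x : M}
    (hf : MDifferentiableAt 𝓘(ℝ, E) 𝓘(ℝ, ℂ) f x) (hs : DiffSectionAt E F s x) :
    DiffSectionAt E F (fun x => f x • s x) x := by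
  let e := trivializationAt F B x
  have hx : x ∈ e.baseSet := mem_baseSet_trivializationAt F B x
  rw [diffSectionAt_iff e hx] at hs ⊢
  have h : MDifferentiableAt 𝓘(ℝ, E) 𝓘(ℝ, F) (fun x => f x • (e ⟨x, s x⟩).2) x := by
    rw [mdifferentiableAt_iff_chart (mem_chart_source E x)] at hf hs ⊢
    exact hf.smul hs
  refine h.congr_of_eventuallyEq ?_
  filter_upwards [e.open_baseSet.mem_nhds hx] with x' hx'
  rw [snd_eq e hx', snd_eq e hx', map_smul]

variable (F B) in
/-- A partial connection which is not required to be smooth. -/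
structure RoughPartialConnection (L : Π x : M, Submodule ℂ (CTangent E x)) where
  toFun : (Π x : M, B x) → Π x : M, L x →ₗ[ℂ] B x
  add : ∀ (s t : Π x : M, B x) (x : M), DiffSectionAt E F s x → DiffSectionAt E F t x →
    toFun (fun x => s x + t x) x = toFun s x + toFun t x
  leibniz : ∀ (f : M → ℂ) (s : Π x : M, B x) (x : M),
    MDifferentiableAt 𝓘(ℝ, E) 𝓘(ℝ, ℂ) f x → DiffSectionAt E F s x → ∀ u : L x,
      toFun (fun x => f x • s x) x u = f x • toFun s x u +
        LinearMap.liftBaseChange ℂ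
          (mvfderiv 𝓘(ℝ, E) f x : TangentSpace 𝓘(ℝ, E) x →ₗ[ℝ] ℂ) (u : CTangent E x) • s x

namespace RoughPartialConnection

variable {L : Π x : M, Submodule ℂ (CTangent E x)} (D : RoughPartialConnection F B L)

open Classical in
/-- The derivative along a complex tangent vector in `L`. -/
def deriv (s : Π x : M, B x) (x : M) (u : CTangent E x) : B x :=
  if h : u ∈ L x then D.toFun s x ⟨u, h⟩ else 0

theorem deriv_of_mem (s : Π x : M, B x) {x : M} {u : CTangent E x} (hu : u ∈ L x) :
    D.deriv s x u = D.toFun s x ⟨u, hu⟩ := dif_pos hu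

theorem deriv_add {s t : Π x : M, B x} {x : M} (hs : DiffSectionAt E F s x)
    (ht : DiffSectionAt E F t x) (u : CTangent E x) :
    D.deriv (fun x => s x + t x) x u = D.deriv s x u + D.deriv t x u := by
  by_cases hu : u ∈ L x
  · simp only [D.deriv_of_mem _ hu, D.add s t x hs ht, LinearMap.add_apply]
  · simp [deriv, hu]

theorem deriv_leibniz {f : M → ℂ} {s : Π x : M, B x} {x : M}
    (hf : MDifferentiableAt 𝓘(ℝ, E) 𝓘(ℝ, ℂ) f x) (hs : DiffSectionAt E F s x)
    {u : CTangent E x} (hu : u ∈ L x) :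
    D.deriv (fun x => f x • s x) x u = f x • D.deriv s x u +
        LinearMap.liftBaseChange ℂ
          (mvfderiv 𝓘(ℝ, E) f x : TangentSpace 𝓘(ℝ, E) x →ₗ[ℝ] ℂ) u • s x := by
  simp only [D.deriv_of_mem _ hu]
  exact D.leibniz f s x hf hs ⟨u, hu⟩

theorem deriv_const_smul {c : ℂ} {s : Π x : M, B x} {x : M} (hs : DiffSectionAt E F s x)
    {u : CTangent E x} (hu : u ∈ L x) : D.deriv (fun x => c • s x) x u = c • D.deriv s x u := by
  have h0 : (mvfderiv 𝓘(ℝ, E) (fun _ : M => c) x : TangentSpace 𝓘(ℝ, E) x →ₗ[ℝ] ℂ) = 0 := by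
    ext u
    simp [mvfderiv]
  rw [D.deriv_leibniz (f := fun _ => c) mdifferentiableAt_const hs hu, h0]
  simp

/-- Locality follows from the Leibniz rule without bump functions: the indicator function of the set
where `s = t` equals 1 near `x`, hence has zero derivative there, and its products with `s` and with
`t` agree everywhere. -/
theorem deriv_congr {s t : Π x : M, B x} {x : M} (hs : DiffSectionAt E F s x)
    (ht : DiffSectionAt E F t x) (h : ∀ᶠ x' in 𝓝 x, s x' = t x') (u : CTangent E x) :
    D.deriv s x u = D.deriv t x u := by
  classical
  by_cases hu : u ∈ L x
  swap
  · simp [deriv, hu]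
  let f : M → ℂ := fun x' => if s x' = t x' then 1 else 0
  have hf1 : f =ᶠ[𝓝 x] fun _ => 1 := by
    filter_upwards [h] with x' hx'
    simp [f, hx']
  have hfx : f x = 1 := hf1.self_of_nhds
  have hfd : MDifferentiableAt 𝓘(ℝ, E) 𝓘(ℝ, ℂ) f x :=
    mdifferentiableAt_const.congr_of_eventuallyEq hf1
  have hst : (fun x' => f x' • s x') = fun x' => f x' • t x' := by
    ext x'
    by_cases hx' : s x' = t x'
    · rw [hx']
    · simp [f, hx']
  have h0 : (mvfderiv 𝓘(ℝ, E) f x : TangentSpace 𝓘(ℝ, E) x →ₗ[ℝ] ℂ) = 0 := by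
    rw [mvfderiv_congr hf1]
    ext u
    simp [mvfderiv]
  have h1 := D.deriv_leibniz hfd hs hu
  have h2 := D.deriv_leibniz hfd ht hu
  rw [hst, h2, h0, hfx] at h1
  simpa using h1.symm

theorem deriv_sum {ι : Type*} (S : Finset ι) {f : ι → M → ℂ} {s : ι → Π x : M, B x} {x : M}
    (hf : ∀ i, MDifferentiableAt 𝓘(ℝ, E) 𝓘(ℝ, ℂ) (f i) x) (hs : ∀ i, DiffSectionAt E F (s i) x)
    {u : CTangent E x} (hu : u ∈ L x) :
    DiffSectionAt E F (fun x => ∑ i ∈ S, f i x • s i x) x ∧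
    D.deriv (fun x => ∑ i ∈ S, f i x • s i x) x u = ∑ i ∈ S, (f i x • D.deriv (s i) x u +
        LinearMap.liftBaseChange ℂ
          (mvfderiv 𝓘(ℝ, E) (f i) x : TangentSpace 𝓘(ℝ, E) x →ₗ[ℝ] ℂ) u • s i x) := by
  classical
  induction S using Finset.induction_on with
  | empty =>
    have h0 : DiffSectionAt E F (fun x : M => (0 : B x)) x :=
      mdifferentiableAt_zeroSection (𝕜 := ℝ) ..
    refine ⟨by simpa using h0, ?_⟩
    have := D.deriv_add h0 h0 u
    simpa using this
  | insert i S hi ih =>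
    have h1 := DiffSectionAt.smul (hf i) (hs i)
    simp only [Finset.sum_insert hi]
    refine ⟨h1.add ih.1, ?_⟩
    rw [D.deriv_add h1 ih.1, ih.2, D.deriv_leibniz (hf i) (hs i) hu]

variable [FiniteDimensional ℂ F]

/-- Local expression of a partial connection in a trivialization. -/
theorem deriv_eq (e : Trivialization F (π F B)) [MemTrivializationAtlas e] {x : M}
    (hx : x ∈ e.baseSet) {s : Π x : M, B x} (hs : DiffSectionAt E F s x)
    {u : CTangent E x} (hu : u ∈ L x) :
    D.deriv s x u = e.symmₗ ℂ x (LinearMap.liftBaseChange ℂ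
          (mvfderiv 𝓘(ℝ, E) (fun x => (e ⟨x, s x⟩).2) x : TangentSpace 𝓘(ℝ, E) x →ₗ[ℝ] F) u)
        + D.deriv (constSec e (e ⟨x, s x⟩).2) x u := by
  let b := Module.finBasis ℂ F
  let l : Fin (Module.finrank ℂ F) → F →L[ℝ] ℂ := fun i =>
    (LinearMap.toContinuousLinearMap (b.coord i)).restrictScalars ℝ
  have hl : ∀ f : F, ∑ i, l i f • b i = f := b.sum_repr
  have hσ := (diffSectionAt_iff e hx s).1 hs
  have hf : ∀ i, MDifferentiableAt 𝓘(ℝ, E) 𝓘(ℝ, ℂ) (fun x => l i (e ⟨x, s x⟩).2) x := fun i =>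
    hσ.clm_comp' (l i)
  have hc := fun i => diffSectionAt_constSec (E := E) e (b i) hx
  -- The section is expanded in the frame `constSec e (b i)` with differentiable coefficients, so
  -- that the Leibniz rule applies term by term; the second expansion freezes the coefficients at
  -- `x`.
  have hexp : ∀ᶠ x' in 𝓝 x, s x' = ∑ i, l i (e ⟨x', s x'⟩).2 • constSec e (b i) x' := by
    filter_upwards [e.open_baseSet.mem_nhds hx] with x' hx'
    simp only [constSec_eq e hx', ← map_smul, ← map_sum, hl]
    rw [← constSec_eq e hx', constSec_snd e hx']
  have hexp2 : ∀ᶠ x' in 𝓝 x, constSec e (e ⟨x, s x⟩).2 x' =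
      ∑ i, l i (e ⟨x, s x⟩).2 • constSec e (b i) x' := by
    filter_upwards [e.open_baseSet.mem_nhds hx] with x' hx'
    simp only [constSec_eq e hx', ← map_smul, ← map_sum, hl]
  have h1 := D.deriv_sum Finset.univ hf hc hu
  have h2 := D.deriv_sum Finset.univ (f := fun i _ => l i (e ⟨x, s x⟩).2)
    (fun i => mdifferentiableAt_const) hc hu
  rw [D.deriv_congr hs h1.1 hexp u, h1.2,
    D.deriv_congr (diffSectionAt_constSec (E := E) e _ hx) h2.1 hexp2 u, h2.2]
  have h0 : ∀ c : ℂ, (mvfderiv 𝓘(ℝ, E) (fun _ : M => c) x : TangentSpace 𝓘(ℝ, E) x →ₗ[ℝ] ℂ) = 0 := by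
    intro c
    ext u
    simp [mvfderiv]
  obtain ⟨u₁, u₂, rfl⟩ := complexify_exists u
  simp only [h0, liftBaseChange_complex, LinearMap.zero_apply, smul_zero, zero_smul, add_zero]
  rw [Finset.sum_add_distrib, add_comm]
  congr 1
  have h3 : ∀ i v, (mvfderiv 𝓘(ℝ, E) (fun x => l i (e ⟨x, s x⟩).2) x : TangentSpace 𝓘(ℝ, E) x →ₗ[ℝ] ℂ) v
      = l i (mvfderiv 𝓘(ℝ, E) (fun x => (e ⟨x, s x⟩).2) x v) := fun i v =>
    mvfderiv_clm_comp hσ (l i) v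
  have h4 : ∀ i (a b : F), l i a + Complex.I • l i b = l i (a + Complex.I • b) := fun i a b => by
    simp [l]
  simp only [h3, h4, constSec_eq e hx, ← map_smul, ← map_sum, hl]
  rfl

end RoughPartialConnection

namespace PartialConnection

variable {L : Π x : M, Submodule ℂ (CTangent E x)} (D : PartialConnection F B L)

/-- Forget the smoothness of a partial connection. -/
def rough : RoughPartialConnection F B L := ⟨D.toFun, D.add, D.leibniz⟩

theorem deriv_of_mem (s : Π x : M, B x) {x : M} {u : CTangent E x} (hu : u ∈ L x) :
    D.deriv s x u = D.toFun s x ⟨u, hu⟩ := dif_pos hu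

theorem deriv_add {s t : Π x : M, B x} {x : M} (hs : DiffSectionAt E F s x)
    (ht : DiffSectionAt E F t x) (u : CTangent E x) :
    D.deriv (fun x => s x + t x) x u = D.deriv s x u + D.deriv t x u :=
  D.rough.deriv_add hs ht u

theorem deriv_leibniz {f : M → ℂ} {s : Π x : M, B x} {x : M}
    (hf : MDifferentiableAt 𝓘(ℝ, E) 𝓘(ℝ, ℂ) f x) (hs : DiffSectionAt E F s x)
    {u : CTangent E x} (hu : u ∈ L x) :
    D.deriv (fun x => f x • s x) x u = f x • D.deriv s x u +
        LinearMap.liftBaseChange ℂ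
          (mvfderiv 𝓘(ℝ, E) f x : TangentSpace 𝓘(ℝ, E) x →ₗ[ℝ] ℂ) u • s x :=
  D.rough.deriv_leibniz hf hs hu

theorem deriv_const_smul {c : ℂ} {s : Π x : M, B x} {x : M} (hs : DiffSectionAt E F s x)
    {u : CTangent E x} (hu : u ∈ L x) : D.deriv (fun x => c • s x) x u = c • D.deriv s x u :=
  D.rough.deriv_const_smul hs hu

theorem deriv_congr {s t : Π x : M, B x} {x : M} (hs : DiffSectionAt E F s x)
    (ht : DiffSectionAt E F t x) (h : ∀ᶠ x' in 𝓝 x, s x' = t x') (u : CTangent E x) :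
    D.deriv s x u = D.deriv t x u :=
  D.rough.deriv_congr hs ht h u

theorem deriv_eq [FiniteDimensional ℂ F] (e : Trivialization F (π F B)) [MemTrivializationAtlas e]
    {x : M} (hx : x ∈ e.baseSet) {s : Π x : M, B x} (hs : DiffSectionAt E F s x)
    {u : CTangent E x} (hu : u ∈ L x) :
    D.deriv s x u = e.symmₗ ℂ x (LinearMap.liftBaseChange ℂ
          (mvfderiv 𝓘(ℝ, E) (fun x => (e ⟨x, s x⟩).2) x : TangentSpace 𝓘(ℝ, E) x →ₗ[ℝ] F) u)
        + D.deriv (constSec e (e ⟨x, s x⟩).2) x u :=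
  D.rough.deriv_eq e hx hs hu

theorem deriv_constSec_add (e : Trivialization F (π F B)) [MemTrivializationAtlas e] {x : M} (hx : x ∈ e.baseSet) (f g : F)
    (u : CTangent E x) :
    D.deriv (constSec e (f + g)) x u =
      D.deriv (constSec e f) x u + D.deriv (constSec e g) x u := by
  have hf := diffSectionAt_constSec (E := E) e f hx
  have hg := diffSectionAt_constSec (E := E) e g hx
  rw [← D.deriv_add hf hg]
  refine D.deriv_congr (diffSectionAt_constSec e _ hx) (hf.add hg) ?_ u
  filter_upwards [e.open_baseSet.mem_nhds hx] with x' hx'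
  rw [constSec_eq e hx', constSec_eq e hx', constSec_eq e hx', map_add]

theorem deriv_constSec_smul (e : Trivialization F (π F B)) [MemTrivializationAtlas e] {x : M} (hx : x ∈ e.baseSet) (c : ℂ)
    (f : F) {u : CTangent E x} (hu : u ∈ L x) :
    D.deriv (constSec e (c • f)) x u = c • D.deriv (constSec e f) x u := by
  have hf := diffSectionAt_constSec (E := E) e f hx
  rw [← D.deriv_const_smul hf hu]
  refine D.deriv_congr (diffSectionAt_constSec e _ hx)
    (DiffSectionAt.smul mdifferentiableAt_const hf) ?_ u
  filter_upwards [e.open_baseSet.mem_nhds hx] with x' hx'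
  rw [constSec_eq e hx', constSec_eq e hx', map_smul]

end PartialConnection

end PartialConnections

/-! ### Smoothness of directional derivatives and the chain rule -/

section SmoothDerivative

variable {E : Type*} [NormedAddCommGroup E] [NormedSpace ℝ E]
  {M : Type*} [TopologicalSpace M] [ChartedSpace E M] [IsManifold 𝓘(ℝ, E) ∞ M]
  {E' : Type*} [NormedAddCommGroup E'] [NormedSpace ℝ E']
  {M' : Type*} [TopologicalSpace M'] [ChartedSpace E' M'] [IsManifold 𝓘(ℝ, E') ∞ M']
  {G : Type*} [NormedAddCommGroup G] [NormedSpace ℝ G]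

theorem contMDiffAt_mvfderiv_apply {f : M → G} {x : M} (hf : ContMDiffAt 𝓘(ℝ, E) 𝓘(ℝ, G) ∞ f x)
    {Z : Π x : M, TangentSpace 𝓘(ℝ, E) x}
    (hZ : ContMDiffAt 𝓘(ℝ, E) 𝓘(ℝ, E).tangent ∞ (fun x => (⟨x, Z x⟩ : TangentBundle 𝓘(ℝ, E) M)) x) :
    ContMDiffAt 𝓘(ℝ, E) 𝓘(ℝ, G) ∞ (fun x => mvfderiv 𝓘(ℝ, E) f x (Z x)) x := by
  have hx := mem_chart_source E x
  have hd : ∀ᶠ x' in 𝓝 x, MDifferentiableAt 𝓘(ℝ, E) 𝓘(ℝ, G) f x' := by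
    have h1 : ContMDiffAt 𝓘(ℝ, E) 𝓘(ℝ, G) 1 f x := hf.of_le (by norm_num)
    filter_upwards [(contMDiffAt_iff_contMDiffAt_nhds (by norm_num)).1 h1] with x' hx'
    exact hx'.mdifferentiableAt (by norm_num)
  rw [contMDiffAt_iff_chart hx] at hf ⊢
  rw [contMDiffAt_field_iff hx] at hZ
  have h1 : ContDiffAt ℝ ∞ (fun z => fderiv ℝ (f ∘ (extChartAt 𝓘(ℝ, E) x).symm) z (fieldRep x Z z))
      (extChartAt 𝓘(ℝ, E) x x) :=
    (hf.fderiv_right (m := ∞) (by norm_num)).clm_apply hZ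
  refine h1.congr_of_eventuallyEq ?_
  have hc : Filter.Tendsto (extChartAt 𝓘(ℝ, E) x).symm (𝓝 (extChartAt 𝓘(ℝ, E) x x)) (𝓝 x) := by
    have := continuousAt_extChartAt_symm (I := 𝓘(ℝ, E)) x
    rwa [ContinuousAt, extChartAt_to_inv] at this
  filter_upwards [(isOpen_extChartAt_target x).mem_nhds (mem_extChartAt_target_of_mem hx),
    hc.eventually hd] with z hz hdz
  simp only [Function.comp_apply]
  rw [mvfderiv_eq_fderiv_chart (extChartAt_symm_mem hz) hdz, (extChartAt 𝓘(ℝ, E) x).right_inv hz]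
  rfl

theorem mvfderiv_comp_mfderiv {f : M' → G} {g : M → M'} {x : M}
    (hf : MDifferentiableAt 𝓘(ℝ, E') 𝓘(ℝ, G) f (g x))
    (hg : MDifferentiableAt 𝓘(ℝ, E) 𝓘(ℝ, E') g x) (u : TangentSpace 𝓘(ℝ, E) x) :
    mvfderiv 𝓘(ℝ, E) (fun x => f (g x)) x u =
      mvfderiv 𝓘(ℝ, E') f (g x) (mfderiv 𝓘(ℝ, E) 𝓘(ℝ, E') g x u) := by
  have h : mfderiv 𝓘(ℝ, E) 𝓘(ℝ, G) (fun x => f (g x)) x = _ := mfderiv_comp x hf hg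
  simp only [mvfderiv]
  rw [h]
  rfl

theorem chartD_apply_mfderiv {g : M → M'} {x : M} {x₀ : M'} (hx : g x ∈ (chartAt E' x₀).source)
    (hg : MDifferentiableAt 𝓘(ℝ, E) 𝓘(ℝ, E') g x) (u : TangentSpace 𝓘(ℝ, E) x) :
    mvfderiv 𝓘(ℝ, E) (fun x => extChartAt 𝓘(ℝ, E') x₀ (g x)) x u =
      chartD x₀ (g x) (mfderiv 𝓘(ℝ, E) 𝓘(ℝ, E') g x u) := by
  rw [mvfderiv_comp_mfderiv (f := extChartAt 𝓘(ℝ, E') x₀) (mdifferentiableAt_extChartAt hx) hg]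
  rfl

theorem baseChange_complex {T T' : Type*} [AddCommGroup T] [Module ℝ T] [AddCommGroup T']
    [Module ℝ T'] (l : T →ₗ[ℝ] T') (u₁ u₂ : T) :
    LinearMap.baseChange ℂ l ((1 : ℂ) ⊗ₜ[ℝ] u₁ + Complex.I ⊗ₜ[ℝ] u₂) =
      (1 : ℂ) ⊗ₜ[ℝ] l u₁ + Complex.I ⊗ₜ[ℝ] l u₂ := by
  simp

end SmoothDerivative

/-! ### Pullback of partial connections along a smooth map -/

section Pullback

variable {V : Type*} [NormedAddCommGroup V] [NormedSpace ℂ V]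
  {X : Type*} [TopologicalSpace X] [ChartedSpace V X] [IsManifold 𝓘(ℝ, V) ∞ X]
  {W : Type*} [NormedAddCommGroup W] [NormedSpace ℝ W]
  {Y : Type*} [TopologicalSpace Y] [ChartedSpace W Y] [IsManifold 𝓘(ℝ, W) ∞ Y]
  {F : Type*} [NormedAddCommGroup F] [NormedSpace ℂ F]
  {B : X → Type*} [TopologicalSpace (TotalSpace F B)]
  [∀ x, AddCommGroup (B x)] [∀ x, Module ℂ (B x)] [∀ x, Module ℝ (B x)]
  [∀ x, IsScalarTower ℝ ℂ (B x)]
  [∀ x, TopologicalSpace (B x)] [∀ x, IsTopologicalAddGroup (B x)]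
  [∀ x, ContinuousSMul ℝ (B x)]
  [FiberBundle F B] [VectorBundle ℂ F B] [VectorBundle ℝ F B]
  [ContMDiffVectorBundle ∞ F B 𝓘(ℝ, V)]
  (p : C^∞⟮𝓘(ℝ, W), Y; 𝓘(ℝ, V), X⟯)

instance pullbackIsScalarTower (p : Y → X) (y : Y) : IsScalarTower ℝ ℂ ((p *ᵖ B) y) :=
  inferInstanceAs (IsScalarTower ℝ ℂ (B (p y)))

instance memTrivializationAtlas_pullback (e : Trivialization F (π F B)) [MemTrivializationAtlas e] :
    MemTrivializationAtlas (e.pullback p) :=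
  ⟨⟨e, inferInstance, rfl⟩⟩

theorem mdifferentiableAt_proj (y : Y) : MDifferentiableAt 𝓘(ℝ, W) 𝓘(ℝ, V) p y :=
  p.contMDiff.mdifferentiableAt (by norm_num)

theorem constSec_pullback (e : Trivialization F (π F B)) {y : Y} (hy : p y ∈ e.baseSet) (f : F) :
    constSec (e.pullback p) f y = (constSec e f (p y) : B (p y)) := by
  refine snd_injective (e.pullback p) (x := y) hy ?_
  rw [snd_constSec _ (by exact hy)]
  exact (snd_constSec e hy f).symm

/-- The expression of a section of the pullback bundle in a trivialization. -/
def pullbackRep (e : Trivialization F (π F B)) (s : Π y : Y, (p *ᵖ B) y) (y : Y) : F :=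
  (e ⟨p y, (s y : B (p y))⟩).2

theorem pullbackRep_eq (e : Trivialization F (π F B)) [MemTrivializationAtlas e] {y : Y}
    (hy : p y ∈ e.baseSet) (s : Π y : Y, (p *ᵖ B) y) :
    pullbackRep p e s y = e.linearMapAt ℂ (p y) (s y : B (p y)) :=
  snd_eq e hy _

theorem diffSectionAt_pullback_iff (e : Trivialization F (π F B)) [MemTrivializationAtlas e] {y : Y}
    (hy : p y ∈ e.baseSet) (s : Π y : Y, (p *ᵖ B) y) :
    DiffSectionAt W F s y ↔
      MDifferentiableAt 𝓘(ℝ, W) 𝓘(ℝ, F) (pullbackRep p e s) y :=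
  diffSectionAt_iff (e.pullback p) hy s

/-- The pullback of a section. -/
def pullbackSection (s : Π x : X, B x) (y : Y) : (p *ᵖ B) y := (s (p y) : B (p y))

theorem diffSectionAt_pullback {s : Π x : X, B x} {y : Y} (hs : DiffSectionAt V F s (p y)) :
    DiffSectionAt W F (pullbackSection p s) y := by
  let e := trivializationAt F B (p y)
  have hx : p y ∈ e.baseSet := mem_baseSet_trivializationAt F B (p y)
  rw [diffSectionAt_pullback_iff p e hx]
  rw [diffSectionAt_iff e hx] at hs
  exact hs.comp y (mdifferentiableAt_proj p y)

/-- The complexified differential of `p`. -/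
abbrev dprojC (y : Y) : CTangent W y →ₗ[ℂ] CTangent V (p y) :=
  LinearMap.baseChange ℂ (dproj p y : TangentSpace 𝓘(ℝ, W) y →ₗ[ℝ] TangentSpace 𝓘(ℝ, V) (p y))

variable {p} {L : Π x : X, Submodule ℂ (CTangent V x)} {L' : Π y : Y, Submodule ℂ (CTangent W y)}
  [FiniteDimensional ℂ F]

theorem liftBaseChange_mvfderiv_add {G : Type*} [NormedAddCommGroup G] [NormedSpace ℂ G]
    {f g : Y → G} {y : Y} (hf : MDifferentiableAt 𝓘(ℝ, W) 𝓘(ℝ, G) f y)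
    (hg : MDifferentiableAt 𝓘(ℝ, W) 𝓘(ℝ, G) g y) (u : CTangent W y) :
    LinearMap.liftBaseChange ℂ
        (mvfderiv 𝓘(ℝ, W) (fun y => f y + g y) y : TangentSpace 𝓘(ℝ, W) y →ₗ[ℝ] G) u =
      LinearMap.liftBaseChange ℂ (mvfderiv 𝓘(ℝ, W) f y : TangentSpace 𝓘(ℝ, W) y →ₗ[ℝ] G) u +
      LinearMap.liftBaseChange ℂ (mvfderiv 𝓘(ℝ, W) g y : TangentSpace 𝓘(ℝ, W) y →ₗ[ℝ] G) u := by
  obtain ⟨u₁, u₂, rfl⟩ := complexify_exists u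
  have h : ∀ v, mvfderiv 𝓘(ℝ, W) (fun y => f y + g y) y v =
      mvfderiv 𝓘(ℝ, W) f y v + mvfderiv 𝓘(ℝ, W) g y v := fun v => by
    have : mfderiv 𝓘(ℝ, W) 𝓘(ℝ, G) (fun y => f y + g y) y = _ :=
      (hf.hasMFDerivAt.add hg.hasMFDerivAt).mfderiv
    simp only [mvfderiv]
    rw [this]
    rfl
  simp only [liftBaseChange_complex, ContinuousLinearMap.coe_coe, h, smul_add]
  abel

theorem liftBaseChange_mvfderiv_smul {G : Type*} [NormedAddCommGroup G] [NormedSpace ℂ G]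
    {f : Y → ℂ} {g : Y → G} {y : Y} (hf : MDifferentiableAt 𝓘(ℝ, W) 𝓘(ℝ, ℂ) f y)
    (hg : MDifferentiableAt 𝓘(ℝ, W) 𝓘(ℝ, G) g y) (u : CTangent W y) :
    LinearMap.liftBaseChange ℂ
        (mvfderiv 𝓘(ℝ, W) (fun y => f y • g y) y : TangentSpace 𝓘(ℝ, W) y →ₗ[ℝ] G) u =
      f y • LinearMap.liftBaseChange ℂ
        (mvfderiv 𝓘(ℝ, W) g y : TangentSpace 𝓘(ℝ, W) y →ₗ[ℝ] G) u +
      LinearMap.liftBaseChange ℂ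
        (mvfderiv 𝓘(ℝ, W) f y : TangentSpace 𝓘(ℝ, W) y →ₗ[ℝ] ℂ) u • g y := by
  obtain ⟨u₁, u₂, rfl⟩ := complexify_exists u
  have hy := mem_chart_source W y
  have hfg : MDifferentiableAt 𝓘(ℝ, W) 𝓘(ℝ, G) (fun y => f y • g y) y := by
    rw [mdifferentiableAt_iff_chart hy] at hf hg ⊢
    exact hf.smul hg
  have h : ∀ v, mvfderiv 𝓘(ℝ, W) (fun y => f y • g y) y v =
      f y • mvfderiv 𝓘(ℝ, W) g y v + mvfderiv 𝓘(ℝ, W) f y v • g y := fun v => by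
    rw [mvfderiv_eq_fderiv_chart hy hf, mvfderiv_eq_fderiv_chart hy hg,
      mvfderiv_eq_fderiv_chart hy hfg]
    rw [mdifferentiableAt_iff_chart hy] at hf hg
    have := (hf.hasFDerivAt.smul hg.hasFDerivAt).fderiv
    have h2 : ((fun y => f y • g y) ∘ (extChartAt 𝓘(ℝ, W) y).symm) =
      (f ∘ (extChartAt 𝓘(ℝ, W) y).symm) • (g ∘ (extChartAt 𝓘(ℝ, W) y).symm) := rfl
    rw [h2, this]
    have h3 : (extChartAt 𝓘(ℝ, W) y).symm (extChartAt 𝓘(ℝ, W) y y) = y := extChartAt_to_inv y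
    simp only [add_apply, smul_apply,
      ContinuousLinearMap.smulRight_apply, Function.comp_apply, h3]
  simp only [liftBaseChange_complex, ContinuousLinearMap.coe_coe, h, smul_add, add_smul, smul_smul,
    smul_eq_mul, mul_comm (f y)]
  abel

/-- The value of the pullback of `D` in a given trivialization. -/
def pullbackDeriv (D : PartialConnection F B L) (e : Trivialization F (π F B))
    [MemTrivializationAtlas e] (hL : ∀ y, ∀ u ∈ L' y, dprojC p y u ∈ L (p y))
    (s : Π y : Y, (p *ᵖ B) y) (y : Y) : L' y →ₗ[ℂ] B (p y) :=
  (e.symmₗ ℂ (p y) ∘ₗ LinearMap.liftBaseChange ℂ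
    (mvfderiv 𝓘(ℝ, W) (pullbackRep p e s) y : TangentSpace 𝓘(ℝ, W) y →ₗ[ℝ] F)) ∘ₗ (L' y).subtype +
  D.toFun (constSec e (pullbackRep p e s y)) (p y) ∘ₗ
    ((dprojC p y).restrict (hL y))

theorem pullbackDeriv_apply (D : PartialConnection F B L) (e : Trivialization F (π F B))
    [MemTrivializationAtlas e] (hL : ∀ y, ∀ u ∈ L' y, dprojC p y u ∈ L (p y))
    (s : Π y : Y, (p *ᵖ B) y) (y : Y) (u : L' y) : pullbackDeriv D e hL s y u =
      e.symmₗ ℂ (p y) (LinearMap.liftBaseChange ℂ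
        (mvfderiv 𝓘(ℝ, W) (pullbackRep p e s) y : TangentSpace 𝓘(ℝ, W) y →ₗ[ℝ] F) u) +
      D.deriv (constSec e (pullbackRep p e s y)) (p y) (dprojC p y u) := by
  rw [D.deriv_of_mem _ (hL y u u.2)]
  rfl

/-- The chain rule turns the derivative of the pulled-back components along `u` into the derivative
of the components of `s` along `dp(u)`, and the right-hand side is the local expression of `D`. -/
theorem pullbackDeriv_pullback (D : PartialConnection F B L) (e : Trivialization F (π F B))
    [MemTrivializationAtlas e] (hL : ∀ y, ∀ u ∈ L' y, dprojC p y u ∈ L (p y))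
    {s : Π x : X, B x} {y : Y} (hy : p y ∈ e.baseSet) (hs : DiffSectionAt V F s (p y)) (u : L' y) :
    pullbackDeriv D e hL (pullbackSection p s) y u =
      D.deriv s (p y) (dprojC p y u) := by
  rw [pullbackDeriv_apply, D.deriv_eq e hy hs (hL y u u.2)]
  congr 2
  obtain ⟨u, hu⟩ := u
  obtain ⟨u₁, u₂, rfl⟩ := complexify_exists u
  rw [diffSectionAt_iff e hy] at hs
  rw [dprojC, baseChange_complex, liftBaseChange_complex, liftBaseChange_complex]
  simp only [ContinuousLinearMap.coe_coe]
  rw [← mvfderiv_comp_mfderiv hs (mdifferentiableAt_proj p y),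
    ← mvfderiv_comp_mfderiv hs (mdifferentiableAt_proj p y)]
  rfl

theorem pullbackDeriv_add (D : PartialConnection F B L) (e : Trivialization F (π F B))
    [MemTrivializationAtlas e] (hL : ∀ y, ∀ u ∈ L' y, dprojC p y u ∈ L (p y))
    {s t : Π y : Y, (p *ᵖ B) y} {y : Y} (hy : p y ∈ e.baseSet)
    (hs : DiffSectionAt W F s y) (ht : DiffSectionAt W F t y) :
    pullbackDeriv D e hL (fun y => s y + t y) y =
      pullbackDeriv D e hL s y + pullbackDeriv D e hL t y := by
  ext u
  rw [diffSectionAt_pullback_iff p e hy] at hs ht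
  have h : pullbackRep p e (fun y => s y + t y) =ᶠ[𝓝 y]
      fun y => pullbackRep p e s y + pullbackRep p e t y := by
    filter_upwards [(e.pullback p).open_baseSet.mem_nhds (show y ∈ (e.pullback p).baseSet from hy)]
      with y' hy'
    rw [pullbackRep_eq p e hy', pullbackRep_eq p e hy', pullbackRep_eq p e hy']
    exact map_add _ _ _
  rw [LinearMap.add_apply, pullbackDeriv_apply, pullbackDeriv_apply, pullbackDeriv_apply,
    mvfderiv_congr h, liftBaseChange_mvfderiv_add hs ht, h.self_of_nhds,
    D.deriv_constSec_add e hy, map_add]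
  abel

theorem pullbackDeriv_leibniz (D : PartialConnection F B L) (e : Trivialization F (π F B))
    [MemTrivializationAtlas e] (hL : ∀ y, ∀ u ∈ L' y, dprojC p y u ∈ L (p y))
    {f : Y → ℂ} {s : Π y : Y, (p *ᵖ B) y} {y : Y} (hy : p y ∈ e.baseSet)
    (hf : MDifferentiableAt 𝓘(ℝ, W) 𝓘(ℝ, ℂ) f y) (hs : DiffSectionAt W F s y) (u : L' y) :
    pullbackDeriv D e hL (fun y => f y • s y) y u = f y • pullbackDeriv D e hL s y u +
      LinearMap.liftBaseChange ℂ
        (mvfderiv 𝓘(ℝ, W) f y : TangentSpace 𝓘(ℝ, W) y →ₗ[ℝ] ℂ) (u : CTangent W y) •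
          e.symmₗ ℂ (p y) (pullbackRep p e s y) := by
  rw [diffSectionAt_pullback_iff p e hy] at hs
  have h : pullbackRep p e (fun y => f y • s y) =ᶠ[𝓝 y] fun y => f y • pullbackRep p e s y := by
    filter_upwards [(e.pullback p).open_baseSet.mem_nhds (show y ∈ (e.pullback p).baseSet from hy)]
      with y' hy'
    rw [pullbackRep_eq p e hy', pullbackRep_eq p e hy']
    exact map_smul _ _ _
  rw [pullbackDeriv_apply, pullbackDeriv_apply,
    mvfderiv_congr h, liftBaseChange_mvfderiv_smul hf hs, h.self_of_nhds,
    D.deriv_constSec_smul e hy _ _ (hL y u u.2), map_add, map_smul, map_smul, smul_add]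
  abel

/-- The pullback of a partial connection, as a rough partial connection. -/
def roughPullback (D : PartialConnection F B L)
    (hL : ∀ y, ∀ u ∈ L' y, dprojC p y u ∈ L (p y)) : RoughPartialConnection F (p *ᵖ B) L' where
  -- The trivialization changes with `y`, so smoothness cannot be read off from this formula;
  -- `roughPullback_eq` permits a fixed trivialization.
  toFun s y := pullbackDeriv D (trivializationAt F B (p y)) hL s y
  add s t y hs ht := pullbackDeriv_add D _ hL (mem_baseSet_trivializationAt F B (p y)) hs ht
  leibniz f s y hf hs u := by
    have hy := mem_baseSet_trivializationAt F B (p y)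
    have h := pullbackDeriv_leibniz D _ hL hy hf hs u
    have h2 : (trivializationAt F B (p y)).symmₗ ℂ (p y)
        (pullbackRep p (trivializationAt F B (p y)) s y) = s y := by
      rw [← constSec_eq _ hy]
      exact constSec_snd _ hy _
    rw [h2] at h
    exact h

/-- Independence of the trivialization. The Leibniz rule reduces the claim to sections constant in
`e.pullback p`; these are pulled back from `X`, and on such sections the value is prescribed by `D`.
-/
theorem roughPullback_eq (D : PartialConnection F B L)
    (hL : ∀ y, ∀ u ∈ L' y, dprojC p y u ∈ L (p y)) (e : Trivialization F (π F B))
    [MemTrivializationAtlas e] {y : Y} (hy : p y ∈ e.baseSet) {s : Π y : Y, (p *ᵖ B) y}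
    (hs : DiffSectionAt W F s y) (u : L' y) :
    (roughPullback D hL).toFun s y u = pullbackDeriv D e hL s y u := by
  have h := (roughPullback D hL).deriv_eq (e.pullback p) (x := y) hy hs u.2
  rw [RoughPartialConnection.deriv_of_mem _ _ u.2] at h
  refine h.trans ?_
  rw [pullbackDeriv_apply]
  refine congrArg₂ (· + ·) ?_ ?_
  · rw [← constSec_eq (e.pullback p) (x := y) hy, ← constSec_eq e hy]
    exact constSec_pullback p e hy _
  have h1 := (roughPullback D hL).deriv_congr
    (diffSectionAt_constSec (E := W) (e.pullback p) (pullbackRep p e s y) (x := y) hy)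
    (diffSectionAt_pullback p (diffSectionAt_constSec (E := V) e (pullbackRep p e s y) hy)) (by
      filter_upwards [(e.pullback p).open_baseSet.mem_nhds hy] with y' hy'
      exact constSec_pullback p e hy' _) (u : CTangent W y)
  refine h1.trans ?_
  rw [RoughPartialConnection.deriv_of_mem _ _ u.2]
  exact pullbackDeriv_pullback D _ hL (mem_baseSet_trivializationAt F B (p y))
    (diffSectionAt_constSec (E := V) e (pullbackRep p e s y) hy) u

/-- A partial connection has smooth coefficients if near every point it is given, in the chart and
the trivialization at this point, by a smooth family of real bilinear maps. -/
def HasSmoothCoeff (D : PartialConnection F B L) : Prop :=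
  ∀ x₀ : X, ∃ γ : X → (V × V) →L[ℝ] F →L[ℝ] F,
    ContMDiffAt 𝓘(ℝ, V) 𝓘(ℝ, (V × V) →L[ℝ] F →L[ℝ] F) ∞ γ x₀ ∧
    ∀ᶠ x in 𝓝 x₀, ∀ u₁ u₂ : TangentSpace 𝓘(ℝ, V) x,
      (1 : ℂ) ⊗ₜ[ℝ] u₁ + Complex.I ⊗ₜ[ℝ] u₂ ∈ L x → ∀ f : F,
      (trivializationAt F B x₀ ⟨x, D.deriv (constSec (trivializationAt F B x₀) f) x
        ((1 : ℂ) ⊗ₜ[ℝ] u₁ + Complex.I ⊗ₜ[ℝ] u₂)⟩).2 = γ x (chartD x₀ x u₁, chartD x₀ x u₂) f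

theorem pullbackDeriv_snd (D : PartialConnection F B L) (e : Trivialization F (π F B))
    [MemTrivializationAtlas e] (hL : ∀ y, ∀ u ∈ L' y, dprojC p y u ∈ L (p y))
    (s : Π y : Y, (p *ᵖ B) y) {y : Y} (hy : p y ∈ e.baseSet) {u₁ u₂ : TangentSpace 𝓘(ℝ, W) y}
    (hu : (1 : ℂ) ⊗ₜ[ℝ] u₁ + Complex.I ⊗ₜ[ℝ] u₂ ∈ L' y) :
    (e ⟨p y, pullbackDeriv D e hL s y ⟨_, hu⟩⟩).2 =
      mvfderiv 𝓘(ℝ, W) (pullbackRep p e s) y u₁ +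
      Complex.I • mvfderiv 𝓘(ℝ, W) (pullbackRep p e s) y u₂ +
      (e ⟨p y, D.deriv (constSec e (pullbackRep p e s y)) (p y)
        ((1 : ℂ) ⊗ₜ[ℝ] dproj p y u₁ + Complex.I ⊗ₜ[ℝ] dproj p y u₂)⟩).2 := by
  rw [pullbackDeriv_apply, snd_eq e hy, map_add, snd_eq e hy, e.linearMapAt_symmₗ hy,
    liftBaseChange_complex, dprojC, baseChange_complex]
  rfl

/-- The pullback of a partial connection with smooth coefficients. -/
def PartialConnection.pullback (D : PartialConnection F B L) (hD : HasSmoothCoeff D)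
    (hL : ∀ y, ∀ u ∈ L' y, dprojC p y u ∈ L (p y)) : PartialConnection F (p *ᵖ B) L' where
  toFun := (roughPullback D hL).toFun
  add := (roughPullback D hL).add
  leibniz := (roughPullback D hL).leibniz
  smooth O hO s hs U₁ U₂ hU t ht y hy := by
    refine ContMDiffAt.contMDiffWithinAt ?_
    let e := trivializationAt F B (p y)
    have hey : p y ∈ e.baseSet := mem_baseSet_trivializationAt F B (p y)
    have hOy := hO.mem_nhds hy
    rw [smoothSectionAt_iff (e.pullback p) (x := y) hey]
    obtain ⟨γ, hγ, hγ2⟩ := hD (p y)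
    have hσ : ContMDiffAt 𝓘(ℝ, W) 𝓘(ℝ, F) ∞ (pullbackRep p e s) y :=
      (smoothSectionAt_iff (e.pullback p) (x := y) hey s).1 (hs.contMDiffAt hO hy)
    have hU1 := (hU.smooth_re y hy).contMDiffAt hOy
    have hU2 := (hU.smooth_im y hy).contMDiffAt hOy
    have hp : ContMDiffAt 𝓘(ℝ, W) 𝓘(ℝ, V) ∞ p y := p.contMDiff y
    have hq : ContMDiffAt 𝓘(ℝ, W) 𝓘(ℝ, V) ∞ (fun y' => extChartAt 𝓘(ℝ, V) (p y) (p y')) y :=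
      (contMDiffAt_extChartAt (I := 𝓘(ℝ, V))).comp y hp
    have hpair : ContMDiffAt 𝓘(ℝ, W) 𝓘(ℝ, V × V) ∞ (fun y' =>
        (mvfderiv 𝓘(ℝ, W) (fun y' => extChartAt 𝓘(ℝ, V) (p y) (p y')) y' (U₁ y'),
        mvfderiv 𝓘(ℝ, W) (fun y' => extChartAt 𝓘(ℝ, V) (p y) (p y')) y' (U₂ y'))) y :=
      (contMDiffAt_mvfderiv_apply hq hU1).prodMk_space (contMDiffAt_mvfderiv_apply hq hU2)
    -- In the fixed trivialization the derivative is `dσ(U₁) + i dσ(U₂) + γ(p)(dp U₁, dp U₂) σ`, a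
    -- sum of smooth terms.
    have hmain := (contMDiffAt_mvfderiv_apply hσ hU1).add
      (((contMDiffAt_const (c := (Complex.I • ContinuousLinearMap.id ℝ F : F →L[ℝ] F))).clm_apply
        (contMDiffAt_mvfderiv_apply hσ hU2)))
    have hmain2 := hmain.add (((hγ.comp y hp).clm_apply hpair).clm_apply hσ)
    refine hmain2.congr_of_eventuallyEq ?_
    have hsrc : ∀ᶠ y' in 𝓝 y, p y' ∈ (chartAt V (p y)).source :=
      hp.continuousAt.eventually ((chartAt V (p y)).open_source.mem_nhds (mem_chart_source V _))
    filter_upwards [hOy, (e.pullback p).open_baseSet.mem_nhds hey, hsrc,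
      hp.continuousAt.eventually hγ2] with y' hy' hey' hs' hγ'
    rw [ht y' hy' (hU.mem y' hy')]
    rw [roughPullback_eq D hL e hey' (hs.diffSectionAt hO hy')]
    have h1 := pullbackDeriv_snd D e hL s hey' (hU.mem y' hy')
    refine h1.trans ?_
    have h2 := hL y' _ (hU.mem y' hy')
    rw [complexField, dprojC, baseChange_complex] at h2
    congr 1
    refine (hγ' _ _ h2 _).trans ?_
    have h3 := fun u => chartD_apply_mfderiv hs' (mdifferentiableAt_proj p y') u
    simp only [h3]
    rfl

theorem PartialConnection.pullback_isPullback [IsManifold 𝓘(ℂ, V) ω X] (D : PartialConnection F B L) (hD : HasSmoothCoeff D)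
    (hL : ∀ y, ∀ u ∈ L' y, dprojC p y u ∈ L (p y)) :
    IsPullbackPartialConnection p D (D.pullback hD hL) := fun y u hu => by
  refine ⟨hL y u hu, fun s hs => ?_⟩
  exact ((D.pullback hD hL).deriv_of_mem (pullbackSection p s) hu).trans
    (pullbackDeriv_pullback D _ hL (mem_baseSet_trivializationAt F B (p y)) hs ⟨u, hu⟩)

end Pullback

/-! ### Flatness of pulled-back operators of type (0,1): calculus in vector spaces -/

section RealCalculus

variable {N : Type*} [NormedAddCommGroup N] [NormedSpace ℝ N]
  {V : Type*} [NormedAddCommGroup V] [NormedSpace ℝ V]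
  {F : Type*} [NormedAddCommGroup F] [NormedSpace ℝ F]

-- Product rule for the pulled-back connection term `Γ(P)(dP U) σ`. The summand containing the
-- second derivative of `P` is the one whose symmetry makes curvature natural.
set_option synthInstance.maxHeartbeats 400000 in
theorem hasFDerivAt_coeff_apply {P : N → V} {σ : N → F} {U : N → N} {Γ : V → V →L[ℝ] F →L[ℝ] F}
    {z : N} (hP : ContDiffAt ℝ 2 P z) (hσ : ContDiffAt ℝ 2 σ z) (hU : DifferentiableAt ℝ U z)
    (hΓ : DifferentiableAt ℝ Γ (P z)) (w : N) :
    DifferentiableAt ℝ (fun z => Γ (P z) (fderiv ℝ P z (U z)) (σ z)) z ∧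
    fderiv ℝ (fun z => Γ (P z) (fderiv ℝ P z (U z)) (σ z)) z w =
      fderiv ℝ Γ (P z) (fderiv ℝ P z w) (fderiv ℝ P z (U z)) (σ z) +
      Γ (P z) (fderiv ℝ (fderiv ℝ P) z w (U z) + fderiv ℝ P z (fderiv ℝ U z w)) (σ z) +
      Γ (P z) (fderiv ℝ P z (U z)) (fderiv ℝ σ z w) := by
  have hP1 : HasFDerivAt P (fderiv ℝ P z) z := (hP.differentiableAt (by norm_num)).hasFDerivAt
  have hσ1 : HasFDerivAt σ (fderiv ℝ σ z) z := (hσ.differentiableAt (by norm_num)).hasFDerivAt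
  have hP2 : HasFDerivAt (fderiv ℝ P) (fderiv ℝ (fderiv ℝ P) z) z :=
    ((hP.fderiv_right (m := 1) (by norm_num)).differentiableAt (by norm_num)).hasFDerivAt
  have hG : HasFDerivAt (fun z => Γ (P z)) ((fderiv ℝ Γ (P z)).comp (fderiv ℝ P z)) z :=
    HasFDerivAt.comp (G := V →L[ℝ] F →L[ℝ] F) z hΓ.hasFDerivAt hP1
  have h := (hG.clm_apply (hP2.clm_apply hU.hasFDerivAt)).clm_apply hσ1
  refine ⟨h.differentiableAt, ?_⟩
  rw [h.fderiv]
  simp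
  abel

end RealCalculus

section Calculus

variable {N : Type*} [NormedAddCommGroup N] [NormedSpace ℝ N]
  {V : Type*} [NormedAddCommGroup V] [NormedSpace ℂ V]
  {F : Type*} [NormedAddCommGroup F] [NormedSpace ℂ F]

theorem fderiv_fderiv_apply {G : Type*} [NormedAddCommGroup G] [NormedSpace ℝ G] {σ : N → G}
    {U : N → N} {z : N} (hσ : ContDiffAt ℝ 2 σ z) (hU : DifferentiableAt ℝ U z) (w : N) :
    DifferentiableAt ℝ (fun z => fderiv ℝ σ z (U z)) z ∧
    fderiv ℝ (fun z => fderiv ℝ σ z (U z)) z w =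
      fderiv ℝ (fderiv ℝ σ) z w (U z) + fderiv ℝ σ z (fderiv ℝ U z w) := by
  have hσ2 : HasFDerivAt (fderiv ℝ σ) (fderiv ℝ (fderiv ℝ σ) z) z :=
    ((hσ.fderiv_right (m := 1) (by norm_num)).differentiableAt (by norm_num)).hasFDerivAt
  have h := hσ2.clm_apply hU.hasFDerivAt
  refine ⟨h.differentiableAt, ?_⟩
  rw [h.fderiv]
  simp
  abel

/-- The local expression of a partial connection of type `(0,1)` along `U₁ + i U₂`. -/
def localDbar (P : N → V) (Γ : V → V →L[ℝ] F →L[ℝ] F) (U₁ U₂ : N → N) (σ : N → F) (z : N) : F :=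
  fderiv ℝ σ z (U₁ z) + Complex.I • fderiv ℝ σ z (U₂ z) + Γ (P z) (fderiv ℝ P z (U₁ z)) (σ z)

theorem fderiv_localDbar {P : N → V} {Γ : V → V →L[ℝ] F →L[ℝ] F} {U₁ U₂ : N → N} {σ : N → F} {z : N}
    (hP : ContDiffAt ℝ 2 P z) (hσ : ContDiffAt ℝ 2 σ z) (hU₁ : DifferentiableAt ℝ U₁ z)
    (hU₂ : DifferentiableAt ℝ U₂ z) (hΓ : DifferentiableAt ℝ Γ (P z)) (w : N) :
    fderiv ℝ (localDbar P Γ U₁ U₂ σ) z w =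
      (fderiv ℝ (fderiv ℝ σ) z w (U₁ z) + fderiv ℝ σ z (fderiv ℝ U₁ z w)) +
      Complex.I • (fderiv ℝ (fderiv ℝ σ) z w (U₂ z) + fderiv ℝ σ z (fderiv ℝ U₂ z w)) +
      (fderiv ℝ Γ (P z) (fderiv ℝ P z w) (fderiv ℝ P z (U₁ z)) (σ z) +
      Γ (P z) (fderiv ℝ (fderiv ℝ P) z w (U₁ z) + fderiv ℝ P z (fderiv ℝ U₁ z w)) (σ z) +
      Γ (P z) (fderiv ℝ P z (U₁ z)) (fderiv ℝ σ z w)) := by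
  have h1 := fderiv_fderiv_apply hσ hU₁ w
  have h2 := fderiv_fderiv_apply hσ hU₂ w
  have h3 := hasFDerivAt_coeff_apply hP hσ hU₁ hΓ w
  rw [← h1.2, ← h2.2, ← h3.2]
  have h := ((h1.1.hasFDerivAt.add (h2.1.hasFDerivAt.const_smul Complex.I)).add
    h3.1.hasFDerivAt).fderiv
  have h4 : localDbar P Γ U₁ U₂ σ = ((fun z => fderiv ℝ σ z (U₁ z)) +
    Complex.I • (fun z => fderiv ℝ σ z (U₂ z))) +
      fun z => Γ (P z) (fderiv ℝ P z (U₁ z)) (σ z) := rfl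
  rw [h4, h]
  rfl

/-- Obtained by differentiating `dP Z₂ = i dP Z₁` along `w`. It eliminates all derivatives of the
imaginary parts of the fields after projection by `dP`. -/
theorem fderiv_comp_I {P : N → V} {Z₁ Z₂ : N → N} {z : N} (hP : ContDiffAt ℝ 2 P z)
    (h1 : DifferentiableAt ℝ Z₁ z) (h2 : DifferentiableAt ℝ Z₂ z)
    (h : ∀ᶠ z in 𝓝 z, fderiv ℝ P z (Z₂ z) = Complex.I • fderiv ℝ P z (Z₁ z)) (w : N) :
    fderiv ℝ P z (fderiv ℝ Z₂ z w) = Complex.I • (fderiv ℝ (fderiv ℝ P) z w (Z₁ z) +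
      fderiv ℝ P z (fderiv ℝ Z₁ z w)) - fderiv ℝ (fderiv ℝ P) z w (Z₂ z) := by
  have e1 := fderiv_fderiv_apply hP h1 w
  have e2 := fderiv_fderiv_apply hP h2 w
  have e3 : (fun z => fderiv ℝ P z (Z₂ z)) =ᶠ[𝓝 z]
    Complex.I • fun z => fderiv ℝ P z (Z₁ z) := h
  have e4 := congrArg (fun l => l w) (e3.fderiv_eq.trans
    (e1.1.hasFDerivAt.const_smul Complex.I).fderiv)
  rw [e2.2, smul_apply, e1.2] at e4
  rw [← e4]
  abel

/-- This is the involutivity of the preimage of `T^{0,1}`: once `fderiv_comp_I` is inserted, only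
second derivatives of `P` are left over, and they cancel by symmetry. -/
theorem fderiv_lieBracket_comp {P : N → V} {U₁ U₂ V₁ V₂ : N → N} {z : N}
    (hP : ContDiffAt ℝ 2 P z) (hU₁ : DifferentiableAt ℝ U₁ z) (hU₂ : DifferentiableAt ℝ U₂ z)
    (hV₁ : DifferentiableAt ℝ V₁ z) (hV₂ : DifferentiableAt ℝ V₂ z)
    (hU : ∀ᶠ z in 𝓝 z, fderiv ℝ P z (U₂ z) = Complex.I • fderiv ℝ P z (U₁ z))
    (hV : ∀ᶠ z in 𝓝 z, fderiv ℝ P z (V₂ z) = Complex.I • fderiv ℝ P z (V₁ z)) :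
    fderiv ℝ P z (VectorField.lieBracket ℝ U₁ V₂ z + VectorField.lieBracket ℝ U₂ V₁ z) =
      Complex.I • fderiv ℝ P z
        (VectorField.lieBracket ℝ U₁ V₁ z - VectorField.lieBracket ℝ U₂ V₂ z) := by
  have hs : ∀ a b, fderiv ℝ (fderiv ℝ P) z a b = fderiv ℝ (fderiv ℝ P) z b a :=
    fun a b => (hP.isSymmSndFDerivAt (by simp)) a b
  simp only [VectorField.lieBracket, map_add, map_sub, fderiv_comp_I hP hU₁ hU₂ hU, fderiv_comp_I hP hV₁ hV₂ hV,
    smul_add, smul_sub, smul_smul, Complex.I_mul_I]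
  rw [hs (U₁ z) (V₂ z), hs (V₁ z) (U₂ z), hs (U₂ z) (V₁ z), hs (V₂ z) (U₁ z), hs (V₂ z) (U₂ z),
    hs (V₁ z) (U₁ z)]
  module

/-- The second derivatives of `P` and `σ` cancel by symmetry, the first derivatives of `σ` along
derivatives of the fields are absorbed by the bracket, and the mixed terms `Γ(dP V)(dσ U)` cancel by
complex linearity. What remains is the curvature of `Γ` at `dP U₁`, `dP V₁`, which is `hflat`. -/
theorem localDbar_flat {P : N → V} {Γ : V → V →L[ℝ] F →L[ℝ] F} {U₁ U₂ V₁ V₂ : N → N} {σ : N → F}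
    {z : N} (hP : ContDiffAt ℝ 2 P z) (hσ : ContDiffAt ℝ 2 σ z) (hΓ : DifferentiableAt ℝ Γ (P z))
    (hU₁ : DifferentiableAt ℝ U₁ z) (hU₂ : DifferentiableAt ℝ U₂ z)
    (hV₁ : DifferentiableAt ℝ V₁ z) (hV₂ : DifferentiableAt ℝ V₂ z)
    (hU : ∀ᶠ z in 𝓝 z, fderiv ℝ P z (U₂ z) = Complex.I • fderiv ℝ P z (U₁ z))
    (hV : ∀ᶠ z in 𝓝 z, fderiv ℝ P z (V₂ z) = Complex.I • fderiv ℝ P z (V₁ z))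
    (hanti : ∀ v f, Γ (P z) (Complex.I • v) f = -(Complex.I • Γ (P z) v f))
    (hlin : ∀ v f, Γ (P z) v (Complex.I • f) = Complex.I • Γ (P z) v f)
    (hflat : ∀ a b f, fderiv ℝ Γ (P z) a b f + Complex.I • fderiv ℝ Γ (P z) (Complex.I • a) b f -
      (fderiv ℝ Γ (P z) b a f + Complex.I • fderiv ℝ Γ (P z) (Complex.I • b) a f) +
      (Γ (P z) a (Γ (P z) b f) - Γ (P z) b (Γ (P z) a f)) = 0) :
    localDbar P Γ U₁ U₂ (localDbar P Γ V₁ V₂ σ) z - localDbar P Γ V₁ V₂ (localDbar P Γ U₁ U₂ σ) z -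
      localDbar P Γ
        (fun z => VectorField.lieBracket ℝ U₁ V₁ z - VectorField.lieBracket ℝ U₂ V₂ z)
        (fun z => VectorField.lieBracket ℝ U₁ V₂ z + VectorField.lieBracket ℝ U₂ V₁ z) σ z = 0 := by
  have hs : ∀ a b, fderiv ℝ (fderiv ℝ P) z a b = fderiv ℝ (fderiv ℝ P) z b a :=
    fun a b => (hP.isSymmSndFDerivAt (by simp)) a b
  have hsσ : ∀ a b, fderiv ℝ (fderiv ℝ σ) z a b = fderiv ℝ (fderiv ℝ σ) z b a :=
    fun a b => (hσ.isSymmSndFDerivAt (by simp)) a b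
  have hfl := hflat (fderiv ℝ P z (U₁ z)) (fderiv ℝ P z (V₁ z)) (σ z)
  have e : ∀ (Z₁ Z₂ : N → N) (τ : N → F), localDbar P Γ Z₁ Z₂ τ z = fderiv ℝ τ z (Z₁ z) +
    Complex.I • fderiv ℝ τ z (Z₂ z) + Γ (P z) (fderiv ℝ P z (Z₁ z)) (τ z) := fun _ _ _ => rfl
  rw [e _ _ (localDbar P Γ V₁ V₂ σ), e _ _ (localDbar P Γ U₁ U₂ σ)]
  simp only [fderiv_localDbar hP hσ hV₁ hV₂ hΓ, fderiv_localDbar hP hσ hU₁ hU₂ hΓ]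
  simp only [localDbar, VectorField.lieBracket, map_add, map_sub, fderiv_comp_I hP hU₁ hU₂ hU, fderiv_comp_I hP hV₁ hV₂ hV,
    hU.self_of_nhds, hV.self_of_nhds, hanti, hlin, add_apply, sub_apply, smul_add, smul_sub,
    smul_smul, Complex.I_mul_I]
  rw [hs (V₂ z) (U₂ z), hs (V₁ z) (U₁ z), hsσ (U₁ z) (V₂ z), hsσ (V₁ z) (U₂ z), hsσ (V₂ z) (U₂ z),
    hsσ (V₁ z) (U₁ z)]
  refine Eq.trans ?_ hfl
  module

end Calculus

/-! ### Vectors of type (0,1) and holomorphic charts -/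

section AntiholomorphicPart

variable {E : Type*} [NormedAddCommGroup E] [NormedSpace ℝ E]
  {M : Type*} [TopologicalSpace M] [ChartedSpace E M] [IsManifold 𝓘(ℝ, E) ∞ M]

theorem mem_antiholomorphicPart_iff
    (Φ : Π x : M, TangentSpace 𝓘(ℝ, E) x →L[ℝ] TangentSpace 𝓘(ℝ, E) x) (x : M)
    (u₁ u₂ : TangentSpace 𝓘(ℝ, E) x) :
    (1 : ℂ) ⊗ₜ[ℝ] u₁ + Complex.I ⊗ₜ[ℝ] u₂ ∈ antiholomorphicPart Φ x ↔
      Φ x u₁ = u₂ ∧ Φ x u₂ = -u₁ := by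
  rw [antiholomorphicPart, Module.End.mem_eigenspace_iff, baseChange_complex]
  have h : (-Complex.I) • ((1 : ℂ) ⊗ₜ[ℝ] u₁ + Complex.I ⊗ₜ[ℝ] u₂) =
      (1 : ℂ) ⊗ₜ[ℝ] u₂ + Complex.I ⊗ₜ[ℝ] (-u₁) := by
    simp only [smul_add, TensorProduct.smul_tmul', TensorProduct.tmul_neg,
      smul_eq_mul, neg_mul, Complex.I_mul_I, neg_neg, mul_one, TensorProduct.neg_tmul]
    abel
  rw [h]
  constructor
  · exact fun h => complexify_inj h
  · rintro ⟨h1, h2⟩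
    simp only [ContinuousLinearMap.coe_coe, h1, h2]

end AntiholomorphicPart

section ComplexManifold

variable {V : Type*} [NormedAddCommGroup V] [NormedSpace ℂ V]
  {X : Type*} [TopologicalSpace X] [ChartedSpace V X] [IsManifold 𝓘(ℂ, V) ω X]

theorem complexStructure_complexStructure (x : X) (u : TangentSpace 𝓘(ℝ, V) x) :
    complexStructure x (complexStructure x u) = -u := by
  have h : ∀ v : V, Complex.I • Complex.I • v = -v := fun v => by
    rw [smul_smul, Complex.I_mul_I, neg_one_smul]
  exact h u

theorem mem_antiholomorphicPart_complexStructure_iff (x : X) (u₁ u₂ : TangentSpace 𝓘(ℝ, V) x) :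
    (1 : ℂ) ⊗ₜ[ℝ] u₁ + Complex.I ⊗ₜ[ℝ] u₂ ∈
      antiholomorphicPart (complexStructure (V := V) (X := X)) x ↔ u₂ = complexStructure x u₁ := by
  rw [mem_antiholomorphicPart_iff]
  constructor
  · exact fun h => h.1.symm
  · rintro rfl
    exact ⟨rfl, complexStructure_complexStructure x u₁⟩

/-- Holomorphic charts commute with the complex structure. -/
theorem chartD_complexStructure {x₀ x : X} (hx : x ∈ (chartAt V x₀).source)
    (u : TangentSpace 𝓘(ℝ, V) x) :
    chartD x₀ x (complexStructure x u) = Complex.I • chartD x₀ x u := by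
  have : IsManifold 𝓘(ℂ, V) 1 X := IsManifold.of_le (n := ω) le_top
  have h1 : MDifferentiableAt 𝓘(ℂ, V) 𝓘(ℂ, V) (extChartAt 𝓘(ℂ, V) x₀) x :=
    mdifferentiableAt_extChartAt hx
  have h2 : DifferentiableAt ℂ (extChartAt 𝓘(ℂ, V) x₀ ∘ (extChartAt 𝓘(ℂ, V) x).symm)
      (extChartAt 𝓘(ℂ, V) x x) := by
    rw [mdifferentiableAt_iff_source_of_mem_source (mem_chart_source V x)] at h1
    simpa [mdifferentiableWithinAt_univ, mdifferentiableAt_iff_differentiableAt] using h1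
  -- The change of holomorphic charts is complex differentiable, and its real derivative is the
  -- complex one with restricted scalars; hence it commutes with `i`.
  have h3 := h2.hasFDerivAt.restrictScalars ℝ
  have h4 : MDifferentiableAt 𝓘(ℝ, V) 𝓘(ℝ, V) (extChartAt 𝓘(ℝ, V) x₀) x :=
    mdifferentiableAt_extChartAt hx
  have h5 : ∀ v : V, (chartD x₀ x : V →L[ℝ] V) v = fderiv ℝ (extChartAt 𝓘(ℝ, V) x₀ ∘
      (extChartAt 𝓘(ℝ, V) x).symm) (extChartAt 𝓘(ℝ, V) x x) v := fun v => by
    rw [fderiv_chart (mem_chart_source V x) h4, coordL_self]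
    rfl
  have h6 : fderiv ℝ (extChartAt 𝓘(ℝ, V) x₀ ∘
      (extChartAt 𝓘(ℝ, V) x).symm) (extChartAt 𝓘(ℝ, V) x x) = _ := h3.fderiv
  have h7 : ∀ v : V, (chartD x₀ x : V →L[ℝ] V) (Complex.I • v) =
      Complex.I • (chartD x₀ x : V →L[ℝ] V) v := fun v => by
    rw [h5, h5, h6]
    exact map_smul (fderiv ℂ (extChartAt 𝓘(ℂ, V) x₀ ∘ (extChartAt 𝓘(ℂ, V) x).symm)
      (extChartAt 𝓘(ℂ, V) x x)) Complex.I v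
  exact h7 u

theorem coordL_smul_I {x₀ x : X} (hx : x ∈ (chartAt V x₀).source) (v : V) :
    coordL x₀ x (Complex.I • v) = complexStructure x (coordL x₀ x v) := by
  have h := chartD_complexStructure hx (coordL x₀ x v)
  rw [chartD_coordL hx] at h
  rw [← h, coordL_chartD hx]

theorem coordField_mem {x₀ x : X} (hx : x ∈ (chartAt V x₀).source) (v : V) :
    complexField (coordField x₀ v) (coordField x₀ (Complex.I • v)) x ∈
      antiholomorphicPart (complexStructure (V := V) (X := X)) x := by
  rw [complexField, mem_antiholomorphicPart_complexStructure_iff]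
  exact coordL_smul_I hx v

theorem isLocalSection_coordField (x₀ : X) (v : V) {O : Set X} (hO : O ⊆ (chartAt V x₀).source) :
    IsLocalSection (antiholomorphicPart (complexStructure (V := V) (X := X))) O
      (coordField x₀ v) (coordField x₀ (Complex.I • v)) where
  smooth_re := (smoothFieldOn_coordField x₀ v).mono hO
  smooth_im := (smoothFieldOn_coordField x₀ _).mono hO
  mem _ hx := coordField_mem (hO hx) v

end ComplexManifold

/-! ### Smooth families of linear maps in finite dimension -/

section LinearFamilies

/-- In a basis of `D` a linear map is a finite tuple of vectors of `G`, so smoothness can be checked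
one argument at a time. -/
theorem contDiffAt_clm_of_apply {N D G : Type*} [NormedAddCommGroup N] [NormedSpace ℝ N]
    [NormedAddCommGroup D] [NormedSpace ℝ D] [FiniteDimensional ℝ D]
    [NormedAddCommGroup G] [NormedSpace ℝ G] {n : ℕ∞ω}
    {f : N → D →L[ℝ] G} {z : N} (h : ∀ y, ContDiffAt ℝ n (fun x => f x y) z) :
    ContDiffAt ℝ n f z := by
  let d := Module.finrank ℝ D
  have hd : d = Module.finrank ℝ (Fin d → ℝ) := (Module.finrank_fin_fun ℝ).symm
  let e₁ := ContinuousLinearEquiv.ofFinrankEq hd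
  let e₂ := (e₁.arrowCongr (1 : G ≃L[ℝ] G)).trans (ContinuousLinearEquiv.piRing (Fin d))
  rw [← e₂.comp_contDiffAt_iff]
  exact contDiffAt_pi.2 fun i => h _

theorem contMDiffAt_clm_of_apply {E M D G : Type*} [NormedAddCommGroup E] [NormedSpace ℝ E]
    [TopologicalSpace M] [ChartedSpace E M] [IsManifold 𝓘(ℝ, E) ∞ M]
    [NormedAddCommGroup D] [NormedSpace ℝ D] [FiniteDimensional ℝ D]
    [NormedAddCommGroup G] [NormedSpace ℝ G]
    {f : M → D →L[ℝ] G} {x : M} (h : ∀ y, ContMDiffAt 𝓘(ℝ, E) 𝓘(ℝ, G) ∞ (fun x => f x y) x) :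
    ContMDiffAt 𝓘(ℝ, E) 𝓘(ℝ, D →L[ℝ] G) ∞ f x := by
  rw [contMDiffAt_iff_chart (mem_chart_source E x)]
  refine contDiffAt_clm_of_apply fun y => ?_
  have := h y
  rwa [contMDiffAt_iff_chart (mem_chart_source E x)] at this

theorem exists_bilinear {D₁ D₂ G : Type*} [NormedAddCommGroup D₁] [NormedSpace ℝ D₁]
    [FiniteDimensional ℝ D₁] [NormedAddCommGroup D₂] [NormedSpace ℝ D₂] [FiniteDimensional ℝ D₂]
    [NormedAddCommGroup G] [NormedSpace ℝ G] (f : D₁ → D₂ → G)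
    (h1 : ∀ a b c, f (a + b) c = f a c + f b c) (h2 : ∀ (r : ℝ) a c, f (r • a) c = r • f a c)
    (h3 : ∀ a b c, f a (b + c) = f a b + f a c) (h4 : ∀ (r : ℝ) a c, f a (r • c) = r • f a c) :
    ∃ g : D₁ →L[ℝ] D₂ →L[ℝ] G, ∀ a c, g a c = f a c :=
  ⟨LinearMap.toContinuousLinearMap
    ((LinearMap.toContinuousLinearMap (E := D₂) (F' := G) (𝕜 := ℝ)).toLinearMap ∘ₗ
      LinearMap.mk₂ ℝ f h1 h2 h3 h4), fun _ _ => rfl⟩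

end LinearFamilies

/-! ### Coefficients of a holomorphic structure in a chart and a trivialization -/

section HolomorphicBundle

variable {V : Type*} [NormedAddCommGroup V] [NormedSpace ℂ V] [FiniteDimensional ℂ V]
  {X : Type*} [TopologicalSpace X] [ChartedSpace V X] [IsManifold 𝓘(ℂ, V) ω X]
  {F : Type*} [NormedAddCommGroup F] [NormedSpace ℂ F] [FiniteDimensional ℂ F]
  {B : X → Type*} [TopologicalSpace (TotalSpace F B)]
  [∀ x, AddCommGroup (B x)] [∀ x, Module ℂ (B x)] [∀ x, Module ℝ (B x)]
  [∀ x, IsScalarTower ℝ ℂ (B x)]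
  [∀ x, TopologicalSpace (B x)] [∀ x, IsTopologicalAddGroup (B x)]
  [∀ x, ContinuousSMul ℝ (B x)]
  [FiberBundle F B] [VectorBundle ℂ F B] [VectorBundle ℝ F B]
  [ContMDiffVectorBundle ∞ F B 𝓘(ℝ, V)]

theorem PartialConnection.deriv_add_right {L : Π x : X, Submodule ℂ (CTangent V x)}
    (D : PartialConnection F B L) (s : Π x : X, B x) {x : X} {u v : CTangent V x} (hu : u ∈ L x)
    (hv : v ∈ L x) : D.deriv s x (u + v) = D.deriv s x u + D.deriv s x v := by
  rw [D.deriv_of_mem s hu, D.deriv_of_mem s hv, D.deriv_of_mem s (add_mem hu hv)]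
  exact (D.toFun s x).map_add ⟨u, hu⟩ ⟨v, hv⟩

theorem PartialConnection.deriv_smul_right {L : Π x : X, Submodule ℂ (CTangent V x)}
    (D : PartialConnection F B L) (s : Π x : X, B x) {x : X} (c : ℂ) {u : CTangent V x}
    (hu : u ∈ L x) : D.deriv s x (c • u) = c • D.deriv s x u := by
  rw [D.deriv_of_mem s hu, D.deriv_of_mem s ((L x).smul_mem c hu)]
  exact (D.toFun s x).map_smul c ⟨u, hu⟩

/-- The complex coordinate field of type `(0,1)`. -/
def dbarField (x₀ : X) (v : V) (x : X) : CTangent V x :=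
  complexField (coordField x₀ v) (coordField x₀ (Complex.I • v)) x

theorem dbarField_add (x₀ : X) (v w : V) (x : X) :
    dbarField x₀ (v + w) x = dbarField x₀ v x + dbarField x₀ w x := by
  simp only [dbarField, complexField, coordField, smul_add, map_add, TensorProduct.tmul_add]
  abel

theorem dbarField_smul (x₀ : X) (r : ℝ) (v : V) (x : X) :
    dbarField x₀ (r • v) x = (r : ℂ) • dbarField x₀ v x := by
  simp only [dbarField, complexField, coordField, smul_comm Complex.I r v, map_smul, smul_add,
    TensorProduct.smul_tmul', ← TensorProduct.smul_tmul, Complex.real_smul, smul_eq_mul]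

theorem dbarField_mem {x₀ x : X} (hx : x ∈ (chartAt V x₀).source) (v : V) :
    dbarField x₀ v x ∈ antiholomorphicPart (complexStructure (V := V) (X := X)) x :=
  coordField_mem hx v

theorem dbarField_smul_I (x₀ : X) (v : V) (x : X) :
    dbarField x₀ (Complex.I • v) x = (-Complex.I) • dbarField x₀ v x := by
  simp only [dbarField, complexField, coordField, smul_smul, Complex.I_mul_I, neg_smul, one_smul,
    map_neg, TensorProduct.tmul_neg]
  rw [smul_add, TensorProduct.smul_tmul', TensorProduct.smul_tmul', smul_eq_mul, smul_eq_mul,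
    mul_one, Complex.I_mul_I, TensorProduct.neg_tmul]
  abel

variable (D : PartialConnection F B (antiholomorphicPart (complexStructure (V := V) (X := X))))

/-- `Γ` is the family of coefficients of `D` in the chart and the trivialization at `x₀`. -/
structure IsDbarCoeff (x₀ : X) (Γ : X → V →L[ℝ] F →L[ℝ] F) : Prop where
  smooth : ∀ x ∈ (chartAt V x₀).source ∩ (trivializationAt F B x₀).baseSet,
    ContMDiffAt 𝓘(ℝ, V) 𝓘(ℝ, V →L[ℝ] F →L[ℝ] F) ∞ Γ x
  eq : ∀ x ∈ (chartAt V x₀).source ∩ (trivializationAt F B x₀).baseSet, ∀ v f,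
    Γ x v f = (trivializationAt F B x₀
      ⟨x, D.deriv (constSec (trivializationAt F B x₀) f) x (dbarField x₀ v x)⟩).2

-- The coefficients are the values of `D` on constant frame sections along the fields `dbarField x₀
-- v`. They are real bilinear in `v` and `f`, and smooth because `D` maps smooth data to smooth
-- sections.
set_option synthInstance.maxHeartbeats 400000 in
theorem exists_isDbarCoeff (x₀ : X) : ∃ Γ, IsDbarCoeff D x₀ Γ := by
  let e := trivializationAt F B x₀
  let N := (chartAt V x₀).source ∩ e.baseSet
  have hN : IsOpen N := (chartAt V x₀).open_source.inter e.open_baseSet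
  have : FiniteDimensional ℝ V := FiniteDimensional.complexToReal V
  have : FiniteDimensional ℝ F := FiniteDimensional.complexToReal F
  have h : ∀ x, ∃ g : V →L[ℝ] F →L[ℝ] F, x ∈ N → ∀ v f, g v f =
      (e ⟨x, D.deriv (constSec e f) x (dbarField x₀ v x)⟩).2 := fun x => by
    by_cases hx : x ∈ N
    · obtain ⟨g, hg⟩ := exists_bilinear
        (fun v f => (e ⟨x, D.deriv (constSec e f) x (dbarField x₀ v x)⟩).2)
        (fun a b c => by
          rw [dbarField_add, D.deriv_add_right _ (dbarField_mem hx.1 a) (dbarField_mem hx.1 b),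
            snd_eq e hx.2, snd_eq e hx.2, snd_eq e hx.2, map_add])
        (fun r a c => by
          rw [dbarField_smul, D.deriv_smul_right _ _ (dbarField_mem hx.1 a),
            snd_eq e hx.2, snd_eq e hx.2, map_smul, Complex.coe_smul])
        (fun a b c => by
          rw [D.deriv_constSec_add e hx.2, snd_eq e hx.2, snd_eq e hx.2, snd_eq e hx.2, map_add])
        (fun r a c => by
          rw [← Complex.coe_smul, D.deriv_constSec_smul e hx.2 _ _ (dbarField_mem hx.1 a),
            snd_eq e hx.2, snd_eq e hx.2, map_smul, Complex.coe_smul])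
      exact ⟨g, fun _ => hg⟩
    -- Off the common domain of the chart and the trivialization the value is irrelevant.
    · exact ⟨0, fun h => absurd h hx⟩
  choose Γ hΓ using h
  refine ⟨Γ, fun x hx => ?_, hΓ⟩
  refine contMDiffAt_clm_of_apply fun v => contMDiffAt_clm_of_apply fun f => ?_
  have h1 := D.smooth N hN (constSec e f)
    ((smoothSectionOn_constSec e f).mono inter_subset_right) _ _
    (isLocalSection_coordField x₀ v inter_subset_left)
    (fun x => D.deriv (constSec e f) x (dbarField x₀ v x))
    (fun x _ hU => D.deriv_of_mem _ hU)
  have h2 := (smoothSectionAt_iff e hx.2 _).1 (h1.contMDiffAt hN hx)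
  refine h2.congr_of_eventuallyEq ?_
  filter_upwards [hN.mem_nhds hx] with x' hx'
  exact hΓ x' hx' v f

end HolomorphicBundle

set_option synthInstance.maxHeartbeats 400000 in
theorem fderiv_apply_apply {N V F F' : Type*} [NormedAddCommGroup N] [NormedSpace ℝ N]
    [NormedAddCommGroup V] [NormedSpace ℝ V] [NormedAddCommGroup F] [NormedSpace ℝ F]
    [NormedAddCommGroup F'] [NormedSpace ℝ F']
    {G : N → V →L[ℝ] F →L[ℝ] F'} {z : N} (hG : DifferentiableAt ℝ G z) (v : V) (f : F) (u : N) :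
    fderiv ℝ (fun z => G z v f) z u = fderiv ℝ G z u v f := by
  rw [((HasFDerivAt.clm_apply (G := V) (H := F →L[ℝ] F') hG.hasFDerivAt
    (hasFDerivAt_const v z)).clm_apply (hasFDerivAt_const f z)).fderiv]
  simp

section HolomorphicBundle

variable {V : Type*} [NormedAddCommGroup V] [NormedSpace ℂ V] [FiniteDimensional ℂ V]
  {X : Type*} [TopologicalSpace X] [ChartedSpace V X] [IsManifold 𝓘(ℂ, V) ω X]
  {F : Type*} [NormedAddCommGroup F] [NormedSpace ℂ F] [FiniteDimensional ℂ F]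
  {B : X → Type*} [TopologicalSpace (TotalSpace F B)]
  [∀ x, AddCommGroup (B x)] [∀ x, Module ℂ (B x)] [∀ x, Module ℝ (B x)]
  [∀ x, IsScalarTower ℝ ℂ (B x)]
  [∀ x, TopologicalSpace (B x)] [∀ x, IsTopologicalAddGroup (B x)]
  [∀ x, ContinuousSMul ℝ (B x)]
  [FiberBundle F B] [VectorBundle ℂ F B] [VectorBundle ℝ F B]
  [ContMDiffVectorBundle ∞ F B 𝓘(ℝ, V)]

theorem dbarField_chartD {x₀ x : X} (hx : x ∈ (chartAt V x₀).source) (u : TangentSpace 𝓘(ℝ, V) x) :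
    dbarField x₀ (chartD x₀ x u) x =
      (1 : ℂ) ⊗ₜ[ℝ] u + Complex.I ⊗ₜ[ℝ] complexStructure x u := by
  rw [dbarField, complexField, coordField, coordField, coordL_smul_I hx, coordL_chartD hx]

theorem mlieBracket_coordField (x₀ : X) (v w : V) :
    VectorField.mlieBracket 𝓘(ℝ, V) (coordField x₀ v) (coordField x₀ w) x₀ = 0 := by
  have h1 := fieldRep_coordField_eventuallyEq (mem_chart_source V x₀) v
  have h2 := fieldRep_coordField_eventuallyEq (mem_chart_source V x₀) w
  have h : VectorField.lieBracket ℝ (fieldRep x₀ (coordField x₀ v)) (fieldRep x₀ (coordField x₀ w))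
      (extChartAt 𝓘(ℝ, V) x₀ x₀) = 0 := by
    rw [VectorField.lieBracket, h1.fderiv_eq, h2.fderiv_eq]
    simp
  exact (mlieBracket_eq _ _ x₀).trans h

variable {D : PartialConnection F B (antiholomorphicPart (complexStructure (V := V) (X := X)))}
  {x₀ : X} {Γ : X → V →L[ℝ] F →L[ℝ] F}

namespace IsDbarCoeff

theorem smul_I (hΓ : IsDbarCoeff D x₀ Γ) {x : X}
    (hx : x ∈ (chartAt V x₀).source ∩ (trivializationAt F B x₀).baseSet) (v : V) (f : F) :
    Γ x (Complex.I • v) f = -(Complex.I • Γ x v f) := by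
  rw [hΓ.eq x hx, hΓ.eq x hx, dbarField_smul_I, D.deriv_smul_right _ _ (dbarField_mem hx.1 v),
    snd_eq _ hx.2, snd_eq _ hx.2, map_smul, neg_smul]

theorem apply_smul_I (hΓ : IsDbarCoeff D x₀ Γ) {x : X}
    (hx : x ∈ (chartAt V x₀).source ∩ (trivializationAt F B x₀).baseSet) (v : V) (f : F) :
    Γ x v (Complex.I • f) = Complex.I • Γ x v f := by
  rw [hΓ.eq x hx, hΓ.eq x hx, D.deriv_constSec_smul _ hx.2 _ _ (dbarField_mem hx.1 v),
    snd_eq _ hx.2, snd_eq _ hx.2, map_smul]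

theorem deriv_eq (hΓ : IsDbarCoeff D x₀ Γ) {x : X}
    (hx : x ∈ (chartAt V x₀).source ∩ (trivializationAt F B x₀).baseSet) {s : Π x : X, B x}
    (hs : DiffSectionAt V F s x) (v : V) :
    (trivializationAt F B x₀ ⟨x, D.deriv s x (dbarField x₀ v x)⟩).2 =
      mvfderiv 𝓘(ℝ, V) (fun x => (trivializationAt F B x₀ ⟨x, s x⟩).2) x (coordL x₀ x v) +
      Complex.I • mvfderiv 𝓘(ℝ, V) (fun x => (trivializationAt F B x₀ ⟨x, s x⟩).2) x
        (coordL x₀ x (Complex.I • v)) +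
      Γ x v (trivializationAt F B x₀ ⟨x, s x⟩).2 := by
  rw [D.deriv_eq _ hx.2 hs (dbarField_mem hx.1 v), snd_eq _ hx.2, map_add,
    Trivialization.linearMapAt_symmₗ _ hx.2, hΓ.eq x hx]
  refine congrArg₂ (· + ·) ?_ (snd_eq _ hx.2 _).symm
  rw [dbarField, complexField, liftBaseChange_complex]
  rfl

/-- Flatness is tested on the coordinate fields of type (0,1) and on a constant frame section. The
two second derivatives yield derivatives and products of coefficients, and there is no bracket term.
-/
theorem flat (hΓ : IsDbarCoeff D x₀ Γ) (hD : D.IsFlat) (a b : V) (f : F) :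
    let G := Γ ∘ (extChartAt 𝓘(ℝ, V) x₀).symm
    let z := extChartAt 𝓘(ℝ, V) x₀ x₀
    fderiv ℝ G z a b f + Complex.I • fderiv ℝ G z (Complex.I • a) b f -
      (fderiv ℝ G z b a f + Complex.I • fderiv ℝ G z (Complex.I • b) a f) +
      (G z a (G z b f) - G z b (G z a f)) = 0 := by
  intro G z
  let e := trivializationAt F B x₀
  let N := (chartAt V x₀).source ∩ e.baseSet
  have hN : IsOpen N := (chartAt V x₀).open_source.inter e.open_baseSet
  have hx : x₀ ∈ N := ⟨mem_chart_source V x₀, mem_baseSet_trivializationAt F B x₀⟩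
  have hGz : G z = Γ x₀ := by
    simp only [G, z, Function.comp_apply, extChartAt_to_inv]
  have hsm := smoothSectionOn_constSec (E := V) e f
  have hΓd := (hΓ.smooth x₀ hx)
  have hGd : DifferentiableAt ℝ G z := by
    rw [contMDiffAt_iff_chart hx.1] at hΓd
    exact hΓd.differentiableAt (by norm_num)
  have key : ∀ v w : V, (e ⟨x₀, D.deriv (fun x => D.deriv (constSec e f) x (dbarField x₀ w x)) x₀
      (dbarField x₀ v x₀)⟩).2 = fderiv ℝ G z v w f + Complex.I • fderiv ℝ G z (Complex.I • v) w f +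
      G z v (G z w f) := fun v w => by
    have hrep : (fun x => (e ⟨x, D.deriv (constSec e f) x (dbarField x₀ w x)⟩).2) =ᶠ[𝓝 x₀]
        fun x => Γ x w f := by
      filter_upwards [hN.mem_nhds hx] with x' hx'
      exact (hΓ.eq x' hx' w f).symm
    have hd : MDifferentiableAt 𝓘(ℝ, V) 𝓘(ℝ, F) (fun x => Γ x w f) x₀ :=
      ((hΓd.clm_apply contMDiffAt_const).clm_apply contMDiffAt_const).mdifferentiableAt (by norm_num)
    have hd2 : DiffSectionAt V F (fun x => D.deriv (constSec e f) x (dbarField x₀ w x)) x₀ := by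
      rw [diffSectionAt_iff e hx.2]
      exact hd.congr_of_eventuallyEq hrep
    have hself : (trivializationAt F B x₀ ⟨x₀, D.deriv (constSec e f) x₀ (dbarField x₀ w x₀)⟩).2 =
      Γ x₀ w f := hrep.self_of_nhds
    rw [hΓ.deriv_eq hx hd2, mvfderiv_congr hrep, hself,
      ← fderiv_chart hx.1 hd, ← fderiv_chart hx.1 hd, hGz]
    have h2 : ∀ u, fderiv ℝ ((fun x => Γ x w f) ∘ (extChartAt 𝓘(ℝ, V) x₀).symm) z u =
        fderiv ℝ G z u w f := fun u => by
      have h3 : ((fun x => Γ x w f) ∘ (extChartAt 𝓘(ℝ, V) x₀).symm) = fun z => G z w f := rfl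
      rw [h3, fderiv_apply_apply hGd]
    rw [h2, h2]
  have h := hD.2 N hN _ _ _ _ (isLocalSection_coordField x₀ a inter_subset_left)
    (isLocalSection_coordField x₀ b inter_subset_left) (constSec e f)
    (hsm.mono inter_subset_right) x₀ hx
  -- Coordinate fields have constant expressions in the chart, so all four real brackets vanish at
  -- `x₀`.
  have hbr : complexBracket (coordField x₀ a) (coordField x₀ (Complex.I • a)) (coordField x₀ b)
      (coordField x₀ (Complex.I • b)) x₀ = 0 := by
    simp only [complexBracket, complexField, mlieBracket_coordField]
    simp
  have h0 : D.deriv (constSec e f) x₀ 0 = 0 := by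
    have := D.deriv_smul_right (constSec e f) 0 (dbarField_mem hx.1 a)
    simpa using this
  rw [hbr, h0, sub_zero] at h
  have h2 := congrArg (e.linearMapAt ℂ x₀) h
  rw [map_sub, map_zero, ← snd_eq e hx.2, ← snd_eq e hx.2] at h2
  have k1 := key a b
  have k2 := key b a
  simp only [dbarField] at k1 k2
  rw [k1, k2] at h2
  rw [← h2]
  abel

/-- A vector of type (0,1) is determined by its real part, so the family may ignore the second
component. -/
theorem hasSmoothCoeff : HasSmoothCoeff D := fun x₀ => by
  obtain ⟨Γ, hΓ⟩ := exists_isDbarCoeff D x₀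
  have hx : x₀ ∈ (chartAt V x₀).source ∩ (trivializationAt F B x₀).baseSet :=
    ⟨mem_chart_source V x₀, mem_baseSet_trivializationAt F B x₀⟩
  have : FiniteDimensional ℝ V := FiniteDimensional.complexToReal V
  refine ⟨fun x => (Γ x).comp (ContinuousLinearMap.fst ℝ V V), ?_, ?_⟩
  · refine contMDiffAt_clm_of_apply fun y => ?_
    exact (hΓ.smooth x₀ hx).clm_apply contMDiffAt_const
  · filter_upwards [((chartAt V x₀).open_source.inter
      (trivializationAt F B x₀).open_baseSet).mem_nhds hx] with x hx' u₁ u₂ hu f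
    rw [mem_antiholomorphicPart_complexStructure_iff] at hu
    rw [hu, ← dbarField_chartD hx'.1]
    exact (hΓ.eq x hx' _ f).symm

end IsDbarCoeff

end HolomorphicBundle

/-! ### Flatness of the pullback of a holomorphic structure -/

section FlatPullback

variable {V : Type*} [NormedAddCommGroup V] [NormedSpace ℂ V] [FiniteDimensional ℂ V]
  {X : Type*} [TopologicalSpace X] [ChartedSpace V X] [IsManifold 𝓘(ℂ, V) ω X]
  {W : Type*} [NormedAddCommGroup W] [NormedSpace ℝ W]
  {Y : Type*} [TopologicalSpace Y] [ChartedSpace W Y] [IsManifold 𝓘(ℝ, W) ∞ Y]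
  {F : Type*} [NormedAddCommGroup F] [NormedSpace ℂ F] [FiniteDimensional ℂ F]
  {B : X → Type*} [TopologicalSpace (TotalSpace F B)]
  [∀ x, AddCommGroup (B x)] [∀ x, Module ℂ (B x)] [∀ x, Module ℝ (B x)]
  [∀ x, IsScalarTower ℝ ℂ (B x)]
  [∀ x, TopologicalSpace (B x)] [∀ x, IsTopologicalAddGroup (B x)]
  [∀ x, ContinuousSMul ℝ (B x)]
  [FiberBundle F B] [VectorBundle ℂ F B] [VectorBundle ℝ F B]
  [ContMDiffVectorBundle ∞ F B 𝓘(ℝ, V)]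
  (p : C^∞⟮𝓘(ℝ, W), Y; 𝓘(ℝ, V), X⟯)

/-- The expression of `p` in the charts at `y₀` and `p y₀`. -/
def localProj (y₀ : Y) (z : W) : V :=
  extChartAt 𝓘(ℝ, V) (p y₀) (p ((extChartAt 𝓘(ℝ, W) y₀).symm z))

/-- The domain on which `p` is expressed in the charts at `y₀` and `p y₀`. -/
def projDomain (y₀ : Y) : Set Y := (chartAt W y₀).source ∩ p ⁻¹' (chartAt V (p y₀)).source

theorem isOpen_projDomain (y₀ : Y) : IsOpen (projDomain p y₀) :=
  (chartAt W y₀).open_source.inter ((chartAt V (p y₀)).open_source.preimage p.contMDiff.continuous)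

theorem mem_projDomain (y₀ : Y) : y₀ ∈ projDomain p y₀ :=
  ⟨mem_chart_source W y₀, mem_chart_source V (p y₀)⟩

theorem contDiffAt_localProj {y₀ y : Y} (hy : y ∈ projDomain p y₀) :
    ContDiffAt ℝ ∞ (localProj p y₀) (extChartAt 𝓘(ℝ, W) y₀ y) := by
  have h : ContMDiffAt 𝓘(ℝ, W) 𝓘(ℝ, V) ∞ (fun y => extChartAt 𝓘(ℝ, V) (p y₀) (p y)) y :=
    (contMDiffAt_extChartAt' hy.2).comp y (p.contMDiff y)
  rwa [contMDiffAt_iff_chart hy.1] at h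

theorem fderiv_localProj {y₀ y : Y} (hy : y ∈ projDomain p y₀) (u : TangentSpace 𝓘(ℝ, W) y) :
    fderiv ℝ (localProj p y₀) (extChartAt 𝓘(ℝ, W) y₀ y) (chartD y₀ y u) =
      chartD (p y₀) (p y) (dproj p y u) := by
  have h : MDifferentiableAt 𝓘(ℝ, W) 𝓘(ℝ, V) (fun y => extChartAt 𝓘(ℝ, V) (p y₀) (p y)) y :=
    (mdifferentiableAt_extChartAt hy.2).comp y (mdifferentiableAt_proj p y)
  rw [← chartD_apply_mfderiv hy.2 (mdifferentiableAt_proj p y), mvfderiv_eq_fderiv_chart hy.1 h]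
  rfl

theorem localProj_extChartAt {y₀ y : Y} (hy : y ∈ projDomain p y₀) :
    localProj p y₀ (extChartAt 𝓘(ℝ, W) y₀ y) = extChartAt 𝓘(ℝ, V) (p y₀) (p y) := by
  rw [localProj, extChartAt_symm_apply_of_mem hy.1]

theorem eventually_extChartAt_symm {y₀ : Y} {s : Set Y} (hs : s ∈ 𝓝 y₀) :
    ∀ᶠ z in 𝓝 (extChartAt 𝓘(ℝ, W) y₀ y₀), (extChartAt 𝓘(ℝ, W) y₀).symm z ∈ s ∧
      extChartAt 𝓘(ℝ, W) y₀ ((extChartAt 𝓘(ℝ, W) y₀).symm z) = z := by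
  have hc : Filter.Tendsto (extChartAt 𝓘(ℝ, W) y₀).symm (𝓝 (extChartAt 𝓘(ℝ, W) y₀ y₀)) (𝓝 y₀) := by
    have := continuousAt_extChartAt_symm (I := 𝓘(ℝ, W)) y₀
    rwa [ContinuousAt, extChartAt_to_inv] at this
  filter_upwards [hc.eventually hs, (isOpen_extChartAt_target y₀).mem_nhds
    (mem_extChartAt_target_of_mem (mem_chart_source W y₀))] with z h1 h2
  exact ⟨h1, (extChartAt 𝓘(ℝ, W) y₀).right_inv h2⟩

variable {p} {L' : Π y : Y, Submodule ℂ (CTangent W y)}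

theorem fderiv_localProj_I (hL' : ∀ y (u₁ u₂ : TangentSpace 𝓘(ℝ, W) y),
      (1 : ℂ) ⊗ₜ[ℝ] u₁ + Complex.I ⊗ₜ[ℝ] u₂ ∈ L' y ↔
        dproj p y u₂ = complexStructure (p y) (dproj p y u₁))
    {O : Set Y} (hO : IsOpen O) {U₁ U₂ : Π y : Y, TangentSpace 𝓘(ℝ, W) y}
    (hU : IsLocalSection L' O U₁ U₂) {y₀ : Y} (hy : y₀ ∈ O) :
    ∀ᶠ z in 𝓝 (extChartAt 𝓘(ℝ, W) y₀ y₀), fderiv ℝ (localProj p y₀) z (fieldRep y₀ U₂ z) =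
      Complex.I • fderiv ℝ (localProj p y₀) z (fieldRep y₀ U₁ z) := by
  filter_upwards [eventually_extChartAt_symm (Filter.inter_mem (hO.mem_nhds hy)
    ((isOpen_projDomain p y₀).mem_nhds (mem_projDomain p y₀)))] with z hz
  obtain ⟨⟨hz1, hz2⟩, hz3⟩ := hz
  have h1 := fun u => fderiv_localProj p hz2 u
  rw [hz3] at h1
  rw [fieldRep, fieldRep, h1, h1, (hL' _ _ _).1 (hU.mem _ hz1), chartD_complexStructure hz2.2]

theorem differentiableAt_fieldRep {O : Set Y} (hO : IsOpen O)
    {U : Π y : Y, TangentSpace 𝓘(ℝ, W) y} (hU : SmoothFieldOn U O) {y₀ : Y} (hy : y₀ ∈ O) :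
    DifferentiableAt ℝ (fieldRep y₀ U) (extChartAt 𝓘(ℝ, W) y₀ y₀) :=
  ((contMDiffAt_field_iff (mem_chart_source W y₀) U).1
    ((hU y₀ hy).contMDiffAt (hO.mem_nhds hy))).differentiableAt (by norm_num)

/-- At the centre of a chart the bracket is the Euclidean bracket of the chart expressions, and `dp`
is the derivative of `localProj`; the claim becomes `fderiv_lieBracket_comp`. -/
theorem isInvolutive_of_proj (hL' : ∀ y (u₁ u₂ : TangentSpace 𝓘(ℝ, W) y),
      (1 : ℂ) ⊗ₜ[ℝ] u₁ + Complex.I ⊗ₜ[ℝ] u₂ ∈ L' y ↔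
        dproj p y u₂ = complexStructure (p y) (dproj p y u₁)) : IsInvolutive L' := by
  intro O hO U₁ U₂ V₁ V₂ hU hV y₀ hy
  have h := fderiv_lieBracket_comp ((contDiffAt_localProj p (mem_projDomain p y₀)).of_le
    (m := 2) (by norm_cast))
    (differentiableAt_fieldRep hO hU.smooth_re hy) (differentiableAt_fieldRep hO hU.smooth_im hy)
    (differentiableAt_fieldRep hO hV.smooth_re hy) (differentiableAt_fieldRep hO hV.smooth_im hy)
    (fderiv_localProj_I hL' hO hU hy) (fderiv_localProj_I hL' hO hV hy)
  rw [complexBracket, complexField, hL']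
  have h1 := fun u => fderiv_localProj p (mem_projDomain p y₀) u
  simp only [chartD_self] at h1
  rw [mlieBracket_eq, mlieBracket_eq, mlieBracket_eq, mlieBracket_eq]
  exact (h1 _).symm.trans (h.trans (congrArg (fun v : V => Complex.I • v) (h1 _)))

variable {D : PartialConnection F B (antiholomorphicPart (complexStructure (V := V) (X := X)))}

/-- This identifies the abstract pullback with the operator `localDbar` of the calculus lemmas, at
every point of the domain of the charts at `y₀` and `p y₀`. -/
theorem localDbar_pullback (hL : ∀ y, ∀ u ∈ L' y, dprojC p y u ∈
      antiholomorphicPart (complexStructure (V := V) (X := X)) (p y)) {y₀ : Y}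
    {Γ : X → V →L[ℝ] F →L[ℝ] F} (hΓ : IsDbarCoeff D (p y₀) Γ) {y : Y}
    (hy : y ∈ projDomain p y₀) (hey : p y ∈ (trivializationAt F B (p y₀)).baseSet)
    {s : Π y : Y, (p *ᵖ B) y} (hs : DiffSectionAt W F s y)
    {U₁ U₂ : Π y : Y, TangentSpace 𝓘(ℝ, W) y} (hU : complexField U₁ U₂ y ∈ L' y) :
    pullbackRep p (trivializationAt F B (p y₀)) (fun y => (D.pullback IsDbarCoeff.hasSmoothCoeff
        hL).deriv s y (complexField U₁ U₂ y)) y =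
      localDbar (localProj p y₀) (Γ ∘ (extChartAt 𝓘(ℝ, V) (p y₀)).symm) (fieldRep y₀ U₁)
        (fieldRep y₀ U₂) (pullbackRep p (trivializationAt F B (p y₀)) s ∘
          (extChartAt 𝓘(ℝ, W) y₀).symm) (extChartAt 𝓘(ℝ, W) y₀ y) := by
  let e := trivializationAt F B (p y₀)
  have h1 := pullbackDeriv_snd D e hL s hey hU
  have h2 : (D.pullback IsDbarCoeff.hasSmoothCoeff hL).deriv s y (complexField U₁ U₂ y) =
      pullbackDeriv D e hL s y ⟨_, hU⟩ := by
    rw [PartialConnection.deriv_of_mem _ _ hU]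
    exact roughPullback_eq D hL e hey hs ⟨_, hU⟩
  have h3 := hL y _ hU
  rw [complexField, dprojC, baseChange_complex, ContinuousLinearMap.coe_coe,
    mem_antiholomorphicPart_complexStructure_iff] at h3
  have h4 : pullbackRep p e (fun y => (D.pullback IsDbarCoeff.hasSmoothCoeff
        hL).deriv s y (complexField U₁ U₂ y)) y = (e ⟨p y, pullbackDeriv D e hL s y ⟨_, hU⟩⟩).2 :=
    congrArg (fun b : B (p y) => (e ⟨p y, b⟩).2) h2
  have hsd : MDifferentiableAt 𝓘(ℝ, W) 𝓘(ℝ, F) (pullbackRep p e s) y :=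
    (diffSectionAt_pullback_iff p e hey s).1 hs
  refine h4.trans (h1.trans ?_)
  rw [h3, ← dbarField_chartD hy.2]
  have h5 := (hΓ.eq (p y) ⟨hy.2, hey⟩ (chartD (p y₀) (p y) (dproj p y (U₁ y)))
    (pullbackRep p e s y)).symm
  rw [localDbar, localProj_extChartAt p hy]
  simp only [Function.comp_apply, fieldRep]
  rw [extChartAt_symm_apply_of_mem hy.1, extChartAt_symm_apply_of_mem hy.2, fderiv_localProj p hy,
    mvfderiv_eq_fderiv_chart hy.1 hsd, mvfderiv_eq_fderiv_chart hy.1 hsd]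
  refine congrArg₂ (· + ·) rfl h5

theorem localDbar_congr {P : W → V} {G : V → V →L[ℝ] F →L[ℝ] F} {U₁ U₂ U₁' U₂' : W → W}
    {σ τ : W → F} {z : W} (h : σ =ᶠ[𝓝 z] τ) (h₁ : U₁ z = U₁' z) (h₂ : U₂ z = U₂' z) :
    localDbar P G U₁ U₂ σ z = localDbar P G U₁' U₂' τ z := by
  rw [localDbar, localDbar, h.fderiv_eq, h.self_of_nhds, h₁, h₂]

theorem sub_sub_eq_zero_of_linearMapAt (e : Trivialization F (π F B)) [MemTrivializationAtlas e]
    {x : X} (hx : x ∈ e.baseSet) {a b c : B x}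
    (h : e.linearMapAt ℂ x a - e.linearMapAt ℂ x b - e.linearMapAt ℂ x c = 0) : a - b - c = 0 := by
  rw [← map_sub, ← map_sub] at h
  refine snd_injective e hx ?_
  rw [snd_eq e hx, snd_eq e hx, map_zero, h]

/-- The three terms of the curvature are read at the centre `y₀` as values of `localDbar`, where
`localDbar_flat` applies; its curvature hypothesis is the flatness of `D` at `p y₀`. -/
theorem pullback_isFlat (hD : D.IsFlat) (hL' : ∀ y (u₁ u₂ : TangentSpace 𝓘(ℝ, W) y),
      (1 : ℂ) ⊗ₜ[ℝ] u₁ + Complex.I ⊗ₜ[ℝ] u₂ ∈ L' y ↔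
        dproj p y u₂ = complexStructure (p y) (dproj p y u₁))
    (hL : ∀ y, ∀ u ∈ L' y, dprojC p y u ∈
      antiholomorphicPart (complexStructure (V := V) (X := X)) (p y)) :
    (D.pullback IsDbarCoeff.hasSmoothCoeff hL).IsFlat := by
  refine ⟨isInvolutive_of_proj hL', ?_⟩
  intro O hO U₁ U₂ V₁ V₂ hU hV s hs y₀ hy
  let D' := D.pullback IsDbarCoeff.hasSmoothCoeff hL
  let e := trivializationAt F B (p y₀)
  have hey : p y₀ ∈ e.baseSet := mem_baseSet_trivializationAt F B (p y₀)
  obtain ⟨Γ, hΓ⟩ := exists_isDbarCoeff D (p y₀)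
  have hx : p y₀ ∈ (chartAt V (p y₀)).source ∩ e.baseSet := ⟨mem_chart_source V _, hey⟩
  let G := Γ ∘ (extChartAt 𝓘(ℝ, V) (p y₀)).symm
  let P := localProj p y₀
  let z := extChartAt 𝓘(ℝ, W) y₀ y₀
  let σ := pullbackRep p e s ∘ (extChartAt 𝓘(ℝ, W) y₀).symm
  have hdom := mem_projDomain p y₀
  have hPz : P z = extChartAt 𝓘(ℝ, V) (p y₀) (p y₀) := localProj_extChartAt p hdom
  have hGz : G (P z) = Γ (p y₀) := by
    rw [hPz]; simp only [G, Function.comp_apply, extChartAt_to_inv]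
  have h2 : (2 : ℕ∞ω) ≤ ∞ := by norm_cast
  have hP : ContDiffAt ℝ 2 P z := (contDiffAt_localProj p hdom).of_le h2
  have hσ : ContDiffAt ℝ 2 σ z := by
    have h := (smoothSectionAt_iff (e.pullback p) (x := y₀) hey s).1 (hs.contMDiffAt hO hy)
    rw [contMDiffAt_iff_chart (mem_chart_source W y₀)] at h
    exact h.of_le h2
  have hG : DifferentiableAt ℝ G (P z) := by
    have h := hΓ.smooth _ hx
    rw [contMDiffAt_iff_chart hx.1] at h
    rw [hPz]
    exact h.differentiableAt (by norm_num)
  have hmain := localDbar_flat hP hσ hG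
    (differentiableAt_fieldRep hO hU.smooth_re hy) (differentiableAt_fieldRep hO hU.smooth_im hy)
    (differentiableAt_fieldRep hO hV.smooth_re hy) (differentiableAt_fieldRep hO hV.smooth_im hy)
    (fderiv_localProj_I hL' hO hU hy) (fderiv_localProj_I hL' hO hV hy)
    (fun v f => by rw [hGz]; exact hΓ.smul_I hx v f)
    (fun v f => by rw [hGz]; exact hΓ.apply_smul_I hx v f)
    (fun a b f => by rw [hPz]; exact hΓ.flat hD a b f)
  -- The inner derivative is differentiated once more, so its expression is needed as a germ and not
  -- only at `y₀`.
  have hgerm : ∀ {Z₁ Z₂}, IsLocalSection L' O Z₁ Z₂ →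
      (pullbackRep p e (fun y => D'.deriv s y (complexField Z₁ Z₂ y)) ∘
        (extChartAt 𝓘(ℝ, W) y₀).symm) =ᶠ[𝓝 z]
      localDbar P G (fieldRep y₀ Z₁) (fieldRep y₀ Z₂) σ := by
    intro Z₁ Z₂ hZ
    filter_upwards [eventually_extChartAt_symm (Filter.inter_mem (hO.mem_nhds hy)
      (((isOpen_projDomain p y₀).inter (e.pullback p).open_baseSet).mem_nhds ⟨hdom, hey⟩))]
      with z' hz'
    obtain ⟨⟨h1, h2, h3⟩, h4⟩ := hz'
    have := localDbar_pullback hL hΓ h2 h3 (hs.diffSectionAt hO h1) (hZ.mem _ h1)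
    rw [h4] at this
    exact this
  have hsm : ∀ {Z₁ Z₂}, IsLocalSection L' O Z₁ Z₂ →
      DiffSectionAt W F (fun y => D'.deriv s y (complexField Z₁ Z₂ y)) y₀ := fun hZ =>
    (D'.smooth O hO s hs _ _ hZ _ fun y _ hy' => D'.deriv_of_mem _ hy').diffSectionAt hO hy
  have hUV := localDbar_pullback hL hΓ hdom hey (hsm hV) (hU.mem _ hy)
  have hVU := localDbar_pullback hL hΓ hdom hey (hsm hU) (hV.mem _ hy)
  have hbr := localDbar_pullback hL hΓ hdom hey (hs.diffSectionAt hO hy)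
    (isInvolutive_of_proj hL' O hO U₁ U₂ V₁ V₂ hU hV y₀ hy)
  rw [localDbar_congr (hgerm hV) rfl rfl] at hUV
  rw [localDbar_congr (hgerm hU) rfl rfl] at hVU
  have hc : ∀ Z : Π y : Y, TangentSpace 𝓘(ℝ, W) y, fieldRep y₀ Z (extChartAt 𝓘(ℝ, W) y₀ y₀) =
      Z y₀ := fun Z => by
    rw [fieldRep, extChartAt_to_inv, chartD_self]
  -- `localDbar` at a point involves only the values of the fields there, so it suffices that the
  -- expression of the bracket agrees with the Euclidean bracket at the centre.
  rw [localDbar_congr (Filter.EventuallyEq.refl _ _)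
    (U₁' := fun z => VectorField.lieBracket ℝ (fieldRep y₀ U₁) (fieldRep y₀ V₁) z -
      VectorField.lieBracket ℝ (fieldRep y₀ U₂) (fieldRep y₀ V₂) z)
    (U₂' := fun z => VectorField.lieBracket ℝ (fieldRep y₀ U₁) (fieldRep y₀ V₂) z +
      VectorField.lieBracket ℝ (fieldRep y₀ U₂) (fieldRep y₀ V₁) z)
    (by rw [hc, mlieBracket_eq, mlieBracket_eq]; rfl)
    (by rw [hc, mlieBracket_eq, mlieBracket_eq]; rfl)] at hbr
  rw [pullbackRep_eq p e hey] at hUV hVU hbr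
  rw [← hUV, ← hVU, ← hbr] at hmain
  exact sub_sub_eq_zero_of_linearMapAt e hey hmain

end FlatPullback

/-! ### Restriction of partial connections to smaller distributions -/

section Restrict

variable {E : Type*} [NormedAddCommGroup E] [NormedSpace ℝ E]
  {M : Type*} [TopologicalSpace M] [ChartedSpace E M] [IsManifold 𝓘(ℝ, E) ∞ M]
  {F : Type*} [NormedAddCommGroup F] [NormedSpace ℂ F]
  {B : M → Type*} [TopologicalSpace (TotalSpace F B)]
  [∀ x, AddCommGroup (B x)] [∀ x, Module ℂ (B x)]
  [∀ x, TopologicalSpace (B x)] [FiberBundle F B]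

/-- The restriction of a partial connection to a smaller distribution. -/
def PartialConnection.restrict {L L₁ : Π x : M, Submodule ℂ (CTangent E x)}
    (D : PartialConnection F B L) (h : ∀ x, L₁ x ≤ L x) : PartialConnection F B L₁ where
  toFun s x := D.toFun s x ∘ₗ Submodule.inclusion (h x)
  add s t x hs ht := by rw [D.add s t x hs ht]; rfl
  leibniz f s x hf hs u := D.leibniz f s x hf hs (Submodule.inclusion (h x) u)
  smooth O hO s hs U₁ U₂ hU t ht :=
    D.smooth O hO s hs U₁ U₂ ⟨hU.smooth_re, hU.smooth_im, fun x hx => h x (hU.mem x hx)⟩ t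
      fun x hx _ => ht x hx (hU.mem x hx)

theorem PartialConnection.restrict_deriv {L L₁ : Π x : M, Submodule ℂ (CTangent E x)}
    (D : PartialConnection F B L) (h : ∀ x, L₁ x ≤ L x) (s : Π x : M, B x) {x : M}
    {u : CTangent E x} (hu : u ∈ L₁ x) : D.deriv s x u = (D.restrict h).deriv s x u := by
  rw [PartialConnection.deriv, PartialConnection.deriv, dif_pos hu, dif_pos (h x hu)]
  rfl

end Restrict

/-! ### The splitting of the tangent spaces and the holomorphic Sasakian bundle -/

section Splitting

variable {V : Type*} [NormedAddCommGroup V] [NormedSpace ℂ V] [FiniteDimensional ℂ V]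
  {X : Type*} [TopologicalSpace X] [ChartedSpace V X] [IsManifold 𝓘(ℂ, V) ω X]
  {W : Type*} [NormedAddCommGroup W] [NormedSpace ℝ W] [FiniteDimensional ℝ W]
  {Y : Type*} [TopologicalSpace Y] [ChartedSpace W Y] [IsManifold 𝓘(ℝ, W) ∞ Y]
  {p : C^∞⟮𝓘(ℝ, W), Y; 𝓘(ℝ, V), X⟯} {θ : Π y : Y, TangentSpace 𝓘(ℝ, W) y →L[ℝ] ℝ}

theorem splitting_injective
    (hθ : ∀ (y : Y) (v : TangentSpace 𝓘(ℝ, W) y), dproj p y v = 0 → v ≠ 0 → θ y v ≠ 0)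
    {y : Y} {u v : TangentSpace 𝓘(ℝ, W) y} (h1 : dproj p y u = dproj p y v)
    (h2 : θ y u = θ y v) : u = v := by
  by_contra hne
  refine hθ y (u - v) ?_ (sub_ne_zero.2 hne) ?_
  · rw [map_sub, h1, sub_self]
  · rw [map_sub, h2, sub_self]

/-- A splitting which is a pointwise isomorphism. -/
def IsSplitting (p : C^∞⟮𝓘(ℝ, W), Y; 𝓘(ℝ, V), X⟯)
    (θ : Π y : Y, TangentSpace 𝓘(ℝ, W) y →L[ℝ] ℝ) : Prop :=
  ∀ y, ∃ e : W ≃L[ℝ] (V × ℝ), (e : W →L[ℝ] V × ℝ) = splitting p θ y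

/-- `(dp, θ)` is injective because `θ` is nonzero on nonzero vertical vectors, hence bijective by
dimension; in particular `dp` is surjective. -/
theorem isSplitting (hdim : Module.finrank ℝ W = Module.finrank ℝ V + 1)
    (hθ : ∀ (y : Y) (v : TangentSpace 𝓘(ℝ, W) y), dproj p y v = 0 → v ≠ 0 → θ y v ≠ 0) :
    IsSplitting p θ := fun y => by
  have : FiniteDimensional ℝ V := FiniteDimensional.complexToReal V
  let l : W →L[ℝ] V × ℝ := splitting p θ y
  have hinj : Function.Injective (l : W →ₗ[ℝ] V × ℝ) := fun u v h => by
    have h' : splitting p θ y u = splitting p θ y v := h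
    exact splitting_injective hθ (congrArg Prod.fst h') (congrArg Prod.snd h')
  have hr : Module.finrank ℝ W = Module.finrank ℝ (V × ℝ) := by
    rw [hdim, Module.finrank_prod, Module.finrank_self]
  refine ⟨(LinearEquiv.ofInjectiveOfFinrankEq (l : W →ₗ[ℝ] V × ℝ)
    hinj hr).toContinuousLinearEquiv, ?_⟩
  have h : ∀ u, (LinearEquiv.ofInjectiveOfFinrankEq (l : W →ₗ[ℝ] V × ℝ)
    hinj hr).toContinuousLinearEquiv u = l u := fun u => rfl
  exact ContinuousLinearMap.ext h

theorem splitting_inverse (h : IsSplitting p θ) (y : Y) (v : TangentSpace 𝓘(ℝ, V) (p y)) (t : ℝ) :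
    dproj p y ((splitting p θ y).inverse (v, t)) = v ∧
      θ y ((splitting p θ y).inverse (v, t)) = t := by
  obtain ⟨e, he⟩ := h y
  have h1 : (splitting p θ y).inverse = (e.symm : V × ℝ →L[ℝ] W) :=
    (congrArg ContinuousLinearMap.inverse he.symm).trans (ContinuousLinearMap.inverse_equiv e)
  have h2 : (splitting p θ y) ((splitting p θ y).inverse (v, t)) = (v, t) := by
    rw [h1]
    have h3 : splitting p θ y (e.symm (v, t)) = e (e.symm (v, t)) :=
      congrArg (fun l : W →L[ℝ] V × ℝ => l (e.symm (v, t))) he.symm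
    exact h3.trans (e.apply_symm_apply _)
  exact ⟨congrArg Prod.fst h2, congrArg Prod.snd h2⟩

theorem dproj_reebField (h : IsSplitting p θ) (y : Y) : dproj p y (reebField p θ y) = 0 :=
  (splitting_inverse h y 0 1).1

theorem form_reebField (h : IsSplitting p θ) (y : Y) : θ y (reebField p θ y) = 1 :=
  (splitting_inverse h y 0 1).2

theorem dproj_transverse (h : IsSplitting p θ) (y : Y) (u : TangentSpace 𝓘(ℝ, W) y) :
    dproj p y (transverseComplexStructure p θ y u) = complexStructure (p y) (dproj p y u) :=
  (splitting_inverse h y (complexStructure (p y) (dproj p y u)) 0).1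

theorem form_transverse (h : IsSplitting p θ) (y : Y) (u : TangentSpace 𝓘(ℝ, W) y) :
    θ y (transverseComplexStructure p θ y u) = 0 :=
  (splitting_inverse h y (complexStructure (p y) (dproj p y u)) 0).2

theorem reebLine_smul (y : Y) (ξ : TangentSpace 𝓘(ℝ, W) y) (c : ℂ) :
    c • ((1 : ℂ) ⊗ₜ[ℝ] ξ) = (1 : ℂ) ⊗ₜ[ℝ] (c.re • ξ) + Complex.I ⊗ₜ[ℝ] (c.im • ξ) := by
  rw [← TensorProduct.smul_tmul, ← TensorProduct.smul_tmul, ← TensorProduct.add_tmul,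
    TensorProduct.smul_tmul']
  congr 1
  apply Complex.ext <;> simp

/-- Adding `ℂξ = ker dp` to `B^{0,1}` gives the whole preimage of `T^{0,1}X`. For the converse
direction, subtracting `θ(u) ξ` from `u` gives the component in the kernel of `θ`, on which `Φ` is
determined by its image under `dp`. -/
theorem mem_extendedAntiholomorphicPart_iff (h : IsSplitting p θ)
    (hθ : ∀ (y : Y) (v : TangentSpace 𝓘(ℝ, W) y), dproj p y v = 0 → v ≠ 0 → θ y v ≠ 0)
    (y : Y) (u₁ u₂ : TangentSpace 𝓘(ℝ, W) y) :
    (1 : ℂ) ⊗ₜ[ℝ] u₁ + Complex.I ⊗ₜ[ℝ] u₂ ∈ extendedAntiholomorphicPart θ (reebField p θ)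
        (transverseComplexStructure p θ) y ↔
      dproj p y u₂ = complexStructure (p y) (dproj p y u₁) := by
  rw [extendedAntiholomorphicPart, Submodule.mem_sup]
  constructor
  · rintro ⟨a, ha, b, hb, hab⟩
    obtain ⟨a₁, a₂, rfl⟩ := complexify_exists a
    obtain ⟨c, rfl⟩ := Submodule.mem_span_singleton.1 hb
    have h1 := (mem_antiholomorphicPart_iff _ _ _ _).1 ha.2
    rw [reebLine_smul] at hab
    have hab' : (1 : ℂ) ⊗ₜ[ℝ] (a₁ + c.re • reebField p θ y) +
        Complex.I ⊗ₜ[ℝ] (a₂ + c.im • reebField p θ y) =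
        (1 : ℂ) ⊗ₜ[ℝ] u₁ + Complex.I ⊗ₜ[ℝ] u₂ := by
      rw [← hab, TensorProduct.tmul_add, TensorProduct.tmul_add]
      abel
    obtain ⟨rfl, rfl⟩ := complexify_inj hab'
    simp only [map_add, map_smul, dproj_reebField h, smul_zero, add_zero]
    rw [← h1.1, dproj_transverse h]
  · intro hu
    let ξ := reebField p θ y
    refine ⟨(1 : ℂ) ⊗ₜ[ℝ] (u₁ - θ y u₁ • ξ) + Complex.I ⊗ₜ[ℝ] (u₂ - θ y u₂ • ξ), ⟨?_, ?_⟩,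
      (⟨θ y u₁, θ y u₂⟩ : ℂ) • ((1 : ℂ) ⊗ₜ[ℝ] ξ),
      Submodule.smul_mem _ _ (Submodule.mem_span_singleton_self _), ?_⟩
    · have h1 : ∀ u, θ y (u - θ y u • ξ) = 0 := fun u => by
        rw [map_sub, map_smul, form_reebField h, smul_eq_mul, mul_one, sub_self]
      rw [SetLike.mem_coe, LinearMap.mem_ker, baseChange_complex]
      simp only [ContinuousLinearMap.coe_coe, h1, TensorProduct.tmul_zero, add_zero]
    · rw [SetLike.mem_coe, mem_antiholomorphicPart_iff]
      have h1 : ∀ u, dproj p y (u - θ y u • ξ) = dproj p y u := fun u => by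
        rw [map_sub, map_smul, dproj_reebField h, smul_zero, sub_zero]
      have h2 : ∀ u, θ y (u - θ y u • ξ) = 0 := fun u => by
        rw [map_sub, map_smul, form_reebField h, smul_eq_mul, mul_one, sub_self]
      constructor
      · refine splitting_injective hθ ?_ ?_
        · rw [dproj_transverse h, h1, h1, hu]
        · rw [form_transverse h, h2]
      · refine splitting_injective hθ ?_ ?_
        · rw [dproj_transverse h, h1, map_neg, h1, hu, complexStructure_complexStructure]
        · rw [form_transverse h, map_neg, h2, neg_zero]
    · rw [reebLine_smul, TensorProduct.tmul_sub, TensorProduct.tmul_sub]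
      abel

variable {F : Type*} [NormedAddCommGroup F] [NormedSpace ℂ F] [FiniteDimensional ℂ F]
  {B : X → Type*} [TopologicalSpace (TotalSpace F B)]
  [∀ x, AddCommGroup (B x)] [∀ x, Module ℂ (B x)] [∀ x, Module ℝ (B x)]
  [∀ x, IsScalarTower ℝ ℂ (B x)]
  [∀ x, TopologicalSpace (B x)] [∀ x, IsTopologicalAddGroup (B x)]
  [∀ x, ContinuousSMul ℝ (B x)]
  [FiberBundle F B] [VectorBundle ℂ F B] [VectorBundle ℝ F B]
  [ContMDiffVectorBundle ∞ F B 𝓘(ℝ, V)]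

/-- The operator along `ξ` is defined as the restriction of the pulled-back `∂̄₀`, so the
compatibility of the two holds by construction. -/
theorem exists_holomorphicSasakianBundle (h : IsSplitting p θ)
    (hθ : ∀ (y : Y) (v : TangentSpace 𝓘(ℝ, W) y), dproj p y v = 0 → v ≠ 0 → θ y v ≠ 0)
    (hol : HolomorphicStructure V F B) :
    ∃ S : HolomorphicSasakianBundle F (p *ᵖ B) θ (reebField p θ) (transverseComplexStructure p θ),
      IsPullbackPartialConnection p hol.dbar S.dbar := by
  have hL' := mem_extendedAntiholomorphicPart_iff h hθ
  have hL : ∀ y, ∀ u ∈ extendedAntiholomorphicPart θ (reebField p θ)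
      (transverseComplexStructure p θ) y, dprojC p y u ∈
      antiholomorphicPart (complexStructure (V := V) (X := X)) (p y) := fun y u hu => by
    obtain ⟨u₁, u₂, rfl⟩ := complexify_exists u
    rw [dprojC, baseChange_complex]
    exact (mem_antiholomorphicPart_complexStructure_iff _ _ _).2 ((hL' y u₁ u₂).1 hu)
  let D' := hol.dbar.pullback IsDbarCoeff.hasSmoothCoeff hL
  have hle : ∀ y, reebLine (reebField p θ) y ≤ extendedAntiholomorphicPart θ (reebField p θ)
      (transverseComplexStructure p θ) y := fun y => le_sup_right
  exact ⟨⟨D'.restrict hle, D', pullback_isFlat hol.flat hL' hL,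
    fun s y _ u hu => D'.restrict_deriv hle s hu⟩, hol.dbar.pullback_isPullback IsDbarCoeff.hasSmoothCoeff hL⟩

end Splitting

/-! ### Connections as partial connections along the whole complexified tangent bundle -/

section ConnectionCoefficients

variable {E : Type*} [NormedAddCommGroup E] [NormedSpace ℝ E] [FiniteDimensional ℝ E]
  {M : Type*} [TopologicalSpace M] [ChartedSpace E M] [IsManifold 𝓘(ℝ, E) ∞ M]
  {F : Type*} [NormedAddCommGroup F] [NormedSpace ℂ F] [FiniteDimensional ℂ F]
  {B : M → Type*} [TopologicalSpace (TotalSpace F B)]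
  [∀ x, AddCommGroup (B x)] [∀ x, Module ℂ (B x)] [∀ x, Module ℝ (B x)]
  [∀ x, IsScalarTower ℝ ℂ (B x)]
  [∀ x, TopologicalSpace (B x)] [∀ x, IsTopologicalAddGroup (B x)]
  [∀ x, ContinuousSMul ℝ (B x)] [FiberBundle F B] [VectorBundle ℂ F B] [VectorBundle ℝ F B]
  [ContMDiffVectorBundle ∞ F B 𝓘(ℝ, E)]
  {A : CovariantDerivative 𝓘(ℝ, E) F B}

theorem CovariantDerivative.apply_add {s t : Π x : M, B x} {x : M} (hs : DiffSectionAt E F s x)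
    (ht : DiffSectionAt E F t x) : A (fun x => s x + t x) x = A s x + A t x :=
  A.isCovariantDerivativeOn.add (s := univ) hs ht trivial

theorem CovariantDerivative.apply_smul {f : M → ℝ} {s : Π x : M, B x} {x : M}
    (hf : MDifferentiableAt 𝓘(ℝ, E) 𝓘(ℝ, ℝ) f x) (hs : DiffSectionAt E F s x)
    (v : TangentSpace 𝓘(ℝ, E) x) :
    A (fun x => f x • s x) x v = f x • A s x v + mvfderiv 𝓘(ℝ, E) f x v • s x := by
  have h := congrArg (fun l => l v) (A.isCovariantDerivativeOn.leibniz (s := univ) hs hf trivial)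
  exact h

/-- With `f = Re f + i Im f`, the real Leibniz rule and commutation with `i` give the complex one.
-/
theorem IsComplexConnection.apply_smul (hA : IsComplexConnection A) {f : M → ℂ} {s : Π x : M, B x}
    {x : M} (hf : MDifferentiableAt 𝓘(ℝ, E) 𝓘(ℝ, ℂ) f x) (hs : DiffSectionAt E F s x)
    (v : TangentSpace 𝓘(ℝ, E) x) :
    A (fun x => f x • s x) x v = f x • A s x v + mvfderiv 𝓘(ℝ, E) f x v • s x := by
  have hre := hf.clm_comp' Complex.reCLM
  have him := hf.clm_comp' Complex.imCLM
  have hI : DiffSectionAt E F (fun x => Complex.I • s x) x :=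
    DiffSectionAt.smul mdifferentiableAt_const hs
  have hsm : ∀ {g : M → ℝ} {t : Π x : M, B x}, MDifferentiableAt 𝓘(ℝ, E) 𝓘(ℝ, ℝ) g x →
      DiffSectionAt E F t x → DiffSectionAt E F (fun x => g x • t x) x := fun {g t} hg ht => by
    have h := DiffSectionAt.smul (hg.clm_comp' Complex.ofRealCLM) ht
    have h2 : (fun x => g x • t x) = fun x => Complex.ofRealCLM (g x) • t x := by
      ext x'; exact (algebraMap_smul ℂ (g x') (t x')).symm
    rw [h2]
    exact h
  have hsplit : ∀ {N : Type _} [AddCommGroup N] [Module ℂ N] [Module ℝ N] [IsScalarTower ℝ ℂ N]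
      (c : ℂ) (b : N), c • b = c.re • b + c.im • (Complex.I • b) := by
    intro N _ _ _ _ c b
    rw [← smul_assoc, ← algebraMap_smul ℂ c.re b, ← add_smul]
    congr 1
    apply Complex.ext <;> simp
  have h1 : (fun x => f x • s x) = fun x => Complex.reCLM (f x) • s x +
      Complex.imCLM (f x) • (Complex.I • s x) := by
    ext x'; exact hsplit _ _
  rw [h1, CovariantDerivative.apply_add (hsm hre hs) (hsm him hI), add_apply,
    CovariantDerivative.apply_smul hre hs, CovariantDerivative.apply_smul him hI,
    hA.complex_linear s x hs, mvfderiv_clm_comp hf, mvfderiv_clm_comp hf, hsplit (f x),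
    hsplit (mvfderiv 𝓘(ℝ, E) f x v)]
  simp only [Complex.reCLM_apply, Complex.imCLM_apply]
  abel

theorem IsComplexConnection.smoothSectionOn_apply (hA : IsComplexConnection A) {O : Set M}
    (hO : IsOpen O) {s : Π x : M, B x} (hs : SmoothSectionOn (E := E) F s O)
    {U : Π x : M, TangentSpace 𝓘(ℝ, E) x} (hU : SmoothFieldOn U O) :
    SmoothSectionOn (E := E) F (fun x => A s x (U x)) O := fun x hx =>
  ContMDiffWithinAt.clm_bundle_apply ((hA.smooth O hO).contMDiff (σ := s) hs x hx) (hU x hx)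

/-- A connection on a complex vector bundle as a partial connection along the full
complexified tangent bundle. -/
def IsComplexConnection.toPartial (hA : IsComplexConnection A) :
    PartialConnection F B (fun x : M => (⊤ : Submodule ℂ (CTangent E x))) where
  toFun s x := LinearMap.liftBaseChange ℂ (A s x : TangentSpace 𝓘(ℝ, E) x →ₗ[ℝ] B x) ∘ₗ
    (⊤ : Submodule ℂ (CTangent E x)).subtype
  add s t x hs ht := by
    ext ⟨u, _⟩
    obtain ⟨u₁, u₂, rfl⟩ := complexify_exists u
    simp only [LinearMap.comp_apply, LinearMap.add_apply, Submodule.subtype_apply,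
      liftBaseChange_complex, CovariantDerivative.apply_add hs ht]
    simp only [ContinuousLinearMap.coe_coe, add_apply, smul_add]
    abel
  leibniz f s x hf hs u := by
    obtain ⟨u, _⟩ := u
    obtain ⟨u₁, u₂, rfl⟩ := complexify_exists u
    simp only [LinearMap.comp_apply, Submodule.subtype_apply,
      liftBaseChange_complex, ContinuousLinearMap.coe_coe, hA.apply_smul hf hs, smul_add, add_smul,
      smul_smul, smul_eq_mul, mul_comm (f x)]
    abel
  smooth O hO s hs U₁ U₂ hU t ht := by
    have h1 := hA.smoothSectionOn_apply hO hs hU.smooth_re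
    have h2 := hA.smoothSectionOn_apply hO hs hU.smooth_im
    intro x hx
    refine ContMDiffAt.contMDiffWithinAt ?_
    let e := trivializationAt F B x
    have hex : x ∈ e.baseSet := mem_baseSet_trivializationAt F B x
    have k1 := (smoothSectionAt_iff e hex _).1 (h1.contMDiffAt hO hx)
    have k2 := (smoothSectionAt_iff e hex _).1 (h2.contMDiffAt hO hx)
    rw [smoothSectionAt_iff e hex]
    have k3 := k1.add ((contMDiffAt_const (c := (Complex.I • ContinuousLinearMap.id ℝ F :
      F →L[ℝ] F))).clm_apply k2)
    refine k3.congr_of_eventuallyEq ?_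
    filter_upwards [hO.mem_nhds hx, e.open_baseSet.mem_nhds hex] with x' hx' hex'
    rw [ht x' hx' trivial]
    simp only [LinearMap.comp_apply, Submodule.subtype_apply, complexField, liftBaseChange_complex]
    rw [snd_eq e hex', map_add, map_smul, ← snd_eq e hex', ← snd_eq e hex']
    rfl

theorem IsComplexConnection.toPartial_deriv (hA : IsComplexConnection A) (s : Π x : M, B x) {x : M}
    (u : CTangent E x) : hA.toPartial.deriv s x u =
      LinearMap.liftBaseChange ℂ (A s x : TangentSpace 𝓘(ℝ, E) x →ₗ[ℝ] B x) u :=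
  hA.toPartial.deriv_of_mem s (Submodule.mem_top (x := u))

theorem IsComplexConnection.toPartial_deriv_real (hA : IsComplexConnection A) (s : Π x : M, B x)
    {x : M} (v : TangentSpace 𝓘(ℝ, E) x) :
    hA.toPartial.deriv s x ((1 : ℂ) ⊗ₜ[ℝ] v) = A s x v := by
  rw [hA.toPartial_deriv, LinearMap.liftBaseChange_tmul, one_smul]
  rfl

variable (A) in
/-- `Γ` is the family of connection coefficients of `A` in the chart and the trivialization
at `x₀`. -/
structure IsConnectionCoeff (x₀ : M) (Γ : M → E →L[ℝ] F →L[ℝ] F) : Prop where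
  smooth : ∀ x ∈ (chartAt E x₀).source ∩ (trivializationAt F B x₀).baseSet,
    ContMDiffAt 𝓘(ℝ, E) 𝓘(ℝ, E →L[ℝ] F →L[ℝ] F) ∞ Γ x
  eq : ∀ x ∈ (chartAt E x₀).source ∩ (trivializationAt F B x₀).baseSet, ∀ v f,
    Γ x v f = (trivializationAt F B x₀
      ⟨x, A (constSec (trivializationAt F B x₀) f) x (coordL x₀ x v)⟩).2

set_option synthInstance.maxHeartbeats 400000 in
theorem IsComplexConnection.exists_coeff (hA : IsComplexConnection A) (x₀ : M) :
    ∃ Γ, IsConnectionCoeff A x₀ Γ := by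
  let e := trivializationAt F B x₀
  let N := (chartAt E x₀).source ∩ e.baseSet
  have hN : IsOpen N := (chartAt E x₀).open_source.inter e.open_baseSet
  have : FiniteDimensional ℝ F := FiniteDimensional.complexToReal F
  have h : ∀ x, ∃ g : E →L[ℝ] F →L[ℝ] F, x ∈ N → ∀ v f, g v f =
      (e ⟨x, A (constSec e f) x (coordL x₀ x v)⟩).2 := fun x => by
    by_cases hx : x ∈ N
    · have hadd : ∀ f g, A (constSec e (f + g)) x = A (constSec e f) x + A (constSec e g) x := by
        intro f g
        ext v
        have := hA.toPartial.deriv_constSec_add e hx.2 f g ((1 : ℂ) ⊗ₜ[ℝ] v)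
        simp only [hA.toPartial_deriv_real] at this
        exact this
      obtain ⟨g, hg⟩ := exists_bilinear (fun v f => (e ⟨x, A (constSec e f) x (coordL x₀ x v)⟩).2)
        (fun a b c => by
          rw [map_add, map_add, snd_eq e hx.2, snd_eq e hx.2, snd_eq e hx.2, map_add])
        (fun r a c => by
          rw [map_smul, map_smul,
            ← algebraMap_smul ℂ r (A (constSec e c) x (coordL x₀ x a) : B x), snd_eq e hx.2,
            snd_eq e hx.2, map_smul, algebraMap_smul])
        (fun a b c => by
          rw [hadd, add_apply, snd_eq e hx.2, snd_eq e hx.2, snd_eq e hx.2, map_add])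
        (fun r a c => by
          rw [← Complex.coe_smul r c]
          have := hA.toPartial.deriv_constSec_smul e hx.2 (r : ℂ) c
            (u := (1 : ℂ) ⊗ₜ[ℝ] coordL x₀ x a) Submodule.mem_top
          simp only [hA.toPartial_deriv_real] at this
          rw [this, snd_eq e hx.2, snd_eq e hx.2, map_smul, Complex.coe_smul])
      exact ⟨g, fun _ => hg⟩
    · exact ⟨0, fun h => absurd h hx⟩
  choose Γ hΓ using h
  refine ⟨Γ, fun x hx => ?_, hΓ⟩
  refine contMDiffAt_clm_of_apply fun v => contMDiffAt_clm_of_apply fun f => ?_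
  have h1 := hA.smoothSectionOn_apply hN ((smoothSectionOn_constSec e f).mono inter_subset_right)
    ((smoothFieldOn_coordField x₀ v).mono inter_subset_left)
  have h2 := (smoothSectionAt_iff e hx.2 _).1 (h1.contMDiffAt hN hx)
  refine h2.congr_of_eventuallyEq ?_
  filter_upwards [hN.mem_nhds hx] with x' hx'
  exact hΓ x' hx' v f

end ConnectionCoefficients

/-! ### From partial connections back to connections, and curvature in coordinates -/

section Connections

variable {E : Type*} [NormedAddCommGroup E] [NormedSpace ℝ E] [FiniteDimensional ℝ E]
  {M : Type*} [TopologicalSpace M] [ChartedSpace E M] [IsManifold 𝓘(ℝ, E) ∞ M]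
  {F : Type*} [NormedAddCommGroup F] [NormedSpace ℂ F] [FiniteDimensional ℂ F]
  {B : M → Type*} [TopologicalSpace (TotalSpace F B)]
  [∀ x, AddCommGroup (B x)] [∀ x, Module ℂ (B x)] [∀ x, Module ℝ (B x)]
  [∀ x, IsScalarTower ℝ ℂ (B x)]
  [∀ x, TopologicalSpace (B x)] [∀ x, IsTopologicalAddGroup (B x)]
  [∀ x, ContinuousSMul ℝ (B x)] [FiberBundle F B] [VectorBundle ℂ F B] [VectorBundle ℝ F B]
  [ContMDiffVectorBundle ∞ F B 𝓘(ℝ, E)]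

namespace PartialConnection

variable (D : PartialConnection F B (fun x : M => (⊤ : Submodule ℂ (CTangent E x))))

/-- The derivative along real tangent vectors. -/
def realDeriv (s : Π x : M, B x) (x : M) : TangentSpace 𝓘(ℝ, E) x →L[ℝ] B x :=
  letI : FiniteDimensional ℝ (TangentSpace 𝓘(ℝ, E) x) := inferInstanceAs (FiniteDimensional ℝ E)
  letI : T2Space (TangentSpace 𝓘(ℝ, E) x) := inferInstanceAs (T2Space E)
  LinearMap.toContinuousLinearMap
    { toFun := fun v => D.toFun s x ⟨(1 : ℂ) ⊗ₜ[ℝ] v, Submodule.mem_top⟩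
      map_add' := fun v w => by
        rw [← map_add]
        congr 1
        exact Subtype.ext (TensorProduct.tmul_add _ _ _)
      map_smul' := fun r v => by
        rw [RingHom.id_apply, ← algebraMap_smul ℂ r (D.toFun s x _), ← map_smul]
        congr 1
        refine Subtype.ext ?_
        change (1 : ℂ) ⊗ₜ[ℝ] (r • v) = algebraMap ℝ ℂ r • ((1 : ℂ) ⊗ₜ[ℝ] v)
        rw [TensorProduct.smul_tmul', ← TensorProduct.smul_tmul, smul_eq_mul, mul_one,
          Algebra.algebraMap_eq_smul_one] }

theorem realDeriv_apply (s : Π x : M, B x) (x : M) (v : TangentSpace 𝓘(ℝ, E) x) :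
    D.realDeriv s x v = D.deriv s x ((1 : ℂ) ⊗ₜ[ℝ] v) :=
  (D.deriv_of_mem s Submodule.mem_top).symm

/-- A partial connection along the full complexified tangent bundle as a connection. -/
def toConnection : CovariantDerivative 𝓘(ℝ, E) F B where
  toFun := D.realDeriv
  isCovariantDerivativeOnUniv :=
    { add := fun {s t x} hs ht _ => by
        ext v
        rw [add_apply, realDeriv_apply, realDeriv_apply, realDeriv_apply]
        exact D.deriv_add hs ht _
      leibniz := fun {s f x} hs hf _ => by
        ext v
        have h1 := D.deriv_leibniz (hf.clm_comp' Complex.ofRealCLM) hs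
          (u := (1 : ℂ) ⊗ₜ[ℝ] v) Submodule.mem_top
        rw [LinearMap.liftBaseChange_tmul, one_smul, ContinuousLinearMap.coe_coe,
          mvfderiv_clm_comp hf] at h1
        have h2 : (f • s) = fun x => Complex.ofRealCLM (f x) • s x := by
          ext x'; exact (algebraMap_smul ℂ (f x') (s x')).symm
        rw [h2, add_apply, smul_apply, realDeriv_apply, realDeriv_apply, h1]
        refine congrArg₂ (· + ·) ?_ ?_
        · exact algebraMap_smul ℂ (f x) (D.deriv s x ((1 : ℂ) ⊗ₜ[ℝ] v))
        · exact algebraMap_smul ℂ (mvfderiv 𝓘(ℝ, E) f x v : ℝ) (s x) }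

theorem toConnection_apply (s : Π x : M, B x) (x : M) (v : TangentSpace 𝓘(ℝ, E) x) :
    D.toConnection s x v = D.deriv s x ((1 : ℂ) ⊗ₜ[ℝ] v) :=
  D.realDeriv_apply s x v

theorem isComplexConnection_toConnection : IsComplexConnection D.toConnection where
  smooth O hO := ⟨fun {s} hs x₀ hx₀ => by
    refine ContMDiffAt.contMDiffWithinAt ?_
    let e := trivializationAt F B x₀
    have he : x₀ ∈ e.baseSet := mem_baseSet_trivializationAt F B x₀
    let N := O ∩ (chartAt E x₀).source
    have hN : IsOpen N := hO.inter (chartAt E x₀).open_source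
    have hx : x₀ ∈ N := ⟨hx₀, mem_chart_source E x₀⟩
    have hs' : SmoothSectionOn (E := E) F s N := ContMDiffOn.mono hs inter_subset_left
    have h0 : SmoothFieldOn (fun x : M => (0 : TangentSpace 𝓘(ℝ, E) x)) N := by
      have := ((smoothFieldOn_coordField x₀ (0 : E)).mono
        (inter_subset_right : N ⊆ (chartAt E x₀).source))
      refine this.congr fun x hx => ?_
      simp [coordField]
    refine contMDiffAt_hom_bundle _ |>.2 ⟨contMDiffAt_id, ?_⟩
    refine contMDiffAt_clm_of_apply fun v => ?_
    -- Smoothness of a section of the bundle of homomorphisms is tested on coordinate fields,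
    -- regarded as complex fields with zero imaginary part.
    have h1 := D.smooth N hN s hs' (coordField x₀ v) (fun x => 0)
      ⟨(smoothFieldOn_coordField x₀ v).mono inter_subset_right, h0, fun _ _ => trivial⟩
      (fun x => D.toConnection s x (coordL x₀ x v)) (fun x _ hU => by
        rw [toConnection_apply, D.deriv_of_mem _ Submodule.mem_top]
        congr 1
        exact Subtype.ext (by simp [complexField, coordField]))
    have h2 := (smoothSectionAt_iff e he _).1 (h1.contMDiffAt hN hx)
    refine h2.congr_of_eventuallyEq ?_
    filter_upwards [e.open_baseSet.mem_nhds he] with x hx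
    exact (congrFun (Trivialization.coe_linearMapAt_of_mem (R := ℝ) e hx) _)⟩
  complex_linear s x hs v := by
    rw [toConnection_apply, toConnection_apply]
    exact D.deriv_const_smul hs Submodule.mem_top

end PartialConnection

theorem coordL_extChartAt_symm {x₀ : M} {z : E} (hz : z ∈ (extChartAt 𝓘(ℝ, E) x₀).target)
    (v : E) : coordL x₀ ((extChartAt 𝓘(ℝ, E) x₀).symm z) v =
      mfderiv 𝓘(ℝ, E) 𝓘(ℝ, E) (extChartAt 𝓘(ℝ, E) x₀).symm z v := by
  have h1 := coordL_eq_mfderiv (extChartAt_symm_mem hz)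
  have h2 := congrArg (fun z' : E =>
    show E →L[ℝ] E from mfderiv 𝓘(ℝ, E) 𝓘(ℝ, E) (extChartAt 𝓘(ℝ, E) x₀).symm z')
      ((extChartAt 𝓘(ℝ, E) x₀).right_inv hz)
  exact congrArg (fun T : E →L[ℝ] E => T v) (h1.trans h2)

variable {A : CovariantDerivative 𝓘(ℝ, E) F B} {x₀ : M} {Γ : M → E →L[ℝ] F →L[ℝ] F}

namespace IsConnectionCoeff

theorem deriv_eq (hA : IsComplexConnection A) (hΓ : IsConnectionCoeff A x₀ Γ) {x : M}
    (hx : x ∈ (chartAt E x₀).source ∩ (trivializationAt F B x₀).baseSet) {s : Π x : M, B x}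
    (hs : DiffSectionAt E F s x) (u : TangentSpace 𝓘(ℝ, E) x) :
    (trivializationAt F B x₀ ⟨x, A s x u⟩).2 =
      mvfderiv 𝓘(ℝ, E) (fun x => (trivializationAt F B x₀ ⟨x, s x⟩).2) x u +
      Γ x (chartD x₀ x u) (trivializationAt F B x₀ ⟨x, s x⟩).2 := by
  have h := hA.toPartial.deriv_eq (trivializationAt F B x₀) hx.2 hs
    (u := (1 : ℂ) ⊗ₜ[ℝ] u) Submodule.mem_top
  rw [hA.toPartial_deriv_real, hA.toPartial_deriv_real] at h
  rw [h, snd_eq _ hx.2, map_add, Trivialization.linearMapAt_symmₗ _ hx.2, hΓ.eq x hx,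
    coordL_chartD hx.1, LinearMap.liftBaseChange_tmul, one_smul]
  refine congrArg₂ (· + ·) rfl (snd_eq _ hx.2 _).symm

theorem apply_smul (hA : IsComplexConnection A) (hΓ : IsConnectionCoeff A x₀ Γ) {x : M}
    (hx : x ∈ (chartAt E x₀).source ∩ (trivializationAt F B x₀).baseSet) (v : E) (c : ℂ) (f : F) :
    Γ x v (c • f) = c • Γ x v f := by
  have h := hA.toPartial.deriv_constSec_smul (trivializationAt F B x₀) hx.2 c f
    (u := (1 : ℂ) ⊗ₜ[ℝ] coordL x₀ x v) Submodule.mem_top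
  rw [hA.toPartial_deriv_real, hA.toPartial_deriv_real] at h
  rw [hΓ.eq x hx, hΓ.eq x hx, h, snd_eq _ hx.2, snd_eq _ hx.2, map_smul]

theorem connectionForm_eq (hΓ : IsConnectionCoeff A x₀ Γ) {z : E}
    (hz : z ∈ (extChartAt 𝓘(ℝ, E) x₀).target)
    (hx : (extChartAt 𝓘(ℝ, E) x₀).symm z ∈ (trivializationAt F B x₀).baseSet) (v : E) (f : F) :
    connectionForm A x₀ z v f = Γ ((extChartAt 𝓘(ℝ, E) x₀).symm z) v f := by
  rw [hΓ.eq _ ⟨extChartAt_symm_mem hz, hx⟩, connectionForm]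
  exact congrArg (fun w : TangentSpace 𝓘(ℝ, E) ((extChartAt 𝓘(ℝ, E) x₀).symm z) =>
    (trivializationAt F B x₀ ⟨_, A (constSec (trivializationAt F B x₀) f) _ w⟩).2)
    (coordL_extChartAt_symm hz v).symm

theorem mem_center (x₀ : M) :
    x₀ ∈ (chartAt E x₀).source ∩ (trivializationAt F B x₀).baseSet :=
  ⟨mem_chart_source E x₀, mem_baseSet_trivializationAt F B x₀⟩

theorem connectionForm_eventuallyEq (hΓ : IsConnectionCoeff A x₀ Γ) :
    ∀ᶠ z in 𝓝 (extChartAt 𝓘(ℝ, E) x₀ x₀), ∀ v f,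
      connectionForm A x₀ z v f = Γ ((extChartAt 𝓘(ℝ, E) x₀).symm z) v f := by
  filter_upwards [(isOpen_extChartAt_target x₀).mem_nhds (mem_extChartAt_target (I := 𝓘(ℝ, E)) x₀),
    eventually_extChartAt_symm ((trivializationAt F B x₀).open_baseSet.mem_nhds
      (mem_baseSet_trivializationAt F B x₀))] with z h1 h2 v f
  exact hΓ.connectionForm_eq h1 h2.1 v f

set_option synthInstance.maxHeartbeats 400000 in
theorem differentiableAt (hΓ : IsConnectionCoeff A x₀ Γ) :
    DifferentiableAt ℝ (Γ ∘ (extChartAt 𝓘(ℝ, E) x₀).symm) (extChartAt 𝓘(ℝ, E) x₀ x₀) :=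
  ((contMDiffAt_iff_chart (mem_chart_source E x₀) (G := E →L[ℝ] F →L[ℝ] F) Γ).1
    (hΓ.smooth x₀ (mem_center x₀))).differentiableAt (by norm_num)

-- Only the germ of the connection form at the centre enters, and there it agrees with the smooth
-- bilinear family `Γ`.
set_option synthInstance.maxHeartbeats 400000 in
theorem localCurvature_eq (hΓ : IsConnectionCoeff A x₀ Γ) (u v : E) (f : F) :
    localCurvature A x₀ u v f =
      fderiv ℝ (Γ ∘ (extChartAt 𝓘(ℝ, E) x₀).symm) (extChartAt 𝓘(ℝ, E) x₀ x₀) u v f -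
      fderiv ℝ (Γ ∘ (extChartAt 𝓘(ℝ, E) x₀).symm) (extChartAt 𝓘(ℝ, E) x₀ x₀) v u f +
      Γ x₀ u (Γ x₀ v f) - Γ x₀ v (Γ x₀ u f) := by
  have h := hΓ.connectionForm_eventuallyEq
  have h1 : ∀ w : E, (fun z => connectionForm A x₀ z w f) =ᶠ[𝓝 (extChartAt 𝓘(ℝ, E) x₀ x₀)]
      fun z => (Γ ∘ (extChartAt 𝓘(ℝ, E) x₀).symm) z w f := fun w => by
    filter_upwards [h] with z hz
    exact hz w f
  have h2 : ∀ w g, connectionForm A x₀ (extChartAt 𝓘(ℝ, E) x₀ x₀) w g = Γ x₀ w g := fun w g => by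
    rw [h.self_of_nhds, extChartAt_to_inv]
  rw [localCurvature, (h1 u).fderiv_eq, (h1 v).fderiv_eq, fderiv_apply_apply hΓ.differentiableAt,
    fderiv_apply_apply hΓ.differentiableAt, h2, h2, h2, h2]

end IsConnectionCoeff

end Connections

/-! ### Existence of the pullback connection -/

section PullbackConnection

variable {V : Type*} [NormedAddCommGroup V] [NormedSpace ℂ V] [FiniteDimensional ℂ V]
  {X : Type*} [TopologicalSpace X] [ChartedSpace V X] [IsManifold 𝓘(ℂ, V) ω X]
  {W : Type*} [NormedAddCommGroup W] [NormedSpace ℝ W] [FiniteDimensional ℝ W]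
  {Y : Type*} [TopologicalSpace Y] [ChartedSpace W Y] [IsManifold 𝓘(ℝ, W) ∞ Y]
  {F : Type*} [NormedAddCommGroup F] [NormedSpace ℂ F] [FiniteDimensional ℂ F]
  {B : X → Type*} [TopologicalSpace (TotalSpace F B)]
  [∀ x, AddCommGroup (B x)] [∀ x, Module ℂ (B x)] [∀ x, Module ℝ (B x)]
  [∀ x, IsScalarTower ℝ ℂ (B x)]
  [∀ x, TopologicalSpace (B x)] [∀ x, IsTopologicalAddGroup (B x)]
  [∀ x, ContinuousSMul ℝ (B x)]
  [FiberBundle F B] [VectorBundle ℂ F B] [VectorBundle ℝ F B]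
  [ContMDiffVectorBundle ∞ F B 𝓘(ℝ, V)]
  {A : CovariantDerivative 𝓘(ℝ, V) F B} {p : C^∞⟮𝓘(ℝ, W), Y; 𝓘(ℝ, V), X⟯}

set_option synthInstance.maxHeartbeats 400000 in
theorem IsComplexConnection.hasSmoothCoeff (hA : IsComplexConnection A) :
    HasSmoothCoeff hA.toPartial := fun x₀ => by
  have : FiniteDimensional ℝ V := FiniteDimensional.complexToReal V
  have : FiniteDimensional ℝ F := FiniteDimensional.complexToReal F
  obtain ⟨Γ, hΓ⟩ := hA.exists_coeff x₀
  have hx := IsConnectionCoeff.mem_center (E := V) (F := F) (B := B) x₀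
  let mulI : F →L[ℝ] F := Complex.I • ContinuousLinearMap.id ℝ F
  refine ⟨fun x => (Γ x).comp (ContinuousLinearMap.fst ℝ V V) +
    (ContinuousLinearMap.compL ℝ F F F mulI).comp
      ((Γ x).comp (ContinuousLinearMap.snd ℝ V V)), ?_, ?_⟩
  · refine contMDiffAt_clm_of_apply fun v => contMDiffAt_clm_of_apply fun f => ?_
    have h : ∀ w : V, ContMDiffAt 𝓘(ℝ, V) 𝓘(ℝ, F) ∞ (fun x => Γ x w f) x₀ := fun w =>
      ((hΓ.smooth x₀ hx).clm_apply contMDiffAt_const).clm_apply contMDiffAt_const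
    exact (h v.1).add ((contMDiffAt_const (c := mulI)).clm_apply (h v.2))
  · filter_upwards [((chartAt V x₀).open_source.inter
      (trivializationAt F B x₀).open_baseSet).mem_nhds hx] with x hx' u₁ u₂ _ f
    rw [hA.toPartial_deriv, liftBaseChange_complex, snd_eq _ hx'.2, map_add, map_smul,
      ← snd_eq _ hx'.2, ← snd_eq _ hx'.2]
    have h := fun u => hΓ.eq x hx' (chartD x₀ x u) f
    simp only [coordL_chartD hx'.1] at h
    exact congrArg₂ (fun a b => a + Complex.I • b) (h u₁).symm (h u₂).symm

/-- The construction used for `∂̄₀` serves again: the connection is extended to the complexified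
tangent bundle, pulled back as a partial connection, and restricted to real vectors. -/
theorem IsComplexConnection.exists_pullback (hA : IsComplexConnection A) :
    ∃ A' : CovariantDerivative 𝓘(ℝ, W) F (p *ᵖ B),
      IsComplexConnection A' ∧ IsPullbackConnection p A A' := by
  have hL : ∀ y, ∀ u ∈ (⊤ : Submodule ℂ (CTangent W y)),
    dprojC p y u ∈ (⊤ : Submodule ℂ (CTangent V (p y))) := fun _ _ _ => trivial
  refine ⟨(hA.toPartial.pullback hA.hasSmoothCoeff hL).toConnection,
    PartialConnection.isComplexConnection_toConnection _, fun s y hs v => ?_⟩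
  have h := (hA.toPartial.pullback_isPullback hA.hasSmoothCoeff hL y ((1 : ℂ) ⊗ₜ[ℝ] v) trivial).2 s hs
  refine (PartialConnection.toConnection_apply _ _ y v).trans (h.trans ?_)
  rw [LinearMap.baseChange_tmul]
  exact hA.toPartial_deriv_real s _

end PullbackConnection

/-- The alternating map of two vectors defined by an alternating bilinear function. -/
def AlternatingMap.ofBilinear {T G : Type*} [AddCommGroup T] [Module ℝ T] [AddCommGroup G]
    [Module ℝ G] (f : T → T → G) (hadd : ∀ u u' v, f (u + u') v = f u v + f u' v)
    (hsmul : ∀ (r : ℝ) u v, f (r • u) v = r • f u v) (hswap : ∀ u v, f u v = -f v u) :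
    T [⋀^Fin 2]→ₗ[ℝ] G where
  toFun w := f (w 0) (w 1)
  map_update_add' w i a b := by
    fin_cases i
    · simp [hadd]
    · simp [hswap (w 0), hadd]
      abel
  map_update_smul' w i r a := by
    fin_cases i
    · simp [hsmul]
    · simp [hswap (w 0), hsmul]
  map_eq_zero_of_eq' w i j hw hij := by
    have h0 : ∀ u, f u u = 0 := fun u => by
      have h2 : (2 : ℝ) • f u u = 0 := by
        rw [two_smul]
        exact eq_neg_iff_add_eq_zero.1 (hswap u u)
      exact (smul_eq_zero.1 h2).resolve_left two_ne_zero
    have h1 : w 0 = w 1 := by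
      fin_cases i <;> fin_cases j
      · exact absurd rfl hij
      · exact hw
      · exact hw.symm
      · exact absurd rfl hij
    rw [h1, h0]

/-! ### Curvature as an alternating form, and its skewness for unitary connections -/

section Curvature

variable {E : Type*} [NormedAddCommGroup E] [NormedSpace ℝ E] [FiniteDimensional ℝ E]
  {M : Type*} [TopologicalSpace M] [ChartedSpace E M] [IsManifold 𝓘(ℝ, E) ∞ M]
  {F : Type*} [NormedAddCommGroup F] [NormedSpace ℂ F] [FiniteDimensional ℂ F]
  {B : M → Type*} [TopologicalSpace (TotalSpace F B)]
  [∀ x, AddCommGroup (B x)] [∀ x, Module ℂ (B x)] [∀ x, Module ℝ (B x)]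
  [∀ x, IsScalarTower ℝ ℂ (B x)]
  [∀ x, TopologicalSpace (B x)] [∀ x, IsTopologicalAddGroup (B x)]
  [∀ x, ContinuousSMul ℝ (B x)] [FiberBundle F B] [VectorBundle ℂ F B] [VectorBundle ℝ F B]
  [ContMDiffVectorBundle ∞ F B 𝓘(ℝ, E)]
  {A : CovariantDerivative 𝓘(ℝ, E) F B}

theorem constSec_smul_real (e : Trivialization F (π F B)) [MemTrivializationAtlas e] {x : M}
    (hx : x ∈ e.baseSet) (r : ℝ) (f : F) : constSec e (r • f) x = r • constSec e f x := by
  rw [constSec_eq e hx, constSec_eq e hx, ← algebraMap_smul ℂ r (e.symmₗ ℂ x f), ← map_smul,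
    algebraMap_smul]

theorem mvfderiv_eq_fderiv_chart_self {G : Type*} [NormedAddCommGroup G] [NormedSpace ℝ G]
    {f : M → G} {x₀ : M} (hf : MDifferentiableAt 𝓘(ℝ, E) 𝓘(ℝ, G) f x₀)
    (u : TangentSpace 𝓘(ℝ, E) x₀) : mvfderiv 𝓘(ℝ, E) f x₀ u =
      fderiv ℝ (f ∘ (extChartAt 𝓘(ℝ, E) x₀).symm) (extChartAt 𝓘(ℝ, E) x₀ x₀) u := by
  rw [mvfderiv_eq_fderiv_chart (mem_chart_source E x₀) hf, chartD_self]

set_option synthInstance.maxHeartbeats 400000 in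
/-- The curvature of a connection is an alternating form. -/
theorem IsComplexConnection.exists_curvatureForm (hA : IsComplexConnection A) (x₀ : M) :
    ∃ R : TangentSpace 𝓘(ℝ, E) x₀ [⋀^Fin 2]→ₗ[ℝ] (B x₀ → B x₀), ⇑R = curvature A x₀ := by
  obtain ⟨Γ, hΓ⟩ := hA.exists_coeff x₀
  have hx := mem_baseSet_trivializationAt F B x₀
  let e := trivializationAt F B x₀
  have hL := hΓ.localCurvature_eq
  generalize fderiv ℝ (Γ ∘ (extChartAt 𝓘(ℝ, E) x₀).symm) (extChartAt 𝓘(ℝ, E) x₀ x₀) = L at hL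
  have hadd : ∀ (u u' v : E) f, localCurvature A x₀ (u + u') v f =
      localCurvature A x₀ u v f + localCurvature A x₀ u' v f := fun u u' v f => by
    have h1 : L (u + u') = L u + L u' := L.map_add u u'
    have h2 : L v (u + u') = L v u + L v u' := (L v).map_add u u'
    have h3 : Γ x₀ (u + u') = Γ x₀ u + Γ x₀ u' := (Γ x₀).map_add u u'
    rw [hL, hL, hL, h1, h2, h3]
    simp only [add_apply, (Γ x₀ v).map_add]
    abel
  have hsmul : ∀ (r : ℝ) (u v : E) f, localCurvature A x₀ (r • u) v f =
      r • localCurvature A x₀ u v f := fun r u v f => by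
    have h1 : L (r • u) = r • L u := L.map_smul r u
    have h2 : L v (r • u) = r • L v u := (L v).map_smul r u
    have h3 : Γ x₀ (r • u) = r • Γ x₀ u := (Γ x₀).map_smul r u
    rw [hL, hL, h1, h2, h3]
    simp only [smul_apply, (Γ x₀ v).map_smul, smul_add, smul_sub]
  have hswap : ∀ (u v : E) f, localCurvature A x₀ u v f = -localCurvature A x₀ v u f :=
    fun u v f => by
      rw [hL, hL]
      abel
  refine ⟨AlternatingMap.ofBilinear (fun u v b => constSec e
    (localCurvature A x₀ u v (e ⟨x₀, b⟩).2) x₀) ?_ ?_ ?_, rfl⟩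
  · intro u u' v
    ext b
    simp only [Pi.add_apply, constSec_eq e hx, ← map_add]
    exact congrArg _ (hadd u u' v _)
  · intro r u v
    ext b
    simp only [Pi.smul_apply, ← constSec_smul_real e hx]
    exact congrArg (fun g => constSec e g x₀) (hsmul r u v _)
  · intro u v
    ext b
    simp only [Pi.neg_apply, constSec_eq e hx, ← map_neg]
    exact congrArg _ (hswap u v _)

/-- The covariant derivative of a frame section along a coordinate field. -/
def coordDeriv (A : CovariantDerivative 𝓘(ℝ, E) F B) (x₀ : M) (v : E) (f : F) (x : M) : B x :=
  A (constSec (trivializationAt F B x₀) f) x (coordL x₀ x v)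

theorem smoothSectionOn_coordDeriv (hA : IsComplexConnection A) (x₀ : M) (v : E) (f : F) :
    SmoothSectionOn (E := E) F (coordDeriv A x₀ v f)
      ((chartAt E x₀).source ∩ (trivializationAt F B x₀).baseSet) :=
  hA.smoothSectionOn_apply ((chartAt E x₀).open_source.inter (trivializationAt F B x₀).open_baseSet)
    ((smoothSectionOn_constSec _ f).mono inter_subset_right)
    ((smoothFieldOn_coordField x₀ v).mono inter_subset_left)

theorem diffSectionAt_coordDeriv (hA : IsComplexConnection A) {x₀ x : M}
    (hx : x ∈ (chartAt E x₀).source ∩ (trivializationAt F B x₀).baseSet) (v : E) (f : F) :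
    DiffSectionAt E F (coordDeriv A x₀ v f) x :=
  (smoothSectionOn_coordDeriv hA x₀ v f).diffSectionAt
    ((chartAt E x₀).open_source.inter (trivializationAt F B x₀).open_baseSet) hx

set_option synthInstance.maxHeartbeats 400000 in
/-- The curvature as the commutator of second covariant derivatives. -/
theorem IsComplexConnection.curvature_eq (hA : IsComplexConnection A) (x₀ : M)
    (u v : TangentSpace 𝓘(ℝ, E) x₀) (f : F) :
    curvature A x₀ ![u, v] (constSec (trivializationAt F B x₀) f x₀) =
      A (coordDeriv A x₀ v f) x₀ u - A (coordDeriv A x₀ u f) x₀ v := by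
  obtain ⟨Γ, hΓ⟩ := hA.exists_coeff x₀
  have hx := IsConnectionCoeff.mem_center (E := E) (F := F) (B := B) x₀
  let e := trivializationAt F B x₀
  have hrep : ∀ v : E, (fun x => (e ⟨x, coordDeriv A x₀ v f x⟩).2) =ᶠ[𝓝 x₀] fun x => Γ x v f := by
    intro v
    filter_upwards [((chartAt E x₀).open_source.inter e.open_baseSet).mem_nhds hx] with x hx'
    exact (hΓ.eq x hx' v f).symm
  have key : ∀ u v : E, (e ⟨x₀, A (coordDeriv A x₀ v f) x₀ u⟩).2 =
      fderiv ℝ (Γ ∘ (extChartAt 𝓘(ℝ, E) x₀).symm) (extChartAt 𝓘(ℝ, E) x₀ x₀) u v f +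
        Γ x₀ u (Γ x₀ v f) := by
    intro u v
    have h1 := hΓ.deriv_eq hA hx (diffSectionAt_coordDeriv hA hx v f) u
    have h0 : (e ⟨x₀, coordDeriv A x₀ v f x₀⟩).2 = Γ x₀ v f := (hrep v).self_of_nhds
    refine h1.trans ?_
    have h2 : MDifferentiableAt 𝓘(ℝ, E) 𝓘(ℝ, F) (fun x => Γ x v f) x₀ := by
      have h3 := (diffSectionAt_iff e hx.2 _).1 (diffSectionAt_coordDeriv hA hx v f)
      exact h3.congr_of_eventuallyEq (hrep v).symm
    refine congrArg₂ (· + ·) ?_ (congrArg₂ (fun w g => Γ x₀ w g) (chartD_self x₀ u) h0)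
    rw [mvfderiv_congr (hrep v)]
    exact (mvfderiv_eq_fderiv_chart_self h2 u).trans
      (fderiv_apply_apply hΓ.differentiableAt v f u)
  refine snd_injective e hx.2 ?_
  rw [snd_eq e hx.2 (_ - _), map_sub, ← snd_eq e hx.2, ← snd_eq e hx.2, key u v, key v u]
  have h4 := snd_constSec e hx.2 (localCurvature A x₀ u v f)
  have h5 := snd_constSec e hx.2 f
  simp only [curvature, Matrix.cons_val_zero, Matrix.cons_val_one]
  refine (congrArg (fun g => (e ⟨x₀, constSec e (localCurvature A x₀ u v g) x₀⟩).2) h5).trans ?_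
  refine h4.trans ((hΓ.localCurvature_eq u v f).trans ?_)
  abel

/-- Coordinate fields are constant in the chart, so this is the symmetry of second derivatives of
the expression of `φ`. -/
theorem mvfderiv_mvfderiv_symm {G : Type*} [NormedAddCommGroup G] [NormedSpace ℝ G] {φ : M → G}
    {O : Set M} (hO : IsOpen O) (hφ : ContMDiffOn 𝓘(ℝ, E) 𝓘(ℝ, G) ∞ φ O) {x₀ : M} (hx : x₀ ∈ O)
    (u v : E) :
    mvfderiv 𝓘(ℝ, E) (fun x => mvfderiv 𝓘(ℝ, E) φ x (coordL x₀ x v)) x₀ u =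
      mvfderiv 𝓘(ℝ, E) (fun x => mvfderiv 𝓘(ℝ, E) φ x (coordL x₀ x u)) x₀ v := by
  have hφ2 := (contMDiffAt_iff_chart (mem_chart_source E x₀) φ).1
    ((hφ x₀ hx).contMDiffAt (hO.mem_nhds hx))
  have hd : DifferentiableAt ℝ (fderiv ℝ (φ ∘ (extChartAt 𝓘(ℝ, E) x₀).symm))
      (extChartAt 𝓘(ℝ, E) x₀ x₀) :=
    (hφ2.fderiv_right (m := 1) (by norm_cast)).differentiableAt (by norm_num)
  have key : ∀ u v : E, mvfderiv 𝓘(ℝ, E) (fun x => mvfderiv 𝓘(ℝ, E) φ x (coordL x₀ x v)) x₀ u =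
      fderiv ℝ (fderiv ℝ (φ ∘ (extChartAt 𝓘(ℝ, E) x₀).symm)) (extChartAt 𝓘(ℝ, E) x₀ x₀) u v := by
    intro u v
    have h1 : (fun x => mvfderiv 𝓘(ℝ, E) φ x (coordL x₀ x v)) =ᶠ[𝓝 x₀]
        fun x => fderiv ℝ (φ ∘ (extChartAt 𝓘(ℝ, E) x₀).symm) (extChartAt 𝓘(ℝ, E) x₀ x) v := by
      filter_upwards [hO.mem_nhds hx, (chartAt E x₀).open_source.mem_nhds (mem_chart_source E x₀)]
        with x h2 h3
      exact (fderiv_chart h3 (((hφ x h2).contMDiffAt (hO.mem_nhds h2)).mdifferentiableAt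
        (by norm_num)) v).symm
    have h4 : ((fun x => fderiv ℝ (φ ∘ (extChartAt 𝓘(ℝ, E) x₀).symm) (extChartAt 𝓘(ℝ, E) x₀ x) v) ∘
        (extChartAt 𝓘(ℝ, E) x₀).symm) =ᶠ[𝓝 (extChartAt 𝓘(ℝ, E) x₀ x₀)]
        fun z => fderiv ℝ (φ ∘ (extChartAt 𝓘(ℝ, E) x₀).symm) z v := by
      filter_upwards [(isOpen_extChartAt_target x₀).mem_nhds
        (mem_extChartAt_target (I := 𝓘(ℝ, E)) x₀)] with z hz
      simp only [Function.comp_apply, (extChartAt 𝓘(ℝ, E) x₀).right_inv hz]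
    have h5 := hd.hasFDerivAt.clm_apply (hasFDerivAt_const v _)
    have h6 : MDifferentiableAt 𝓘(ℝ, E) 𝓘(ℝ, G) (fun x =>
        fderiv ℝ (φ ∘ (extChartAt 𝓘(ℝ, E) x₀).symm) (extChartAt 𝓘(ℝ, E) x₀ x) v) x₀ := by
      rw [mdifferentiableAt_iff_chart (mem_chart_source E x₀)]
      exact h4.differentiableAt_iff.2 h5.differentiableAt
    rw [mvfderiv_congr h1]
    refine (mvfderiv_eq_fderiv_chart_self h6 u).trans ?_
    rw [h4.fderiv_eq, h5.fderiv]
    simp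
  rw [key, key]
  exact hφ2.isSymmSndFDerivAt (by simp; norm_cast) u v

/-- The curvature of a unitary connection is skew-Hermitian. -/
theorem IsUnitary.curvature_skew {h : HermitianMetric E F B} (hA : IsComplexConnection A)
    (hu : IsUnitary h A) (x₀ : M) (u v : TangentSpace 𝓘(ℝ, E) x₀) (b c : B x₀) :
    h.toFun x₀ (curvature A x₀ ![u, v] b) c + h.toFun x₀ b (curvature A x₀ ![u, v] c) = 0 := by
  let e := trivializationAt F B x₀
  let N := (chartAt E x₀).source ∩ e.baseSet
  have hx : x₀ ∈ N := IsConnectionCoeff.mem_center (E := E) (F := F) (B := B) x₀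
  have hN : IsOpen N := (chartAt E x₀).open_source.inter e.open_baseSet
  obtain ⟨f, rfl⟩ : ∃ f, constSec e f x₀ = b := ⟨_, constSec_snd e hx.2 b⟩
  obtain ⟨g, rfl⟩ : ∃ g, constSec e g x₀ = c := ⟨_, constSec_snd e hx.2 c⟩
  have hs : ∀ f, SmoothSectionOn (E := E) F (constSec e f) N := fun f =>
    (smoothSectionOn_constSec e f).mono inter_subset_right
  have hs' : ∀ f, ∀ x ∈ N, DiffSectionAt E F (constSec e f) x := fun f x hx =>
    (hs f).diffSectionAt hN hx
  have hsd : ∀ v f, DiffSectionAt E F (coordDeriv A x₀ v f) x₀ := fun v f =>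
    diffSectionAt_coordDeriv hA hx v f
  have hdiff : ∀ {s t : Π x : M, B x}, SmoothSectionOn (E := E) F s N →
      SmoothSectionOn (E := E) F t N → MDifferentiableAt 𝓘(ℝ, E) 𝓘(ℝ, ℂ)
        (fun x => h.toFun x (s x) (t x)) x₀ := fun hs ht =>
    ((h.smooth N hN _ _ hs ht x₀ hx).contMDiffAt (hN.mem_nhds hx)).mdifferentiableAt (by norm_num)
  -- Second derivative of `h(s, t)` in coordinate directions. On antisymmetrizing in `u` and `v` the
  -- left side vanishes, the products of first derivatives cancel, and the two curvature terms
  -- remain.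
  have key : ∀ u v : TangentSpace 𝓘(ℝ, E) x₀, mvfderiv 𝓘(ℝ, E) (fun x => mvfderiv 𝓘(ℝ, E)
      (fun x => h.toFun x (constSec e f x) (constSec e g x)) x (coordL x₀ x v)) x₀ u =
      (h.toFun x₀ (A (coordDeriv A x₀ v f) x₀ u) (constSec e g x₀) +
        h.toFun x₀ (coordDeriv A x₀ v f x₀) (A (constSec e g) x₀ u)) +
      (h.toFun x₀ (A (constSec e f) x₀ u) (coordDeriv A x₀ v g x₀) +
        h.toFun x₀ (constSec e f x₀) (A (coordDeriv A x₀ v g) x₀ u)) := by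
    intro u v
    have h1 : (fun x => mvfderiv 𝓘(ℝ, E)
        (fun x => h.toFun x (constSec e f x) (constSec e g x)) x (coordL x₀ x v)) =ᶠ[𝓝 x₀]
        fun x => h.toFun x (coordDeriv A x₀ v f x) (constSec e g x) +
          h.toFun x (constSec e f x) (coordDeriv A x₀ v g x) := by
      filter_upwards [hN.mem_nhds hx] with x hx'
      exact hu _ _ x (hs' f x hx') (hs' g x hx') _
    rw [mvfderiv_congr h1, ← hu _ _ x₀ (hsd v f) (hs' g x₀ hx) u,
      ← hu _ _ x₀ (hs' f x₀ hx) (hsd v g) u]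
    have h2 := (hdiff (smoothSectionOn_coordDeriv hA x₀ v f) (hs g)).hasMFDerivAt.add
      (hdiff (hs f) (smoothSectionOn_coordDeriv hA x₀ v g)).hasMFDerivAt
    exact congrArg (fun T : E →L[ℝ] ℂ => T u) h2.mfderiv
  have hcoord : ∀ (v : TangentSpace 𝓘(ℝ, E) x₀) f, coordDeriv A x₀ v f x₀ = A (constSec e f) x₀ v := fun v f =>
    congrArg (A (constSec e f) x₀) (coordL_self (E := E) x₀ v)
  have hsym := (key u v).symm.trans ((mvfderiv_mvfderiv_symm hN
    (h.smooth N hN _ _ (hs f) (hs g)) hx u v).trans (key v u))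
  simp only [hcoord] at hsym
  rw [hA.curvature_eq, hA.curvature_eq]
  simp only [map_sub, LinearMap.sub_apply]
  linear_combination hsym

end Curvature

/-! ### The curvature of a Chern connection has type (1,1) -/

section Instantons

variable {V : Type*} [NormedAddCommGroup V] [NormedSpace ℂ V] [FiniteDimensional ℂ V]
  {X : Type*} [TopologicalSpace X] [ChartedSpace V X] [IsManifold 𝓘(ℂ, V) ω X]
  {F : Type*} [NormedAddCommGroup F] [NormedSpace ℂ F] [FiniteDimensional ℂ F]
  {B : X → Type*} [TopologicalSpace (TotalSpace F B)]
  [∀ x, AddCommGroup (B x)] [∀ x, Module ℂ (B x)] [∀ x, Module ℝ (B x)]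
  [∀ x, IsScalarTower ℝ ℂ (B x)]
  [∀ x, TopologicalSpace (B x)] [∀ x, IsTopologicalAddGroup (B x)]
  [∀ x, ContinuousSMul ℝ (B x)]
  [FiberBundle F B] [VectorBundle ℂ F B] [VectorBundle ℝ F B]
  [ContMDiffVectorBundle ∞ F B 𝓘(ℝ, V)]
  {A : CovariantDerivative 𝓘(ℝ, V) F B}

set_option synthInstance.maxHeartbeats 400000 in
theorem IsDbarCoeff.differentiableAt
    {D : PartialConnection F B (antiholomorphicPart (complexStructure (V := V) (X := X)))} {x₀ : X}
    {Γ : X → V →L[ℝ] F →L[ℝ] F} (hΓ : IsDbarCoeff D x₀ Γ) :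
    DifferentiableAt ℝ (Γ ∘ (extChartAt 𝓘(ℝ, V) x₀).symm) (extChartAt 𝓘(ℝ, V) x₀ x₀) :=
  ((contMDiffAt_iff_chart (mem_chart_source V x₀) (G := V →L[ℝ] F →L[ℝ] F) Γ).1
    (hΓ.smooth x₀ (IsConnectionCoeff.mem_center x₀))).differentiableAt (by norm_num)

/-- The coefficients of the partial connection of type `(0,1)` induced by a connection. -/
theorem IsDbarCoeff.eq_add_of_induces
    {D : PartialConnection F B (antiholomorphicPart (complexStructure (V := V) (X := X)))} {x₀ : X}
    {Γ Γ' : X → V →L[ℝ] F →L[ℝ] F} (hΓ' : IsDbarCoeff D x₀ Γ') (hΓ : IsConnectionCoeff A x₀ Γ)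
    (hD : InducesPartialConnection A D) {x : X}
    (hx : x ∈ (chartAt V x₀).source ∩ (trivializationAt F B x₀).baseSet) (v : V) (f : F) :
    Γ' x v f = Γ x v f + Complex.I • Γ x (Complex.I • v) f := by
  rw [hΓ'.eq x hx, hΓ.eq x hx, hΓ.eq x hx,
    ← hD _ x (diffSectionAt_constSec _ f hx.2) _ (dbarField_mem hx.1 v), dbarField, complexField,
    liftBaseChange_complex, snd_eq _ hx.2, map_add, map_smul, ← snd_eq _ hx.2, ← snd_eq _ hx.2]
  rfl

set_option synthInstance.maxHeartbeats 400000 in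
theorem IsDbarCoeff.fderiv_eq_add_of_induces
    {D : PartialConnection F B (antiholomorphicPart (complexStructure (V := V) (X := X)))} {x₀ : X}
    {Γ Γ' : X → V →L[ℝ] F →L[ℝ] F} (hΓ' : IsDbarCoeff D x₀ Γ') (hΓ : IsConnectionCoeff A x₀ Γ)
    (hD : InducesPartialConnection A D) (a b : V) (f : F) :
    fderiv ℝ (Γ' ∘ (extChartAt 𝓘(ℝ, V) x₀).symm) (extChartAt 𝓘(ℝ, V) x₀ x₀) a b f =
      fderiv ℝ (Γ ∘ (extChartAt 𝓘(ℝ, V) x₀).symm) (extChartAt 𝓘(ℝ, V) x₀ x₀) a b f +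
      Complex.I • fderiv ℝ (Γ ∘ (extChartAt 𝓘(ℝ, V) x₀).symm) (extChartAt 𝓘(ℝ, V) x₀ x₀) a
        (Complex.I • b) f := by
  have : FiniteDimensional ℝ V := FiniteDimensional.complexToReal V
  have hd := hΓ.differentiableAt
  rw [← fderiv_apply_apply hΓ'.differentiableAt, ← fderiv_apply_apply hd, ← fderiv_apply_apply hd]
  have h : (fun z => (Γ' ∘ (extChartAt 𝓘(ℝ, V) x₀).symm) z b f) =ᶠ[𝓝 (extChartAt 𝓘(ℝ, V) x₀ x₀)]
      (fun z => (Γ ∘ (extChartAt 𝓘(ℝ, V) x₀).symm) z b f) +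
        Complex.I • fun z => (Γ ∘ (extChartAt 𝓘(ℝ, V) x₀).symm) z (Complex.I • b) f := by
    filter_upwards [eventually_extChartAt_symm (((chartAt V x₀).open_source.inter
      (trivializationAt F B x₀).open_baseSet).mem_nhds (IsConnectionCoeff.mem_center x₀))] with z hz
    exact hΓ'.eq_add_of_induces hΓ hD hz.1 b f
  have hd2 : ∀ b : V, DifferentiableAt ℝ (fun z => (Γ ∘ (extChartAt 𝓘(ℝ, V) x₀).symm) z b f)
      (extChartAt 𝓘(ℝ, V) x₀ x₀) := fun b =>
    ((HasFDerivAt.clm_apply (G := V) (H := F →L[ℝ] F) hd.hasFDerivAt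
      (hasFDerivAt_const b _)).clm_apply (hasFDerivAt_const f _)).differentiableAt
  rw [h.fderiv_eq, fderiv_add (hd2 b) ((hd2 _).const_smul _), fderiv_const_smul (hd2 _)]
  rfl

set_option synthInstance.maxHeartbeats 400000 in
/-- The curvature of a Chern connection has no part of type `(0,2)`. -/
theorem IsChernConnection.type_zero_two {hol : HolomorphicStructure V F B}
    {h : HermitianMetric V F B} (hA : IsChernConnection hol h A) (x : X)
    (u v : TangentSpace 𝓘(ℝ, V) x) (e : B x) :
    (curvature A x ![u, v] e - curvature A x ![complexStructure x u, complexStructure x v] e)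
      + Complex.I • (curvature A x ![u, complexStructure x v] e
        + curvature A x ![complexStructure x u, v] e) = 0 := by
  have : FiniteDimensional ℝ V := FiniteDimensional.complexToReal V
  obtain ⟨Γ, hΓ⟩ := hA.connection.exists_coeff x
  obtain ⟨Γ', hΓ'⟩ := exists_isDbarCoeff hol.dbar x
  have hx := IsConnectionCoeff.mem_center (E := V) (F := F) (B := B) x
  let t := trivializationAt F B x
  have key : ∀ (a b : V) (f : F),
      (localCurvature A x a b f - localCurvature A x (Complex.I • a) (Complex.I • b) f) +
        Complex.I • (localCurvature A x a (Complex.I • b) f +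
          localCurvature A x (Complex.I • a) b f) = 0 := by
    intro a b f
    have h1 := hΓ'.flat hol.flat a b f
    have h2 := hΓ'.fderiv_eq_add_of_induces hΓ hA.integrable
    have h3 : ∀ v f, (Γ' ∘ (extChartAt 𝓘(ℝ, V) x).symm) (extChartAt 𝓘(ℝ, V) x x) v f =
        Γ x v f + Complex.I • Γ x (Complex.I • v) f := by
      intro v f
      rw [Function.comp_apply, extChartAt_to_inv]
      exact hΓ'.eq_add_of_induces hΓ hA.integrable hx v f
    have h4 := hΓ.apply_smul hA.connection hx
    have h5 := hΓ.localCurvature_eq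
    have h6 : ∀ v f g, Γ x v (f + g) = Γ x v f + Γ x v g := fun v f g => (Γ x v).map_add f g
    have hI : ∀ g : F, Complex.I • Complex.I • g = -g := fun g => by
      rw [smul_smul, Complex.I_mul_I, neg_one_smul]
    -- Substituting `Γ'(v) = Γ(v) + i Γ(i v)` into the flatness of `∂̄₀` gives, term by term, the
    -- (0,2) combination of the curvature of `A`.
    simp only [h2, h3] at h1
    rw [h5, h5, h5, h5]
    generalize fderiv ℝ (Γ ∘ (extChartAt 𝓘(ℝ, V) x).symm) (extChartAt 𝓘(ℝ, V) x x) = L at h1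
    rw [← h1]
    simp only [h6, h4, smul_add, smul_sub, hI]
    abel
  simp only [curvature, Matrix.cons_val_zero, Matrix.cons_val_one]
  have h := congrArg (t.symmₗ ℂ x) (key u v (t ⟨x, e⟩).2)
  simp only [map_add, map_sub, map_smul, map_zero] at h
  simp only [← constSec_eq t hx.2] at h
  exact h

/-- The curvature of a Chern connection is of type `(1,1)`. -/
theorem IsChernConnection.curvature_complexStructure {hol : HolomorphicStructure V F B}
    {h : HermitianMetric V F B} (hA : IsChernConnection hol h A) (x : X)
    (u v : TangentSpace 𝓘(ℝ, V) x) :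
    curvature A x ![complexStructure x u, complexStructure x v] = curvature A x ![u, v] := by
  have hskew := hA.unitary.curvature_skew hA.connection x
  have h02 := hA.type_zero_two x u v
  -- With `P, Q, S, T` as named below, the vanishing (0,2) part says `P - Q = -i (S + T)`. The left
  -- side is skew-Hermitian and the right side Hermitian, so both are zero. Concretely, pairing with
  -- `c = (S + T) b` gives `h(c, c) = 0`, against positivity if `c ≠ 0`.
  have hm : ∀ b, curvature A x ![u, complexStructure x v] b +
      curvature A x ![complexStructure x u, v] b = 0 := by
    intro b
    have h1 := hskew u v
    have h2 := hskew (complexStructure x u) (complexStructure x v)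
    have h3 := hskew u (complexStructure x v)
    have h4 := hskew (complexStructure x u) v
    generalize curvature A x ![u, v] = P at *
    generalize curvature A x ![complexStructure x u, complexStructure x v] = Q at *
    generalize curvature A x ![u, complexStructure x v] = S at *
    generalize curvature A x ![complexStructure x u, v] = T at *
    have h5 : ∀ c, P c = Q c - Complex.I • (S c + T c) := fun c => by
      rw [eq_sub_iff_add_eq, ← sub_eq_zero, ← h02 c]
      abel
    by_contra hb
    have hpos := h.pos x _ hb
    have e1 := h1 b (S b + T b)
    have e2 := h2 b (S b + T b)
    have e3 := h3 b (S b + T b)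
    have e4 := h4 b (S b + T b)
    rw [h5, h5] at e1
    have hI : starRingEnd ℂ Complex.I = -Complex.I := Complex.conj_I
    generalize hc : S b + T b = c at *
    simp only [map_sub, LinearMap.sub_apply, LinearMap.map_smulₛₗ, LinearMap.smul_apply, hI,
      smul_eq_mul, map_smul] at e1
    have e5 : h.toFun x (S b) c + h.toFun x (T b) c = h.toFun x c c := by
      rw [← LinearMap.add_apply, ← map_add, hc]
    have e6 : Complex.I * (2 * h.toFun x c c) = 0 := by
      rw [map_add] at e1
      linear_combination e1 - e2 + Complex.I * e3 + Complex.I * e4 - Complex.I * e5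
    have e7 : h.toFun x c c = 0 := by
      simpa using e6
    rw [e7] at hpos
    simp at hpos
  funext b
  have h5 := h02 b
  rw [hm b, smul_zero, add_zero, sub_eq_zero] at h5
  exact h5.symm

/-! ### Curvature of the pullback connection and the instanton equation -/

section Pullback

variable {W : Type*} [NormedAddCommGroup W] [NormedSpace ℝ W] [FiniteDimensional ℝ W]
  {Y : Type*} [TopologicalSpace Y] [ChartedSpace W Y] [IsManifold 𝓘(ℝ, W) ∞ Y]
  {p : C^∞⟮𝓘(ℝ, W), Y; 𝓘(ℝ, V), X⟯} {A' : CovariantDerivative 𝓘(ℝ, W) F (p *ᵖ B)}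

theorem fderiv_localProj_self (y : Y) (u : TangentSpace 𝓘(ℝ, W) y) :
    fderiv ℝ (localProj p y) (extChartAt 𝓘(ℝ, W) y y) u = dproj p y u := by
  have h1 := fderiv_localProj p (mem_projDomain p y) u
  rw [chartD_self, chartD_self] at h1
  exact h1

theorem constSec_pullback_eq (e : Trivialization F (π F B)) (f : F) :
    constSec (e.pullback p) f = pullbackSection p (constSec e f) := by
  ext y
  by_cases hy : p y ∈ e.baseSet
  · exact constSec_pullback p e hy f
  · have h1 : constSec (e.pullback p) f y = (Classical.arbitrary (B (p y)) : B (p y)) := dif_neg hy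
    have h2 : constSec e f (p y) = Classical.arbitrary (B (p y)) := dif_neg hy
    exact h1.trans h2.symm

-- The frame sections of the pulled-back trivialization are pullbacks of frame sections on `X`, and
-- on these `A'` is prescribed by `A`; the rest is the chain rule for charts.
set_option synthInstance.maxHeartbeats 400000 in
theorem IsPullbackConnection.connectionForm_eventuallyEq {y : Y}
    {Γ : X → V →L[ℝ] F →L[ℝ] F} (hΓ : IsConnectionCoeff A (p y) Γ)
    (hp : IsPullbackConnection p A A') :
    ∀ᶠ z in 𝓝 (extChartAt 𝓘(ℝ, W) y y), ∀ v f, connectionForm A' y z v f =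
      (Γ ∘ (extChartAt 𝓘(ℝ, V) (p y)).symm) (localProj p y z) (fderiv ℝ (localProj p y) z v) f := by
  have hb : ∀ᶠ y' in 𝓝 y, p y' ∈ (trivializationAt F B (p y)).baseSet :=
    p.contMDiff.continuous.continuousAt.eventually ((trivializationAt F B (p y)).open_baseSet.mem_nhds
      (mem_baseSet_trivializationAt F B (p y)))
  filter_upwards [(isOpen_extChartAt_target y).mem_nhds (mem_extChartAt_target (I := 𝓘(ℝ, W)) y),
    eventually_extChartAt_symm (Filter.inter_mem hb
      ((isOpen_projDomain p y).mem_nhds (mem_projDomain p y)))] with z h1 h2 v f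
  obtain ⟨⟨h3, h4⟩, h5⟩ := h2
  let e := trivializationAt F B (p y)
  have h6 := hp (constSec e f) _ (diffSectionAt_constSec e f h3)
    (mfderiv 𝓘(ℝ, W) 𝓘(ℝ, W) (extChartAt 𝓘(ℝ, W) y).symm z v)
  have h7 : connectionForm A' y z v f =
      (e ⟨p ((extChartAt 𝓘(ℝ, W) y).symm z), A (constSec e f) _ (dproj p _
        (mfderiv 𝓘(ℝ, W) 𝓘(ℝ, W) (extChartAt 𝓘(ℝ, W) y).symm z v))⟩).2 := by
    refine Eq.trans ?_ (congrArg (fun b => (e ⟨p ((extChartAt 𝓘(ℝ, W) y).symm z), b⟩).2) h6)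
    exact congrArg (fun s => (e ⟨p ((extChartAt 𝓘(ℝ, W) y).symm z), A' s
      ((extChartAt 𝓘(ℝ, W) y).symm z) (mfderiv 𝓘(ℝ, W) 𝓘(ℝ, W) (extChartAt 𝓘(ℝ, W) y).symm z v)⟩).2)
      (constSec_pullback_eq e f)
  have h8 := fderiv_localProj p h4 (mfderiv 𝓘(ℝ, W) 𝓘(ℝ, W) (extChartAt 𝓘(ℝ, W) y).symm z v)
  have h9 := hΓ.eq _ ⟨h4.2, h3⟩ (chartD (p y) _ (dproj p _
    (mfderiv 𝓘(ℝ, W) 𝓘(ℝ, W) (extChartAt 𝓘(ℝ, W) y).symm z v))) f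
  rw [coordL_chartD h4.2] at h9
  have h10 := localProj_extChartAt p h4
  have h11 : chartD y ((extChartAt 𝓘(ℝ, W) y).symm z)
      (mfderiv 𝓘(ℝ, W) 𝓘(ℝ, W) (extChartAt 𝓘(ℝ, W) y).symm z v) = v := by
    rw [← coordL_extChartAt_symm h1]
    exact chartD_coordL (extChartAt_symm_mem h1) v
  rw [h5] at h8 h10
  rw [h7, Function.comp_apply, h10, extChartAt_symm_apply_of_mem h4.2]
  refine h9.symm.trans ?_
  rw [← h8, h11]

set_option synthInstance.maxHeartbeats 400000 in
/-- The curvature of a pullback connection. -/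
theorem IsPullbackConnection.curvature_eq (hA : IsComplexConnection A)
    (hp : IsPullbackConnection p A A') (y : Y) (w : Fin 2 → TangentSpace 𝓘(ℝ, W) y) :
    curvature A' y w = (curvature A (p y) (fun i => dproj p y (w i)) : B (p y) → B (p y)) := by
  obtain ⟨Γ, hΓ⟩ := hA.exists_coeff (p y)
  have h := hp.connectionForm_eventuallyEq hΓ
  have hd := hΓ.differentiableAt
  have hP := (contDiffAt_localProj p (mem_projDomain p y)).of_le (m := 2) (by norm_cast)
  have hPz := localProj_extChartAt p (mem_projDomain p y)
  let dp : W →L[ℝ] V := dproj p y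
  have hPd : ∀ u : W, fderiv ℝ (localProj p y) (extChartAt 𝓘(ℝ, W) y y) u = dp u :=
    fderiv_localProj_self y
  have hsymm : ∀ u v, fderiv ℝ (fderiv ℝ (localProj p y)) (extChartAt 𝓘(ℝ, W) y y) u v =
      fderiv ℝ (fderiv ℝ (localProj p y)) (extChartAt 𝓘(ℝ, W) y y) v u := fun u v =>
    hP.isSymmSndFDerivAt (by simp) u v
  have key : ∀ (u v : W) (f : F), localCurvature A' y u v f =
      localCurvature A (p y) (dp u) (dp v) f := by
    intro u v f
    rw [← hPz] at hd
    -- The last summand comes from differentiating `dP v`. It is symmetric in `u` and `v`, so it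
    -- drops out of the curvature.
    have h2 : ∀ u v : W, fderiv ℝ (fun z => connectionForm A' y z v f) (extChartAt 𝓘(ℝ, W) y y) u =
        fderiv ℝ (Γ ∘ (extChartAt 𝓘(ℝ, V) (p y)).symm) (localProj p y (extChartAt 𝓘(ℝ, W) y y))
          (fderiv ℝ (localProj p y) (extChartAt 𝓘(ℝ, W) y y) u)
          (fderiv ℝ (localProj p y) (extChartAt 𝓘(ℝ, W) y y) v) f +
        (Γ ∘ (extChartAt 𝓘(ℝ, V) (p y)).symm) (localProj p y (extChartAt 𝓘(ℝ, W) y y))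
          (fderiv ℝ (fderiv ℝ (localProj p y)) (extChartAt 𝓘(ℝ, W) y y) u v) f := by
      intro u v
      have h3 : (fun z => connectionForm A' y z v f) =ᶠ[𝓝 (extChartAt 𝓘(ℝ, W) y y)] fun z =>
          (Γ ∘ (extChartAt 𝓘(ℝ, V) (p y)).symm) (localProj p y z)
            (fderiv ℝ (localProj p y) z v) f := by
        filter_upwards [h] with z hz
        exact hz v f
      have h4 := (hasFDerivAt_coeff_apply (σ := fun _ => f) (U := fun _ => v) hP contDiffAt_const
        (differentiableAt_const _) hd u).2
      rw [h3.fderiv_eq, h4]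
      simp
    have h5 : ∀ v g, connectionForm A' y (extChartAt 𝓘(ℝ, W) y y) v g =
        Γ (p y) (fderiv ℝ (localProj p y) (extChartAt 𝓘(ℝ, W) y y) v) g := fun v g => by
      rw [h.self_of_nhds, hPz, Function.comp_apply, extChartAt_to_inv]
    have h6 : localCurvature A' y u v f =
      fderiv ℝ (fun z => connectionForm A' y z v f) (extChartAt 𝓘(ℝ, W) y y) u -
      fderiv ℝ (fun z => connectionForm A' y z u f) (extChartAt 𝓘(ℝ, W) y y) v +
      connectionForm A' y (extChartAt 𝓘(ℝ, W) y y) u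
        (connectionForm A' y (extChartAt 𝓘(ℝ, W) y y) v f) -
      connectionForm A' y (extChartAt 𝓘(ℝ, W) y y) v
        (connectionForm A' y (extChartAt 𝓘(ℝ, W) y y) u f) := rfl
    rw [h6, h2 u v, h2 v u, h5, h5, h5, h5, hsymm v u, hPd, hPd, hPz]
    refine Eq.trans ?_ (hΓ.localCurvature_eq _ _ f).symm
    abel
  funext b
  have h7 : curvature A' y w b = constSec ((trivializationAt F B (p y)).pullback p)
    (localCurvature A' y (w 0) (w 1) (trivializationAt F B (p y) ⟨p y, b⟩).2) y := rfl
  refine h7.trans ((constSec_pullback p _ (mem_baseSet_trivializationAt F B (p y)) _).trans ?_)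
  exact congrArg (fun f => constSec (trivializationAt F B (p y)) f (p y)) (key (w 0) (w 1) _)

theorem IsCircleFibration.surjective (hp : IsCircleFibration p) : Function.Surjective p := fun x => by
  obtain ⟨U, _, hx, τ, σ, _, _, _, h⟩ := hp x
  exact ⟨σ (x, 1), (h x hx 1).1⟩

variable (cy : CalabiYauStructure V X)

/-- The value of the Kähler form at a point, as a form on the model space. -/
def CalabiYauStructure.kahForm (x : X) : V [⋀^Fin 2]→ₗ[ℝ] ℝ := (cy.kah x).toAlternatingMap

/-- The real part of the holomorphic volume form at a point, as a form on the model space. -/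
def CalabiYauStructure.reVolForm (x : X) : V [⋀^Fin 3]→ₗ[ℝ] ℝ :=
  Complex.reLm.compAlternatingMap (cy.vol x).toAlternatingMap

theorem CalabiYauStructure.isThreeZeroRe (x : X) : IsThreeZeroRe (cy.reVolForm x) := by
  have hswap : ∀ u v w : TangentSpace 𝓘(ℝ, V) x, cy.vol x ![u, v, w] = -cy.vol x ![v, u, w] := by
    intro u v w
    have h := (cy.vol x).toAlternatingMap.map_swap ![v, u, w] (i := 0) (j := 1) (by decide)
    have h' : (![v, u, w] ∘ Equiv.swap (0 : Fin 3) 1 : Fin 3 → TangentSpace 𝓘(ℝ, V) x) =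
        ![u, v, w] := by
      ext i; fin_cases i <;> simp [Equiv.swap_apply_of_ne_of_ne]
    rw [h'] at h
    exact h
  have h2 : ∀ u v w : TangentSpace 𝓘(ℝ, V) x,
      cy.vol x ![u, complexStructure x v, w] = Complex.I * cy.vol x ![u, v, w] := by
    intro u v w
    rw [hswap, cy.vol_type, hswap v u w]
    ring
  exact fun u v w => congrArg Complex.re ((cy.vol_type x u v w).trans (h2 u v w).symm)

theorem CalabiYauStructure.isOneOne (x : X) : IsOneOne (cy.kahForm x) :=
  fun u v => cy.kah_type x u v

/-- The sum over an orthonormal basis which appears in the Hermitian Yang–Mills equations. -/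
theorem isHYM_trace_iff {x : X}
    {R : V [⋀^Fin 2]→ₗ[ℝ] (B x → B x)} (hR : ⇑R = curvature A x) (h11 : IsOneOne R)
    (e : Module.Basis (Fin 3) ℂ V)
    (h1 : ∀ i j, cy.kahForm x ![e i, Complex.I • e j] = if i = j then 1 else 0)
    (h2 : ∀ i j, cy.kahForm x ![e i, e j] = 0) :
    (∀ b : Fin 6 → TangentSpace 𝓘(ℝ, V) x,
      (∀ i j, cy.metric x (b i) (b j) = if i = j then 1 else 0) →
        ∑ i, ∑ j with i < j, cy.kah x ![b i, b j] • curvature A x ![b i, b j] = 0) ↔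
      ∑ i, R ![e i, Complex.I • e i] = 0 := by
  have hκ := cy.isOneOne x
  have hs := fun (b : Fin 6 → V) => h11.sum_orthonormal hκ e h1 h2 b
  rw [hR] at hs
  constructor
  · intro h
    rw [hR, ← hs (realFrame e) (hκ.realFrame_orthonormal e h1 h2)]
    exact h (realFrame (V := V) e) (hκ.realFrame_orthonormal e h1 h2)
  · intro h b hb
    rw [hR] at h
    exact (hs b hb).trans h

/-- The pullback of a Chern connection is a G₂-instanton if and only if the connection is Hermitian
Yang–Mills. -/
theorem IsChernConnection.isHYM_iff {θ : Π y : Y, TangentSpace 𝓘(ℝ, W) y →L[ℝ] ℝ}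
    (hV : Module.finrank ℂ V = 3) (hsplit : IsSplitting p θ) (hsurj : Function.Surjective p)
    {hol : HolomorphicStructure V F B} {h : HermitianMetric V F B} (hA : IsChernConnection hol h A)
    (hp : IsPullbackConnection p A A') :
    IsHYM cy A ↔ IsGTwoInstanton (naturalFourForm cy p θ) A' := by
  -- Pointwise equivalence: the trace condition at `p y` and the instanton equation at `y` both
  -- amount to the vanishing of the alternating sum of `κ`, `κ` and the curvature over six vectors.
  have key : ∀ y : Y,
      (∀ b : Fin 6 → TangentSpace 𝓘(ℝ, V) (p y),
        (∀ i j, cy.metric (p y) (b i) (b j) = if i = j then 1 else 0) →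
          ∑ i, ∑ j with i < j, cy.kah (p y) ![b i, b j] • curvature A (p y) ![b i, b j] = 0) ↔
      ∀ v : Fin 6 → TangentSpace 𝓘(ℝ, W) y,
        wedge (𝕜 := ℝ) (k := 2) (l := 4) (curvature A' y) (naturalFourForm cy p θ y) v = 0 := by
    intro y
    obtain ⟨R, hR⟩ : ∃ R : V [⋀^Fin 2]→ₗ[ℝ] (B (p y) → B (p y)), ⇑R = curvature A (p y) :=
      hA.connection.exists_curvatureForm (p y)
    have h11 : IsOneOne R := fun u v => by
      have := hA.curvature_complexStructure (p y) u v
      rw [← hR] at this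
      exact this
    have hκ := cy.isOneOne (p y)
    obtain ⟨e, h1, h2⟩ := exists_unitary_basis hV hκ (cy.kah_pos (p y))
    rw [isHYM_trace_iff cy hR h11 e h1 h2, ← h11.altSum_six_eq_zero_iff hκ e h1 h2]
    let L : TangentSpace 𝓘(ℝ, W) y →ₗ[ℝ] V := (dproj p y).toLinearMap
    have hL : Function.Surjective L := fun u => ⟨_, (splitting_inverse hsplit y u 0).1⟩
    have hw := fun v => wedge_fourForm L (fun u => θ y u) h11 (cy.isThreeZeroRe (p y))
      (κ := cy.kahForm (p y)) e v
    have hcurv : curvature A' y = fun w => (R (fun i => L (w i)) : B (p y) → B (p y)) := by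
      funext w
      rw [hp.curvature_eq hA.connection y w, hR]
      rfl
    have hw' := fun v => (congrArg (fun c : (Fin 2 → TangentSpace 𝓘(ℝ, W) y) → B (p y) → B (p y) =>
      wedge (𝕜 := ℝ) (k := 2) (l := 4) c (naturalFourForm cy p θ y) v) hcurv).trans (hw v)
    constructor
    · intro h0 v
      refine (hw' v).trans ?_
      rw [h0, smul_zero]
      rfl
    · intro h0 v
      -- `dp` is onto, so any six vectors of the base lift to `Y`, where the instanton equation can
      -- be evaluated.
      choose u hu using fun i => hL (v i)
      have h3 := (hw' u).symm.trans (h0 u)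
      have h4 := (smul_eq_zero.1 h3).resolve_left (by norm_num)
      simp only [hu] at h4
      exact h4
  constructor
  · exact fun hh y => (key y).1 (hh.trace_zero (p y))
  · intro hh
    refine ⟨fun x => ?_, fun x u v e => hA.type_zero_two x u v e⟩
    -- The condition has to hold at every point of `X`, and each lies below a point of `Y`. The
    -- (0,2) condition holds for every Chern connection.
    obtain ⟨y, rfl⟩ := hsurj x
    exact (key y).2 (hh y)

end Pullback

end Instantons

/-! ### Linear algebra of the Koszul formula for the metric of the fibration -/

section LocalMetric

variable {N V : Type*} [NormedAddCommGroup N] [NormedSpace ℝ N]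
  [NormedAddCommGroup V] [NormedSpace ℂ V]

/-- The metric `r κ(L a, i L b) + t(a) t(b)`. -/
def localMetric (r : ℝ) (k : V →L[ℝ] V →L[ℝ] ℝ) (L : N →L[ℝ] V) (t : N →L[ℝ] ℝ) (a b : N) : ℝ :=
  r * k (L a) (Complex.I • L b) + t a * t b

/-- The derivative of `localMetric` along `u`, when `S`, `b` and `k'` are the derivatives of
`L`, `t` and `k`. -/
def localMetricDeriv (r : ℝ) (k : V →L[ℝ] V →L[ℝ] ℝ) (k' : V →L[ℝ] V →L[ℝ] V →L[ℝ] ℝ)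
    (L : N →L[ℝ] V) (S : N →L[ℝ] N →L[ℝ] V) (t : N →L[ℝ] ℝ) (b : N →L[ℝ] N →L[ℝ] ℝ)
    (u z w : N) : ℝ :=
  r * (k' (L u) (L z) (Complex.I • L w) + k (S u z) (Complex.I • L w) +
    k (L z) (Complex.I • S u w)) + (b u z * t w + t z * b u w)

theorem localMetric_add_left (r : ℝ) (k : V →L[ℝ] V →L[ℝ] ℝ) (L : N →L[ℝ] V) (t : N →L[ℝ] ℝ)
    (a a' b : N) : localMetric r k L t (a + a') b = localMetric r k L t a b +
      localMetric r k L t a' b := by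
  simp only [localMetric, map_add, add_apply]
  ring

theorem localMetric_add_right (r : ℝ) (k : V →L[ℝ] V →L[ℝ] ℝ) (L : N →L[ℝ] V) (t : N →L[ℝ] ℝ)
    (a b b' : N) : localMetric r k L t a (b + b') = localMetric r k L t a b +
      localMetric r k L t a b' := by
  simp only [localMetric, map_add, smul_add]
  ring

set_option synthInstance.maxHeartbeats 400000 in
theorem fderiv_localMetric (r : ℝ) {P : N → V} {t : N → N →L[ℝ] ℝ}
    {K : V → V →L[ℝ] V →L[ℝ] ℝ} {A B : N → N} {z : N} (hP : ContDiffAt ℝ 2 P z)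
    (ht : DifferentiableAt ℝ t z) (hK : DifferentiableAt ℝ K (P z))
    (hA : DifferentiableAt ℝ A z) (hB : DifferentiableAt ℝ B z) (u : N) :
    DifferentiableAt ℝ (fun z => localMetric r (K (P z)) (fderiv ℝ P z) (t z) (A z) (B z)) z ∧
    fderiv ℝ (fun z => localMetric r (K (P z)) (fderiv ℝ P z) (t z) (A z) (B z)) z u =
      localMetricDeriv r (K (P z)) (fderiv ℝ K (P z)) (fderiv ℝ P z) (fderiv ℝ (fderiv ℝ P) z)
        (t z) (fderiv ℝ t z) u (A z) (B z) +
      localMetric r (K (P z)) (fderiv ℝ P z) (t z) (fderiv ℝ A z u) (B z) +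
      localMetric r (K (P z)) (fderiv ℝ P z) (t z) (A z) (fderiv ℝ B z u) := by
  have hP1 : HasFDerivAt P (fderiv ℝ P z) z := (hP.differentiableAt (by norm_num)).hasFDerivAt
  have hP2 : HasFDerivAt (fderiv ℝ P) (fderiv ℝ (fderiv ℝ P) z) z :=
    ((hP.fderiv_right (m := 1) (by norm_num)).differentiableAt (by norm_num)).hasFDerivAt
  have hKP : HasFDerivAt (fun z => K (P z)) ((fderiv ℝ K (P z)).comp (fderiv ℝ P z)) z :=
    HasFDerivAt.comp (G := V →L[ℝ] V →L[ℝ] ℝ) (g := K) z hK.hasFDerivAt hP1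
  have hA1 := hP2.clm_apply hA.hasFDerivAt
  have hB1 := (hP2.clm_apply hB.hasFDerivAt).const_smul Complex.I
  have h1 := (HasFDerivAt.clm_apply (G := V) (H := V →L[ℝ] ℝ) hKP hA1).clm_apply hB1
  have hA2 := ht.hasFDerivAt.clm_apply hA.hasFDerivAt
  have hB2 := ht.hasFDerivAt.clm_apply hB.hasFDerivAt
  have h2 := (h1.const_mul r).add (hA2.mul hB2)
  have h3 := congrArg (fun T : N →L[ℝ] ℝ => T u) h2.fderiv
  refine ⟨h2.differentiableAt, Eq.trans ?_ (h3.trans ?_)⟩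
  · rfl
  · clear h3 h2 hA2 hB2 h1 hA1 hB1 hKP hP2 hP1
    simp only [localMetric, localMetricDeriv]
    generalize fderiv ℝ (fderiv ℝ P) z = S
    generalize fderiv ℝ K (P z) = k'
    generalize hL : fderiv ℝ P z = L
    simp [hL]
    ring

variable {r l : ℝ} {k : V →L[ℝ] V →L[ℝ] ℝ} {k' : V →L[ℝ] V →L[ℝ] V →L[ℝ] ℝ}
  {L : N →L[ℝ] V} {S : N →L[ℝ] N →L[ℝ] V} {t : N →L[ℝ] ℝ} {b : N →L[ℝ] N →L[ℝ] ℝ}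

/-- By the symmetry of `S` only one second-derivative term is left. The derivative `b` of `t` splits
into a symmetric part, multiplied by `t w`, and antisymmetric parts, which equal `l k(L ·, L ·)`. -/
theorem koszul_localMetric (hk : ∀ x y, k x y = -k y x)
    (hkI : ∀ x y, k (Complex.I • x) (Complex.I • y) = k x y)
    (hS : ∀ u v, S u v = S v u) (hb : ∀ u v, b u v - b v u = l * k (L u) (L v)) (u z w : N) :
    localMetricDeriv r k k' L S t b u z w + localMetricDeriv r k k' L S t b z u w -
      localMetricDeriv r k k' L S t b w u z =
      r * (k' (L u) (L z) (Complex.I • L w) + k' (L z) (L u) (Complex.I • L w) -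
        k' (L w) (L u) (Complex.I • L z)) + 2 * r * k (S u z) (Complex.I • L w) +
      (b u z + b z u) * t w + t z * (l * k (L u) (L w)) + t u * (l * k (L z) (L w)) := by
  have hsymm : ∀ x y, k x (Complex.I • y) = k y (Complex.I • x) := fun x y => by
    rw [hk, ← hkI, smul_smul, Complex.I_mul_I, neg_one_smul, map_neg, neg_apply, neg_neg]
  rw [← hb, ← hb]
  simp only [localMetricDeriv]
  rw [hS z u, hS w u, hS w z, hsymm (L z), hsymm (L u)]
  ring

-- Here `m` plays the role of the derivative of the Reeb field along `u`: `hm` and `hm'` come from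
-- differentiating `dp(ξ) = 0` and `θ(ξ) = 1`. The only term left is `l k(L u, L w)`, which equals
-- `-2 r k(i L u, i L w)` exactly for `r = -l/2`.
set_option synthInstance.maxHeartbeats 400000 in
theorem localMetric_nabla_reeb (hk : ∀ x y, k x y = -k y x)
    (hkI : ∀ x y, k (Complex.I • x) (Complex.I • y) = k x y)
    (hS : ∀ u v, S u v = S v u) (hb : ∀ u v, b u v - b v u = l * k (L u) (L v)) (hr : r = -l / 2)
    {ξ u w m φu : N} (hξ : L ξ = 0) (hξ1 : t ξ = 1) (hm : L m = -S u ξ) (hm' : t m = -b u ξ)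
    (hφ : L φu = Complex.I • L u) (hφ' : t φu = 0) :
    2 * localMetric r k L t m w + (localMetricDeriv r k k' L S t b u ξ w +
      localMetricDeriv r k k' L S t b ξ u w - localMetricDeriv r k k' L S t b w u ξ) =
      -(2 * localMetric r k L t φu w) := by
  have hbξ := hb u ξ
  rw [koszul_localMetric hk hkI hS hb]
  simp only [localMetric, hξ, hξ1, hm, hm', hφ, hφ', hkI, map_zero, map_neg, zero_apply, neg_apply,
    smul_zero] at hbξ ⊢
  rw [hr]
  linear_combination (-t w) * hbξ

-- Here `d` and `m` are the derivatives along `u` of `Z` and of `ΦZ`; `hm` and `hm'` come from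
-- differentiating `dp(ΦZ) = J dp(Z)` and `θ(ΦZ) = 0`. As `Φ` is skew for the metric, the left side
-- is twice the pairing of `(∇_u Φ) Z` with `w`.
set_option synthInstance.maxHeartbeats 400000 in
theorem localMetric_nabla_endo (hk : ∀ x y, k x y = -k y x)
    (hkI : ∀ x y, k (Complex.I • x) (Complex.I • y) = k x y)
    (hkI' : ∀ a x y, k' a (Complex.I • x) (Complex.I • y) = k' a x y)
    (hclosed : ∀ x y z, k' x y z - k' y x z + k' z x y = 0)
    (hS : ∀ u v, S u v = S v u) (hb : ∀ u v, b u v - b v u = l * k (L u) (L v)) (hr : r = -l / 2)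
    {u z w d m φz φw : N} (hz : L φz = Complex.I • L z) (hz' : t φz = 0)
    (hw : L φw = Complex.I • L w) (hw' : t φw = 0)
    (hm : L m = Complex.I • (S u z + L d) - S u φz) (hm' : t m = -b u φz) :
    2 * localMetric r k L t m w + (localMetricDeriv r k k' L S t b u φz w +
      localMetricDeriv r k k' L S t b φz u w - localMetricDeriv r k k' L S t b w u φz) +
    (2 * localMetric r k L t d φw + (localMetricDeriv r k k' L S t b u z φw +
      localMetricDeriv r k k' L S t b z u φw - localMetricDeriv r k k' L S t b φw u z)) =
      2 * (localMetric r k L t u z * t w - t z * localMetric r k L t u w) := by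
  have hII : ∀ x : V, Complex.I • Complex.I • x = -x := fun x => by
    rw [smul_smul, Complex.I_mul_I, neg_one_smul]
  have hmove : ∀ a x y, k' a (Complex.I • x) y = -k' a x (Complex.I • y) := fun a x y => by
    rw [← hkI' a (Complex.I • x), hII, map_neg, neg_apply]
  have hmovek : ∀ x y, k (Complex.I • x) y = -k x (Complex.I • y) := fun x y => by
    rw [← hkI (Complex.I • x), hII, map_neg, neg_apply]
  have hbz := hb u φz
  rw [koszul_localMetric hk hkI hS hb, koszul_localMetric hk hkI hS hb]
  simp only [localMetric, hz, hz', hw, hw', hm, hm', map_add, map_sub, map_neg, add_apply,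
    sub_apply, smul_add, hII, hmove, hmovek] at hbz ⊢
  rw [hr]
  -- Closedness is used at `(u, z, w)` and at `(u, i z, i w)`, as in the classical proof that `J` is
  -- parallel for a Kähler metric.
  have c1 := hclosed (L u) (L z) (L w)
  have c2 := hclosed (L u) (Complex.I • L z) (Complex.I • L w)
  simp only [hmove, hII, map_neg] at c2
  linear_combination (-l / 2) * c1 - (-l / 2) * c2 - t w * hbz

end LocalMetric

/-! ### Covector fields and 2-forms in a chart -/

section Representations

variable {E : Type*} [NormedAddCommGroup E] [NormedSpace ℝ E] [FiniteDimensional ℝ E]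
  {M : Type*} [TopologicalSpace M] [ChartedSpace E M] [IsManifold 𝓘(ℝ, E) ∞ M]

/-- The expression of a covector field in the chart at `x₀`. -/
def covectorRep (θ : Π x : M, TangentSpace 𝓘(ℝ, E) x →L[ℝ] ℝ) (x₀ : M) (z : E) : E →L[ℝ] ℝ :=
  (θ ((extChartAt 𝓘(ℝ, E) x₀).symm z)).comp (coordL x₀ ((extChartAt 𝓘(ℝ, E) x₀).symm z))

theorem exists_twoFormRep (α : DForm E M ℝ 2) (x₀ : M) (z : E) :
    ∃ g : E →L[ℝ] E →L[ℝ] ℝ, ∀ a b, g a b = α ((extChartAt 𝓘(ℝ, E) x₀).symm z)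
      ![coordL x₀ ((extChartAt 𝓘(ℝ, E) x₀).symm z) a,
        coordL x₀ ((extChartAt 𝓘(ℝ, E) x₀).symm z) b] := by
  refine exists_bilinear _ ?_ ?_ ?_ ?_
  · intro a b c
    rw [map_add, twoForm_add_left]
  · intro r a c
    rw [map_smul, twoForm_smul_left, smul_eq_mul]
  · intro a b c
    rw [map_add, twoForm_swap, twoForm_add_left, twoForm_swap, twoForm_swap _ _ (coordL _ _ a)]
    ring
  · intro r a c
    rw [map_smul, twoForm_swap, twoForm_smul_left, twoForm_swap, smul_eq_mul]
    ring

/-- The expression of a `2`-form in the chart at `x₀`, as a bilinear form. -/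
def twoFormRep (α : DForm E M ℝ 2) (x₀ : M) (z : E) : E →L[ℝ] E →L[ℝ] ℝ :=
  (exists_twoFormRep α x₀ z).choose

theorem twoFormRep_apply (α : DForm E M ℝ 2) (x₀ : M) (z : E) (a b : E) :
    twoFormRep α x₀ z a b = α ((extChartAt 𝓘(ℝ, E) x₀).symm z)
      ![coordL x₀ ((extChartAt 𝓘(ℝ, E) x₀).symm z) a,
        coordL x₀ ((extChartAt 𝓘(ℝ, E) x₀).symm z) b] :=
  (exists_twoFormRep α x₀ z).choose_spec a b

theorem covectorRep_chartD (θ : Π x : M, TangentSpace 𝓘(ℝ, E) x →L[ℝ] ℝ) {x₀ x : M}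
    (hx : x ∈ (chartAt E x₀).source) (u : TangentSpace 𝓘(ℝ, E) x) :
    covectorRep θ x₀ (extChartAt 𝓘(ℝ, E) x₀ x) (chartD x₀ x u) = θ x u := by
  rw [covectorRep, ContinuousLinearMap.comp_apply, extChartAt_symm_apply_of_mem hx,
    coordL_chartD hx]

theorem twoFormRep_chartD (α : DForm E M ℝ 2) {x₀ x : M}
    (hx : x ∈ (chartAt E x₀).source) (u v : TangentSpace 𝓘(ℝ, E) x) :
    twoFormRep α x₀ (extChartAt 𝓘(ℝ, E) x₀ x) (chartD x₀ x u) (chartD x₀ x v) = α x ![u, v] := by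
  rw [twoFormRep_apply, extChartAt_symm_apply_of_mem hx, coordL_chartD hx, coordL_chartD hx]

theorem twoFormRep_swap (α : DForm E M ℝ 2) (x₀ : M) (z a b : E) :
    twoFormRep α x₀ z a b = -twoFormRep α x₀ z b a := by
  rw [twoFormRep_apply, twoFormRep_apply, twoForm_swap]

theorem inChart_covectorForm (θ : Π x : M, TangentSpace 𝓘(ℝ, E) x →L[ℝ] ℝ) {x₀ : M} {z : E}
    (hz : z ∈ (extChartAt 𝓘(ℝ, E) x₀).target) (v : Fin 1 → E) :
    (covectorForm θ).inChart x₀ z v = covectorRep θ x₀ z (v 0) :=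
  (congrArg (θ ((extChartAt 𝓘(ℝ, E) x₀).symm z)) (coordL_extChartAt_symm hz (v 0))).symm

theorem inChart_twoForm (α : DForm E M ℝ 2) {x₀ : M} {z : E}
    (hz : z ∈ (extChartAt 𝓘(ℝ, E) x₀).target) (v : Fin 2 → E) :
    α.inChart x₀ z v = twoFormRep α x₀ z (v 0) (v 1) := by
  rw [twoFormRep_apply, DForm.inChart]
  refine congrArg (α ((extChartAt 𝓘(ℝ, E) x₀).symm z)) (funext fun i => ?_)
  fin_cases i
  · exact (coordL_extChartAt_symm hz (v 0)).symm
  · exact (coordL_extChartAt_symm hz (v 1)).symm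

theorem contDiffAt_inChart_apply {k : ℕ} {α : DForm E M ℝ k} (hα : α.IsSmooth) (x₀ : M)
    (v : Fin k → E) :
    ContDiffAt ℝ ∞ (fun z => α.inChart x₀ z v) (extChartAt 𝓘(ℝ, E) x₀ x₀) :=
  ((ContinuousAlternatingMap.apply ℝ E ℝ v).contDiff.contDiffAt).comp _
    ((hα x₀).contDiffAt (extChartAt_target_mem_nhds x₀))

theorem contDiffAt_covectorRep {θ : Π x : M, TangentSpace 𝓘(ℝ, E) x →L[ℝ] ℝ}
    (hθ : (covectorForm θ).IsSmooth) (x₀ : M) :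
    ContDiffAt ℝ ∞ (covectorRep θ x₀) (extChartAt 𝓘(ℝ, E) x₀ x₀) := by
  refine contDiffAt_clm_of_apply fun v => ?_
  refine (contDiffAt_inChart_apply hθ x₀ fun _ => v).congr_of_eventuallyEq ?_
  filter_upwards [extChartAt_target_mem_nhds x₀] with z hz
  exact (inChart_covectorForm θ hz fun _ => v).symm

theorem contDiffAt_twoFormRep {α : DForm E M ℝ 2} (hα : α.IsSmooth) (x₀ : M) :
    ContDiffAt ℝ ∞ (twoFormRep α x₀) (extChartAt 𝓘(ℝ, E) x₀ x₀) := by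
  refine contDiffAt_clm_of_apply fun v => contDiffAt_clm_of_apply fun w => ?_
  refine (contDiffAt_inChart_apply hα x₀ ![v, w]).congr_of_eventuallyEq ?_
  filter_upwards [extChartAt_target_mem_nhds x₀] with z hz
  exact (inChart_twoForm α hz ![v, w]).symm

theorem d_covectorForm {θ : Π x : M, TangentSpace 𝓘(ℝ, E) x →L[ℝ] ℝ}
    (hθ : (covectorForm θ).IsSmooth) (x₀ : M) (u v : E) :
    (covectorForm θ).d x₀ ![u, v] =
      fderiv ℝ (covectorRep θ x₀) (extChartAt 𝓘(ℝ, E) x₀ x₀) u v -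
      fderiv ℝ (covectorRep θ x₀) (extChartAt 𝓘(ℝ, E) x₀ x₀) v u := by
  have h := extDeriv_apply (((hθ x₀).contDiffAt (extChartAt_target_mem_nhds x₀)).differentiableAt
    (by norm_num)) ![u, v]
  have hT := ((contDiffAt_covectorRep hθ x₀).differentiableAt (by norm_num)).hasFDerivAt
  have key : ∀ w : Fin 1 → E, ∀ a : E,
      fderiv ℝ (fun z => (covectorForm θ).inChart x₀ z w) (extChartAt 𝓘(ℝ, E) x₀ x₀) a =
      fderiv ℝ (covectorRep θ x₀) (extChartAt 𝓘(ℝ, E) x₀ x₀) a (w 0) := fun w a => by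
    have h1 : (fun z => (covectorForm θ).inChart x₀ z w) =ᶠ[𝓝 (extChartAt 𝓘(ℝ, E) x₀ x₀)]
        fun z => covectorRep θ x₀ z (w 0) := by
      filter_upwards [extChartAt_target_mem_nhds x₀] with z hz
      exact inChart_covectorForm θ hz _
    rw [h1.fderiv_eq, (hT.clm_apply (hasFDerivAt_const (w 0) _)).fderiv]
    simp
  refine Eq.trans h ?_
  simp only [key]
  simp [Fin.removeNth]
  ring

theorem d_twoForm {α : DForm E M ℝ 2} (hα : α.IsSmooth) (x₀ : M) (u v w : E) :
    α.d x₀ ![u, v, w] =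
      fderiv ℝ (twoFormRep α x₀) (extChartAt 𝓘(ℝ, E) x₀ x₀) u v w -
      fderiv ℝ (twoFormRep α x₀) (extChartAt 𝓘(ℝ, E) x₀ x₀) v u w +
      fderiv ℝ (twoFormRep α x₀) (extChartAt 𝓘(ℝ, E) x₀ x₀) w u v := by
  have h := extDeriv_apply (((hα x₀).contDiffAt (extChartAt_target_mem_nhds x₀)).differentiableAt
    (by norm_num)) ![u, v, w]
  have hT := (contDiffAt_twoFormRep hα x₀).differentiableAt (by norm_num)
  have key : ∀ w : Fin 2 → E, ∀ a : E,
      fderiv ℝ (fun z => α.inChart x₀ z w) (extChartAt 𝓘(ℝ, E) x₀ x₀) a =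
      fderiv ℝ (twoFormRep α x₀) (extChartAt 𝓘(ℝ, E) x₀ x₀) a (w 0) (w 1) := fun w a => by
    have h1 : (fun z => α.inChart x₀ z w) =ᶠ[𝓝 (extChartAt 𝓘(ℝ, E) x₀ x₀)]
        fun z => twoFormRep α x₀ z (w 0) (w 1) := by
      filter_upwards [extChartAt_target_mem_nhds x₀] with z hz
      exact inChart_twoForm α hz _
    rw [h1.fderiv_eq]
    exact fderiv_apply_apply hT (w 0) (w 1) a
  refine Eq.trans h ?_
  simp only [key]
  refine (Fin.sum_univ_three _).trans ?_
  simp [Fin.removeNth, Fin.succAbove]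
  ring

end Representations

/-- Inversion of operators is smooth, and invertibility is an open condition. This gives smoothness
of vector fields known only through their components `dp` and `θ`. -/
theorem exists_contDiffAt_leftInverse {N D : Type*} [NormedAddCommGroup N] [NormedSpace ℝ N]
    [CompleteSpace N] [NormedAddCommGroup D] [NormedSpace ℝ D] {n : ℕ∞ω} {T : N → N →L[ℝ] D}
    {z₀ : N} (hT : ContDiffAt ℝ n T z₀) (e : N ≃L[ℝ] D) (he : (e : N →L[ℝ] D) = T z₀) :
    ∃ R : N → D →L[ℝ] N, ContDiffAt ℝ n R z₀ ∧ ∀ᶠ z in 𝓝 z₀, ∀ a, R z (T z a) = a := by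
  refine ⟨fun z => (T z).inverse, ?_, ?_⟩
  · have h := contDiffAt_map_inverse (𝕜 := ℝ) (n := n) e
    rw [he] at h
    exact h.comp z₀ hT
  · have h := hT.continuousAt.eventually (he ▸ ContinuousLinearEquiv.nhds e)
    filter_upwards [h] with z hz a
    obtain ⟨e', he'⟩ := hz
    rw [← he', ContinuousLinearMap.inverse_equiv]
    exact e'.symm_apply_apply a

/-! ### Chart expressions and smoothness of the Reeb field, `Φ` and the metric -/

section Fibration

variable {V : Type*} [NormedAddCommGroup V] [NormedSpace ℂ V] [FiniteDimensional ℂ V]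
  {X : Type*} [TopologicalSpace X] [ChartedSpace V X] [IsManifold 𝓘(ℂ, V) ω X]
  {W : Type*} [NormedAddCommGroup W] [NormedSpace ℝ W] [FiniteDimensional ℝ W]
  {Y : Type*} [TopologicalSpace Y] [ChartedSpace W Y] [IsManifold 𝓘(ℝ, W) ∞ Y]
  (cy : CalabiYauStructure V X)
  {p : C^∞⟮𝓘(ℝ, W), Y; 𝓘(ℝ, V), X⟯} {θ : Π y : Y, TangentSpace 𝓘(ℝ, W) y →L[ℝ] ℝ}

theorem covectorRep_self (y : Y) (u : TangentSpace 𝓘(ℝ, W) y) :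
    covectorRep θ y (extChartAt 𝓘(ℝ, W) y y) u = θ y u := by
  have h := covectorRep_chartD θ (mem_chart_source W y) u
  rwa [chartD_self] at h

theorem fieldRep_self (Z : Π y : Y, TangentSpace 𝓘(ℝ, W) y) (y : Y) :
    fieldRep y Z (extChartAt 𝓘(ℝ, W) y y) = Z y := by
  rw [fieldRep, extChartAt_to_inv, chartD_self]

theorem fibrationMetric_eq_localMetric (r : ℝ) {y₀ y : Y} (hy : y ∈ projDomain p y₀)
    (u v : TangentSpace 𝓘(ℝ, W) y) : fibrationMetric cy p θ r y u v =
      localMetric r (twoFormRep cy.kah (p y₀) (localProj p y₀ (extChartAt 𝓘(ℝ, W) y₀ y)))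
        (fderiv ℝ (localProj p y₀) (extChartAt 𝓘(ℝ, W) y₀ y))
        (covectorRep θ y₀ (extChartAt 𝓘(ℝ, W) y₀ y)) (chartD y₀ y u) (chartD y₀ y v) := by
  rw [localMetric, fderiv_localProj p hy, fderiv_localProj p hy, ← chartD_complexStructure hy.2,
    localProj_extChartAt p hy, twoFormRep_chartD cy.kah hy.2, covectorRep_chartD θ hy.1,
    covectorRep_chartD θ hy.1]
  rfl

theorem fibrationMetric_fieldRep (r : ℝ) (y₀ : Y) (A B : Π y : Y, TangentSpace 𝓘(ℝ, W) y) :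
    (fun y => fibrationMetric cy p θ r y (A y) (B y)) ∘ (extChartAt 𝓘(ℝ, W) y₀).symm
      =ᶠ[𝓝 (extChartAt 𝓘(ℝ, W) y₀ y₀)] fun z =>
      localMetric r (twoFormRep cy.kah (p y₀) (localProj p y₀ z)) (fderiv ℝ (localProj p y₀) z)
        (covectorRep θ y₀ z) (fieldRep y₀ A z) (fieldRep y₀ B z) := by
  filter_upwards [eventually_extChartAt_symm ((isOpen_projDomain p y₀).mem_nhds
    (mem_projDomain p y₀))] with z hz
  have h := fibrationMetric_eq_localMetric cy (θ := θ) r hz.1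
    (A ((extChartAt 𝓘(ℝ, W) y₀).symm z)) (B ((extChartAt 𝓘(ℝ, W) y₀).symm z))
  rwa [hz.2] at h

theorem reebField_rep (h : IsSplitting p θ) (y₀ : Y) :
    ∀ᶠ z in 𝓝 (extChartAt 𝓘(ℝ, W) y₀ y₀),
      fderiv ℝ (localProj p y₀) z (fieldRep y₀ (reebField p θ) z) = 0 ∧
      covectorRep θ y₀ z (fieldRep y₀ (reebField p θ) z) = 1 := by
  filter_upwards [eventually_extChartAt_symm ((isOpen_projDomain p y₀).mem_nhds
    (mem_projDomain p y₀))] with z hz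
  have h1 := fderiv_localProj p hz.1 (reebField p θ ((extChartAt 𝓘(ℝ, W) y₀).symm z))
  have h2 := covectorRep_chartD θ hz.1.1 (reebField p θ ((extChartAt 𝓘(ℝ, W) y₀).symm z))
  rw [dproj_reebField h, map_zero, hz.2] at h1
  rw [form_reebField h, hz.2] at h2
  exact ⟨h1, h2⟩

theorem transverse_rep (h : IsSplitting p θ) (y₀ : Y) (Z : Π y : Y, TangentSpace 𝓘(ℝ, W) y) :
    ∀ᶠ z in 𝓝 (extChartAt 𝓘(ℝ, W) y₀ y₀),
      fderiv ℝ (localProj p y₀) z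
        (fieldRep y₀ (fun y => transverseComplexStructure p θ y (Z y)) z) =
          Complex.I • fderiv ℝ (localProj p y₀) z (fieldRep y₀ Z z) ∧
      covectorRep θ y₀ z
        (fieldRep y₀ (fun y => transverseComplexStructure p θ y (Z y)) z) = 0 := by
  filter_upwards [eventually_extChartAt_symm ((isOpen_projDomain p y₀).mem_nhds
    (mem_projDomain p y₀))] with z hz
  have h1 := fun u => fderiv_localProj p hz.1 u
  have h2 := fun u => covectorRep_chartD θ hz.1.1 u
  rw [hz.2] at h1 h2
  constructor
  · rw [fieldRep, fieldRep, h1, h1, dproj_transverse h, chartD_complexStructure hz.1.2]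
  · rw [fieldRep, h2, form_transverse h]

theorem contDiffAt_fderiv_localProj (y₀ : Y) :
    ContDiffAt ℝ ∞ (fderiv ℝ (localProj p y₀)) (extChartAt 𝓘(ℝ, W) y₀ y₀) :=
  (contDiffAt_localProj p (mem_projDomain p y₀)).fderiv_right (by norm_cast)

/-- The coordinate expression of a vector field is a smooth function of its components. -/
theorem exists_splitting_leftInverse (hs : (covectorForm θ).IsSmooth) (h : IsSplitting p θ)
    (y₀ : Y) : ∃ R : W → V × ℝ →L[ℝ] W, ContDiffAt ℝ ∞ R (extChartAt 𝓘(ℝ, W) y₀ y₀) ∧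
      ∀ᶠ z in 𝓝 (extChartAt 𝓘(ℝ, W) y₀ y₀), ∀ a,
        R z (fderiv ℝ (localProj p y₀) z a, covectorRep θ y₀ z a) = a := by
  obtain ⟨e, he⟩ := h y₀
  have hT : ContDiffAt ℝ ∞ (fun z => (fderiv ℝ (localProj p y₀) z).prod (covectorRep θ y₀ z))
      (extChartAt 𝓘(ℝ, W) y₀ y₀) :=
    contDiffAt_clm_of_apply fun _ => ((contDiffAt_fderiv_localProj y₀).clm_apply
      contDiffAt_const).prodMk ((contDiffAt_covectorRep hs y₀).clm_apply contDiffAt_const)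
  refine exists_contDiffAt_leftInverse hT e (he.trans ?_)
  exact ContinuousLinearMap.ext fun u => Prod.ext
    (fderiv_localProj_self (V := V) (p := p) y₀ u).symm (covectorRep_self y₀ u).symm

theorem contDiffAt_field_reeb (hs : (covectorForm θ).IsSmooth) (h : IsSplitting p θ) (y₀ : Y) :
    ContDiffAt ℝ ∞ (fieldRep y₀ (reebField p θ)) (extChartAt 𝓘(ℝ, W) y₀ y₀) := by
  obtain ⟨R, hR, hR'⟩ := exists_splitting_leftInverse hs h y₀
  have h1 : ContDiffAt ℝ ∞ (fun z => R z (0, 1)) (extChartAt 𝓘(ℝ, W) y₀ y₀) :=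
    hR.clm_apply contDiffAt_const
  refine h1.congr_of_eventuallyEq ?_
  filter_upwards [hR', reebField_rep h y₀] with z hz hz'
  rw [← hz'.1, ← hz'.2, hz]

theorem fieldRep_transverse_eq (hs : (covectorForm θ).IsSmooth) (h : IsSplitting p θ) (y₀ : Y)
    (Z : Π y : Y, TangentSpace 𝓘(ℝ, W) y) :
    ∃ R : W → W →L[ℝ] W, ContDiffAt ℝ ∞ R (extChartAt 𝓘(ℝ, W) y₀ y₀) ∧
      fieldRep y₀ (fun y => transverseComplexStructure p θ y (Z y))
        =ᶠ[𝓝 (extChartAt 𝓘(ℝ, W) y₀ y₀)] fun z => R z (fieldRep y₀ Z z) := by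
  obtain ⟨R, hR, hR'⟩ := exists_splitting_leftInverse hs h y₀
  -- The components of `ΦZ` are `(i dP Z, 0)`; applying the inverse `R` of the splitting recovers
  -- the field.
  refine ⟨fun z => (R z).comp ((Complex.I • fderiv ℝ (localProj p y₀) z).prod 0), ?_, ?_⟩
  · exact hR.clm_comp (contDiffAt_clm_of_apply fun _ => (((contDiffAt_fderiv_localProj y₀).clm_apply
      contDiffAt_const).const_smul Complex.I).prodMk contDiffAt_const)
  · filter_upwards [hR', transverse_rep h y₀ Z] with z hz hz'
    have h3 := hz (fieldRep y₀ (fun y => transverseComplexStructure p θ y (Z y)) z)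
    rw [hz'.1, hz'.2] at h3
    exact h3.symm

theorem smoothFieldOn_reebField (hs : (covectorForm θ).IsSmooth) (h : IsSplitting p θ) :
    SmoothFieldOn (reebField p θ) univ := fun y _ =>
  ((contMDiffAt_field_iff (mem_chart_source W y) _).2
    (contDiffAt_field_reeb hs h y)).contMDiffWithinAt

theorem diffFieldAt_reebField (hs : (covectorForm θ).IsSmooth) (h : IsSplitting p θ) (y : Y) :
    DiffFieldAt (reebField p θ) y :=
  (diffFieldAt_iff (mem_chart_source W y) _).2
    ((contDiffAt_field_reeb hs h y).differentiableAt (by norm_num))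

theorem smoothFieldOn_transverse (hs : (covectorForm θ).IsSmooth) (h : IsSplitting p θ)
    {O : Set Y} (hO : IsOpen O) {Z : Π y : Y, TangentSpace 𝓘(ℝ, W) y} (hZ : SmoothFieldOn Z O) :
    SmoothFieldOn (fun y => transverseComplexStructure p θ y (Z y)) O := fun y hy => by
  refine ContMDiffAt.contMDiffWithinAt ?_
  rw [contMDiffAt_field_iff (mem_chart_source W y)]
  obtain ⟨R, hR, hR'⟩ := fieldRep_transverse_eq hs h y Z
  exact (hR.clm_apply ((contMDiffAt_field_iff (mem_chart_source W y) _).1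
    ((hZ y hy).contMDiffAt (hO.mem_nhds hy)))).congr_of_eventuallyEq hR'

theorem diffFieldAt_transverse (hs : (covectorForm θ).IsSmooth) (h : IsSplitting p θ)
    {y : Y} {Z : Π y : Y, TangentSpace 𝓘(ℝ, W) y} (hZ : DiffFieldAt Z y) :
    DiffFieldAt (fun y => transverseComplexStructure p θ y (Z y)) y := by
  rw [diffFieldAt_iff (mem_chart_source W y)] at hZ ⊢
  obtain ⟨R, hR, hR'⟩ := fieldRep_transverse_eq hs h y Z
  exact ((hR.differentiableAt (by norm_num)).clm_apply hZ).congr_of_eventuallyEq hR'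

set_option synthInstance.maxHeartbeats 400000 in
theorem contMDiffOn_fibrationMetric (hs : (covectorForm θ).IsSmooth) (r : ℝ) {O : Set Y}
    (hO : IsOpen O) {A B : Π y : Y, TangentSpace 𝓘(ℝ, W) y} (hA : SmoothFieldOn A O)
    (hB : SmoothFieldOn B O) :
    ContMDiffOn 𝓘(ℝ, W) 𝓘(ℝ, ℝ) ∞ (fun y => fibrationMetric cy p θ r y (A y) (B y)) O :=
    fun y hy => by
  refine ContMDiffAt.contMDiffWithinAt ?_
  rw [contMDiffAt_iff_chart (mem_chart_source W y)]
  refine ContDiffAt.congr_of_eventuallyEq ?_ (fibrationMetric_fieldRep cy r y A B)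
  have hA' := (contMDiffAt_field_iff (mem_chart_source W y) _).1
    ((hA y hy).contMDiffAt (hO.mem_nhds hy))
  have hB' := (contMDiffAt_field_iff (mem_chart_source W y) _).1
    ((hB y hy).contMDiffAt (hO.mem_nhds hy))
  have hP := contDiffAt_localProj p (mem_projDomain p y)
  have hK : ContDiffAt ℝ ∞ (fun z => twoFormRep cy.kah (p y) (localProj p y z))
      (extChartAt 𝓘(ℝ, W) y y) := by
    have h1 := contDiffAt_twoFormRep cy.kah_smooth (p y)
    rw [← localProj_extChartAt p (mem_projDomain p y)] at h1
    exact h1.comp _ hP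
  have hT := contDiffAt_covectorRep hs y
  have hL := contDiffAt_fderiv_localProj (p := p) y
  exact (contDiffAt_const.mul ((hK.clm_apply (hL.clm_apply hA')).clm_apply
    ((hL.clm_apply hB').const_smul Complex.I))).add ((hT.clm_apply hA').mul (hT.clm_apply hB'))

end Fibration

/-! ### The metric of the fibration and its Levi-Civita connections -/

section Sasaki

variable {V : Type*} [NormedAddCommGroup V] [NormedSpace ℂ V] [FiniteDimensional ℂ V]
  {X : Type*} [TopologicalSpace X] [ChartedSpace V X] [IsManifold 𝓘(ℂ, V) ω X]
  {W : Type*} [NormedAddCommGroup W] [NormedSpace ℝ W] [FiniteDimensional ℝ W]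
  {Y : Type*} [TopologicalSpace Y] [ChartedSpace W Y] [IsManifold 𝓘(ℝ, W) ∞ Y]
  (cy : CalabiYauStructure V X)
  (p : C^∞⟮𝓘(ℝ, W), Y; 𝓘(ℝ, V), X⟯) (θ : Π y : Y, TangentSpace 𝓘(ℝ, W) y →L[ℝ] ℝ)

/-- The metric of the fibration at the centre of a chart. -/
def centreMetric (r : ℝ) (y : Y) : W → W → ℝ :=
  localMetric r (twoFormRep cy.kah (p y) (localProj p y (extChartAt 𝓘(ℝ, W) y y)))
    (fderiv ℝ (localProj p y) (extChartAt 𝓘(ℝ, W) y y))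
    (covectorRep θ y (extChartAt 𝓘(ℝ, W) y y))

set_option synthInstance.maxHeartbeats 400000 in
/-- The derivative of the coefficients of the metric of the fibration at the centre of a chart. -/
def centreMetricDeriv (r : ℝ) (y : Y) : W → W → W → ℝ :=
  localMetricDeriv r (twoFormRep cy.kah (p y) (localProj p y (extChartAt 𝓘(ℝ, W) y y)))
    (fderiv ℝ (twoFormRep cy.kah (p y)) (localProj p y (extChartAt 𝓘(ℝ, W) y y)))
    (fderiv ℝ (localProj p y) (extChartAt 𝓘(ℝ, W) y y))
    (fderiv ℝ (fderiv ℝ (localProj p y)) (extChartAt 𝓘(ℝ, W) y y))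
    (covectorRep θ y (extChartAt 𝓘(ℝ, W) y y))
    (fderiv ℝ (covectorRep θ y) (extChartAt 𝓘(ℝ, W) y y))

variable {p θ}

theorem fibrationMetric_self (r : ℝ) (y : Y) (u v : TangentSpace 𝓘(ℝ, W) y) :
    fibrationMetric cy p θ r y u v = centreMetric cy p θ r y u v := by
  have h := fibrationMetric_eq_localMetric cy (θ := θ) r (mem_projDomain p y) u v
  rw [chartD_self, chartD_self] at h
  exact h

theorem fibrationMetric_symm (r : ℝ) (y : Y) (u v : TangentSpace 𝓘(ℝ, W) y) :
    fibrationMetric cy p θ r y u v = fibrationMetric cy p θ r y v u := by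
  have h : cy.metric (p y) (dproj p y u) (dproj p y v) =
      cy.metric (p y) (dproj p y v) (dproj p y u) := by
    rw [CalabiYauStructure.metric, CalabiYauStructure.metric, twoForm_swap, ← cy.kah_type,
      complexStructure_complexStructure, ← neg_one_smul ℝ (dproj p y v), twoForm_smul_left]
    ring
  have h1 : ∀ u v, fibrationMetric cy p θ r y u v =
    r * cy.metric (p y) (dproj p y u) (dproj p y v) + θ y u * θ y v := fun _ _ => rfl
  rw [h1, h1, h]
  ring

theorem fibrationMetric_pos {r : ℝ} (hr : 0 < r)
    (hθ : ∀ (y : Y) (v : TangentSpace 𝓘(ℝ, W) y), dproj p y v = 0 → v ≠ 0 → θ y v ≠ 0) (y : Y)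
    {u : TangentSpace 𝓘(ℝ, W) y} (hu : u ≠ 0) : 0 < fibrationMetric cy p θ r y u u := by
  have h1 : fibrationMetric cy p θ r y u u =
    r * cy.kah (p y) ![dproj p y u, complexStructure (p y) (dproj p y u)] + θ y u * θ y u := rfl
  rw [h1]
  by_cases h : dproj p y u = 0
  · have h2 := hθ y u h hu
    have h3 : cy.kah (p y) ![dproj p y u, complexStructure (p y) (dproj p y u)] = 0 := by
      rw [h]
      exact (cy.kah (p y)).toAlternatingMap.map_coord_zero 0 rfl
    rw [h3, mul_zero, zero_add]
    exact mul_self_pos.2 h2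
  · have := mul_pos hr (cy.kah_pos (p y) _ h)
    nlinarith [mul_self_nonneg (θ y u)]

/-- It reduces the vector equations for `∇ξ` and `∇Φ` to their pairings with an arbitrary vector,
which the Koszul formula computes. -/
theorem fibrationMetric_nondegenerate {r : ℝ} (hr : 0 < r)
    (hθ : ∀ (y : Y) (v : TangentSpace 𝓘(ℝ, W) y), dproj p y v = 0 → v ≠ 0 → θ y v ≠ 0) {y : Y}
    {u v : TangentSpace 𝓘(ℝ, W) y}
    (h : ∀ w, fibrationMetric cy p θ r y u w = fibrationMetric cy p θ r y v w) : u = v := by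
  by_contra hne
  have h1 := fibrationMetric_pos cy hr hθ y (sub_ne_zero.2 hne)
  rw [LinearMap.map_sub₂, h, sub_self] at h1
  exact lt_irrefl _ h1

theorem differentiableAt_twoFormRep_localProj (y : Y) :
    DifferentiableAt ℝ (twoFormRep cy.kah (p y))
      (localProj p y (extChartAt 𝓘(ℝ, W) y y)) := by
  rw [localProj_extChartAt p (mem_projDomain p y)]
  exact (contDiffAt_twoFormRep cy.kah_smooth (p y)).differentiableAt (by norm_num)

theorem mvfderiv_fibrationMetric (hs : (covectorForm θ).IsSmooth) (r : ℝ) {y : Y}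
    {A B : Π y : Y, TangentSpace 𝓘(ℝ, W) y} (hA : DiffFieldAt A y) (hB : DiffFieldAt B y)
    (u : W) :
    mvfderiv 𝓘(ℝ, W) (fun y' => fibrationMetric cy p θ r y' (A y') (B y')) y u =
      centreMetricDeriv cy p θ r y u (A y) (B y) +
      centreMetric cy p θ r y (fderiv ℝ (fieldRep y A) (extChartAt 𝓘(ℝ, W) y y) u) (B y) +
      centreMetric cy p θ r y (A y) (fderiv ℝ (fieldRep y B) (extChartAt 𝓘(ℝ, W) y y) u) := by
  have hA' := (diffFieldAt_iff (mem_chart_source W y) A).1 hA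
  have hB' := (diffFieldAt_iff (mem_chart_source W y) B).1 hB
  have hrep := fibrationMetric_fieldRep cy (p := p) (θ := θ) r y A B
  have hmain := fderiv_localMetric r ((contDiffAt_localProj p (mem_projDomain p y)).of_le
    (m := 2) (by norm_cast)) ((contDiffAt_covectorRep hs y).differentiableAt (by norm_num))
    (differentiableAt_twoFormRep_localProj cy y) hA' hB' u
  have hd : MDifferentiableAt 𝓘(ℝ, W) 𝓘(ℝ, ℝ)
      (fun y' => fibrationMetric cy p θ r y' (A y') (B y')) y := by
    rw [mdifferentiableAt_iff_chart (mem_chart_source W y)]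
    exact hmain.1.congr_of_eventuallyEq hrep
  have h1 := hmain.2
  rw [fieldRep_self, fieldRep_self] at h1
  refine (mvfderiv_eq_fderiv_chart_self hd u).trans ?_
  rw [hrep.fderiv_eq]
  exact h1

theorem fderiv_fieldRep_coordField (y : Y) (v : W) :
    fderiv ℝ (fieldRep y (coordField y v)) (extChartAt 𝓘(ℝ, W) y y) = 0 := by
  rw [(fieldRep_coordField_eventuallyEq (mem_chart_source W y) v).fderiv_eq]
  exact fderiv_const_apply v

/-- The Koszul formula at the centre of a chart. -/
theorem IsLeviCivita.koszul (hs : (covectorForm θ).IsSmooth) {r : ℝ}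
    {cov : CovariantDerivative 𝓘(ℝ, W) W (TangentSpace 𝓘(ℝ, W) : Y → Type _)}
    (hcov : IsLeviCivita (fibrationMetric cy p θ r) cov) {y : Y}
    {Z : Π y : Y, TangentSpace 𝓘(ℝ, W) y} (hZ : DiffFieldAt Z y) (u w : W) :
    2 * centreMetric cy p θ r y (cov Z y u) w =
      2 * centreMetric cy p θ r y (fderiv ℝ (fieldRep y Z) (extChartAt 𝓘(ℝ, W) y y) u) w +
      (centreMetricDeriv cy p θ r y u (Z y) w + centreMetricDeriv cy p θ r y (Z y) u w -
        centreMetricDeriv cy p θ r y w u (Z y)) := by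
  have hsymm : ∀ a b : W, centreMetric cy p θ r y a b = centreMetric cy p θ r y b a :=
    fun a b => (fibrationMetric_self cy r y a b).symm.trans
      ((fibrationMetric_symm cy r y a b).trans (fibrationMetric_self cy r y b a))
  have hc : ∀ v : W, (coordField y v y : W) = v := fun v => coordL_self y v
  have hd : ∀ v : W, DiffFieldAt (coordField y v) y :=
    fun v => diffFieldAt_coordField (mem_chart_source W y) v
  have hadd : ∀ a a' b : W, centreMetric cy p θ r y (a + a') b =
      centreMetric cy p θ r y a b + centreMetric cy p θ r y a' b :=
    fun a a' b => localMetric_add_left r _ _ _ a a' b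
  have hadd' : ∀ a b b' : W, centreMetric cy p θ r y a (b + b') =
      centreMetric cy p θ r y a b + centreMetric cy p θ r y a b' :=
    fun a b b' => localMetric_add_right r _ _ _ a b b'
  have hzero : ∀ a : W, centreMetric cy p θ r y a 0 = 0 := fun a => by
    have := hadd' a 0 0
    rw [add_zero] at this
    linarith
  -- At the centre all tangent vectors are treated as elements of `W`.
  let c : (Π y : Y, TangentSpace 𝓘(ℝ, W) y) → W → W := fun A v => cov A y v
  have hzero' : ∀ a : W, centreMetric cy p θ r y 0 a = 0 := fun a => by rw [hsymm, hzero]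
  have hmetric : ∀ (A B : Π y : Y, TangentSpace 𝓘(ℝ, W) y) (a b : W), A y = a → B y = b →
      DiffFieldAt A y → DiffFieldAt B y → ∀ v : W, centreMetricDeriv cy p θ r y v a b +
      centreMetric cy p θ r y (fderiv ℝ (fieldRep y A) (extChartAt 𝓘(ℝ, W) y y) v) b +
      centreMetric cy p θ r y a (fderiv ℝ (fieldRep y B) (extChartAt 𝓘(ℝ, W) y y) v) =
      centreMetric cy p θ r y (c A v) b + centreMetric cy p θ r y a (c B v) := by
    rintro A B a b rfl rfl hA hB v
    exact (mvfderiv_fibrationMetric cy hs r hA hB v).symm.trans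
      ((hcov.metric y A B hA hB v).trans (congrArg₂ (· + ·) (fibrationMetric_self cy r y _ _)
        (fibrationMetric_self cy r y _ _)))
  have htor : ∀ (A B : Π y : Y, TangentSpace 𝓘(ℝ, W) y) (a b : W), A y = a → B y = b →
      DiffFieldAt A y → DiffFieldAt B y → c B a = c A b +
        (fderiv ℝ (fieldRep y B) (extChartAt 𝓘(ℝ, W) y y) a -
          fderiv ℝ (fieldRep y A) (extChartAt 𝓘(ℝ, W) y y) b) := by
    rintro A B a b rfl rfl hA hB
    have h := (hcov.torsion_free y A B hA hB).trans (mlieBracket_eq A B y)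
    rw [VectorField.lieBracket, fieldRep_self, fieldRep_self] at h
    exact (sub_eq_iff_eq_add'.1 h)
  suffices key : ∀ ζ : W, Z y = ζ → 2 * centreMetric cy p θ r y (c Z u) w =
      2 * centreMetric cy p θ r y (fderiv ℝ (fieldRep y Z) (extChartAt 𝓘(ℝ, W) y y) u) w +
      (centreMetricDeriv cy p θ r y u ζ w + centreMetricDeriv cy p θ r y ζ u w -
        centreMetricDeriv cy p θ r y w u ζ) from key _ rfl
  intro ζ hζ
  -- The classical cyclic combination `m1 + m2 - m3`, with coordinate fields extending `u` and `w`.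
  -- Their expressions have zero derivative at the centre, so only the derivatives of the metric
  -- coefficients and of `Z` appear.
  have m1 := hmetric Z (coordField y w) ζ w hζ (hc w) hZ (hd w) u
  have m2 := hmetric (coordField y u) (coordField y w) u w (hc u) (hc w) (hd u) (hd w) ζ
  have m3 := hmetric (coordField y u) Z u ζ (hc u) hζ (hd u) hZ w
  have t1 := htor (coordField y u) (coordField y w) u w (hc u) (hc w) (hd u) (hd w)
  have t2 := htor (coordField y u) Z u ζ (hc u) hζ (hd u) hZ
  have t3 := htor (coordField y w) Z w ζ (hc w) hζ (hd w) hZ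
  simp only [fderiv_fieldRep_coordField, zero_apply, sub_zero, add_zero, hzero, hzero']
    at m1 m2 m3 t1 t2 t3
  rw [t1] at m1
  rw [t3, hadd'] at m3
  have e2 := congrArg (fun a : W => centreMetric cy p θ r y a w) t2
  simp only [hadd] at e2
  have s1 := hsymm ζ (c (coordField y u) w)
  linarith

end Sasaki

/-! ### Kähler and contact identities for the coefficients at the centre of a chart -/

section Sasaki

variable {V : Type*} [NormedAddCommGroup V] [NormedSpace ℂ V] [FiniteDimensional ℂ V]
  {X : Type*} [TopologicalSpace X] [ChartedSpace V X] [IsManifold 𝓘(ℂ, V) ω X]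
  {W : Type*} [NormedAddCommGroup W] [NormedSpace ℝ W] [FiniteDimensional ℝ W]
  {Y : Type*} [TopologicalSpace Y] [ChartedSpace W Y] [IsManifold 𝓘(ℝ, W) ∞ Y]
  (cy : CalabiYauStructure V X)
  {p : C^∞⟮𝓘(ℝ, W), Y; 𝓘(ℝ, V), X⟯} {θ : Π y : Y, TangentSpace 𝓘(ℝ, W) y →L[ℝ] ℝ}

theorem twoFormRep_kah_I {x₀ : X} {z : V} (hz : z ∈ (extChartAt 𝓘(ℝ, V) x₀).target) (a b : V) :
    twoFormRep cy.kah x₀ z (Complex.I • a) (Complex.I • b) = twoFormRep cy.kah x₀ z a b := by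
  rw [twoFormRep_apply, twoFormRep_apply, coordL_smul_I (extChartAt_symm_mem hz),
    coordL_smul_I (extChartAt_symm_mem hz), cy.kah_type]

/-- In a holomorphic chart `J` is constant multiplication by `i`, so the invariance of the Kähler
form passes to the derivatives of its coefficients. -/
theorem fderiv_twoFormRep_kah_I (x₀ : X) (u a b : V) :
    fderiv ℝ (twoFormRep cy.kah x₀) (extChartAt 𝓘(ℝ, V) x₀ x₀) u (Complex.I • a) (Complex.I • b) =
      fderiv ℝ (twoFormRep cy.kah x₀) (extChartAt 𝓘(ℝ, V) x₀ x₀) u a b := by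
  have hK := (contDiffAt_twoFormRep cy.kah_smooth x₀).differentiableAt (by norm_num)
  have h : (fun z => twoFormRep cy.kah x₀ z (Complex.I • a) (Complex.I • b))
      =ᶠ[𝓝 (extChartAt 𝓘(ℝ, V) x₀ x₀)] fun z => twoFormRep cy.kah x₀ z a b := by
    filter_upwards [extChartAt_target_mem_nhds x₀] with z hz
    exact twoFormRep_kah_I cy hz a b
  have h1 := h.fderiv_eq (𝕜 := ℝ)
  exact (fderiv_apply_apply hK _ _ u).symm.trans
    ((congrArg (fun T : V →L[ℝ] ℝ => T u) h1).trans (fderiv_apply_apply hK _ _ u))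

theorem fderiv_twoFormRep_kah_closed (x₀ : X) (u v w : V) :
    fderiv ℝ (twoFormRep cy.kah x₀) (extChartAt 𝓘(ℝ, V) x₀ x₀) u v w -
      fderiv ℝ (twoFormRep cy.kah x₀) (extChartAt 𝓘(ℝ, V) x₀ x₀) v u w +
      fderiv ℝ (twoFormRep cy.kah x₀) (extChartAt 𝓘(ℝ, V) x₀ x₀) w u v = 0 := by
  rw [← d_twoForm cy.kah_smooth, cy.kah_closed]
  rfl

/-- At the centre the exterior derivative of `θ` is the antisymmetrized derivative of its
coefficients, which turns `dθ = l p^*ω` into the hypothesis `hb` of the linear algebra lemmas. -/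
theorem fderiv_covectorRep_antisymm (hs : (covectorForm θ).IsSmooth) {l : ℝ}
    (hd : ∀ (y : Y) (v : Fin 2 → TangentSpace 𝓘(ℝ, W) y),
      (covectorForm θ).d y v = l * pullbackForm p cy.kah y v) (y : Y) (u v : W) :
    fderiv ℝ (covectorRep θ y) (extChartAt 𝓘(ℝ, W) y y) u v -
      fderiv ℝ (covectorRep θ y) (extChartAt 𝓘(ℝ, W) y y) v u =
      l * twoFormRep cy.kah (p y) (extChartAt 𝓘(ℝ, V) (p y) (p y))
        (fderiv ℝ (localProj p y) (extChartAt 𝓘(ℝ, W) y y) u)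
        (fderiv ℝ (localProj p y) (extChartAt 𝓘(ℝ, W) y y) v) := by
  have h1 : pullbackForm p cy.kah y ![u, v] = cy.kah (p y) ![dproj p y u, dproj p y v] := by
    refine congrArg (cy.kah (p y)) (funext fun i => ?_)
    fin_cases i <;> rfl
  have h2 := twoFormRep_chartD cy.kah (mem_chart_source V (p y)) (dproj p y u) (dproj p y v)
  rw [chartD_self, chartD_self] at h2
  have h3 : ∀ u : W, fderiv ℝ (localProj p y) (extChartAt 𝓘(ℝ, W) y y) u = dproj p y u :=
    fun u => fderiv_localProj_self y u
  rw [← d_covectorForm hs, h3, h3]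
  exact (hd y _).trans (congrArg (l * ·) (h1.trans h2.symm))

theorem fderiv_fderiv_localProj_symm (y : Y) (u v : W) :
    fderiv ℝ (fderiv ℝ (localProj p y)) (extChartAt 𝓘(ℝ, W) y y) u v =
      fderiv ℝ (fderiv ℝ (localProj p y)) (extChartAt 𝓘(ℝ, W) y y) v u :=
  (contDiffAt_localProj p (mem_projDomain p y)).isSymmSndFDerivAt (by simp; norm_cast) u v

theorem fderiv_covectorRep_apply (hs : (covectorForm θ).IsSmooth) {y : Y} {A : W → W}
    (hA : DifferentiableAt ℝ A (extChartAt 𝓘(ℝ, W) y y)) (u : W) :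
    fderiv ℝ (fun z => covectorRep θ y z (A z)) (extChartAt 𝓘(ℝ, W) y y) u =
      fderiv ℝ (covectorRep θ y) (extChartAt 𝓘(ℝ, W) y y) u (A (extChartAt 𝓘(ℝ, W) y y)) +
      covectorRep θ y (extChartAt 𝓘(ℝ, W) y y)
        (fderiv ℝ A (extChartAt 𝓘(ℝ, W) y y) u) := by
  have hT := ((contDiffAt_covectorRep hs y).differentiableAt (by norm_num)).hasFDerivAt
  rw [(hT.clm_apply hA.hasFDerivAt).fderiv]
  simp [add_comm]

theorem fderiv_localProj_apply {y : Y} {A : W → W}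
    (hA : DifferentiableAt ℝ A (extChartAt 𝓘(ℝ, W) y y)) (u : W) :
    DifferentiableAt ℝ (fun z => fderiv ℝ (localProj p y) z (A z)) (extChartAt 𝓘(ℝ, W) y y) ∧
    fderiv ℝ (fun z => fderiv ℝ (localProj p y) z (A z)) (extChartAt 𝓘(ℝ, W) y y) u =
      fderiv ℝ (fderiv ℝ (localProj p y)) (extChartAt 𝓘(ℝ, W) y y) u
        (A (extChartAt 𝓘(ℝ, W) y y)) + fderiv ℝ (localProj p y) (extChartAt 𝓘(ℝ, W) y y)
        (fderiv ℝ A (extChartAt 𝓘(ℝ, W) y y) u) :=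
  fderiv_fderiv_apply ((contDiffAt_localProj p (mem_projDomain p y)).of_le
    (m := 2) (by norm_cast)) hA u

theorem fibrationMetric_transverse_skew (h : IsSplitting p θ) (r : ℝ) (y : Y)
    (u v : TangentSpace 𝓘(ℝ, W) y) :
    fibrationMetric cy p θ r y (transverseComplexStructure p θ y u) v =
      -fibrationMetric cy p θ r y u (transverseComplexStructure p θ y v) := by
  have h1 : ∀ u v, fibrationMetric cy p θ r y u v = r * cy.kah (p y)
    ![dproj p y u, complexStructure (p y) (dproj p y v)] + θ y u * θ y v := fun _ _ => rfl
  rw [h1, h1, dproj_transverse h, dproj_transverse h, form_transverse h, form_transverse h,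
    cy.kah_type, complexStructure_complexStructure, twoForm_swap _ (dproj p y u) (-dproj p y v),
    ← neg_one_smul ℝ (dproj p y v), twoForm_smul_left, twoForm_swap _ (dproj p y u)]
  ring

theorem fibrationMetric_reeb (h : IsSplitting p θ) (r : ℝ) (y : Y)
    (w : TangentSpace 𝓘(ℝ, W) y) : fibrationMetric cy p θ r y (reebField p θ y) w = θ y w := by
  have h1 : ∀ u v, fibrationMetric cy p θ r y u v = r * cy.kah (p y)
    ![dproj p y u, complexStructure (p y) (dproj p y v)] + θ y u * θ y v := fun _ _ => rfl
  have h2 : ∀ v, cy.kah (p y) ![0, v] = 0 := fun v =>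
    (cy.kah (p y)).toAlternatingMap.map_coord_zero 0 rfl
  rw [h1, dproj_reebField h, form_reebField h, h2]
  ring

end Sasaki

/-! ### The Sasakian structure and the main theorem -/

section Sasaki

variable {V : Type*} [NormedAddCommGroup V] [NormedSpace ℂ V] [FiniteDimensional ℂ V]
  {X : Type*} [TopologicalSpace X] [ChartedSpace V X] [IsManifold 𝓘(ℂ, V) ω X]
  {W : Type*} [NormedAddCommGroup W] [NormedSpace ℝ W] [FiniteDimensional ℝ W]
  {Y : Type*} [TopologicalSpace Y] [ChartedSpace W Y] [IsManifold 𝓘(ℝ, W) ∞ Y]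
  (cy : CalabiYauStructure V X)
  {p : C^∞⟮𝓘(ℝ, W), Y; 𝓘(ℝ, V), X⟯} {θ : Π y : Y, TangentSpace 𝓘(ℝ, W) y →L[ℝ] ℝ}
  {l : ℝ}

theorem centreMetric_nabla_reeb (hs : (covectorForm θ).IsSmooth) (h : IsSplitting p θ)
    (hd : ∀ (y : Y) (v : Fin 2 → TangentSpace 𝓘(ℝ, W) y),
      (covectorForm θ).d y v = l * pullbackForm p cy.kah y v) (y : Y) (u w : W) :
    2 * centreMetric cy p θ (-l / 2) y
        (fderiv ℝ (fieldRep y (reebField p θ)) (extChartAt 𝓘(ℝ, W) y y) u) w +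
      (centreMetricDeriv cy p θ (-l / 2) y u (reebField p θ y) w +
        centreMetricDeriv cy p θ (-l / 2) y (reebField p θ y) u w -
        centreMetricDeriv cy p θ (-l / 2) y w u (reebField p θ y)) =
      -(2 * centreMetric cy p θ (-l / 2) y (transverseComplexStructure p θ y u) w) := by
  have hξ := (contDiffAt_field_reeb hs h y).differentiableAt (by norm_num)
  have hrep := reebField_rep h y
  have h1 := (fderiv_localProj_apply (p := p) hξ u).2
  have h2 := fderiv_covectorRep_apply hs hξ u
  have e1 : (fun z => fderiv ℝ (localProj p y) z (fieldRep y (reebField p θ) z))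
      =ᶠ[𝓝 (extChartAt 𝓘(ℝ, W) y y)] fun _ => (0 : V) := hrep.mono fun z hz => hz.1
  have e2 : (fun z => covectorRep θ y z (fieldRep y (reebField p θ) z))
      =ᶠ[𝓝 (extChartAt 𝓘(ℝ, W) y y)] fun _ => (1 : ℝ) := hrep.mono fun z hz => hz.2
  -- Differentiating `dP ξ = 0` and `t(ξ) = 1`, which hold near the centre, determines both
  -- components of the derivative of `ξ`.
  rw [e1.fderiv_eq, fderiv_const_apply, fieldRep_self] at h1
  rw [e2.fderiv_eq, fderiv_const_apply, fieldRep_self] at h2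
  have hL := fun u : W => fderiv_localProj_self (p := p) y u
  have ht := fun u : W => covectorRep_self (θ := θ) y u
  unfold centreMetric centreMetricDeriv
  rw [localProj_extChartAt p (mem_projDomain p y)]
  exact localMetric_nabla_reeb (twoFormRep_swap cy.kah (p y) _)
    (twoFormRep_kah_I cy (mem_extChartAt_target (p y))) (fderiv_fderiv_localProj_symm y)
    (fderiv_covectorRep_antisymm cy hs hd y) rfl
    ((hL _).trans (dproj_reebField h y)) ((ht _).trans (form_reebField h y))
    (eq_neg_of_add_eq_zero_right h1.symm) (eq_neg_of_add_eq_zero_right h2.symm)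
    ((hL _).trans ((dproj_transverse h y u).trans (congrArg (fun v : V => Complex.I • v)
      (hL u).symm))) ((ht _).trans (form_transverse h y u))

theorem centreMetric_nabla_endo (hs : (covectorForm θ).IsSmooth) (h : IsSplitting p θ)
    (hd : ∀ (y : Y) (v : Fin 2 → TangentSpace 𝓘(ℝ, W) y),
      (covectorForm θ).d y v = l * pullbackForm p cy.kah y v) {y : Y}
    {Z : Π y : Y, TangentSpace 𝓘(ℝ, W) y} (hZ : DiffFieldAt Z y) (u w : W) :
    2 * centreMetric cy p θ (-l / 2) y
        (fderiv ℝ (fieldRep y fun y' => transverseComplexStructure p θ y' (Z y'))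
          (extChartAt 𝓘(ℝ, W) y y) u) w +
      (centreMetricDeriv cy p θ (-l / 2) y u (transverseComplexStructure p θ y (Z y)) w +
        centreMetricDeriv cy p θ (-l / 2) y (transverseComplexStructure p θ y (Z y)) u w -
        centreMetricDeriv cy p θ (-l / 2) y w u (transverseComplexStructure p θ y (Z y))) +
      (2 * centreMetric cy p θ (-l / 2) y (fderiv ℝ (fieldRep y Z) (extChartAt 𝓘(ℝ, W) y y) u)
          (transverseComplexStructure p θ y w) +
      (centreMetricDeriv cy p θ (-l / 2) y u (Z y) (transverseComplexStructure p θ y w) +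
        centreMetricDeriv cy p θ (-l / 2) y (Z y) u (transverseComplexStructure p θ y w) -
        centreMetricDeriv cy p θ (-l / 2) y (transverseComplexStructure p θ y w) u (Z y))) =
      2 * (centreMetric cy p θ (-l / 2) y u (Z y) * θ y w -
        θ y (Z y) * centreMetric cy p θ (-l / 2) y u w) := by
  have hZ' := (diffFieldAt_iff (mem_chart_source W y) _).1 hZ
  have hΦ := (diffFieldAt_iff (mem_chart_source W y) _).1 (diffFieldAt_transverse hs h hZ)
  have hrep := transverse_rep h y Z
  have h1 := (fderiv_localProj_apply (p := p) hΦ u).2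
  have h2 := fderiv_covectorRep_apply hs hΦ u
  have h3 := fderiv_localProj_apply (p := p) hZ' u
  have e1 : (fun z => fderiv ℝ (localProj p y) z
      (fieldRep y (fun y' => transverseComplexStructure p θ y' (Z y')) z))
      =ᶠ[𝓝 (extChartAt 𝓘(ℝ, W) y y)] fun z =>
        Complex.I • fderiv ℝ (localProj p y) z (fieldRep y Z z) := hrep.mono fun z hz => hz.1
  have e2 : (fun z => covectorRep θ y z
      (fieldRep y (fun y' => transverseComplexStructure p θ y' (Z y')) z))
      =ᶠ[𝓝 (extChartAt 𝓘(ℝ, W) y y)] fun _ => (0 : ℝ) := hrep.mono fun z hz => hz.2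
  have h4 := congrArg (fun T : W →L[ℝ] V => T u)
    (h3.1.hasFDerivAt.const_smul Complex.I).fderiv
  rw [e1.fderiv_eq, fieldRep_self] at h1
  -- Both sides of `dP(ΦZ) = i dP(Z)` are differentiated along `u` and compared; this gives the
  -- hypothesis `hm`.
  have h5 := h4.symm.trans h1
  rw [smul_apply, h3.2, fieldRep_self] at h5
  rw [e2.fderiv_eq, fderiv_const_apply, fieldRep_self] at h2
  have hL := fun u : W => fderiv_localProj_self (p := p) y u
  have ht := fun u : W => covectorRep_self (θ := θ) y u
  have hΦL : ∀ v : W, fderiv ℝ (localProj p y) (extChartAt 𝓘(ℝ, W) y y)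
      (transverseComplexStructure p θ y v) =
      Complex.I • fderiv ℝ (localProj p y) (extChartAt 𝓘(ℝ, W) y y) v := fun v =>
    (hL _).trans ((dproj_transverse h y v).trans (congrArg (fun v : V => Complex.I • v)
      (hL v).symm))
  have hΦt : ∀ v : W, covectorRep θ y (extChartAt 𝓘(ℝ, W) y y)
      (transverseComplexStructure p θ y v) = 0 := fun v => (ht _).trans (form_transverse h y v)
  unfold centreMetric centreMetricDeriv
  rw [localProj_extChartAt p (mem_projDomain p y), ← ht w, ← covectorRep_self y (Z y)]
  exact localMetric_nabla_endo (twoFormRep_swap cy.kah (p y) _)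
    (twoFormRep_kah_I cy (mem_extChartAt_target (p y))) (fderiv_twoFormRep_kah_I cy (p y))
    (fderiv_twoFormRep_kah_closed cy (p y)) (fderiv_fderiv_localProj_symm y)
    (fderiv_covectorRep_antisymm cy hs hd y) rfl (hΦL _) (hΦt _) (hΦL _) (hΦt _)
    (eq_sub_of_add_eq' h5.symm) (eq_neg_of_add_eq_zero_right h2.symm)

theorem isSasakian (hV : Module.finrank ℂ V = 3) (hθ : IsAngularForm p θ) (h : IsSplitting p θ)
    (hl : l < 0) (hd : ∀ (y : Y) (v : Fin 2 → TangentSpace 𝓘(ℝ, W) y),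
      (covectorForm θ).d y v = l * pullbackForm p cy.kah y v) :
    IsSasakian θ (reebField p θ) (fibrationMetric cy p θ (-l / 2))
      (transverseComplexStructure p θ) where
  smooth_form := hθ.smooth
  smooth_metric O hO A B hA hB := contMDiffOn_fibrationMetric cy hθ.smooth _ hO hA hB
  smooth_endo O hO A hA := smoothFieldOn_transverse hθ.smooth h hO hA
  smooth_reeb := smoothFieldOn_reebField hθ.smooth h
  metric_symm := fibrationMetric_symm cy _
  metric_pos y u hu := fibrationMetric_pos cy (by linarith) hθ.ne_zero y hu
  contact y := by
    obtain ⟨e, h1, h2⟩ := exists_unitary_basis hV (cy.isOneOne (p y))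
      fun u hu => cy.kah_pos (p y) u hu
    -- The seven vectors are `ξ` and the horizontal lifts of the real frame of a unitary basis; by
    -- `wedge_contact` the value is `6 l³`.
    refine ⟨Fin.cons (reebField p θ y)
      fun i => (splitting p θ y).inverse (realFrame (V := V) e i, 0), ?_⟩
    have key := wedge_contact (V := V) (fun v => dproj p y v) (covectorForm θ y) (cy.isOneOne (p y)) l e h1 h2
      (Fin.cons (reebField p θ y) fun i => (splitting p θ y).inverse (realFrame (V := V) e i, 0))
      (form_reebField h y) (fun i => (splitting_inverse h y _ 0).2)
      (fun i => (splitting_inverse h y _ 0).1) ((covectorForm θ).d y) (hd y)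
    rw [key]
    exact mul_ne_zero (by norm_num) (pow_ne_zero _ hl.ne)
  reeb_one := form_reebField h
  reeb_d y v := hθ.d_horizontal y _ v (dproj_reebField h y)
  reeb_unit y := (fibrationMetric_reeb cy h _ y _).trans (form_reebField h y)
  endo_sq y u := by
    refine splitting_injective hθ.ne_zero ?_ ?_
    · rw [dproj_transverse h, dproj_transverse h, complexStructure_complexStructure, map_add,
        map_smul, dproj_reebField h, smul_zero, add_zero, map_neg]
    · rw [form_transverse h, map_add, map_smul, form_reebField h, map_neg, smul_eq_mul]
      ring
  compat y u v := by
    have h1 : ∀ u v, fibrationMetric cy p θ (-l / 2) y u v = (-l / 2) * cy.kah (p y)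
      ![dproj p y u, complexStructure (p y) (dproj p y v)] + θ y u * θ y v := fun _ _ => rfl
    rw [h1, h1, form_transverse h, dproj_transverse h, dproj_transverse h, cy.kah_type]
    ring
  nabla_reeb cov hcov y u := by
    refine fibrationMetric_nondegenerate cy (r := -l / 2) (by linarith) hθ.ne_zero fun w => ?_
    have h1 := hcov.koszul cy hθ.smooth (diffFieldAt_reebField hθ.smooth h y) u w
    have h2 := centreMetric_nabla_reeb cy hθ.smooth h hd y u w
    rw [LinearMap.map_neg₂, fibrationMetric_self, fibrationMetric_self]
    linarith
  nabla_endo cov hcov y Z hZ u := by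
    refine fibrationMetric_nondegenerate cy (r := -l / 2) (by linarith) hθ.ne_zero fun w => ?_
    have h1 := hcov.koszul cy hθ.smooth (diffFieldAt_transverse hθ.smooth h hZ) u w
    -- Koszul is applied to `ΦZ` against `w` and to `Z` against `Φw`, since `g(Φ ∇_u Z, w) = -g(∇_u
    -- Z, Φw)`.
    have h2 := hcov.koszul cy hθ.smooth hZ u (transverseComplexStructure p θ y w)
    have h3 := centreMetric_nabla_endo cy hθ.smooth h hd hZ u w
    rw [LinearMap.map_sub₂, LinearMap.map_sub₂, LinearMap.map_smul₂, LinearMap.map_smul₂,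
      fibrationMetric_transverse_skew cy h, fibrationMetric_reeb cy h, fibrationMetric_self,
      fibrationMetric_self, fibrationMetric_self, fibrationMetric_self, smul_eq_mul, smul_eq_mul]
    linarith

end Sasaki

end

theorem mainTheorem7
    {V : Type*} [NormedAddCommGroup V] [NormedSpace ℂ V] [FiniteDimensional ℂ V]
    (hV : Module.finrank ℂ V = 3)
    {X : Type*} [TopologicalSpace X] [T2Space X] [SecondCountableTopology X] [ChartedSpace V X]
    [IsManifold 𝓘(ℂ, V) ω X] (cy : CalabiYauStructure V X)
    {Y : Type*} [TopologicalSpace Y] [T2Space Y] [SecondCountableTopology Y]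
    [ChartedSpace (EuclideanSpace ℝ (Fin 7)) Y] [IsManifold (𝓡 7) ∞ Y]
    (p : C^∞⟮𝓡 7, Y; 𝓘(ℝ, V), X⟯) (hp : IsCircleFibration p)
    (θ : Π y : Y, TangentSpace (𝓡 7) y →L[ℝ] ℝ) (hθ : IsAngularForm p θ)
    {F : Type*} [NormedAddCommGroup F] [NormedSpace ℂ F] [FiniteDimensional ℂ F]
    {B : X → Type*} [TopologicalSpace (TotalSpace F B)]
    [∀ x, AddCommGroup (B x)] [∀ x, Module ℂ (B x)]
    [∀ x, Module ℝ (B x)] [∀ x, IsScalarTower ℝ ℂ (B x)]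
    [∀ x, TopologicalSpace (B x)] [∀ x, IsTopologicalAddGroup (B x)]
    [∀ x, ContinuousSMul ℝ (B x)] [FiberBundle F B] [VectorBundle ℂ F B] [VectorBundle ℝ F B]
    [ContMDiffVectorBundle ∞ F B 𝓘(ℝ, V)] (hol : HolomorphicStructure V F B) :
    (∀ l : ℝ, l < 0 →
      (∀ (y : Y) (v : Fin 2 → TangentSpace (𝓡 7) y),
        (covectorForm θ).d y v = l * pullbackForm p cy.kah y v) →
      IsSasakian θ (reebField p θ) (fibrationMetric cy p θ (-l / 2))
        (transverseComplexStructure p θ)) ∧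
    (∃ S : HolomorphicSasakianBundle F (p *ᵖ B) θ (reebField p θ)
        (transverseComplexStructure p θ),
      IsPullbackPartialConnection p hol.dbar S.dbar) ∧
    ∀ (h : HermitianMetric V F B) (A : CovariantDerivative 𝓘(ℝ, V) F B),
      IsChernConnection hol h A →
      (∃ A' : CovariantDerivative (𝓡 7) F (p *ᵖ B),
        IsComplexConnection A' ∧ IsPullbackConnection p A A') ∧
      ∀ A' : CovariantDerivative (𝓡 7) F (p *ᵖ B), IsPullbackConnection p A A' →
        (IsHYM cy A ↔ IsGTwoInstanton (naturalFourForm cy p θ) A') := by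
  -- The count `7 = 2 · 3 + 1` behind the splitting `(dp, θ)`.
  have hdim : Module.finrank ℝ (EuclideanSpace ℝ (Fin 7)) = Module.finrank ℝ V + 1 := by
    rw [finrank_euclideanSpace_fin, finrank_real_of_complex, hV]
  have hsplit : IsSplitting p θ := isSplitting hdim hθ.ne_zero
  refine ⟨?_, exists_holomorphicSasakianBundle hsplit hθ.ne_zero hol, ?_⟩
  · exact fun l hl hd => isSasakian cy hV hθ hsplit hl hd
  · exact fun h A hA => ⟨hA.connection.exists_pullback,
      fun A' hA' => hA.isHYM_iff cy hV hsplit hp.surjective hA'⟩
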